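/- **Conventions.** Let $w$ be one of the four weaknesses: strict, pseudo, lax, colax. A *$w$-cell* $x\Rightarrow y$ is, respectively, an equality $x=y$, an isomorphism $x\cong y$, a morphism $x\to y$, a morphism $y\to x$. Composites are written in diagrammatic order, $\alpha\gg\beta$ meaning first $\alpha$, then $\beta$. All 2-categories and 2-functors are strict. **Lawvere 2-theories.** Let $\mathbb F$ be the skeleton of the category of finite sets, with objects the natural numbers. A *Lawvere 2-theory* is a 2-category $\mathbb T$ (with small hom-categories) with an identity-on-objects 2-functor $\theta\colon\mathbb F^{op}\to\mathbb T$ that preserves finite powers: in $\mathbb T$, the object $n$ is the $n$-fold power of $1$ in the 2-categorical sense, with projections the images of the maps $1\to n$. The 1-cells $\theta(p)$ are called *tight*. A *model* $X$ of $\mathbb T$ in $\mathbf{Cat}$ is a 2-functor $\mathbb T\to\mathbf{Cat}$, $n\mapsto X^n$, where $X$ is also the name of the (small) category $X(1)$, which sends tight 1-cells to the reindexing functors. A *$w$-homomorphism* $f\colon X\to Y$ is a $w$-natural transformation that is strict on tight 1-cells: functors $f_n\colon X^n\to Y^n$ and $w$-cells $Y(\alpha)f_m\Rightarrow f_nX(\alpha)$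 for $\alpha\colon m\to n$, compatible with composition and with 2-cells, which are identities for tight $\alpha$. With modifications as 2-cells, models form a 2-category $\mathsf{Mod}_w$ with hom-categories $\mathsf{Hom}_w(X,Y)$. **$w$-commutativity.** A *$w$-commutativity* $\mu$ of $\mathbb T$ is a pseudomonoid structure on $\theta$ for the Gray tensor product with Gray cells of weakness $w$, in which Gray cells with a tight entry are identities. Explicitly, it has unit $1$ and is given on objects by $m\otimes k=mk$; it consists of 2-functors $m\otimes-$ and $-\otimes k$ which on tight 1-cells are the products of finite sets (with $m\times k$ identified lexicographically with $mk$), and of $w$-cells $$\sigma_{\alpha\beta}\colon(\alpha\otimes k)\gg(n\otimes\beta)\Longrightarrow(m\otimes\beta)\gg(\alpha\otimes l)\qquad(\alpha\colon m\to n,\ \beta\colon k\to l)$$ which are compatible with composition and with 2-cells in each variable, and are identities if $\alpha$ or $\beta$ is tight; the multiplication is unital and associative with respect to the canonical isomorphisms of finite sets, on 1-cells, 2-cells and the cells $\sigma$. **Multimaps.** For a finite list $X_1,\dots,X_n$ of models and a model $Z$, a *$w$-multimap* $X_1,\dots,X_n\to Z$ is a $w$-natural transformation $f$, strict on tight 1-cells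 in each variable, between the 2-functors $(a_1,\dots,a_n)\mapsto X_1^{a_1}\times\dots\times X_n^{a_n}$ and $(a_1,\dots,a_n)\mapsto Z^{a_1\cdots a_n}$ on the $n$-fold Gray tensor power of $\mathbb T$, the second one being the composite of $Z$ with the iterated multiplication. So it has component functors, $w$-cells for the 1-cells of $\mathbb T$ in each variable ("a $w$-homomorphism in each variable"), and the latter satisfy, for every pair of variables, the coherence law with the Gray cells $\sigma$. The $w$-multimaps and modifications form a category $\mathsf{Mul}_n(X_1,\dots,X_n;Z)$. Multimaps are composed by pasting; for $n=1$ they are the $w$-homomorphisms. **Lifting.** For a model $Z$, the 2-functor $Z(m\otimes-)$ is the power $Z^m$; a 1-cell $\alpha\colon m\to n$ gives a $w$-natural transformation $Z(\alpha\otimes-)\colon Z^m\to Z^n$, whose cells are the $Z(\sigma_{\alpha\beta})$, and a 2-cell $\eta\colon\alpha\Rightarrow\alpha'$ gives a modification $Z(\eta\otimes-)$. **Theorem.** Let $w$ be any of the four weaknesses and let $\mathbb T$ be a Lawvere 2-theory with a $w$-commutativity $\mu$. 1. For all models $Y,Z$ and all $m$, the projections induce an isomorphism of categories $\mathsf{Hom}_w(Y,Z^m)\cong\mathsf{Hom}_w(Y,Z)^m$.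 Under these isomorphisms, postcomposition with the $Z(\alpha\otimes-)$ and $Z(\eta\otimes-)$ is the structure of a model $\underline{\mathsf{Hom}}_w(Y,Z)$ with underlying category $\mathsf{Hom}_w(Y,Z)$. 2. The models of $\mathbb T$ in $\mathbf{Cat}$, the $w$-multimaps and their modifications form a 2-multicategory (non-symmetric and strict, with laws that hold for multimaps and for 2-cells). 3. This 2-multicategory is right closed with internal hom $\underline{\mathsf{Hom}}_w(Y,Z)$: there are multimaps $\mathrm{ev}\colon\underline{\mathsf{Hom}}_w(Y,Z),Y\to Z$ given by evaluation, $((t_1,\dots,t_k),y)\mapsto(t_1(y),\dots,t_k(y))$, with identity cells in the first variable and the cells of the $t_i$ in the second, such that for every finite (possibly empty) list $\Gamma$ of models and all models $Y,Z$, composition with $\mathrm{ev}$ is an isomorphism of categories $$\mathsf{Mul}(\Gamma;\underline{\mathsf{Hom}}_w(Y,Z))\cong\mathsf{Mul}(\Gamma,Y;Z).$$ 4. In particular, $g\mapsto\mathrm{ev}\circ(g,\mathrm{id})$ is an isomorphism of categories $$\mathsf{Hom}_w(X,\underline{\mathsf{Hom}}_w(Y,Z))\cong\mathsf{Mul}_2(X,Y;Z).$$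 Moreover $\underline{\mathsf{Hom}}_w(-,-)$ is a 2-functor $\mathsf{Mod}_w^{op}\times\mathsf{Mod}_w\to\mathsf{Mod}_w$ which acts on underlying categories by pre- and postcomposition, and the isomorphism is 2-natural in $X$, $Y$ and $Z$. 5. In particular, for the terminal model $*$, the 2-functor $X\mapsto\mathsf{Hom}_w(*,X)$ to categories, acting by postcomposition, is promoted to an endo-2-functor $\underline{\mathsf{Hom}}_w(*,-)$ of $\mathsf{Mod}_w$: it is the restriction of the 2-functor in 4, and its underlying category at $X$ is $\mathsf{Hom}_w(*,X)$. For lax $w$, $\mathsf{Hom}_w(*,X)$ is the category $\mathsf{IntAlg}(X)$ of internal algebras of $X$. -/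

import Mathlib

open CategoryTheory

universe u v₁ v₂ v₃ u₁ u₂ u₃

/-! ### Equality of cells with propositionally equal ends -/

section Cells

variable {C : Type u₁} [Category.{v₁} C] {D : Type u₂} [Category.{v₂} D]
  {E : Type u₃} [Category.{v₃} E]

/-- Two morphisms are equal, where their sources (and their targets) may be equal
only propositionally. -/
inductive HomEq {x y : C} (f : x ⟶ y) : ∀ {x' y' : C}, (x' ⟶ y') → Prop
  | refl : HomEq f f

/-- The four weaknesses. -/
inductive Weakness
  | strict
  | pseudo
  | lax
  | colax

/-- A `w`-cell from `x` to `y`: an equality, an isomorphism, a morphism `x ⟶ y`, or a morphism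
`y ⟶ x`, for `w` strict, pseudo, lax and colax. -/
inductive WHom (x y : C) : Weakness → Type v₁
  | strict (h : x = y) : WHom x y .strict
  | pseudo (e : x ≅ y) : WHom x y .pseudo
  | lax (f : x ⟶ y) : WHom x y .lax
  | colax (f : y ⟶ x) : WHom x y .colax

/-- Two `w`-cells are equal, where their ends may be equal only propositionally. -/
inductive WEq {w : Weakness} {x y : C} (s : WHom x y w) : ∀ {x' y' : C}, WHom x' y' w → Prop
  | refl : WEq s s

namespace WHom

/-- The identity `w`-cell between equal objects. -/
def ofEq {w : Weakness} {x y : C} (h : x = y) : WHom x y w :=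
  match w with
  | .strict => .strict h
  | .pseudo => .pseudo (eqToIso h)
  | .lax => .lax (eqToHom h)
  | .colax => .colax (eqToHom h.symm)

/-- Composition of `w`-cells, in diagrammatic order. -/
def comp {x y z : C} : ∀ {w : Weakness}, WHom x y w → WHom y z w → WHom x z w
  | _, .strict h, .strict h' => .strict (h.trans h')
  | _, .pseudo e, .pseudo e' => .pseudo (e ≪≫ e')
  | _, .lax f, .lax f' => .lax (f ≫ f')
  | _, .colax f, .colax f' => .colax (f' ≫ f)

/-- Composition of `w`-cells across an equality of objects. -/
def compEq {w : Weakness} {x y y' z : C} (s : WHom x y w) (h : y = y') (t : WHom y' z w) :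
    WHom x z w :=
  (s.comp (ofEq h)).comp t

/-- The image of a `w`-cell under a functor. -/
def map (F : C ⥤ D) {x y : C} : ∀ {w : Weakness}, WHom x y w → WHom (F.obj x) (F.obj y) w
  | _, .strict h => .strict (congrArg F.obj h)
  | _, .pseudo e => .pseudo (F.mapIso e)
  | _, .lax f => .lax (F.map f)
  | _, .colax f => .colax (F.map f)

/-- A `w`-cell that is an identity. -/
def IsId {w : Weakness} {x y : C} (s : WHom x y w) : Prop :=
  ∃ h : x = y, s = ofEq h

/-- The square with `w`-cells `s`, `s'` and morphisms `f`, `g` commutes. -/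
def Sq {x y x' y' : C} : ∀ {w : Weakness}, WHom x y w → WHom x' y' w → (x ⟶ x') → (y ⟶ y') → Prop
  | _, .strict h, .strict h', f, g => f ≫ eqToHom h' = eqToHom h ≫ g
  | _, .pseudo e, .pseudo e', f, g => f ≫ e'.hom = e.hom ≫ g
  | _, .lax s, .lax s', f, g => f ≫ s' = s ≫ g
  | _, .colax s, .colax s', f, g => s ≫ f = g ≫ s'

section lemmas

variable {w : Weakness}

theorem ofEq_comp {x y z : C} (h : x = y) (h' : y = z) :
    (ofEq h : WHom x y w).comp (ofEq h') = ofEq (h.trans h') := by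
  subst h h'
  cases w <;> simp [ofEq, comp]

theorem id_comp {x y : C} (s : WHom x y w) : (ofEq rfl).comp s = s := by
  cases s <;> simp [ofEq, comp]

theorem comp_id {x y : C} (s : WHom x y w) : s.comp (ofEq rfl) = s := by
  cases s <;> simp [ofEq, comp]

theorem assoc {x y z t : C} (a : WHom x y w) (b : WHom y z w) (c : WHom z t w) :
    (a.comp b).comp c = a.comp (b.comp c) := by
  cases a <;> cases b <;> cases c <;> simp [comp]

theorem map_ofEq (F : C ⥤ D) {x y : C} (h : x = y) :
    (ofEq h : WHom x y w).map F = ofEq (congrArg F.obj h) := by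
  subst h
  cases w <;> simp [ofEq, map]

theorem map_comp (F : C ⥤ D) {x y z : C} (a : WHom x y w) (b : WHom y z w) :
    (a.comp b).map F = (a.map F).comp (b.map F) := by
  cases a <;> cases b <;> simp [comp, map]

theorem map_map (F : C ⥤ D) (G : D ⥤ E) {x y : C} (a : WHom x y w) :
    (a.map F).map G = a.map (F ⋙ G) := by
  cases a <;> rfl

theorem IsId.comp {x y z : C} {a : WHom x y w} {b : WHom y z w} (ha : a.IsId) (hb : b.IsId) :
    (a.comp b).IsId := by
  obtain ⟨h, rfl⟩ := ha
  obtain ⟨h', rfl⟩ := hb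
  exact ⟨h.trans h', ofEq_comp h h'⟩

theorem IsId.map (F : C ⥤ D) {x y : C} {a : WHom x y w} (ha : a.IsId) : (a.map F).IsId := by
  obtain ⟨h, rfl⟩ := ha
  exact ⟨congrArg F.obj h, map_ofEq F h⟩

theorem Sq.id {x y : C} (s : WHom x y w) : Sq s s (𝟙 x) (𝟙 y) := by
  cases s <;> simp [Sq]

theorem Sq.comp {x y x' y' x'' y'' : C} {s : WHom x y w} {s' : WHom x' y' w}
    {s'' : WHom x'' y'' w} {f : x ⟶ x'} {g : y ⟶ y'} {f' : x' ⟶ x''} {g' : y' ⟶ y''}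
    (h : Sq s s' f g) (h' : Sq s' s'' f' g') : Sq s s'' (f ≫ f') (g ≫ g') := by
  cases s <;> cases s' <;> cases s'' <;> simp only [Sq] at h h' ⊢
  · rw [Category.assoc, h', ← Category.assoc, h, Category.assoc]
  · rw [Category.assoc, h', ← Category.assoc, h, Category.assoc]
  · rw [Category.assoc, h', ← Category.assoc, h, Category.assoc]
  · rw [Category.assoc, ← h', ← Category.assoc, h, Category.assoc]

theorem Sq.hcomp {x y z x' y' z' : C} {s : WHom x y w} {t : WHom y z w} {s' : WHom x' y' w}
    {t' : WHom y' z' w} {f : x ⟶ x'} {g : y ⟶ y'} {k : z ⟶ z'}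
    (h : Sq s s' f g) (h' : Sq t t' g k) : Sq (s.comp t) (s'.comp t') f k := by
  cases s <;> cases s' <;> cases t <;> cases t' <;> simp only [Sq, WHom.comp] at h h' ⊢
  · rename_i a b c d
    cases a; cases b; cases c; cases d
    simp only [eqToHom_refl, Category.comp_id, Category.id_comp] at h h' ⊢
    exact h.trans h'
  · rw [Iso.trans_hom, Iso.trans_hom, ← Category.assoc, h, Category.assoc, h', Category.assoc]
  · rw [← Category.assoc, h, Category.assoc, h', Category.assoc]
  · rw [← Category.assoc, ← h', Category.assoc, h, Category.assoc]

theorem Sq.map (F : C ⥤ D) {x y x' y' : C} {s : WHom x y w} {s' : WHom x' y' w} {f : x ⟶ x'}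
    {g : y ⟶ y'} (h : Sq s s' f g) : Sq (s.map F) (s'.map F) (F.map f) (F.map g) := by
  cases s <;> cases s' <;> simp only [Sq, WHom.map, Functor.mapIso_hom] at h ⊢
  · rename_i a b
    cases a; cases b
    simp only [eqToHom_refl, Category.comp_id, Category.id_comp] at h ⊢
    rw [h]
  · rw [← F.map_comp, h, F.map_comp]
  · rw [← F.map_comp, h, F.map_comp]
  · rw [← F.map_comp, h, F.map_comp]

theorem Sq.nat {F G : C ⥤ D} (τ : F ⟶ G) {x y : C} (s : WHom x y w) :
    Sq (s.map F) (s.map G) (τ.app x) (τ.app y) := by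
  cases s with
  | strict h => cases h; simp [Sq, WHom.map]
  | pseudo e => simp [Sq, WHom.map]
  | lax f => simp [Sq, WHom.map]
  | colax f => simp [Sq, WHom.map]

theorem Sq.ofEq {x y x' y' : C} (h : x = y) (h' : x' = y') {f : x ⟶ x'} {g : y ⟶ y'}
    (e : HomEq f g) : Sq (WHom.ofEq h : WHom x y w) (WHom.ofEq h') f g := by
  subst h h'
  cases e
  cases w <;> simp [Sq, WHom.ofEq]

end lemmas

end WHom

section lemmas2

variable {w : Weakness}

theorem HomEq.of_eq {x y : C} {f g : x ⟶ y} (h : f = g) : HomEq f g := by subst h; exact .refl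

theorem HomEq.symm {x y x' y' : C} {f : x ⟶ y} {g : x' ⟶ y'} (h : HomEq f g) : HomEq g f := by
  cases h; exact .refl

theorem HomEq.trans {x y x' y' x'' y'' : C} {f : x ⟶ y} {g : x' ⟶ y'} {k : x'' ⟶ y''}
    (h : HomEq f g) (h' : HomEq g k) : HomEq f k := by
  cases h; exact h'

theorem HomEq.map (F : C ⥤ D) {x y x' y' : C} {f : x ⟶ y} {g : x' ⟶ y'} (h : HomEq f g) :
    HomEq (F.map f) (F.map g) := by
  cases h; exact .refl

theorem WEq.of_eq {x y : C} {s t : WHom x y w} (h : s = t) : WEq s t := by subst h; exact .refl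

theorem WEq.symm {x y x' y' : C} {s : WHom x y w} {t : WHom x' y' w} (h : WEq s t) :
    WEq t s := by
  cases h; exact .refl

theorem WEq.trans {x y x' y' x'' y'' : C} {s : WHom x y w} {t : WHom x' y' w}
    {r : WHom x'' y'' w} (h : WEq s t) (h' : WEq t r) : WEq s r := by
  cases h; exact h'

theorem WEq.map (F : C ⥤ D) {x y x' y' : C} {s : WHom x y w} {t : WHom x' y' w} (h : WEq s t) :
    WEq (s.map F) (t.map F) := by
  cases h; exact .refl

theorem WEq.map_congr {F G : C ⥤ D} (h : F = G) {x y : C} (s : WHom x y w) :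
    WEq (s.map F) (s.map G) := by
  cases h; exact .refl

theorem WEq.comp {x y z x' y' z' : C} {s : WHom x y w} {t : WHom y z w} {s' : WHom x' y' w}
    {t' : WHom y' z' w} (h : WEq s s') (h' : WEq t t') : WEq (s.comp t) (s'.comp t') := by
  cases h; cases h'; exact .refl

theorem WEq.ofEq_comp {x y z : C} (h : x = y) (s : WHom y z w) :
    WEq ((WHom.ofEq h).comp s) s := by
  subst h; exact .of_eq s.id_comp

theorem WEq.comp_ofEq {x y z : C} (s : WHom x y w) (h : y = z) :
    WEq (s.comp (WHom.ofEq h)) s := by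
  subst h; exact .of_eq s.comp_id

theorem WEq.compEq {x y y₁ z x' y' z' : C} {s : WHom x y w} {h₁ : y = y₁} {t : WHom y₁ z w}
    {s' : WHom x' y' w}
    {t' : WHom y' z' w} (h : WEq s s') (h' : WEq t t') :
    WEq (s.compEq h₁ t) (s'.comp t') :=
  ((WEq.comp_ofEq s h₁).trans h).comp h'

theorem WEq.eq {x y : C} {s t : WHom x y w} (h : WEq s t) : s = t := by
  cases h; rfl

theorem WHom.IsId.wEq {x y x' y' : C} {s : WHom x y w} {t : WHom x' y' w} (hs : s.IsId)
    (ht : t.IsId) (h : x = x') : WEq s t := by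
  obtain ⟨e, rfl⟩ := hs
  obtain ⟨e', rfl⟩ := ht
  subst e e' h
  exact .refl

theorem WEq.isId {x y x' y' : C} {s : WHom x y w} {t : WHom x' y' w} (h : WEq s t)
    (ht : t.IsId) : s.IsId := by
  cases h; exact ht

end lemmas2

end Cells

/-! ### Whiskering of `w`-cells between functors -/

section Whisker

variable {w : Weakness} {A : Type u₁} [Category.{v₁} A] {B : Type u₂} [Category.{v₂} B]
  {C : Type u₃} [Category.{v₃} C]

/-- Left whiskering of a `w`-cell between functors. -/
def WHom.whL (F : A ⥤ B) {G H : B ⥤ C} (s : WHom G H w) : WHom (F ⋙ G) (F ⋙ H) w :=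
  s.map ((Functor.whiskeringLeft A B C).obj F)

/-- Right whiskering of a `w`-cell between functors. -/
def WHom.whR {F G : A ⥤ B} (s : WHom F G w) (H : B ⥤ C) : WHom (F ⋙ H) (G ⋙ H) w :=
  s.map ((Functor.whiskeringRight A B C).obj H)

theorem WHom.interchange {F G : A ⥤ B} {H K : B ⥤ C} (s : WHom F G w) (t : WHom H K w) :
    (t.whL F).comp (s.whR K) = (s.whR H).comp (t.whL G) := by
  cases s with
  | strict h => cases t with | strict h' => cases h; cases h'; rfl
  | pseudo e =>
    cases t with
    | pseudo e' =>
      simp only [WHom.whL, WHom.whR, WHom.comp, WHom.map]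
      congr 1
      ext x
      simp
  | lax f =>
    cases t with
    | lax f' =>
      simp only [WHom.whL, WHom.whR, WHom.comp, WHom.map]
      congr 1
      ext x
      simp
  | colax f =>
    cases t with
    | colax f' =>
      simp only [WHom.whL, WHom.whR, WHom.comp, WHom.map]
      congr 1
      ext x
      simp

end Whisker

/-! ### Strict 2-functors on chosen objects -/

section TwoFunctors

open Bicategory

/-- A strict 2-functor from the full sub-2-category of `B` on the family of objects `p` to `C`,
which sends `p i` to `o i`. If `p` is a bijection, this is a strict 2-functor `B ⥤ C` that is
given on objects by `o`. -/
structure TwoFunctorOn {ι : Type*} {B : Type*} [Bicategory B] {C : Type*} [Bicategory C]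
    (p : ι → B) (o : ι → C) where
  hom (i j : ι) : (p i ⟶ p j) ⥤ (o i ⟶ o j)
  map_id (i : ι) : (hom i i).obj (𝟙 (p i)) = 𝟙 (o i)
  map_comp {i j k : ι} (f : p i ⟶ p j) (g : p j ⟶ p k) :
    (hom i k).obj (f ≫ g) = (hom i j).obj f ≫ (hom j k).obj g
  map_whiskerLeft {i j k : ι} (f : p i ⟶ p j) {g g' : p j ⟶ p k} (η : g ⟶ g') :
    HomEq ((hom i k).map (f ◁ η)) ((hom i j).obj f ◁ (hom j k).map η)
  map_whiskerRight {i j k : ι} {f f' : p i ⟶ p j} (η : f ⟶ f') (g : p j ⟶ p k) :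
    HomEq ((hom i k).map (η ▷ g)) ((hom i j).map η ▷ (hom j k).obj g)

/-- Left whiskering of a `w`-cell between 1-cells. -/
def WHom.whiskerL {B : Type*} [Bicategory B] {a b c : B} {w : Weakness} (f : a ⟶ b)
    {g h : b ⟶ c} (s : WHom g h w) : WHom (f ≫ g) (f ≫ h) w :=
  s.map (precomp c f)

/-- Right whiskering of a `w`-cell between 1-cells. -/
def WHom.whiskerR {B : Type*} [Bicategory B] {a b c : B} {w : Weakness} {f g : a ⟶ b}
    (s : WHom f g w) (h : b ⟶ c) : WHom (f ≫ h) (g ≫ h) w :=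
  s.map (postcomp a h)

/-- `y` is the `r`-fold power of `x`, in the 2-categorical sense, with the projections `π`. -/
def IsTwoPower {B : Type*} [Bicategory B] {x y : B} {r : ℕ} (π : Fin r → (y ⟶ x)) : Prop :=
  ∀ z : B, (Functor.pi' fun i => postcomp z (π i) :
    (z ⟶ y) ⥤ (∀ _ : Fin r, z ⟶ x)).IsIso

end TwoFunctors

/-! ### Lawvere 2-theories and their actions on categories -/

open Bicategory in
/-- A Lawvere 2-theory on the 2-category `𝕋`: an identity-on-objects, finite-power preserving
2-functor to `𝕋` from the opposite of the skeleton of finite sets. A map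
`p : Fin n → Fin m` gives the tight (inert) 1-cell `θ p : m ⟶ n`. -/
structure LawvereTwoTheory (𝕋 : Type*) [Bicategory.{u, u} 𝕋] [Bicategory.Strict 𝕋] where
  ob : ℕ → 𝕋
  ob_bijective : Function.Bijective ob
  θ {m n : ℕ} (p : Fin n → Fin m) : ob m ⟶ ob n
  θ_id (m : ℕ) : θ (id : Fin m → Fin m) = 𝟙 (ob m)
  θ_comp {m n k : ℕ} (p : Fin n → Fin m) (q : Fin k → Fin n) : θ (p ∘ q) = θ p ≫ θ q
  isTwoPower (n : ℕ) : IsTwoPower fun i : Fin n => θ fun _ : Fin 1 => i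

section Theory

variable {𝕋 : Type*} [Bicategory.{u, u} 𝕋] [Bicategory.Strict 𝕋]

/-- A strict 2-functor from the theory to `Cat` that sends the object `n` to `O n`. -/
structure CatAction (T : LawvereTwoTheory 𝕋) (O : ℕ → Type u) [∀ n, Category.{u} (O n)] where
  hom (m n : ℕ) : (T.ob m ⟶ T.ob n) ⥤ (O m ⥤ O n)
  map_id (m : ℕ) : (hom m m).obj (𝟙 (T.ob m)) = 𝟭 (O m)
  map_comp {m n k : ℕ} (α : T.ob m ⟶ T.ob n) (β : T.ob n ⟶ T.ob k) :
    (hom m k).obj (α ≫ β) = (hom m n).obj α ⋙ (hom n k).obj β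
  map_whiskerLeft {m n k : ℕ} (α : T.ob m ⟶ T.ob n) {β β' : T.ob n ⟶ T.ob k} (η : β ⟶ β') :
    HomEq ((hom m k).map (Bicategory.whiskerLeft α η))
      (Functor.whiskerLeft ((hom m n).obj α) ((hom n k).map η))
  map_whiskerRight {m n k : ℕ} {α α' : T.ob m ⟶ T.ob n} (η : α ⟶ α') (β : T.ob n ⟶ T.ob k) :
    HomEq ((hom m k).map (Bicategory.whiskerRight η β))
      (Functor.whiskerRight ((hom m n).map η) ((hom n k).obj β))

/-- A model of the theory in `Cat` with underlying category `C`: a strict 2-functor that sends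
`n` to the power `Cⁿ` and tight 1-cells to the reindexing functors. -/
structure ModelOn (T : LawvereTwoTheory 𝕋) (C : Type u) [Category.{u} C] extends
    CatAction T fun n => (∀ _ : Fin n, C) where
  tight {m n : ℕ} (p : Fin n → Fin m) : (hom m n).obj (T.θ p) = Pi.comap (fun _ => C) p

/-- A strict 2-functor from the theory to `Cat`. The weakness of the transformations between
such 2-functors is carried by the type. -/
structure TwoFun (T : LawvereTwoTheory 𝕋) (w : Weakness) where
  O : ℕ → Type u
  [cat : ∀ n, Category.{u} (O n)]
  act : CatAction T O

attribute [instance] TwoFun.cat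

/-- The functor by which a 1-cell acts. -/
abbrev TwoFun.fn {T : LawvereTwoTheory 𝕋} {w : Weakness} (F : TwoFun T w) {m n : ℕ} (α : T.ob m ⟶ T.ob n) :
    F.O m ⥤ F.O n :=
  (F.act.hom m n).obj α

/-- The natural transformation by which a 2-cell acts. -/
abbrev TwoFun.tr {T : LawvereTwoTheory 𝕋} {w : Weakness} (F : TwoFun T w) {m n : ℕ}
    {α β : T.ob m ⟶ T.ob n} (η : α ⟶ β) : F.fn α ⟶ F.fn β :=
  (F.act.hom m n).map η

/-- A `w`-natural transformation that is strict on tight 1-cells. -/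
structure WTrans {T : LawvereTwoTheory 𝕋} {w : Weakness} (F G : TwoFun T w) where
  app (n : ℕ) : F.O n ⥤ G.O n
  cell {m n : ℕ} (α : T.ob m ⟶ T.ob n) : WHom (app m ⋙ G.fn α) (F.fn α ⋙ app n) w
  cell_tight {m n : ℕ} (p : Fin n → Fin m) : (cell (T.θ p)).IsId
  cell_comp {m n k : ℕ} (α : T.ob m ⟶ T.ob n) (β : T.ob n ⟶ T.ob k) :
    WEq (cell (α ≫ β))
      (((cell α).whR (G.fn β)).comp ((cell β).whL (F.fn α)))
  cell_nat {m n : ℕ} {α β : T.ob m ⟶ T.ob n} (η : α ⟶ β) :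
    (cell α).Sq (cell β) (Functor.whiskerLeft (app m) (G.tr η))
      (Functor.whiskerRight (F.tr η) (app n))

/-- A modification. -/
@[ext]
structure WTrans.Modif {T : LawvereTwoTheory 𝕋} {w : Weakness} {F G : TwoFun T w}
    (f g : WTrans F G) where
  app (n : ℕ) : f.app n ⟶ g.app n
  sq {m n : ℕ} (α : T.ob m ⟶ T.ob n) :
    (f.cell α).Sq (g.cell α) (Functor.whiskerRight (app m) (G.fn α))
      (Functor.whiskerLeft (F.fn α) (app n))

namespace WTrans

variable {T : LawvereTwoTheory 𝕋} {w : Weakness}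

theorem ext' {F G : TwoFun T w} {f g : WTrans F G} (h : f.app = g.app)
    (h' : ∀ {m n : ℕ} (α : T.ob m ⟶ T.ob n), WEq (f.cell α) (g.cell α)) : f = g := by
  obtain ⟨fa, fc, _, _, _⟩ := f
  obtain ⟨ga, gc, _, _, _⟩ := g
  cases h
  have : @fc = @gc := by
    funext m n α
    exact (h' α).eq
  cases this
  rfl

instance category (F G : TwoFun T w) : Category.{u} (WTrans F G) where
  Hom f g := Modif f g
  id f :=
    { app := fun n => 𝟙 (f.app n)
      sq := fun α => by
        rw [Functor.whiskerRight_id', Functor.whiskerLeft_id']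
        exact WHom.Sq.id _ }
  comp a b :=
    { app := fun n => a.app n ≫ b.app n
      sq := fun α => by
        rw [Functor.whiskerRight_comp, Functor.whiskerLeft_comp]
        exact (a.sq α).comp (b.sq α) }
  id_comp _ := Modif.ext (funext fun _ => Category.id_comp _)
  comp_id _ := Modif.ext (funext fun _ => Category.comp_id _)
  assoc _ _ _ := Modif.ext (funext fun _ => Category.assoc _ _ _)

@[ext]
theorem hom_ext {F G : TwoFun T w} {f g : WTrans F G} {a b : f ⟶ g}
    (h : ∀ n, Modif.app a n = Modif.app b n) : a = b :=
  Modif.ext (funext h)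

@[simp]
theorem id_app {F G : TwoFun T w} (f : WTrans F G) (n : ℕ) :
    Modif.app (𝟙 f) n = 𝟙 (f.app n) := rfl

@[simp]
theorem comp_app {F G : TwoFun T w} {f g h : WTrans F G} (a : f ⟶ g) (b : g ⟶ h) (n : ℕ) :
    Modif.app (a ≫ b) n = Modif.app a n ≫ Modif.app b n := rfl

/-- The identity transformation. -/
def id (F : TwoFun T w) : WTrans F F where
  app n := 𝟭 (F.O n)
  cell _ := WHom.ofEq rfl
  cell_tight _ := ⟨rfl, rfl⟩
  cell_comp α β := WHom.IsId.wEq ⟨rfl, rfl⟩ (.comp (.map _ ⟨rfl, rfl⟩) (.map _ ⟨rfl, rfl⟩))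
    (F.act.map_comp α β)
  cell_nat _ := WHom.Sq.ofEq _ _ .refl

/-- Composition of transformations. -/
def comp {F G H : TwoFun T w} (f : WTrans F G) (g : WTrans G H) : WTrans F H where
  app n := f.app n ⋙ g.app n
  cell {m n} α := (WHom.whL (f.app m) (g.cell α)).comp (WHom.whR (f.cell α) (g.app n))
  cell_tight p := .comp (.map _ (g.cell_tight p)) (.map _ (f.cell_tight p))
  cell_comp {m n k} α β := by
    refine (WEq.comp ((g.cell_comp α β).map _) ((f.cell_comp α β).map _)).trans ?_
    rw [WHom.map_comp, WHom.map_comp]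
    refine .of_eq ?_
    have key := WHom.interchange (f.cell α) (g.cell β)
    simp only [WHom.whL, WHom.whR, WHom.map_comp, WHom.map_map] at key ⊢
    simp only [WHom.assoc]
    congr 1
    have := congrArg (fun z => WHom.comp z ((f.cell β).map
      ((Functor.whiskeringRight _ _ _).obj (g.app k) ⋙
        (Functor.whiskeringLeft _ _ _).obj (F.fn α)))) key
    simp only [WHom.assoc] at this
    exact this
  cell_nat {m n α β} η :=
    WHom.Sq.hcomp ((g.cell_nat η).map ((Functor.whiskeringLeft _ _ _).obj (f.app m)))
      ((f.cell_nat η).map ((Functor.whiskeringRight _ _ _).obj (g.app n)))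

theorem eqToHom_app {F G : TwoFun T w} {f g : WTrans F G} (h : f = g) (n : ℕ) :
    Modif.app (eqToHom h) n = eqToHom (congrArg (fun k => k.app n) h) := by
  subst h; rfl

theorem comp_assoc {F G H K : TwoFun T w} (f : WTrans F G) (g : WTrans G H)
    (h : WTrans H K) : (f.comp g).comp h = f.comp (g.comp h) :=
  ext' rfl fun α => .of_eq (by
    simp only [comp, WHom.whL, WHom.whR, WHom.map_comp, WHom.map_map, WHom.assoc]
    rfl)

theorem id_comp {F G : TwoFun T w} (f : WTrans F G) : (WTrans.id F).comp f = f :=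
  ext' rfl fun α => .of_eq (by
    simp only [comp, id, WHom.whL, WHom.whR, WHom.map_ofEq]
    refine (WHom.comp_id _).trans ?_
    cases f.cell α <;> rfl)

theorem comp_id {F G : TwoFun T w} (f : WTrans F G) : f.comp (WTrans.id G) = f :=
  ext' rfl fun α => .of_eq (by
    simp only [comp, id, WHom.whL, WHom.whR, WHom.map_ofEq]
    refine (WHom.id_comp _).trans ?_
    cases f.cell α <;> rfl)

/-- Left whiskering of modifications. -/
def whiskerL {F G H : TwoFun T w} (f : WTrans F G) {g h : WTrans G H} (η : g ⟶ h) :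
    f.comp g ⟶ f.comp h where
  app n := Functor.whiskerLeft (f.app n) (Modif.app η n)
  sq {m n} α := WHom.Sq.hcomp
    ((Modif.sq η α).map ((Functor.whiskeringLeft _ _ _).obj (f.app m)))
    (WHom.Sq.nat ((Functor.whiskeringRight _ _ _).map (Modif.app η n)) (f.cell α))

/-- Right whiskering of modifications. -/
def whiskerR {F G H : TwoFun T w} {f g : WTrans F G} (η : f ⟶ g) (h : WTrans G H) :
    f.comp h ⟶ g.comp h where
  app n := Functor.whiskerRight (Modif.app η n) (h.app n)
  sq {m n} α := WHom.Sq.hcomp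
    (WHom.Sq.nat ((Functor.whiskeringLeft _ _ _).map (Modif.app η m)) (h.cell α))
    ((Modif.sq η α).map ((Functor.whiskeringRight _ _ _).obj (h.app n)))

end WTrans

namespace TwoFun

variable {T : LawvereTwoTheory 𝕋} {w : Weakness}

/-- The 2-category of strict 2-functors, `w`-natural transformations that are strict on tight
1-cells, and modifications. -/
instance bicategory : Bicategory.{u, u} (TwoFun T w) where
  Hom F G := WTrans F G
  id F := WTrans.id F
  comp f g := WTrans.comp f g
  homCategory F G := WTrans.category F G
  whiskerLeft f _ _ η := WTrans.whiskerL f η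
  whiskerRight η h := WTrans.whiskerR η h
  associator f g h := eqToIso (WTrans.comp_assoc f g h)
  leftUnitor f := eqToIso (WTrans.id_comp f)
  rightUnitor f := eqToIso (WTrans.comp_id f)
  whiskerLeft_id f g := WTrans.hom_ext fun n => by ext x; rfl
  whiskerLeft_comp f g h i η θ := WTrans.hom_ext fun n => by ext x; rfl
  id_whiskerLeft η := WTrans.hom_ext fun n => by
    simp only [eqToIso, WTrans.comp_app, WTrans.eqToHom_app]
    exact ((Category.id_comp _).trans (Category.comp_id _)).symm
  comp_whiskerLeft f g h h' η := WTrans.hom_ext fun n => by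
    simp only [eqToIso, WTrans.comp_app, WTrans.eqToHom_app]
    exact ((Category.id_comp _).trans (Category.comp_id _)).symm
  id_whiskerRight f g := WTrans.hom_ext fun n => by
    ext x; exact (g.app n).map_id _
  comp_whiskerRight η θ i := WTrans.hom_ext fun n => by
    ext x; exact (i.app n).map_comp _ _
  whiskerRight_id η := WTrans.hom_ext fun n => by
    simp only [eqToIso, WTrans.comp_app, WTrans.eqToHom_app]
    exact ((Category.id_comp _).trans (Category.comp_id _)).symm
  whiskerRight_comp η g h := WTrans.hom_ext fun n => by
    simp only [eqToIso, WTrans.comp_app, WTrans.eqToHom_app]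
    exact ((Category.id_comp _).trans (Category.comp_id _)).symm
  whisker_assoc f g g' η h := WTrans.hom_ext fun n => by
    simp only [eqToIso, WTrans.comp_app, WTrans.eqToHom_app]
    exact ((Category.id_comp _).trans (Category.comp_id _)).symm
  whisker_exchange η θ := WTrans.hom_ext fun n => by
    ext x; exact ((WTrans.Modif.app θ n).naturality _).symm
  pentagon f g h i := WTrans.hom_ext fun n => by
    simp only [eqToIso, WTrans.comp_app, WTrans.eqToHom_app]
    have h₁ : WTrans.Modif.app (WTrans.whiskerR (eqToHom (WTrans.comp_assoc f g h)) i) n =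
        𝟙 _ := by
      simp only [WTrans.whiskerR, WTrans.eqToHom_app]
      exact Functor.whiskerRight_id' _
    have h₂ : WTrans.Modif.app (WTrans.whiskerL f (eqToHom (WTrans.comp_assoc g h i))) n =
        𝟙 _ := by
      simp only [WTrans.whiskerL, WTrans.eqToHom_app]
      exact Functor.whiskerLeft_id' _
    rw [h₁, h₂]
    exact (Category.id_comp _).trans rfl
  triangle f g := WTrans.hom_ext fun n => by
    simp only [eqToIso, WTrans.comp_app, WTrans.eqToHom_app]
    have h₁ : WTrans.Modif.app (WTrans.whiskerR (eqToHom (WTrans.comp_id f)) g) n = 𝟙 _ := by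
      simp only [WTrans.whiskerR, WTrans.eqToHom_app]
      exact Functor.whiskerRight_id' _
    have h₂ : WTrans.Modif.app (WTrans.whiskerL f (eqToHom (WTrans.id_comp g))) n = 𝟙 _ := by
      simp only [WTrans.whiskerL, WTrans.eqToHom_app]
      exact Functor.whiskerLeft_id' _
    rw [h₁, h₂]
    exact Category.comp_id _

instance strict : Bicategory.Strict (TwoFun T w) where
  id_comp f := WTrans.id_comp f
  comp_id f := WTrans.comp_id f
  assoc f g h := WTrans.comp_assoc f g h

end TwoFun

/-! ### Models -/

/-- A model of the theory in `Cat`. The weakness of the homomorphisms is carried by the type. -/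
structure Model (T : LawvereTwoTheory 𝕋) (w : Weakness) where
  carrier : Type u
  [cat : Category.{u} carrier]
  str : ModelOn T carrier

attribute [instance] Model.cat

namespace Model

variable {T : LawvereTwoTheory 𝕋} {w : Weakness}

/-- The underlying strict 2-functor of a model. -/
abbrev toFun (X : Model T w) : TwoFun T w where
  O n := ∀ _ : Fin n, X.carrier
  act := X.str.toCatAction

open Bicategory in
/-- The 2-category `Mod_w` of models, `w`-homomorphisms and modifications. -/
instance bicategory : Bicategory.{u, u} (Model T w) where
  Hom X Y := X.toFun ⟶ Y.toFun
  id X := 𝟙 X.toFun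
  comp {X Y Z} f g := CategoryStruct.comp (X := X.toFun) (Y := Y.toFun) (Z := Z.toFun) f g
  homCategory X Y := inferInstanceAs (Category (X.toFun ⟶ Y.toFun))
  whiskerLeft {X Y Z} f _ _ η := Bicategory.whiskerLeft (a := X.toFun) (b := Y.toFun)
    (c := Z.toFun) f η
  whiskerRight {X Y Z} _ _ η h := Bicategory.whiskerRight (a := X.toFun) (b := Y.toFun)
    (c := Z.toFun) η h
  associator {X Y Z W} f g h := Bicategory.associator (a := X.toFun) (b := Y.toFun)
    (c := Z.toFun) (d := W.toFun) f g h
  leftUnitor {X Y} f := Bicategory.leftUnitor (a := X.toFun) (b := Y.toFun) f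
  rightUnitor {X Y} f := Bicategory.rightUnitor (a := X.toFun) (b := Y.toFun) f
  whiskerLeft_id _ _ := Bicategory.whiskerLeft_id (B := TwoFun T w) _ _
  whiskerLeft_comp _ _ _ _ _ _ := Bicategory.whiskerLeft_comp (B := TwoFun T w) _ _ _
  id_whiskerLeft _ := Bicategory.id_whiskerLeft (B := TwoFun T w) _
  comp_whiskerLeft _ _ _ _ _ := Bicategory.comp_whiskerLeft (B := TwoFun T w) _ _ _
  id_whiskerRight _ _ := Bicategory.id_whiskerRight (B := TwoFun T w) _ _
  comp_whiskerRight _ _ _ := Bicategory.comp_whiskerRight (B := TwoFun T w) _ _ _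
  whiskerRight_id _ := Bicategory.whiskerRight_id (B := TwoFun T w) _
  whiskerRight_comp _ _ _ := Bicategory.whiskerRight_comp (B := TwoFun T w) _ _ _
  whisker_assoc _ _ _ _ _ := Bicategory.whisker_assoc (B := TwoFun T w) _ _ _
  whisker_exchange _ _ := Bicategory.whisker_exchange (B := TwoFun T w) _ _
  pentagon _ _ _ _ := Bicategory.pentagon (B := TwoFun T w) _ _ _ _
  triangle _ _ := Bicategory.triangle (B := TwoFun T w) _ _

instance strict : Bicategory.Strict (Model T w) where
  id_comp f := WTrans.id_comp f
  comp_id f := WTrans.comp_id f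
  assoc f g h := WTrans.comp_assoc f g h

end Model

section Terminal

variable {A : Type u} [Category.{u} A] {n : ℕ}

theorem functor_to_terminal_ext (F G : A ⥤ (∀ _ : Fin n, Discrete PUnit.{u + 1})) : F = G :=
  CategoryTheory.Functor.ext (fun _ => Subsingleton.elim _ _)
    (fun _ _ _ => by funext i; exact Subsingleton.elim _ _)

theorem natTrans_to_terminal_homEq {F G F' G' : A ⥤ (∀ _ : Fin n, Discrete PUnit.{u + 1})}
    (a : F ⟶ G) (b : F' ⟶ G') : HomEq a b := by
  obtain rfl : F = F' := functor_to_terminal_ext _ _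
  obtain rfl : G = G' := functor_to_terminal_ext _ _
  refine .of_eq ?_
  ext x i
  exact Subsingleton.elim _ _

end Terminal

/-- The terminal model. -/
def terminalModel (T : LawvereTwoTheory 𝕋) (w : Weakness) : Model T w where
  carrier := Discrete PUnit
  str :=
    { hom := fun _ _ => (Functor.const _).obj ((Functor.const _).obj fun _ => ⟨⟨⟩⟩)
      map_id := fun _ => functor_to_terminal_ext _ _
      map_comp := fun _ _ => functor_to_terminal_ext _ _
      map_whiskerLeft := fun _ _ _ _ => natTrans_to_terminal_homEq _ _
      map_whiskerRight := fun _ _ => natTrans_to_terminal_homEq _ _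
      tight := fun _ => functor_to_terminal_ext _ _ }

/-! ### `w`-commutativity -/

/-- The map of finite sets `id × q`, where `m × k` is identified lexicographically with `mk`. -/
def mapRight (m : ℕ) {k l : ℕ} (q : Fin l → Fin k) : Fin (m * l) → Fin (m * k) := fun x =>
  finProdFinEquiv ((finProdFinEquiv.symm x).1, q (finProdFinEquiv.symm x).2)

/-- The map of finite sets `p × id`, where `m × k` is identified lexicographically with `mk`. -/
def mapLeft (k : ℕ) {m n : ℕ} (p : Fin n → Fin m) : Fin (n * k) → Fin (m * k) := fun x =>
  finProdFinEquiv (p (finProdFinEquiv.symm x).1, (finProdFinEquiv.symm x).2)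

open Bicategory in
/-- A `w`-commutativity of a Lawvere 2-theory: a pseudomonoid structure on it for the Gray tensor
product with Gray cells of weakness `w`. The unit is the object `1`; the multiplication is a
2-functor from the Gray tensor square which is given on objects by the product of numbers and
on tight 1-cells by the product of finite sets; so it amounts to 2-functors `L m = m ⊗ -`
and `R k = - ⊗ k`, and to Gray cells `(α ⊗ 1) ≫ (1 ⊗ β) ⟹ (1 ⊗ β) ≫ (α ⊗ 1)` that are subject to
the relations of the Gray tensor product. The unit and associativity isomorphisms are those of
the products of finite sets. -/
structure WCommutativity (T : LawvereTwoTheory 𝕋) (w : Weakness) where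
  L (m : ℕ) : TwoFunctorOn T.ob fun k => T.ob (m * k)
  R (k : ℕ) : TwoFunctorOn T.ob fun m => T.ob (m * k)
  L_tight (m : ℕ) {k l : ℕ} (q : Fin l → Fin k) :
    ((L m).hom k l).obj (T.θ q) = T.θ (mapRight m q)
  R_tight (k : ℕ) {m n : ℕ} (p : Fin n → Fin m) :
    ((R k).hom m n).obj (T.θ p) = T.θ (mapLeft k p)
  /-- The Gray cells. -/
  gray {m n k l : ℕ} (α : T.ob m ⟶ T.ob n) (β : T.ob k ⟶ T.ob l) :
    WHom (((R k).hom m n).obj α ≫ ((L n).hom k l).obj β)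
      (((L m).hom k l).obj β ≫ ((R l).hom m n).obj α) w
  gray_tight_left {m n k l : ℕ} (p : Fin n → Fin m) (β : T.ob k ⟶ T.ob l) :
    (gray (T.θ p) β).IsId
  gray_tight_right {m n k l : ℕ} (α : T.ob m ⟶ T.ob n) (q : Fin l → Fin k) :
    (gray α (T.θ q)).IsId
  gray_comp_left {m n o k l : ℕ} (α : T.ob m ⟶ T.ob n) (α' : T.ob n ⟶ T.ob o)
    (β : T.ob k ⟶ T.ob l) :
    WEq (gray (α ≫ α') β)
      (((gray α' β).whiskerL (((R k).hom m n).obj α)).compEq (Strict.assoc _ _ _).symm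
        ((gray α β).whiskerR (((R l).hom n o).obj α')))
  gray_comp_right {m n k l j : ℕ} (α : T.ob m ⟶ T.ob n) (β : T.ob k ⟶ T.ob l)
    (β' : T.ob l ⟶ T.ob j) :
    WEq (gray α (β ≫ β'))
      (((gray α β).whiskerR (((L n).hom l j).obj β')).compEq (Strict.assoc _ _ _)
        ((gray α β').whiskerL (((L m).hom k l).obj β)))
  gray_nat_left {m n k l : ℕ} {α α' : T.ob m ⟶ T.ob n} (η : α ⟶ α') (β : T.ob k ⟶ T.ob l) :
    (gray α β).Sq (gray α' β) (((R k).hom m n).map η ▷ ((L n).hom k l).obj β)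
      (((L m).hom k l).obj β ◁ ((R l).hom m n).map η)
  gray_nat_right {m n k l : ℕ} (α : T.ob m ⟶ T.ob n) {β β' : T.ob k ⟶ T.ob l} (η : β ⟶ β') :
    (gray α β).Sq (gray α β') (((R k).hom m n).obj α ◁ ((L n).hom k l).map η)
      (((L m).hom k l).map η ▷ ((R l).hom m n).obj α)
  /-- Unit laws. -/
  L_one {k l : ℕ} (β : T.ob k ⟶ T.ob l) :
    ((L 1).hom k l).obj β ≫ T.θ (Fin.cast (one_mul l).symm) =
      T.θ (Fin.cast (one_mul k).symm) ≫ β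
  L_one_map {k l : ℕ} {β β' : T.ob k ⟶ T.ob l} (η : β ⟶ β') :
    HomEq (((L 1).hom k l).map η ▷ T.θ (Fin.cast (one_mul l).symm))
      (T.θ (Fin.cast (one_mul k).symm) ◁ η)
  R_one {m n : ℕ} (α : T.ob m ⟶ T.ob n) :
    ((R 1).hom m n).obj α ≫ T.θ (Fin.cast (mul_one n).symm) =
      T.θ (Fin.cast (mul_one m).symm) ≫ α
  R_one_map {m n : ℕ} {α α' : T.ob m ⟶ T.ob n} (η : α ⟶ α') :
    HomEq (((R 1).hom m n).map η ▷ T.θ (Fin.cast (mul_one n).symm))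
      (T.θ (Fin.cast (mul_one m).symm) ◁ η)
  /-- Associativity on the 1-cells and 2-cells of each of the three variables. -/
  assoc₁ {m n : ℕ} (α : T.ob m ⟶ T.ob n) (k l : ℕ) :
    ((R l).hom _ _).obj (((R k).hom m n).obj α) ≫ T.θ (Fin.cast (mul_assoc n k l).symm) =
      T.θ (Fin.cast (mul_assoc m k l).symm) ≫ ((R (k * l)).hom m n).obj α
  assoc₁_map {m n : ℕ} {α α' : T.ob m ⟶ T.ob n} (η : α ⟶ α') (k l : ℕ) :
    HomEq (((R l).hom _ _).map (((R k).hom m n).map η) ▷ T.θ (Fin.cast (mul_assoc n k l).symm))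
      (T.θ (Fin.cast (mul_assoc m k l).symm) ◁ ((R (k * l)).hom m n).map η)
  assoc₂ (m : ℕ) {k k' : ℕ} (β : T.ob k ⟶ T.ob k') (l : ℕ) :
    ((R l).hom _ _).obj (((L m).hom k k').obj β) ≫ T.θ (Fin.cast (mul_assoc m k' l).symm) =
      T.θ (Fin.cast (mul_assoc m k l).symm) ≫ ((L m).hom _ _).obj (((R l).hom k k').obj β)
  assoc₂_map (m : ℕ) {k k' : ℕ} {β β' : T.ob k ⟶ T.ob k'} (η : β ⟶ β') (l : ℕ) :
    HomEq (((R l).hom _ _).map (((L m).hom k k').map η) ▷ T.θ (Fin.cast (mul_assoc m k' l).symm))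
      (T.θ (Fin.cast (mul_assoc m k l).symm) ◁ ((L m).hom _ _).map (((R l).hom k k').map η))
  assoc₃ (m k : ℕ) {l l' : ℕ} (γ : T.ob l ⟶ T.ob l') :
    ((L (m * k)).hom l l').obj γ ≫ T.θ (Fin.cast (mul_assoc m k l').symm) =
      T.θ (Fin.cast (mul_assoc m k l).symm) ≫ ((L m).hom _ _).obj (((L k).hom l l').obj γ)
  assoc₃_map (m k : ℕ) {l l' : ℕ} {γ γ' : T.ob l ⟶ T.ob l'} (η : γ ⟶ γ') :
    HomEq (((L (m * k)).hom l l').map η ▷ T.θ (Fin.cast (mul_assoc m k l').symm))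
      (T.θ (Fin.cast (mul_assoc m k l).symm) ◁ ((L m).hom _ _).map (((L k).hom l l').map η))
  /-- Associativity on the Gray cells of each of the three pairs of variables. -/
  gray_assoc₁₂ {m n k k' : ℕ} (α : T.ob m ⟶ T.ob n) (β : T.ob k ⟶ T.ob k') (l : ℕ) :
    WEq (((gray α β).map ((R l).hom _ _)).whiskerR (T.θ (Fin.cast (mul_assoc n k' l).symm)))
      ((gray α (((R l).hom k k').obj β)).whiskerL (T.θ (Fin.cast (mul_assoc m k l).symm)))
  gray_assoc₁₃ {m n l l' : ℕ} (α : T.ob m ⟶ T.ob n) (k : ℕ) (γ : T.ob l ⟶ T.ob l') :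
    WEq ((gray (((R k).hom m n).obj α) γ).whiskerR (T.θ (Fin.cast (mul_assoc n k l').symm)))
      ((gray α (((L k).hom l l').obj γ)).whiskerL (T.θ (Fin.cast (mul_assoc m k l).symm)))
  gray_assoc₂₃ (m : ℕ) {k k' l l' : ℕ} (β : T.ob k ⟶ T.ob k') (γ : T.ob l ⟶ T.ob l') :
    WEq ((gray (((L m).hom k k').obj β) γ).whiskerR (T.θ (Fin.cast (mul_assoc m k' l').symm)))
      (((gray β γ).map ((L m).hom _ _)).whiskerL (T.θ (Fin.cast (mul_assoc m k l).symm)))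

section Aux

open Bicategory

variable {w : Weakness}

theorem WEq.of_hom {C : Type u₁} [Category.{v₁} C] {x y x' y' : C} {e : x ≅ y} {e' : x' ≅ y'}
    (h : HomEq e.hom e'.hom) : WEq (WHom.pseudo e) (WHom.pseudo e') := by
  obtain ⟨f, g, _, _⟩ := e
  obtain ⟨f', g', _, _⟩ := e'
  cases h
  refine .of_eq (congrArg WHom.pseudo (Iso.ext rfl))

theorem WEq.of_lax {C : Type u₁} [Category.{v₁} C] {x y x' y' : C} {f : x ⟶ y} {f' : x' ⟶ y'}
    (h : HomEq f f') : WEq (WHom.lax f) (WHom.lax f') := by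
  cases h; exact .refl

theorem WEq.of_colax {C : Type u₁} [Category.{v₁} C] {x y x' y' : C} {f : x ⟶ y}
    {f' : x' ⟶ y'} (h : HomEq f f') : WEq (WHom.colax f) (WHom.colax f') := by
  cases h; exact .refl

theorem WEq.of_strict {C : Type u₁} [Category.{v₁} C] {x y x' y' : C} (h : x = y)
    (h' : x' = y') (e : x = x') : WEq (WHom.strict h) (WHom.strict h') := by
  subst h h' e; exact .refl

theorem HomEq.conj {C : Type u₁} [Category.{v₁} C] {x y x' y' : C} (h : x' = x) (f : x ⟶ y)
    (h' : y = y') : HomEq (eqToHom h ≫ f ≫ eqToHom h') f := by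
  subst h h'
  exact .of_eq (by simp)

theorem HomEq.of_sq {C : Type u₁} [Category.{v₁} C] {x y x' y' : C} {s : WHom x y w}
    {s' : WHom x' y' w} {f : x ⟶ x'} {g : y ⟶ y'} (h : s.Sq s' f g) (hs : s.IsId)
    (hs' : s'.IsId) : HomEq f g := by
  obtain ⟨e, rfl⟩ := hs
  obtain ⟨e', rfl⟩ := hs'
  subst e e'
  cases w <;> simp [WHom.Sq, WHom.ofEq] at h <;> exact .of_eq h

theorem WHom.Sq.congr {C : Type u₁} [Category.{v₁} C] {x y x' y' a b a' b' : C}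
    {s : WHom x y w} {s' : WHom x' y' w} {f : x ⟶ x'} {g : y ⟶ y'} {t : WHom a b w}
    {t' : WHom a' b' w} {f' : a ⟶ a'} {g' : b ⟶ b'} (h : s.Sq s' f g) (hs : WEq s t)
    (hs' : WEq s' t') (hf : HomEq f f') (hg : HomEq g g') : t.Sq t' f' g' := by
  cases hs; cases hs'; cases hf; cases hg; exact h

theorem WHom.map_compEq {C : Type u₁} [Category.{v₁} C] {D : Type u₂} [Category.{v₂} D]
    (F : C ⥤ D) {x y y' z : C} (s : WHom x y w) (h : y = y') (t : WHom y' z w) :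
    (s.compEq h t).map F = (s.map F).compEq (congrArg F.obj h) (t.map F) := by
  rw [WHom.compEq, WHom.compEq, WHom.map_comp, WHom.map_comp, WHom.map_ofEq]

theorem CatAction.map_whiskerR {T : LawvereTwoTheory 𝕋} {O : ℕ → Type u}
    [∀ n, Category.{u} (O n)] (F : CatAction T O) {m n k : ℕ} {α α' : T.ob m ⟶ T.ob n}
    (s : WHom α α' w) (β : T.ob n ⟶ T.ob k) :
    WEq ((s.whiskerR β).map (F.hom m k)) ((s.map (F.hom m n)).whR ((F.hom n k).obj β)) := by
  cases s with
  | strict h => exact .of_strict _ _ (F.map_comp _ _)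
  | pseudo e => exact .of_hom (F.map_whiskerRight _ _)
  | lax f => exact .of_lax (F.map_whiskerRight _ _)
  | colax f => exact .of_colax (F.map_whiskerRight _ _)

theorem CatAction.map_whiskerL {T : LawvereTwoTheory 𝕋} {O : ℕ → Type u}
    [∀ n, Category.{u} (O n)] (F : CatAction T O) {m n k : ℕ} (α : T.ob m ⟶ T.ob n)
    {β β' : T.ob n ⟶ T.ob k} (s : WHom β β' w) :
    WEq ((s.whiskerL α).map (F.hom m k)) ((s.map (F.hom n k)).whL ((F.hom m n).obj α)) := by
  cases s with
  | strict h => exact .of_strict _ _ (F.map_comp _ _)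
  | pseudo e => exact .of_hom (F.map_whiskerLeft _ _)
  | lax f => exact .of_lax (F.map_whiskerLeft _ _)
  | colax f => exact .of_colax (F.map_whiskerLeft _ _)

theorem HomEq.whiskerLeft_comp' {B : Type*} [Bicategory B] [Strict B] {a b c d : B} (f : a ⟶ b)
    (g : b ⟶ c) {h h' : c ⟶ d} (η : h ⟶ h') : HomEq ((f ≫ g) ◁ η) (f ◁ g ◁ η) := by
  rw [comp_whiskerLeft]
  simp only [Strict.associator_eqToIso, eqToIso.hom, eqToIso.inv]
  exact .conj _ _ _

theorem HomEq.whiskerRight_comp' {B : Type*} [Bicategory B] [Strict B] {a b c d : B}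
    {f f' : a ⟶ b} (η : f ⟶ f') (g : b ⟶ c) (h : c ⟶ d) :
    HomEq (η ▷ (g ≫ h)) (η ▷ g ▷ h) := by
  rw [whiskerRight_comp]
  simp only [Strict.associator_eqToIso, eqToIso.hom, eqToIso.inv]
  exact .conj _ _ _

theorem HomEq.whisker_assoc' {B : Type*} [Bicategory B] [Strict B] {a b c d : B} (f : a ⟶ b)
    {g g' : b ⟶ c} (η : g ⟶ g') (h : c ⟶ d) : HomEq ((f ◁ η) ▷ h) (f ◁ η ▷ h) := by
  rw [whisker_assoc]
  simp only [Strict.associator_eqToIso, eqToIso.hom, eqToIso.inv]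
  exact .conj _ _ _

theorem HomEq.whiskerRight_congr {B : Type*} [Bicategory B] {a b c : B} {f f' g g' : a ⟶ b}
    {η : f ⟶ f'} {θ : g ⟶ g'} (h : HomEq η θ) {k k' : b ⟶ c} (e : k = k') :
    HomEq (η ▷ k) (θ ▷ k') := by
  subst e; cases h; exact .refl

theorem HomEq.whiskerLeft_congr {B : Type*} [Bicategory B] {a b c : B} {f f' g g' : b ⟶ c}
    {k k' : a ⟶ b} (e : k = k') {η : f ⟶ f'} {θ : g ⟶ g'} (h : HomEq η θ) :
    HomEq (k ◁ η) (k' ◁ θ) := by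
  subst e; cases h; exact .refl

end Aux

/-! ### The lifting of models -/

namespace WCommutativity

variable {T : LawvereTwoTheory 𝕋} {w : Weakness} (μ : WCommutativity T w)

/-- The projection of `mk` onto the `i`-th of `m` blocks of length `k`. -/
def block {m : ℕ} (i : Fin m) (k : ℕ) : Fin k → Fin (m * k) := fun j => finProdFinEquiv (i, j)

theorem mapLeft_cast {m : ℕ} (i : Fin m) (k : ℕ) :
    mapLeft k (fun _ : Fin 1 => i) ∘ Fin.cast (one_mul k).symm = block i k := by
  funext j
  have : Fin.cast (one_mul k).symm j = finProdFinEquiv ((0 : Fin 1), j) := by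
    apply Fin.ext
    simp
  simp [mapLeft, block, this]

theorem block_comm {m : ℕ} (i : Fin m) {k l : ℕ} (β : T.ob k ⟶ T.ob l) :
    T.θ (block i k) ≫ β = ((μ.L m).hom k l).obj β ≫ T.θ (block i l) := by
  obtain ⟨h, _⟩ := μ.gray_tight_left (fun _ : Fin 1 => i) β
  rw [μ.R_tight, μ.R_tight] at h
  rw [← mapLeft_cast, ← mapLeft_cast, T.θ_comp, T.θ_comp, Bicategory.Strict.assoc, ← μ.L_one,
    ← Bicategory.Strict.assoc, h, Bicategory.Strict.assoc]

open Bicategory in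
theorem block_comm_map {m : ℕ} (i : Fin m) {k l : ℕ} {β β' : T.ob k ⟶ T.ob l} (η : β ⟶ β') :
    HomEq (T.θ (block i k) ◁ η) (((μ.L m).hom k l).map η ▷ T.θ (block i l)) := by
  have h := HomEq.of_sq (μ.gray_nat_right (T.θ fun _ : Fin 1 => i) η)
    (μ.gray_tight_left _ β) (μ.gray_tight_left _ β')
  have e (k : ℕ) : T.θ (block i k) = ((μ.R k).hom m 1).obj (T.θ fun _ : Fin 1 => i) ≫
      T.θ (Fin.cast (one_mul k).symm) := by
    rw [μ.R_tight, ← T.θ_comp, mapLeft_cast]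
  refine (HomEq.whiskerLeft_congr (e k) .refl).trans ?_
  refine (HomEq.whiskerLeft_comp' _ _ _).trans ?_
  refine (HomEq.whiskerLeft_congr rfl (μ.L_one_map η).symm).trans ?_
  refine (HomEq.whisker_assoc' _ _ _).symm.trans ?_
  refine (HomEq.whiskerRight_congr h rfl).trans ?_
  refine (HomEq.whiskerRight_comp' _ _ _).symm.trans ?_
  exact HomEq.whiskerRight_congr .refl (e l).symm

/-- The strict 2-functor `Z(m ⊗ -)`; it is the power `Zᵐ` of the model `Z`. -/
def tensorL (Z : Model T w) (m : ℕ) : TwoFun T w where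
  O k := ∀ _ : Fin (m * k), Z.carrier
  act :=
    { hom := fun k l => (μ.L m).hom k l ⋙ Z.str.hom (m * k) (m * l)
      map_id := fun k => by
        rw [Functor.comp_obj, (μ.L m).map_id, Z.str.map_id]
      map_comp := fun α β => by
        rw [Functor.comp_obj, (μ.L m).map_comp, Z.str.map_comp]
        rfl
      map_whiskerLeft := fun α _ _ η =>
        (((μ.L m).map_whiskerLeft α η).map (Z.str.hom _ _)).trans (Z.str.map_whiskerLeft _ _)
      map_whiskerRight := fun η β =>
        (((μ.L m).map_whiskerRight η β).map (Z.str.hom _ _)).trans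
          (Z.str.map_whiskerRight _ _) }

/-- The `w`-natural transformation `Z(α ⊗ -)`, with the images of the Gray cells as its cells. -/
def lift (Z : Model T w) {m n : ℕ} (α : T.ob m ⟶ T.ob n) : μ.tensorL Z m ⟶ μ.tensorL Z n where
  app k := (Z.str.hom _ _).obj (((μ.R k).hom m n).obj α)
  cell {k l} β :=
    ((WHom.ofEq (Z.str.map_comp _ _).symm).comp
      ((μ.gray α β).map (Z.str.hom (m * k) (n * l)))).comp (WHom.ofEq (Z.str.map_comp _ _))
  cell_tight q := .comp (.comp ⟨_, rfl⟩ (.map _ (μ.gray_tight_right α q))) ⟨_, rfl⟩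
  cell_comp {k l j} β β' := by
    refine ((WEq.comp_ofEq _ _).trans (WEq.ofEq_comp _ _)).trans ?_
    refine ((μ.gray_comp_right α β β').map _).trans ?_
    refine (WEq.of_eq (WHom.map_compEq (Z.str.hom _ _) _ _ _)).trans ?_
    refine WEq.compEq ?_ ?_
    · refine (Z.str.map_whiskerR _ _).trans ?_
      exact WEq.map _ ((WEq.comp_ofEq _ _).trans (WEq.ofEq_comp _ _)).symm
    · refine (Z.str.map_whiskerL _ _).trans ?_
      exact WEq.map _ ((WEq.comp_ofEq _ _).trans (WEq.ofEq_comp _ _)).symm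
  cell_nat {k l β β'} η :=
    ((μ.gray_nat_right α η).map (Z.str.hom _ _)).congr
      ((WEq.comp_ofEq _ _).trans (WEq.ofEq_comp _ _)).symm
      ((WEq.comp_ofEq _ _).trans (WEq.ofEq_comp _ _)).symm
      (Z.str.map_whiskerLeft _ _) (Z.str.map_whiskerRight _ _)

/-- The modification `Z(η ⊗ -)`. -/
def liftMap (Z : Model T w) {m n : ℕ} {α α' : T.ob m ⟶ T.ob n} (η : α ⟶ α') :
    μ.lift Z α ⟶ μ.lift Z α' where
  app k := (Z.str.hom _ _).map (((μ.R k).hom m n).map η)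
  sq {k l} β :=
    ((μ.gray_nat_left η β).map (Z.str.hom _ _)).congr
      ((WEq.comp_ofEq _ _).trans (WEq.ofEq_comp _ _)).symm
      ((WEq.comp_ofEq _ _).trans (WEq.ofEq_comp _ _)).symm
      (Z.str.map_whiskerRight _ _) (Z.str.map_whiskerLeft _ _)

/-- The `i`-th projection from `Zᵐ` to `Z`. -/
def proj (Z : Model T w) {m : ℕ} (i : Fin m) : μ.tensorL Z m ⟶ Z.toFun where
  app k := Pi.comap (fun _ => Z.carrier) (block i k)
  cell {k l} β := WHom.ofEq (by
    rw [← Z.str.tight, ← Z.str.tight]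
    refine (Z.str.map_comp _ _).symm.trans ?_
    rw [μ.block_comm, Z.str.map_comp]
    rfl)
  cell_tight _ := ⟨_, rfl⟩
  cell_comp α β := WHom.IsId.wEq ⟨_, rfl⟩ (.comp (.map _ ⟨_, rfl⟩) (.map _ ⟨_, rfl⟩)) 
    (congrArg (Pi.comap (fun _ => Z.carrier) (block i _) ⋙ ·) (Z.str.map_comp α β))
  cell_nat η := WHom.Sq.ofEq _ _ (by
    have h := ((Z.str.map_whiskerLeft _ _).symm.trans
      ((μ.block_comm_map i η).map (Z.str.hom _ _))).trans (Z.str.map_whiskerRight _ _)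
    rw [Z.str.tight, Z.str.tight] at h
    exact h)

/-- The comparison functor `Hom_w(Y, Zᵐ) ⥤ Hom_w(Y, Z)ᵐ`. -/
def powerComparison (Y Z : Model T w) (m : ℕ) :
    (Y.toFun ⟶ μ.tensorL Z m) ⥤ (∀ _ : Fin m, Y ⟶ Z) :=
  Functor.pi' fun i => Bicategory.postcomp Y.toFun (μ.proj Z i)

/-- A model structure on `Hom_w(Y, Z)` is the one of the internal hom: it corresponds under the
comparison functors to the postcomposition with `Z(α ⊗ -)` and with `Z(η ⊗ -)`. -/
structure IsInternalHom {Y Z : Model T w} (H : ModelOn T (Y ⟶ Z)) : Prop where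
  obj {m n : ℕ} (α : T.ob m ⟶ T.ob n) :
    μ.powerComparison Y Z m ⋙ (H.hom m n).obj α =
      Bicategory.postcomp Y.toFun (μ.lift Z α) ⋙ μ.powerComparison Y Z n
  map {m n : ℕ} {α α' : T.ob m ⟶ T.ob n} (η : α ⟶ α') :
    HomEq (Functor.whiskerLeft (μ.powerComparison Y Z m) ((H.hom m n).map η))
      (Functor.whiskerRight ((Bicategory.postcomposing Y.toFun _ _).map (μ.liftMap Z η))
        (μ.powerComparison Y Z n))

end WCommutativity

/-! ### The iterated Gray tensor powers of the theory, on generators -/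

/-- The objects of the `n`-fold Gray tensor power of the theory: lists of `n` numbers. -/
inductive Ar : ℕ → Type
  | nil : Ar 0
  | cons {n : ℕ} (m : ℕ) (a : Ar n) : Ar (n + 1)

namespace Ar

/-- The right-nested product `m ⊗ a₁ ⊗ ⋯ ⊗ aₙ`. -/
def tensFrom : ∀ {n : ℕ}, ℕ → Ar n → ℕ
  | _, m, nil => m
  | _, m, cons k a => m * tensFrom k a

/-- The right-nested product `a₁ ⊗ ⋯ ⊗ aₙ`, which is the unit `1` for `n = 0`. -/
def tens : ∀ {n : ℕ}, Ar n → ℕ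
  | _, nil => 1
  | _, cons m a => tensFrom m a

theorem tensFrom_eq : ∀ {n : ℕ} (m : ℕ) (a : Ar n), tensFrom m a = m * tens a
  | _, m, nil => (mul_one m).symm
  | _, _, cons _ _ => rfl

theorem tens_cons {n : ℕ} (m : ℕ) (a : Ar n) : tens (cons m a) = m * tens a :=
  tensFrom_eq m a

/-- Concatenation. -/
def append {S : Type*} : ∀ (Γ : List S) {Δ : List S}, Ar Γ.length → Ar Δ.length →
    Ar (Γ ++ Δ).length
  | [], _, _, d => d
  | _ :: Γ, _, cons m a, d => cons m (append Γ a d)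

theorem tens_append {S : Type*} : ∀ (Γ : List S) {Δ : List S} (a : Ar Γ.length)
    (d : Ar Δ.length), tens (append Γ a d) = tens a * tens d
  | [], _, nil, d => (one_mul _).symm
  | _ :: Γ, _, cons m a, d => by
    rw [append]
    refine (tens_cons _ _).trans ?_
    rw [tens_append Γ a d]
    exact (mul_assoc _ _ _).symm.trans (congrArg (· * _) (tens_cons m a).symm)

theorem tens_subst {S : Type*} (Γ Ξ Δ : List S) (Y : S) (a : Ar Γ.length) (x : Ar Ξ.length)
    (d : Ar Δ.length) :
    tens (append Γ (Δ := Y :: Δ) a (cons (tens x) d)) = tens (append Γ a (append Ξ x d)) := by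
  rw [tens_append, tens_append, tens_append]
  exact congrArg _ (tens_cons _ _)

end Ar

/-- The generating 1-cells of the Gray tensor powers of the theory: 1-cells of the theory in one
of the variables. -/
inductive Step (T : LawvereTwoTheory 𝕋) : ∀ {n : ℕ}, Ar n → Ar n → Type u
  | here {n m m' : ℕ} (α : T.ob m ⟶ T.ob m') (a : Ar n) : Step T (.cons m a) (.cons m' a)
  | there {n : ℕ} (m : ℕ) {a b : Ar n} (s : Step T a b) : Step T (.cons m a) (.cons m b)

namespace Step

variable {T : LawvereTwoTheory 𝕋}

/-- The 2-cells between generating 1-cells. -/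
inductive Two : ∀ {n : ℕ} {a b : Ar n}, Step T a b → Step T a b → Type u
  | here {n m m' : ℕ} {α α' : T.ob m ⟶ T.ob m'} (η : α ⟶ α') (a : Ar n) :
    Two (.here α a) (.here α' a)
  | there {n : ℕ} (m : ℕ) {a b : Ar n} {s s' : Step T a b} (σ : Two s s') :
    Two (.there m s) (.there m s')

/-- The tight generating 1-cells. -/
inductive IsTight : ∀ {n : ℕ} {a b : Ar n}, Step T a b → Prop
  | here {n m m' : ℕ} (p : Fin m' → Fin m) (a : Ar n) : IsTight (.here (T.θ p) a)
  | there {n : ℕ} (m : ℕ) {a b : Ar n} {s : Step T a b} (h : IsTight s) : IsTight (.there m s)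

/-- Composition of generating 1-cells in the same variable. -/
inductive IsComp : ∀ {n : ℕ} {a b c : Ar n}, Step T a b → Step T b c → Step T a c → Prop
  | here {n m m' m'' : ℕ} (α : T.ob m ⟶ T.ob m') (β : T.ob m' ⟶ T.ob m'') (a : Ar n) :
    IsComp (.here α a) (.here β a) (.here (α ≫ β) a)
  | there {n : ℕ} (m : ℕ) {a b c : Ar n} {s : Step T a b} {t : Step T b c} {r : Step T a c}
    (h : IsComp s t r) : IsComp (.there m s) (.there m t) (.there m r)

/-- The squares `s ≫ t'`, `t ≫ s'` that are filled by the Gray cells, where `s` and `s'` are given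
by the same 1-cell in an earlier variable than that of `t` and `t'`. -/
inductive GraySq : ∀ {n : ℕ} {a b c d : Ar n}, Step T a b → Step T a c → Step T c d →
    Step T b d → Type u
  | here {n m m' : ℕ} (α : T.ob m ⟶ T.ob m') {a b : Ar n} (t : Step T a b) :
    GraySq (.here α a) (.there m t) (.here α b) (.there m' t)
  | there {n : ℕ} (k : ℕ) {a b c d : Ar n} {s : Step T a b} {t : Step T a c} {s' : Step T c d}
    {t' : Step T b d} (G : GraySq s t s' t') :
    GraySq (.there k s) (.there k t) (.there k s') (.there k t')

/-- A generating 1-cell in one of the first variables. -/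
def inl {S : Type*} : ∀ (Γ : List S) {Δ : List S} {a b : Ar Γ.length} (_ : Step T a b)
    (d : Ar Δ.length), Step T (Ar.append Γ a d) (Ar.append Γ b d)
  | _ :: Γ, _, _, _, here α a, d => here α (Ar.append Γ a d)
  | _ :: Γ, _, _, _, there m s, d => there m (inl Γ s d)

/-- A generating 1-cell in one of the last variables. -/
def inr {S : Type*} : ∀ (Γ : List S) {Δ : List S} (a : Ar Γ.length) {d e : Ar Δ.length}
    (_ : Step T d e), Step T (Ar.append Γ a d) (Ar.append Γ a e)
  | [], _, _, _, _, s => s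
  | _ :: Γ, _, .cons m a, _, _, s => there m (inr Γ a s)

end Step

namespace WCommutativity

variable {T : LawvereTwoTheory 𝕋} {w : Weakness} (μ : WCommutativity T w)

/-- The functor `- ⊗ a₁ ⊗ ⋯ ⊗ aₙ` on 1-cells and 2-cells. -/
def headFun : ∀ {n : ℕ} (a : Ar n) (m m' : ℕ),
    (T.ob m ⟶ T.ob m') ⥤ (T.ob (a.tensFrom m) ⟶ T.ob (a.tensFrom m'))
  | _, .nil, _, _ => 𝟭 _
  | _, .cons k a, m, m' => (μ.R (a.tensFrom k)).hom m m'

/-- The image of a generating 1-cell under `m ⊗ - ⊗ ⋯ ⊗ -`. -/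
def tailMap : ∀ {n : ℕ} (m : ℕ) {a b : Ar n}, Step T a b →
    (T.ob (a.tensFrom m) ⟶ T.ob (b.tensFrom m))
  | _, m, _, _, .here α a => ((μ.L m).hom _ _).obj ((μ.headFun a _ _).obj α)
  | _, m, _, _, .there k s => ((μ.L m).hom _ _).obj (tailMap k s)

/-- The image of a generating 1-cell under the iterated multiplication. -/
def tensMap : ∀ {n : ℕ} {a b : Ar n}, Step T a b → (T.ob a.tens ⟶ T.ob b.tens)
  | _, _, _, .here α a => (μ.headFun a _ _).obj α
  | _, _, _, .there m s => μ.tailMap m s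

/-- The image of a 2-cell under `m ⊗ - ⊗ ⋯ ⊗ -`. -/
def tailMap₂ : ∀ {n : ℕ} (m : ℕ) {a b : Ar n} {s s' : Step T a b}, s.Two s' →
    (μ.tailMap m s ⟶ μ.tailMap m s')
  | _, m, _, _, _, _, .here η a => ((μ.L m).hom _ _).map ((μ.headFun a _ _).map η)
  | _, m, _, _, _, _, .there k σ => ((μ.L m).hom _ _).map (tailMap₂ k σ)

/-- The image of a 2-cell under the iterated multiplication. -/
def tensMap₂ : ∀ {n : ℕ} {a b : Ar n} {s s' : Step T a b}, s.Two s' →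
    (μ.tensMap s ⟶ μ.tensMap s')
  | _, _, _, _, _, .here η a => (μ.headFun a _ _).map η
  | _, _, _, _, _, .there m σ => μ.tailMap₂ m σ

/-- The Gray cell between a 1-cell in the first variable and one in another variable. -/
def headGray {m m' : ℕ} (α : T.ob m ⟶ T.ob m') : ∀ {n : ℕ} {a b : Ar n} (t : Step T a b),
    WHom ((μ.headFun a m m').obj α ≫ μ.tailMap m' t)
      (μ.tailMap m t ≫ (μ.headFun b m m').obj α) w
  | _, _, _, .here β a => μ.gray α ((μ.headFun a _ _).obj β)
  | _, _, _, .there k t => μ.gray α (μ.tailMap k t)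

/-- The image under `m ⊗ -` of a `w`-cell between composites. -/
def mapL (m : ℕ) {k l l' j : ℕ} {α : T.ob k ⟶ T.ob l} {β : T.ob l ⟶ T.ob j}
    {α' : T.ob k ⟶ T.ob l'} {β' : T.ob l' ⟶ T.ob j} (s : WHom (α ≫ β) (α' ≫ β') w) :
    WHom (((μ.L m).hom k l).obj α ≫ ((μ.L m).hom l j).obj β)
      (((μ.L m).hom k l').obj α' ≫ ((μ.L m).hom l' j).obj β') w :=
  ((WHom.ofEq ((μ.L m).map_comp α β).symm).comp (s.map ((μ.L m).hom k j))).comp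
    (WHom.ofEq ((μ.L m).map_comp α' β'))

/-- The image of a Gray cell under `m ⊗ - ⊗ ⋯ ⊗ -`. -/
def tailGray : ∀ {n : ℕ} (m : ℕ) {a b c d : Ar n} {s : Step T a b} {t : Step T a c}
    {s' : Step T c d} {t' : Step T b d}, Step.GraySq s t s' t' →
    WHom (μ.tailMap m s ≫ μ.tailMap m t') (μ.tailMap m t ≫ μ.tailMap m s') w
  | _, m, _, _, _, _, _, _, _, _, .here α t => μ.mapL m (μ.headGray α t)
  | _, m, _, _, _, _, _, _, _, _, .there k G => μ.mapL m (tailGray k G)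

/-- The image of a Gray cell under the iterated multiplication. -/
def tensGray : ∀ {n : ℕ} {a b c d : Ar n} {s : Step T a b} {t : Step T a c}
    {s' : Step T c d} {t' : Step T b d}, Step.GraySq s t s' t' →
    WHom (μ.tensMap s ≫ μ.tensMap t') (μ.tensMap t ≫ μ.tensMap s') w
  | _, _, _, _, _, _, _, _, _, .here α t => μ.headGray α t
  | _, _, _, _, _, _, _, _, _, .there k G => μ.tailGray k G

end WCommutativity

/-! ### Multimaps -/

section MultiMaps

variable {T : LawvereTwoTheory 𝕋} {w : Weakness}

theorem WHom.map_congr' {C D D' E : Type*} [Category* C] [Category* D] [Category* D']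
    [Category* E] {F : C ⥤ D} {G : D ⥤ E} {F' : C ⥤ D'} {G' : D' ⥤ E} {x y : C} (s : WHom x y w)
    (h : F ⋙ G = F' ⋙ G') :
    WEq ((s.map F).map G) ((s.map F').map G') := by
  rw [WHom.map_map, WHom.map_map]
  exact WEq.map_congr h s

/-- The product `X₁(a₁) × ⋯ × Xₙ(aₙ)`. -/
def Dom : (Γ : List (Model T w)) → Ar Γ.length → Type u
  | [], _ => Discrete PUnit
  | X :: Γ, .cons m a => (∀ _ : Fin m, X.carrier) × Dom Γ a

instance Dom.category : (Γ : List (Model T w)) → (a : Ar Γ.length) → Category.{u} (Dom Γ a)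
  | [], _ => inferInstanceAs (Category (Discrete PUnit))
  | X :: Γ, .cons m a =>
    letI := Dom.category Γ a
    inferInstanceAs (Category ((∀ _ : Fin m, X.carrier) × Dom Γ a))

namespace Dom

/-- The functor `X₁ × ⋯ × Xₙ` on generating 1-cells. -/
def map : (Γ : List (Model T w)) → {a b : Ar Γ.length} → Step T a b → (Dom Γ a ⥤ Dom Γ b)
  | X :: Γ, _, _, .here α a => (X.toFun.fn α).prod (𝟭 (Dom Γ a))
  | _ :: Γ, _, _, .there _ s => (𝟭 _).prod (map Γ s)

/-- The functor `X₁ × ⋯ × Xₙ` on 2-cells. -/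
def map₂ : (Γ : List (Model T w)) → {a b : Ar Γ.length} → {s s' : Step T a b} → s.Two s' →
    (map Γ s ⟶ map Γ s')
  | X :: Γ, _, _, _, _, .here η a => NatTrans.prod (X.toFun.tr η) (𝟙 (𝟭 (Dom Γ a)))
  | _ :: Γ, _, _, _, _, .there _ σ => NatTrans.prod (𝟙 (𝟭 _)) (map₂ Γ σ)

/-- The canonical isomorphism from the product of two products. -/
def join : (Γ : List (Model T w)) → {Δ : List (Model T w)} → (a : Ar Γ.length) →
    (d : Ar Δ.length) → (Dom Γ a × Dom Δ d ⥤ Dom (Γ ++ Δ) (Ar.append Γ a d))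
  | [], _, _, _ => CategoryTheory.Prod.snd _ _
  | X :: Γ, Δ, .cons m a, d =>
    CategoryTheory.prod.associator (∀ _ : Fin m, X.carrier) (Dom Γ a) (Dom Δ d) ⋙
      (𝟭 _).prod (join Γ a d)

end Dom

/-- A `w`-multimap `X₁, …, Xₙ → Z` of models: a `w`-natural transformation, strict on tight
1-cells, from `X₁ × ⋯ × Xₙ` to the composite of `Z` with the iterated multiplication, where both
are 2-functors on the `n`-fold Gray tensor power of the theory. Such a transformation is given by
its components and by its cells at the generating 1-cells. -/
structure MultiMap (μ : WCommutativity T w) (Γ : List (Model T w)) (Z : Model T w) where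
  app (a : Ar Γ.length) : Dom Γ a ⥤ (∀ _ : Fin a.tens, Z.carrier)
  cell {a b : Ar Γ.length} (s : Step T a b) :
    WHom (app a ⋙ Z.toFun.fn (μ.tensMap s)) (Dom.map Γ s ⋙ app b) w
  cell_tight {a b : Ar Γ.length} {s : Step T a b} : s.IsTight → (cell s).IsId
  cell_comp {a b c : Ar Γ.length} {s : Step T a b} {t : Step T b c} {r : Step T a c} :
    s.IsComp t r →
      WEq (cell r) (((cell s).whR (Z.toFun.fn (μ.tensMap t))).comp
        ((cell t).whL (Dom.map Γ s)))
  cell_nat {a b : Ar Γ.length} {s s' : Step T a b} (σ : s.Two s') :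
    (cell s).Sq (cell s') (Functor.whiskerLeft (app a) (Z.toFun.tr (μ.tensMap₂ σ)))
      (Functor.whiskerRight (Dom.map₂ Γ σ) (app b))
  cell_gray {a b c d : Ar Γ.length} {s : Step T a b} {t : Step T a c} {s' : Step T c d}
    {t' : Step T b d} (G : Step.GraySq s t s' t') :
    WEq (((cell s).whR (Z.toFun.fn (μ.tensMap t'))).comp ((cell t').whL (Dom.map Γ s)))
      ((((μ.tensGray G).map (Z.str.hom _ _)).whL (app a)).compEq
        (congrArg (app a ⋙ ·) (Z.str.map_comp _ _))
        (((cell t).whR (Z.toFun.fn (μ.tensMap s'))).comp ((cell s').whL (Dom.map Γ t))))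

/-- A modification between multimaps. -/
@[ext]
structure MultiMap.Modif {μ : WCommutativity T w} {Γ : List (Model T w)} {Z : Model T w}
    (f g : MultiMap μ Γ Z) where
  app (a : Ar Γ.length) : f.app a ⟶ g.app a
  sq {a b : Ar Γ.length} (s : Step T a b) :
    (f.cell s).Sq (g.cell s) (Functor.whiskerRight (app a) (Z.toFun.fn (μ.tensMap s)))
      (Functor.whiskerLeft (Dom.map Γ s) (app b))

namespace MultiMap

variable {μ : WCommutativity T w}

/-- The category of `w`-multimaps. -/
instance category (Γ : List (Model T w)) (Z : Model T w) : Category.{u} (MultiMap μ Γ Z) where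
  Hom f g := Modif f g
  id f :=
    { app := fun a => 𝟙 (f.app a)
      sq := fun s => by
        rw [Functor.whiskerRight_id', Functor.whiskerLeft_id']
        exact WHom.Sq.id _ }
  comp φ ψ :=
    { app := fun a => φ.app a ≫ ψ.app a
      sq := fun s => by
        rw [Functor.whiskerRight_comp, Functor.whiskerLeft_comp]
        exact (φ.sq s).comp (ψ.sq s) }
  id_comp _ := Modif.ext (funext fun _ => Category.id_comp _)
  comp_id _ := Modif.ext (funext fun _ => Category.comp_id _)
  assoc _ _ _ := Modif.ext (funext fun _ => Category.assoc _ _ _)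

/-- The unary multimap given by a `w`-homomorphism. -/
def ofHom {X Z : Model T w} (f : X ⟶ Z) : MultiMap μ [X] Z where
  app
    | .cons m .nil => CategoryTheory.Prod.fst _ _ ⋙ WTrans.app f m
  cell
    | .here α .nil => (WTrans.cell f α).whL (CategoryTheory.Prod.fst _ _)
  cell_tight := by
    rintro _ _ _ (⟨p, ⟨⟩⟩ | ⟨_, ⟨⟩⟩)
    exact .map _ (WTrans.cell_tight f p)
  cell_comp := by
    rintro _ _ _ _ _ _ (⟨α, β, ⟨⟩⟩ | ⟨_, ⟨⟩⟩)
    exact ((WTrans.cell_comp f α β).map _).trans ((WEq.of_eq (WHom.map_comp _ _ _)).trans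
      (WEq.comp (WHom.map_congr' (WTrans.cell f α) rfl) (WHom.map_congr' (WTrans.cell f β) rfl)))
  cell_nat := by
    rintro _ _ _ _ (⟨η, ⟨⟩⟩ | ⟨_, ⟨⟩⟩)
    exact WHom.Sq.map _ (WTrans.cell_nat f η)
  cell_gray := by
    rintro _ _ _ _ _ _ _ _ (⟨α, ⟨⟩⟩ | ⟨_, ⟨⟩⟩)

/-- The functor from `w`-homomorphisms to unary multimaps. -/
def unary (μ : WCommutativity T w) (X Z : Model T w) : (X ⟶ Z) ⥤ MultiMap μ [X] Z where
  obj f := ofHom f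
  map {f g} η :=
    { app
        | .cons m .nil => Functor.whiskerLeft (CategoryTheory.Prod.fst _ _)
          (WTrans.Modif.app η m)
      sq
        | .here α .nil => (WTrans.Modif.sq η α).map
          ((Functor.whiskeringLeft _ _ _).obj (CategoryTheory.Prod.fst _ _)) }
  map_id _ := Modif.ext (funext fun a => by
    obtain _ | ⟨m, ⟨⟩⟩ := a
    rfl)
  map_comp _ _ := Modif.ext (funext fun a => by
    obtain _ | ⟨m, ⟨⟩⟩ := a
    rfl)

end MultiMap

end MultiMaps

/-! ### 2-multicategories -/

/-- Transport of multimaps along an equality of lists of sources. -/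
def castSources {Ob : Type*} {Mul : List Ob → Ob → Type*} [∀ Γ Z, Category* (Mul Γ Z)]
    {Γ Δ : List Ob} (h : Γ = Δ) (Z : Ob) : Mul Γ Z ⥤ Mul Δ Z :=
  h ▸ 𝟭 (Mul Γ Z)

/-- A strict (non-symmetric) 2-multicategory with the given categories of multimaps: unary
identities and the composition `f ∘ g` of `f : Γ, Y, Δ → Z` and `g : Ξ → Y` in the variable `Y`,
subject to the unit laws and to sequential and parallel associativity. All laws are equalities of
functors, and so concern multimaps and 2-cells between them. -/
structure TwoMulticategory {Ob : Type*} (Mul : List Ob → Ob → Type*)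
    [∀ Γ Z, Category* (Mul Γ Z)] where
  one (X : Ob) : Mul [X] X
  comp (Γ Ξ Δ : List Ob) (Y Z : Ob) : Mul (Γ ++ Y :: Δ) Z × Mul Ξ Y ⥤ Mul (Γ ++ (Ξ ++ Δ)) Z
  comp_one (Γ Δ : List Ob) (Y Z : Ob) :
    Functor.prod' (𝟭 _) ((Functor.const _).obj (one Y)) ⋙ comp Γ [Y] Δ Y Z =
      𝟭 (Mul (Γ ++ Y :: Δ) Z)
  one_comp (Ξ : List Ob) (Z : Ob) :
    Functor.prod' ((Functor.const _).obj (one Z)) (𝟭 _) ⋙ comp [] Ξ [] Z Z =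
      castSources (List.append_nil Ξ).symm Z
  assoc (Γ Δ Ξ Θ Λ : List Ob) (X Y Z : Ob) :
    ((comp Γ (Ξ ++ X :: Θ) Δ Y Z ⋙
        castSources (by simp : _ = (Γ ++ Ξ) ++ X :: (Θ ++ Δ)) Z).prod (𝟭 (Mul Λ X))) ⋙
      comp (Γ ++ Ξ) Λ (Θ ++ Δ) X Z ⋙
        castSources (by simp : _ = Γ ++ ((Ξ ++ (Λ ++ Θ)) ++ Δ)) Z =
    prod.associator (Mul (Γ ++ Y :: Δ) Z) (Mul (Ξ ++ X :: Θ) Y) (Mul Λ X) ⋙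
      (𝟭 _).prod (comp Ξ Λ Θ X Y) ⋙ comp Γ (Ξ ++ (Λ ++ Θ)) Δ Y Z
  exchange (Γ Δ Θ Ξ Ξ' : List Ob) (Y Y' Z : Ob) :
    ((comp Γ Ξ (Δ ++ Y' :: Θ) Y Z ⋙
        castSources (by simp : _ = (Γ ++ (Ξ ++ Δ)) ++ Y' :: Θ) Z).prod (𝟭 (Mul Ξ' Y'))) ⋙
      comp (Γ ++ (Ξ ++ Δ)) Ξ' Θ Y' Z ⋙
        castSources (by simp : _ = Γ ++ (Ξ ++ (Δ ++ (Ξ' ++ Θ)))) Z =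
    Functor.prod'
        (((castSources (by simp : _ = (Γ ++ Y :: Δ) ++ Y' :: Θ) Z :
            Mul (Γ ++ Y :: (Δ ++ Y' :: Θ)) Z ⥤ _).prod (𝟭 (Mul Ξ Y))).prod (𝟭 (Mul Ξ' Y')) ⋙
          Functor.prod' (CategoryTheory.Prod.fst _ _ ⋙ CategoryTheory.Prod.fst _ _)
            (CategoryTheory.Prod.snd _ _) ⋙
          comp (Γ ++ Y :: Δ) Ξ' Θ Y' Z ⋙
            castSources (by simp : _ = Γ ++ Y :: (Δ ++ (Ξ' ++ Θ))) Z)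
        (CategoryTheory.Prod.fst _ _ ⋙ CategoryTheory.Prod.snd _ _) ⋙
      comp Γ Ξ (Δ ++ (Ξ' ++ Θ)) Y Z

/-! ### Composition of multimaps of models -/

section Substitution

variable {T : LawvereTwoTheory 𝕋} {w : Weakness} {μ : WCommutativity T w}

namespace Dom

/-- The functor `F ↦ id × F × id`. -/
def mid (P A B Q : Type u) [Category.{u} P] [Category.{u} A] [Category.{u} B] [Category.{u} Q] :
    (A ⥤ B) ⥤ (P × (A × Q) ⥤ P × (B × Q)) where
  obj F := (𝟭 P).prod (F.prod (𝟭 Q))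
  map τ := NatTrans.prod (𝟙 (𝟭 P)) (NatTrans.prod τ (𝟙 (𝟭 Q)))

/-- The canonical isomorphism from the product of three products. -/
def join₃ (Γ Ξ Δ : List (Model T w)) (a : Ar Γ.length) (x : Ar Ξ.length) (d : Ar Δ.length) :
    Dom Γ a × (Dom Ξ x × Dom Δ d) ⥤ Dom (Γ ++ (Ξ ++ Δ)) (Ar.append Γ a (Ar.append Ξ x d)) :=
  (𝟭 _).prod (join Ξ x d) ⋙ join Γ a (Ar.append Ξ x d)

/-- The canonical isomorphism from a product with a distinguished variable. -/
def joinAt (Γ Δ : List (Model T w)) (Y : Model T w) (a : Ar Γ.length) (n : ℕ)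
    (d : Ar Δ.length) :
    Dom Γ a × ((∀ _ : Fin n, Y.carrier) × Dom Δ d) ⥤
      Dom (Γ ++ Y :: Δ) (Ar.append Γ (Δ := Y :: Δ) a (.cons n d)) :=
  join Γ (Δ := Y :: Δ) a (.cons n d)

theorem join_inr : (Γ : List (Model T w)) → {Δ : List (Model T w)} → (a : Ar Γ.length) →
    {d e : Ar Δ.length} → (s : Step T d e) →
    join Γ a d ⋙ map (Γ ++ Δ) (Step.inr Γ a s) = (𝟭 _).prod (map Δ s) ⋙ join Γ a e
  | [], _, _, _, _, _ => rfl
  | X :: Γ, Δ, .cons m a, d, e, s => by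
    have h := join_inr Γ a s
    change CategoryTheory.prod.associator (∀ _ : Fin m, X.carrier) (Dom Γ a) (Dom Δ d) ⋙
      (𝟭 _).prod (join Γ a d ⋙ map (Γ ++ Δ) (Step.inr Γ a s)) = _
    rw [h]
    rfl

end Dom

namespace MultiMap

variable {Γ Ξ Δ : List (Model T w)} {Y Z : Model T w}

/-- The reindexing along the associativity of the product of numbers. -/
def reindex (Γ Ξ Δ : List (Model T w)) (Y Z : Model T w) (a : Ar Γ.length) (x : Ar Ξ.length)
    (d : Ar Δ.length) :
    (∀ _ : Fin (Ar.append Γ a (Ar.append Ξ x d)).tens, Z.carrier) ⥤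
      (∀ _ : Fin (Ar.append Γ (Δ := Y :: Δ) a (.cons x.tens d)).tens, Z.carrier) :=
  Pi.comap (fun _ => Z.carrier) (Fin.cast (Ar.tens_subst Γ Ξ Δ Y a x d))

/-- The functor that applies the multimap `g` in the middle variables. -/
def inner (Γ Δ : List (Model T w)) (g : MultiMap μ Ξ Y) (a : Ar Γ.length) (x : Ar Ξ.length)
    (d : Ar Δ.length) :
    Dom Γ a × (Dom Ξ x × Dom Δ d) ⥤
      Dom (Γ ++ Y :: Δ) (Ar.append Γ (Δ := Y :: Δ) a (.cons x.tens d)) :=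
  (Dom.mid _ _ _ _).obj (g.app x) ⋙ Dom.joinAt Γ Δ Y a x.tens d

theorem inner_here (f : MultiMap μ (Γ ++ Y :: Δ) Z) (g : MultiMap μ Ξ Y) (a : Ar Γ.length)
    {x y : Ar Ξ.length} (s : Step T x y) (d : Ar Δ.length) :
    inner Γ Δ g a x d ⋙ Dom.map (Γ ++ Y :: Δ)
        (Step.inr Γ (Δ := Y :: Δ) a (.here (μ.tensMap s) d)) ⋙ f.app _ =
      (Dom.mid _ _ _ _).obj (g.app x ⋙ Y.toFun.fn (μ.tensMap s)) ⋙
        Dom.joinAt Γ Δ Y a y.tens d ⋙ f.app _ :=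
  congrArg (fun F => (Dom.mid _ _ _ _).obj (g.app x) ⋙ F ⋙ f.app _)
    (Dom.join_inr Γ (Δ := Y :: Δ) a (.here (μ.tensMap s) d))

/-- The multimap `h` is the composite of the multimaps `f : Γ, Y, Δ → Z` and `g : Ξ → Y`, that is,
the pasting of the transformations `f` and `id ⊗ g ⊗ id`. -/
structure IsSubst (f : MultiMap μ (Γ ++ Y :: Δ) Z) (g : MultiMap μ Ξ Y)
    (h : MultiMap μ (Γ ++ (Ξ ++ Δ)) Z) : Prop where
  app (a : Ar Γ.length) (x : Ar Ξ.length) (d : Ar Δ.length) :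
    Dom.join₃ Γ Ξ Δ a x d ⋙ h.app _ ⋙ reindex Γ Ξ Δ Y Z a x d =
      inner Γ Δ g a x d ⋙ f.app _
  cell_left {a b : Ar Γ.length} (s : Step T a b) (x : Ar Ξ.length) (d : Ar Δ.length) :
    WEq (((h.cell (s.inl Γ (Ar.append Ξ x d))).whR (reindex Γ Ξ Δ Y Z b x d)).whL
        (Dom.join₃ Γ Ξ Δ a x d))
      ((f.cell (s.inl Γ (Δ := Y :: Δ) (.cons x.tens d))).whL (inner Γ Δ g a x d))
  cell_right (a : Ar Γ.length) (x : Ar Ξ.length) {d e : Ar Δ.length} (s : Step T d e) :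
    WEq (((h.cell (.inr Γ a (.inr Ξ x s))).whR (reindex Γ Ξ Δ Y Z a x e)).whL
        (Dom.join₃ Γ Ξ Δ a x d))
      ((f.cell (.inr Γ (Δ := Y :: Δ) a (.there x.tens s))).whL (inner Γ Δ g a x d))
  cell_mid (a : Ar Γ.length) {x y : Ar Ξ.length} (s : Step T x y) (d : Ar Δ.length) :
    WEq (((h.cell (.inr Γ a (s.inl Ξ d))).whR (reindex Γ Ξ Δ Y Z a y d)).whL
        (Dom.join₃ Γ Ξ Δ a x d))
      (((f.cell (.inr Γ (Δ := Y :: Δ) a (.here (μ.tensMap s) d))).whL (inner Γ Δ g a x d)).compEq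
        (inner_here f g a s d)
        (((g.cell s).map (Dom.mid _ _ _ _)).whR (Dom.joinAt Γ Δ Y a y.tens d ⋙ f.app _)))

/-- The 2-cell `χ` between composite multimaps is the horizontal composite of `φ` and `γ`. -/
def IsSubst₂ {f f' : MultiMap μ (Γ ++ Y :: Δ) Z} {g g' : MultiMap μ Ξ Y}
    {h h' : MultiMap μ (Γ ++ (Ξ ++ Δ)) Z} (φ : f ⟶ f') (γ : g ⟶ g') (χ : h ⟶ h') : Prop :=
  ∀ (a : Ar Γ.length) (x : Ar Ξ.length) (d : Ar Δ.length),
    HomEq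
      (Functor.whiskerLeft (Dom.join₃ Γ Ξ Δ a x d)
        (Functor.whiskerRight (Modif.app χ _) (reindex Γ Ξ Δ Y Z a x d)))
      (NatTrans.hcomp ((Dom.mid _ _ _ _).map (Modif.app γ x))
        (Functor.whiskerLeft (Dom.joinAt Γ Δ Y a x.tens d) (Modif.app φ _)))

end MultiMap

/-- The 2-multicategory structure is the one of multimaps of models: its identities are those of
models, and its composition is the pasting of transformations. -/
structure TwoMulticategory.IsModels (M : TwoMulticategory (MultiMap μ)) : Prop where
  one (X : Model T w) : M.one X = MultiMap.ofHom (𝟙 X)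
  comp {Γ Ξ Δ : List (Model T w)} {Y Z : Model T w} (f : MultiMap μ (Γ ++ Y :: Δ) Z)
    (g : MultiMap μ Ξ Y) : MultiMap.IsSubst f g ((M.comp Γ Ξ Δ Y Z).obj (f, g))
  comp₂ {Γ Ξ Δ : List (Model T w)} {Y Z : Model T w} {f f' : MultiMap μ (Γ ++ Y :: Δ) Z}
    {g g' : MultiMap μ Ξ Y} (φ : f ⟶ f') (γ : g ⟶ g') :
    MultiMap.IsSubst₂ φ γ ((M.comp Γ Ξ Δ Y Z).map (X := (f, g)) (Y := (f', g')) (Prod.mkHom φ γ))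

end Substitution

/-! ### Internal homs -/

section InternalHom

variable {T : LawvereTwoTheory 𝕋} {w : Weakness} (μ : WCommutativity T w)

/-- The model with underlying category `Hom_w(Y, Z)` given by a model structure on it. -/
abbrev homModel {Y Z : Model T w} (H : ModelOn T (Y ⟶ Z)) : Model T w where
  carrier := Y ⟶ Z
  str := H

/-- The component at `l` of `w`-homomorphisms and of modifications. -/
def appFunctor (Y Z : Model T w) (l : ℕ) :
    (Y ⟶ Z) ⥤ ((∀ _ : Fin l, Y.carrier) ⥤ (∀ _ : Fin l, Z.carrier)) where
  obj f := WTrans.app f l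
  map η := WTrans.Modif.app η l

/-- The underlying functor of a `w`-homomorphism, and the underlying natural transformation of a
modification. -/
def underlying (X Y : Model T w) : (X ⟶ Y) ⥤ (X.carrier ⥤ Y.carrier) :=
  appFunctor X Y 1 ⋙
    (Functor.whiskeringLeft _ _ _).obj (Functor.pi' fun _ : Fin 1 => 𝟭 X.carrier) ⋙
    (Functor.whiskeringRight _ _ _).obj (Pi.eval (fun _ : Fin 1 => Y.carrier) 0)

variable {μ} in
/-- The multimap `Hom_w(Y, Z), Y → Z` is the evaluation: it sends `t₁, …, tₖ` and `y` in `Yˡ` to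
the family of the `tᵢ(y)`. -/
structure IsEvaluation {Y Z : Model T w} {H : ModelOn T (Y ⟶ Z)}
    (ev : MultiMap μ [homModel H, Y] Z) : Prop where
  app (k l : ℕ) (i : Fin k) :
    ev.app (.cons k (.cons l .nil)) ⋙
        Pi.comap (fun _ => Z.carrier) (WCommutativity.block i l) =
      ((Pi.eval (fun _ : Fin k => (Y ⟶ Z)) i).prod (CategoryTheory.Prod.fst _ _) ⋙
        Functor.uncurry.obj (appFunctor Y Z l) :
          (∀ _ : Fin k, (Y ⟶ Z)) × ((∀ _ : Fin l, Y.carrier) × Dom (T := T) (w := w) [] .nil) ⥤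
            (∀ _ : Fin l, Z.carrier))
  cell_left {k k' : ℕ} (α : T.ob k ⟶ T.ob k') (l : ℕ) :
    (ev.cell (.here α (.cons l .nil))).IsId
  cell_right (k : ℕ) {l l' : ℕ} (β : T.ob l ⟶ T.ob l') (t : ∀ _ : Fin k, (Y ⟶ Z)) (i : Fin k) :
    WEq (((ev.cell (.there k (.here β .nil))).whR
        (Pi.comap (fun _ => Z.carrier) (WCommutativity.block i l'))).whL
          (Functor.prod' ((Functor.const _).obj t)
            (Functor.prod' (𝟭 _) ((Functor.const _).obj ⟨⟨⟩⟩) :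
              (∀ _ : Fin l, Y.carrier) ⥤
                (∀ _ : Fin l, Y.carrier) × Dom (T := T) (w := w) [] .nil)))
      (WTrans.cell (t i) β)

/-- The functor `Mul(Γ; Hom(Y, Z)) ⥤ Mul(Γ, Y; Z)` that sends `g` to `ev ∘ g`. -/
def TwoMulticategory.curry {Ob : Type*} {Mul : List Ob → Ob → Type*} [∀ Γ Z, Category* (Mul Γ Z)]
    (M : TwoMulticategory Mul) {W Y Z : Ob} (ev : Mul [W, Y] Z) (Γ : List Ob) :
    Mul Γ W ⥤ Mul (Γ ++ [Y]) Z :=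
  Functor.prod' ((Functor.const _).obj ev) (𝟭 _) ⋙ M.comp [] Γ [Y] W Z

open Bicategory Opposite in
/-- The functor `(g, k) ↦ k ∘ - ∘ g`, on 1-cells `g : Y' ⟶ Y` and `k : Z ⟶ Z'` and on 2-cells. -/
def homAction {B : Type*} [Bicategory B] (Y Y' Z Z' : B) :
    (op Y ⟶ op Y') × (Z ⟶ Z') ⥤ ((Y ⟶ Z) ⥤ (Y' ⟶ Z')) :=
  (Bicategory.Opposite.unopFunctor (op Y) (op Y') ⋙ precomposing Y' Y Z).prod
      (postcomposing Y' Z Z') ⋙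
    Functor.uncurry.obj (Functor.whiskeringLeft (Y ⟶ Z) (Y' ⟶ Z) (Y' ⟶ Z'))

/-- The composition functor of a bicategory. -/
def compFunctor {B : Type*} [Bicategory B] (a b c : B) : (a ⟶ b) × (b ⟶ c) ⥤ (a ⟶ c) :=
  Functor.uncurry.obj (Bicategory.precomposing a b c)

/-- The functor `(((f, h), g), k) ↦ k ∘ f ∘ (h, g)` for a binary multimap `f` and unary multimaps
`h`, `g` and `k`. -/
def TwoMulticategory.binary {Ob : Type*} {Mul : List Ob → Ob → Type*}
    [∀ Γ Z, Category* (Mul Γ Z)] (M : TwoMulticategory Mul) (X X' Y Y' Z Z' : Ob) :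
    ((Mul [X, Y] Z × Mul [X'] X) × Mul [Y'] Y) × Mul [Z] Z' ⥤ Mul [X', Y'] Z' :=
  ((M.comp [] [X'] [Y] X Z).prod (𝟭 (Mul [Y'] Y)) ⋙ M.comp [X'] [Y'] [] Y Z).prod
      (𝟭 (Mul [Z] Z')) ⋙
    Functor.prod' (CategoryTheory.Prod.snd _ _) (CategoryTheory.Prod.fst _ _) ⋙
    M.comp [] [X', Y'] [] Z Z'

variable {μ} (H : ∀ Y Z : Model T w, ModelOn T (Y ⟶ Z)) (M : TwoMulticategory (MultiMap μ))
  (ev : ∀ Y Z : Model T w, MultiMap μ [homModel (H Y Z), Y] Z)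

/-- The functor `Hom_w(X, Hom(Y, Z)) ⥤ Mul₂(X, Y; Z)` that sends `g` to `ev ∘ (g, id)`. -/
def homToBinary (X Y Z : Model T w) : (X ⟶ homModel (H Y Z)) ⥤ MultiMap μ [X, Y] Z :=
  MultiMap.unary μ X (homModel (H Y Z)) ⋙ M.curry (ev Y Z) [X]

open Opposite in
/-- A family of functors on `Hom_w(Y', Y) × Hom_w(Z, Z')` is compatible with the functors
`Hom_w(X, Hom(Y, Z)) ⥤ Mul₂(X, Y; Z)`: the image of `F(g, k) ∘ m ∘ h` is the composite of the
image of `m` with `h`, `g` and `k`, and likewise for 2-cells. -/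
def IsNaturalHomToBinary
    (F : ∀ Y Y' Z Z' : Model T w,
      (op Y ⟶ op Y') × (Z ⟶ Z') ⥤ (homModel (H Y Z) ⟶ homModel (H Y' Z'))) : Prop :=
  ∀ X X' Y Y' Z Z' : Model T w,
    ((𝟭 (X' ⟶ X)).prod ((𝟭 (X ⟶ homModel (H Y Z))).prod (F Y Y' Z Z') ⋙ compFunctor _ _ _) ⋙
        compFunctor _ _ _ ⋙ homToBinary H M ev X' Y' Z' :
      (X' ⟶ X) × ((X ⟶ homModel (H Y Z)) × ((op Y ⟶ op Y') × (Z ⟶ Z'))) ⥤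
        MultiMap μ [X', Y'] Z') =
    Functor.prod'
      (Functor.prod'
        (Functor.prod'
          (CategoryTheory.Prod.snd _ _ ⋙ CategoryTheory.Prod.fst _ _ ⋙ homToBinary H M ev X Y Z)
          (CategoryTheory.Prod.fst _ _ ⋙ MultiMap.unary μ X' X))
        (CategoryTheory.Prod.snd _ _ ⋙ CategoryTheory.Prod.snd _ _ ⋙ CategoryTheory.Prod.fst _ _ ⋙
          Bicategory.Opposite.unopFunctor (op Y) (op Y') ⋙ MultiMap.unary μ Y' Y))
      (CategoryTheory.Prod.snd _ _ ⋙ CategoryTheory.Prod.snd _ _ ⋙ CategoryTheory.Prod.snd _ _ ⋙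
        MultiMap.unary μ Z Z') ⋙
      M.binary X X' Y Y' Z Z'

/-- The category of internal algebras of a model `X` (for lax `w`): the category of
`w`-homomorphisms from the terminal model to `X`. -/
abbrev IntAlg (X : Model T w) : Type u := terminalModel T w ⟶ X

/-- The 2-functor `IntAlg` to categories on 1-cells and 2-cells: postcomposition. -/
def intAlgFunctor (X Y : Model T w) : (X ⟶ Y) ⥤ (IntAlg X ⥤ IntAlg Y) :=
  Bicategory.postcomposing (terminalModel T w) X Y

end InternalHom

end Theory

/-!
The 2-multicategory of models is built, and its closed structure is proved, by computing with
*values*. An element of a model `X` is an object of some `Xⁿ`; morphisms of elements are morphisms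
of `Xⁿ`, and a `w`-cell of elements is a `w`-cell `X(α)(p) ⇒ q` over some 1-cell `α : m ⟶ n` of the
theory. The numbers `m` and `n` are part of the data, so that elements of `X^((a b) c)` and of
`X^(a (b c))` can be compared by plain equality, and the coherence isomorphisms between products of
finite sets become equalities of bundled 1-cells (`WCommutativity.left_left`,
`WCommutativity.grayW_right`, `WCommutativity.tensU_inl`, ...). A multimap `f` from a list of models
to `Z` sends a list of elements to an element of `Z` (`MultiMap.val`), a list of morphisms to a
morphism (`MultiMap.valHom`), and a list of elements with a cell in one place to a cell
(`MultiMap.valCell`: the cell of `f`, followed by the image of the given cell). These values satisfy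
the evident laws for composites, squares over 2-cells of the theory and Gray squares. Conversely a
multimap is determined by its values (`MultiMap.ext_val`), every family of values with these laws
comes from a multimap (`MultiMap.Values.exists_multiMap`), and the same holds for modifications
(`MultiMap.hom_ext_val`, `MultiMap.exists_modif`).

Substitution of multimaps is then substitution of values. The only law that is not immediate is that
of Gray squares with one variable inside and one outside of the inserted multimap, which is the
Gray law of the outer multimap (`MultiMap.substCell_gray`). The 2-multicategory laws hold because
both sides have the same values; comparing values with the pasting description of the composite
gives `MultiMap.multicategory_isModels`.

For the internal hom, `Z(m ⊗ -)` is the `m`-fold power of `Z` by projection onto blocks, whence the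
isomorphism of categories `WCommutativity.isIso_powerComparison`. The transformations `Z(α ⊗ -)`
and modifications `Z(η ⊗ -)` form a 2-functor of `α` and `η`; postcomposition with it is transported
along that isomorphism to the model structure `WCommutativity.internalHom`. The evaluation
`WCommutativity.ev` has the Gray cells of `μ` as the reason for its Gray law, because the cells of
`Z(α ⊗ -)` are the `Z(σ)`.

Closedness rests on two facts. First, elements, morphisms and cells of the internal hom are
determined by what the evaluation makes of them (`WCommutativity.elt_ext`,
`WCommutativity.eltHom_ext`, `WCommutativity.eltCell_ext`), and laws between them can be checked
after evaluation (`WCommutativity.sq_of_apply`, `WCommutativity.gray_of_apply`). Second, for a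
multimap `F` on `Γ, Y`, each value in the variables `Γ` can be curried: fixing elements gives a
homomorphism in the last variable (`MultiMap.exists_isCurry`), fixing morphisms gives a modification
(`MultiMap.IsCurry.exists_hom`), and fixing a cell gives a cell of the internal hom, whose
compatibility with the last variable is the Gray law of `F` (`MultiMap.IsCurry.exists_cell`). The
curried values form a multimap because the laws hold after evaluation, and
`MultiMap.isIso_applyEv` follows.

Since unary multimaps are homomorphisms (`MultiMap.isIso_unary`), the case of one variable gives the
isomorphism with binary multimaps. A homomorphism between internal homs that acts by pre- and
postcomposition is determined by this property (`WCommutativity.Acts.unique`,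
`WCommutativity.Acts₂.unique`), and the property is stable under composition and whiskering. So the
action obtained by currying `k ∘ ev ∘ (id, g)` is 2-functorial and 2-natural, and fixing the first
variable to be the terminal model gives the last part.
-/

/-! ### Detecting and constructing `w`-cells componentwise -/

section Components

variable {w : Weakness} {A : Type u₁} [Category.{v₁} A] {B : Type u₂} [Category.{v₂} B]
  {C : Type u₃} [Category.{v₃} C]

/-- A family of functors that jointly detects equality of parallel morphisms. -/
def DetectsEquality {ι : Type*} {E : ι → Type*} [∀ i, Category* (E i)] (K : ∀ i, A ⥤ E i) :
    Prop :=
  ∀ ⦃x y : A⦄ (f g : x ⟶ y), (∀ i, (K i).map f = (K i).map g) → f = g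

namespace WHom

section Joint

variable {ι : Type*} {E : ι → Type*} [∀ i, Category* (E i)] {K : ∀ i, A ⥤ E i}

/-- A `w`-cell is determined by its images under functors that jointly detect equality. -/
theorem ext_of_joint (hK : DetectsEquality K) {x y : A} {s t : WHom x y w}
    (h : ∀ i, s.map (K i) = t.map (K i)) : s = t := by
  cases s with
  | strict h => cases t; rfl
  | pseudo e =>
    cases t with
    | pseudo e' =>
      refine congrArg WHom.pseudo (Iso.ext (hK _ _ fun i => ?_))
      have := h i
      simp only [map, WHom.pseudo.injEq] at this
      exact congrArg Iso.hom this
  | lax e =>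
    cases t with
    | lax e' =>
      refine congrArg WHom.lax (hK _ _ fun i => ?_)
      have := h i
      simpa only [map, WHom.lax.injEq] using this
  | colax e =>
    cases t with
    | colax e' =>
      refine congrArg WHom.colax (hK _ _ fun i => ?_)
      have := h i
      simpa only [map, WHom.colax.injEq] using this

/-- Squares of `w`-cells can be checked after functors that jointly detect equality. -/
theorem sq_of_joint (hK : DetectsEquality K) {x y x' y' : A} {s : WHom x y w}
    {s' : WHom x' y' w} {f : x ⟶ x'} {g : y ⟶ y'}
    (h : ∀ i, (s.map (K i)).Sq (s'.map (K i)) ((K i).map f) ((K i).map g)) : s.Sq s' f g := by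
  cases s <;> cases s' <;> refine hK _ _ fun i => ?_ <;> have := h i <;>
    simpa only [Sq, map, Functor.map_comp, eqToHom_map, Functor.mapIso_hom] using this

end Joint

/-- The component of a `w`-cell between functors. -/
def appAt {F G : A ⥤ B} (s : WHom F G w) (x : A) : WHom (F.obj x) (G.obj x) w :=
  s.map ((evaluation A B).obj x)

theorem appAt_ofEq {F G : A ⥤ B} (h : F = G) (x : A) :
    (ofEq h : WHom F G w).appAt x = ofEq (congrArg (fun F => F.obj x) h) :=
  map_ofEq _ h

theorem appAt_comp {F G H : A ⥤ B} (s : WHom F G w) (t : WHom G H w) (x : A) :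
    (s.comp t).appAt x = (s.appAt x).comp (t.appAt x) :=
  map_comp _ s t

theorem appAt_compEq {F G G' H : A ⥤ B} (s : WHom F G w) (h : G = G') (t : WHom G' H w) (x : A) :
    (s.compEq h t).appAt x =
      ((s.appAt x).comp (ofEq (congrArg (fun F => F.obj x) h))).comp (t.appAt x) := by
  rw [compEq, appAt_comp, appAt_comp, appAt_ofEq]

theorem appAt_whL (F : A ⥤ B) {G H : B ⥤ C} (s : WHom G H w) (x : A) :
    (s.whL F).appAt x = s.appAt (F.obj x) := by
  cases s <;> rfl

theorem appAt_whR {F G : A ⥤ B} (s : WHom F G w) (H : B ⥤ C) (x : A) :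
    (s.whR H).appAt x = (s.appAt x).map H := by
  cases s <;> rfl

theorem detectsEquality_evaluation (A : Type u₁) [Category.{v₁} A] (B : Type u₂)
    [Category.{v₂} B] : DetectsEquality fun x : A => (evaluation A B).obj x :=
  fun _ _ _ _ h => NatTrans.ext (funext h)

theorem ext_appAt {F G : A ⥤ B} {s t : WHom F G w} (h : ∀ x, s.appAt x = t.appAt x) : s = t :=
  ext_of_joint (detectsEquality_evaluation A B) h

theorem sq_of_appAt {F G F' G' : A ⥤ B} {s : WHom F G w} {s' : WHom F' G' w} {f : F ⟶ F'}
    {g : G ⟶ G'} (h : ∀ x, (s.appAt x).Sq (s'.appAt x) (f.app x) (g.app x)) : s.Sq s' f g :=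
  sq_of_joint (detectsEquality_evaluation A B) h

theorem Sq.appAt {F G F' G' : A ⥤ B} {s : WHom F G w} {s' : WHom F' G' w} {f : F ⟶ F'}
    {g : G ⟶ G'} (h : s.Sq s' f g) (x : A) : (s.appAt x).Sq (s'.appAt x) (f.app x) (g.app x) :=
  h.map ((evaluation A B).obj x)

theorem appAt_nat {F G : A ⥤ B} (s : WHom F G w) {x y : A} (f : x ⟶ y) :
    (s.appAt x).Sq (s.appAt y) (F.map f) (G.map f) :=
  Sq.nat ((evaluation A B).map f) s

theorem _root_.WEq.of_appAt {F G F' G' : A ⥤ B} {s : WHom F G w} {t : WHom F' G' w}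
    (hF : F = F') (hG : G = G') (h : ∀ x, WEq (s.appAt x) (t.appAt x)) : WEq s t := by
  subst hF hG
  exact .of_eq (ext_appAt fun x => (h x).eq)

theorem _root_.WEq.appAt {F G F' G' : A ⥤ B} {s : WHom F G w} {t : WHom F' G' w}
    (h : WEq s t) (x : A) : WEq (s.appAt x) (t.appAt x) := by
  cases h
  exact .refl

theorem IsId.appAt {F G : A ⥤ B} {s : WHom F G w} (h : s.IsId) (x : A) : (s.appAt x).IsId :=
  h.map _

theorem isId_of_appAt {F G : A ⥤ B} {s : WHom F G w} (e : F = G) (h : ∀ x, (s.appAt x).IsId) :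
    s.IsId := by
  subst e
  refine ⟨rfl, ext_appAt fun x => ?_⟩
  obtain ⟨_, h⟩ := h x
  rw [h, appAt_ofEq]

/-- A natural family of `w`-cells is a `w`-cell between functors. -/
def ofAppAt {F G : A ⥤ B} : ∀ {w : Weakness} (s : ∀ x, WHom (F.obj x) (G.obj x) w)
    (_ : ∀ {x y : A} (f : x ⟶ y), (s x).Sq (s y) (F.map f) (G.map f)), WHom F G w
  | .strict, s, h => .strict (CategoryTheory.Functor.ext (fun x => match s x with | .strict e => e)
      (fun x y f => by
        have := h f
        revert this
        generalize s x = a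
        generalize s y = b
        cases a; cases b
        intro this
        simp only [Sq] at this
        rw [← Category.assoc, ← this]
        simp))
  | .pseudo, s, h => .pseudo (NatIso.ofComponents (fun x => match s x with | .pseudo e => e)
      (fun {x y} f => by
        have := h f
        revert this
        generalize s x = a
        generalize s y = b
        cases a; cases b
        exact id))
  | .lax, s, h => .lax
    { app := fun x => match s x with | .lax e => e
      naturality := fun x y f => by
        have := h f
        revert this
        generalize s x = a
        generalize s y = b
        cases a; cases b
        exact id }
  | .colax, s, h => .colax
    { app := fun x => match s x with | .colax e => e
      naturality := fun x y f => by
        have := h f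
        revert this
        generalize s x = a
        generalize s y = b
        cases a; cases b
        exact Eq.symm }

theorem appAt_ofAppAt {F G : A ⥤ B} (s : ∀ x, WHom (F.obj x) (G.obj x) w)
    (h : ∀ {x y : A} (f : x ⟶ y), (s x).Sq (s y) (F.map f) (G.map f)) (x : A) :
    (ofAppAt s h).appAt x = s x := by
  cases w with
  | strict => cases s x; rfl
  | pseudo =>
    show WHom.pseudo _ = _
    generalize hs : s x = t
    cases t
    congr 1
    ext
    simp [NatIso.ofComponents, hs]
  | lax =>
    show WHom.lax _ = _
    generalize hs : s x = t
    cases t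
    simp [hs]
  | colax =>
    show WHom.colax _ = _
    generalize hs : s x = t
    cases t
    simp [hs]

/-- A family of `w`-cells is a `w`-cell in a product of categories. -/
def ofPi {ι : Type*} {E : ι → Type*} [∀ i, Category* (E i)] {x y : ∀ i, E i} :
    ∀ {w : Weakness} (_ : ∀ i, WHom (x i) (y i) w), WHom x y w
  | .strict, s => .strict (funext fun i => match s i with | .strict e => e)
  | .pseudo, s => .pseudo
    { hom := fun i => match s i with | .pseudo e => e.hom
      inv := fun i => match s i with | .pseudo e => e.inv
      hom_inv_id := by
        funext i
        show (match s i with | .pseudo e => e.hom) ≫ (match s i with | .pseudo e => e.inv) = 𝟙 _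
        cases s i; simp
      inv_hom_id := by
        funext i
        show (match s i with | .pseudo e => e.inv) ≫ (match s i with | .pseudo e => e.hom) = 𝟙 _
        cases s i; simp }
  | .lax, s => .lax fun i => match s i with | .lax e => e
  | .colax, s => .colax fun i => match s i with | .colax e => e

theorem ofPi_map_eval {ι : Type*} {E : ι → Type*} [∀ i, Category* (E i)] {x y : ∀ i, E i}
    (s : ∀ i, WHom (x i) (y i) w) (i : ι) : (ofPi s).map (Pi.eval E i) = s i := by
  cases w with
  | strict => cases s i; rfl
  | pseudo =>
    show WHom.pseudo _ = _
    generalize hs : s i = t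
    cases t
    congr 1
    ext
    simp only [Functor.mapIso_hom, Pi.eval_map]
    split; simp_all; rfl
  | lax =>
    show WHom.lax _ = _
    generalize hs : s i = t
    cases t
    simp only [Pi.eval_map]
    split; simp_all; rfl
  | colax =>
    show WHom.colax _ = _
    generalize hs : s i = t
    cases t
    simp only [Pi.eval_map]
    split; simp_all; rfl

/-- The `w`-cell with a given image under an isomorphism of categories. -/
noncomputable def unmap (K : A ⥤ B) [K.IsIso] {x y : A} :
    ∀ {w : Weakness}, WHom (K.obj x) (K.obj y) w → WHom x y w
  | _, .strict h => .strict (K.bijective_obj.1 h)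
  | _, .pseudo e => .pseudo (K.preimageIso e)
  | _, .lax f => .lax (K.preimage f)
  | _, .colax f => .colax (K.preimage f)

theorem map_unmap (K : A ⥤ B) [K.IsIso] {x y : A} (s : WHom (K.obj x) (K.obj y) w) :
    (s.unmap K).map K = s := by
  cases s with
  | pseudo e => exact congrArg WHom.pseudo (Iso.ext (by simp))
  | _ => simp [unmap, map]

theorem detectsEquality_of_faithful (K : A ⥤ B) [K.Faithful] :
    DetectsEquality fun _ : Unit => K :=
  fun _ _ _ _ h => K.map_injective (h ())

theorem ext_map (K : A ⥤ B) [K.Faithful] {x y : A} {s t : WHom x y w}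
    (h : s.map K = t.map K) : s = t :=
  ext_of_joint (detectsEquality_of_faithful K) fun _ => h

theorem isId_ofEq {x y : A} (h : x = y) : (ofEq h : WHom x y w).IsId :=
  ⟨h, rfl⟩

theorem _root_.WEq.comp_isId {x y z : A} (s : WHom x y w) {t : WHom y z w} (h : t.IsId) :
    WEq (s.comp t) s := by
  obtain ⟨h, rfl⟩ := h
  exact WEq.comp_ofEq s h

theorem _root_.WEq.isId_comp {x y z : A} {s : WHom x y w} (h : s.IsId) (t : WHom y z w) :
    WEq (s.comp t) t := by
  obtain ⟨h, rfl⟩ := h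
  exact WEq.ofEq_comp h t

end WHom

end Components

section Theory

variable {𝕋 : Type*} [Bicategory.{u, u} 𝕋] [Bicategory.Strict 𝕋]

/-! ### Cells of the theory with variable ends -/

section Untyped

open Bicategory

/-- A 1-cell of the theory, bundled with its ends. -/
structure OneCell (T : LawvereTwoTheory 𝕋) where
  {m n : ℕ}
  hom : T.ob m ⟶ T.ob n

/-- A 2-cell of the theory, bundled with its ends. -/
structure TwoCell (T : LawvereTwoTheory 𝕋) where
  {m n : ℕ}
  {α β : T.ob m ⟶ T.ob n}
  hom : α ⟶ β

/-- A `w`-cell between 1-cells of the theory, bundled with its ends. -/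
structure WCell (T : LawvereTwoTheory 𝕋) (w : Weakness) where
  {m n : ℕ}
  {α β : T.ob m ⟶ T.ob n}
  cell : WHom α β w

theorem HomEq.whiskerRight_one {B : Type*} [Bicategory B] [Strict B] {a b : B} {f g : a ⟶ b}
    (η : f ⟶ g) : HomEq (η ▷ 𝟙 b) η := by
  rw [whiskerRight_id]
  simp only [Strict.rightUnitor_eqToIso, eqToIso.hom, eqToIso.inv]
  exact .conj _ _ _

theorem HomEq.whiskerLeft_one {B : Type*} [Bicategory B] [Strict B] {a b : B} {f g : a ⟶ b}
    (η : f ⟶ g) : HomEq (𝟙 a ◁ η) η := by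
  rw [id_whiskerLeft]
  simp only [Strict.leftUnitor_eqToIso, eqToIso.hom, eqToIso.inv]
  exact .conj _ _ _

theorem WEq.whiskerR_one {B : Type*} [Bicategory B] [Strict B] {w : Weakness} {a b : B}
    {f g : a ⟶ b} (s : WHom f g w) : WEq (s.whiskerR (𝟙 b)) s := by
  cases s with
  | strict h => exact .of_strict _ _ (Strict.comp_id _)
  | pseudo e => exact .of_hom (.whiskerRight_one _)
  | lax f => exact .of_lax (.whiskerRight_one _)
  | colax f => exact .of_colax (.whiskerRight_one _)

theorem WEq.whiskerL_one {B : Type*} [Bicategory B] [Strict B] {w : Weakness} {a b : B}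
    {f g : a ⟶ b} (s : WHom f g w) : WEq (s.whiskerL (𝟙 a)) s := by
  cases s with
  | strict h => exact .of_strict _ _ (Strict.id_comp _)
  | pseudo e => exact .of_hom (.whiskerLeft_one _)
  | lax f => exact .of_lax (.whiskerLeft_one _)
  | colax f => exact .of_colax (.whiskerLeft_one _)

variable {T : LawvereTwoTheory 𝕋} {w : Weakness}

theorem HomEq.twoCell {m n : ℕ} {α β α' β' : T.ob m ⟶ T.ob n} {η : α ⟶ β} {θ : α' ⟶ β'}
    (h : HomEq η θ) : TwoCell.mk η = TwoCell.mk θ := by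
  cases h; rfl

theorem WEq.wCell {m n : ℕ} {α β α' β' : T.ob m ⟶ T.ob n} {s : WHom α β w} {t : WHom α' β' w}
    (h : WEq s t) : WCell.mk s = WCell.mk t := by
  cases h; rfl

theorem LawvereTwoTheory.θ_cast_rfl (T : LawvereTwoTheory 𝕋) (m : ℕ) :
    T.θ (Fin.cast (rfl : m = m)) = 𝟙 (T.ob m) :=
  T.θ_id m

theorem OneCell.eq_of_cast {m n m' n' : ℕ} (hm : m' = m) (hn : n' = n) {α : T.ob m ⟶ T.ob n}
    {β : T.ob m' ⟶ T.ob n'} (e : α ≫ T.θ (Fin.cast hn) = T.θ (Fin.cast hm) ≫ β) :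
    OneCell.mk α = OneCell.mk β := by
  subst hm hn
  rw [T.θ_cast_rfl, T.θ_cast_rfl, Strict.comp_id, Strict.id_comp] at e
  rw [e]

theorem TwoCell.eq_of_cast {m n m' n' : ℕ} (hm : m' = m) (hn : n' = n)
    {α α' : T.ob m ⟶ T.ob n} {β β' : T.ob m' ⟶ T.ob n'} {η : α ⟶ α'} {θ : β ⟶ β'}
    (e : HomEq (η ▷ T.θ (Fin.cast hn)) (T.θ (Fin.cast hm) ◁ θ)) :
    TwoCell.mk η = TwoCell.mk θ := by
  subst hm hn
  rw [T.θ_cast_rfl, T.θ_cast_rfl] at e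
  exact ((HomEq.whiskerRight_one η).symm.trans (e.trans (HomEq.whiskerLeft_one θ))).twoCell

theorem WCell.eq_of_cast {m n m' n' : ℕ} (hm : m' = m) (hn : n' = n)
    {α α' : T.ob m ⟶ T.ob n} {β β' : T.ob m' ⟶ T.ob n'} {s : WHom α α' w} {t : WHom β β' w}
    (e : WEq (s.whiskerR (T.θ (Fin.cast hn))) (t.whiskerL (T.θ (Fin.cast hm)))) :
    WCell.mk s = WCell.mk t := by
  subst hm hn
  rw [T.θ_cast_rfl, T.θ_cast_rfl] at e
  exact ((WEq.whiskerR_one s).symm.trans (e.trans (WEq.whiskerL_one t))).wCell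

/-- Functors that agree on 1-cells and on 2-cells agree on `w`-cells. -/
theorem WCell.map_eq_map {m n m' n' m'' n'' : ℕ} (hm : m' = m'') (hn : n' = n'')
    (F : (T.ob m ⟶ T.ob n) ⥤ (T.ob m' ⟶ T.ob n'))
    (G : (T.ob m ⟶ T.ob n) ⥤ (T.ob m'' ⟶ T.ob n''))
    (h : ∀ α, OneCell.mk (F.obj α) = OneCell.mk (G.obj α))
    (h₂ : ∀ {α β : T.ob m ⟶ T.ob n} (η : α ⟶ β), TwoCell.mk (F.map η) = TwoCell.mk (G.map η))
    {α β : T.ob m ⟶ T.ob n} (s : WHom α β w) :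
    WCell.mk (s.map F) = WCell.mk (s.map G) := by
  subst hm hn
  obtain rfl : F = G := by
    refine Functor.hext (fun α => ?_) (fun α β η => ?_)
    · simpa using h α
    · have := h₂ η
      simp only [TwoCell.mk.injEq, true_and] at this
      exact this.2.2
  rfl

namespace WCommutativity

variable (μ : WCommutativity T w)

/-- `m ⊗ -` on 1-cells. -/
def left (m : ℕ) (a : OneCell T) : OneCell T := ⟨((μ.L m).hom _ _).obj a.hom⟩
/-- `- ⊗ k` on 1-cells. -/
def right (k : ℕ) (a : OneCell T) : OneCell T := ⟨((μ.R k).hom _ _).obj a.hom⟩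
/-- `m ⊗ -` on 2-cells. -/
def left₂ (m : ℕ) (a : TwoCell T) : TwoCell T := ⟨((μ.L m).hom _ _).map a.hom⟩
/-- `- ⊗ k` on 2-cells. -/
def right₂ (k : ℕ) (a : TwoCell T) : TwoCell T := ⟨((μ.R k).hom _ _).map a.hom⟩
/-- `m ⊗ -` on `w`-cells. -/
def leftW (m : ℕ) (a : WCell T w) : WCell T w := ⟨a.cell.map ((μ.L m).hom _ _)⟩
/-- `- ⊗ k` on `w`-cells. -/
def rightW (k : ℕ) (a : WCell T w) : WCell T w := ⟨a.cell.map ((μ.R k).hom _ _)⟩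
/-- The Gray cell of two 1-cells. -/
def grayW (a b : OneCell T) : WCell T w := ⟨μ.gray a.hom b.hom⟩

theorem left_one (a : OneCell T) : μ.left 1 a = a :=
  OneCell.eq_of_cast _ _ (μ.L_one a.hom)
theorem right_one (a : OneCell T) : μ.right 1 a = a :=
  OneCell.eq_of_cast _ _ (μ.R_one a.hom)
theorem right_right (k l : ℕ) (a : OneCell T) : μ.right l (μ.right k a) = μ.right (k * l) a :=
  OneCell.eq_of_cast _ _ (μ.assoc₁ a.hom k l)
theorem right_left (m l : ℕ) (a : OneCell T) : μ.right l (μ.left m a) = μ.left m (μ.right l a) :=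
  OneCell.eq_of_cast _ _ (μ.assoc₂ m a.hom l)
theorem left_left (m k : ℕ) (a : OneCell T) : μ.left m (μ.left k a) = μ.left (m * k) a :=
  (OneCell.eq_of_cast _ _ (μ.assoc₃ m k a.hom)).symm
theorem left₂_one (a : TwoCell T) : μ.left₂ 1 a = a :=
  TwoCell.eq_of_cast _ _ (μ.L_one_map a.hom)
theorem right₂_one (a : TwoCell T) : μ.right₂ 1 a = a :=
  TwoCell.eq_of_cast _ _ (μ.R_one_map a.hom)
theorem right₂_right₂ (k l : ℕ) (a : TwoCell T) :
    μ.right₂ l (μ.right₂ k a) = μ.right₂ (k * l) a :=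
  TwoCell.eq_of_cast _ _ (μ.assoc₁_map a.hom k l)
theorem right₂_left₂ (m l : ℕ) (a : TwoCell T) :
    μ.right₂ l (μ.left₂ m a) = μ.left₂ m (μ.right₂ l a) :=
  TwoCell.eq_of_cast _ _ (μ.assoc₂_map m a.hom l)
theorem left₂_left₂ (m k : ℕ) (a : TwoCell T) :
    μ.left₂ m (μ.left₂ k a) = μ.left₂ (m * k) a :=
  (TwoCell.eq_of_cast _ _ (μ.assoc₃_map m k a.hom)).symm

theorem rightW_grayW (l : ℕ) (a b : OneCell T) :
    μ.rightW l (μ.grayW a b) = μ.grayW a (μ.right l b) :=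
  WCell.eq_of_cast _ _ (μ.gray_assoc₁₂ a.hom b.hom l)
theorem grayW_right (k : ℕ) (a b : OneCell T) :
    μ.grayW (μ.right k a) b = μ.grayW a (μ.left k b) :=
  WCell.eq_of_cast _ _ (μ.gray_assoc₁₃ a.hom k b.hom)
theorem grayW_left (m : ℕ) (a b : OneCell T) :
    μ.grayW (μ.left m a) b = μ.leftW m (μ.grayW a b) :=
  WCell.eq_of_cast _ _ (μ.gray_assoc₂₃ m a.hom b.hom)

theorem leftW_one (a : WCell T w) : μ.leftW 1 a = a := by
  have := WCell.map_eq_map (one_mul _) (one_mul _) ((μ.L 1).hom a.m a.n) (𝟭 _)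
    (fun α => μ.left_one ⟨α⟩) (fun η => μ.left₂_one ⟨η⟩) a.cell
  refine Eq.trans this ?_
  obtain ⟨s⟩ := a
  cases s <;> rfl

theorem leftW_leftW (m k : ℕ) (a : WCell T w) : μ.leftW m (μ.leftW k a) = μ.leftW (m * k) a := by
  have := WCell.map_eq_map (mul_assoc _ _ _).symm (mul_assoc _ _ _).symm
    ((μ.L k).hom a.m a.n ⋙ (μ.L m).hom _ _) ((μ.L (m * k)).hom a.m a.n)
    (fun α => μ.left_left m k ⟨α⟩) (fun η => μ.left₂_left₂ m k ⟨η⟩) a.cell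
  rwa [← WHom.map_map] at this

theorem rightW_leftW (m l : ℕ) (a : WCell T w) :
    μ.rightW l (μ.leftW m a) = μ.leftW m (μ.rightW l a) := by
  have := WCell.map_eq_map (mul_assoc _ _ _) (mul_assoc _ _ _)
    ((μ.L m).hom a.m a.n ⋙ (μ.R l).hom _ _) ((μ.R l).hom a.m a.n ⋙ (μ.L m).hom _ _)
    (fun α => μ.right_left m l ⟨α⟩) (fun η => μ.right₂_left₂ m l ⟨η⟩) a.cell
  rwa [← WHom.map_map, ← WHom.map_map] at this

end WCommutativity

end Untyped

/-! ### The iterated multiplication on a concatenation -/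

/-- The identity 2-cell of a generating 1-cell. -/
def Step.Two.refl {T : LawvereTwoTheory 𝕋} : ∀ {n : ℕ} {a b : Ar n} (s : Step T a b), s.Two s
  | _, _, _, .here α a => .here (𝟙 α) a
  | _, _, _, .there m s => .there m (refl s)

namespace WCommutativity

variable {T : LawvereTwoTheory 𝕋} {w : Weakness} (μ : WCommutativity T w)

/-- The iterated multiplication on a generating 1-cell, with variable ends. -/
def tensU {n : ℕ} {a b : Ar n} (s : Step T a b) : OneCell T := ⟨μ.tensMap s⟩
/-- The iterated multiplication on a 2-cell, with variable ends. -/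
def tensU₂ {n : ℕ} {a b : Ar n} {s s' : Step T a b} (σ : s.Two s') : TwoCell T := ⟨μ.tensMap₂ σ⟩
/-- The iterated multiplication on a Gray square, with variable ends. -/
def tensUG {n : ℕ} {a b c d : Ar n} {s : Step T a b} {t : Step T a c} {s' : Step T c d}
    {t' : Step T b d} (G : Step.GraySq s t s' t') : WCell T w := ⟨μ.tensGray G⟩

theorem tensU_here {n m m' : ℕ} (α : T.ob m ⟶ T.ob m') : ∀ (a : Ar n),
    μ.tensU (.here α a) = μ.right a.tens ⟨α⟩
  | .nil => (μ.right_one _).symm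
  | .cons _ _ => rfl

theorem tensU_there (m : ℕ) : ∀ {n : ℕ} {a b : Ar n} (s : Step T a b),
    μ.tensU (.there m s) = μ.left m (μ.tensU s)
  | _, _, _, .here _ _ => rfl
  | _, _, _, .there _ _ => rfl

theorem tensU₂_here {n m m' : ℕ} {α β : T.ob m ⟶ T.ob m'} (η : α ⟶ β) : ∀ (a : Ar n),
    μ.tensU₂ (.here η a) = μ.right₂ a.tens ⟨η⟩
  | .nil => (μ.right₂_one _).symm
  | .cons _ _ => rfl

theorem tensU₂_there (m : ℕ) : ∀ {n : ℕ} {a b : Ar n} {s s' : Step T a b} (σ : s.Two s'),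
    μ.tensU₂ (.there m σ) = μ.left₂ m (μ.tensU₂ σ)
  | _, _, _, _, _, .here _ _ => rfl
  | _, _, _, _, _, .there _ _ => rfl

theorem tensUG_here {n m m' : ℕ} (α : T.ob m ⟶ T.ob m') : ∀ {a b : Ar n} (t : Step T a b),
    μ.tensUG (.here α t) = μ.grayW ⟨α⟩ (μ.tensU t)
  | _, _, .here _ _ => rfl
  | _, _, .there _ _ => rfl

theorem mapL_wCell (m : ℕ) {k l l' j : ℕ} {α : T.ob k ⟶ T.ob l} {β : T.ob l ⟶ T.ob j}
    {α' : T.ob k ⟶ T.ob l'} {β' : T.ob l' ⟶ T.ob j} (s : WHom (α ≫ β) (α' ≫ β') w) :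
    WCell.mk (μ.mapL m s) = μ.leftW m ⟨s⟩ :=
  WEq.wCell ((WEq.comp_ofEq _ _).trans (WEq.ofEq_comp _ _))

theorem tensUG_there (m : ℕ) : ∀ {n : ℕ} {a b c d : Ar n} {s : Step T a b} {t : Step T a c}
    {s' : Step T c d} {t' : Step T b d} (G : Step.GraySq s t s' t'),
    μ.tensUG (.there m G) = μ.leftW m (μ.tensUG G)
  | _, _, _, _, _, _, _, _, _, .here _ _ => μ.mapL_wCell _ _
  | _, _, _, _, _, _, _, _, _, .there _ _ => μ.mapL_wCell _ _

theorem tensU_inl {S : Type*} : ∀ (Γ : List S) {Δ : List S} {a b : Ar Γ.length} (s : Step T a b)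
    (d : Ar Δ.length), μ.tensU (s.inl Γ d) = μ.right d.tens (μ.tensU s)
  | _ :: Γ, _, _, _, .here α a, d => by
    refine (μ.tensU_here α _).trans ?_
    rw [tensU_here, right_right, Ar.tens_append]
  | _ :: Γ, _, _, _, .there m s, d => by
    refine (μ.tensU_there m _).trans ?_
    rw [tensU_inl Γ, tensU_there, right_left]

theorem tensU_inr {S : Type*} : ∀ (Γ : List S) {Δ : List S} (a : Ar Γ.length)
    {d e : Ar Δ.length} (s : Step T d e), μ.tensU (s.inr Γ a) = μ.left a.tens (μ.tensU s)
  | [], _, .nil, _, _, s => (μ.left_one _).symm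
  | _ :: Γ, _, .cons m a, _, _, s => by
    refine (μ.tensU_there m _).trans ?_
    rw [tensU_inr Γ, left_left, Ar.tens_cons]

end WCommutativity


theorem WHom.appAt_comp_map {w : Weakness} {A : Type u₁} [Category.{v₁} A] {B : Type u₂}
    [Category.{v₂} B] {F G : A ⥤ B} (s : WHom F G w) {x y : A} (σ : WHom x y w) :
    (s.appAt x).comp (σ.map G) = (σ.map F).comp (s.appAt y) := by
  cases s with
  | strict h => cases σ; rfl
  | pseudo e =>
    cases σ
    simp only [appAt, map, comp]
    congr 1
    ext
    simp
  | lax f => cases σ; simp [appAt, map, comp]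
  | colax f => cases σ; simp [appAt, map, comp]

/-! ### The elements of a 2-functor and the cells between them -/

section Elements

variable {T : LawvereTwoTheory 𝕋} {w : Weakness}

/-- An element of a 2-functor `F`: an object of one of the categories `F n`. -/
structure Elt (F : TwoFun T w) where
  {n : ℕ}
  obj : F.O n

/-- A morphism of one of the categories `F n`. -/
structure EltHom (F : TwoFun T w) where
  {n : ℕ}
  {p q : F.O n}
  hom : p ⟶ q

/-- A `w`-cell `F(α)(p) ⇒ q` over a 1-cell `α` of the theory. -/
structure EltCell (F : TwoFun T w) where
  {m n : ℕ}
  α : T.ob m ⟶ T.ob n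
  {p : F.O m}
  {q : F.O n}
  cell : WHom ((F.fn α).obj p) q w

variable {F : TwoFun T w}

/-- The source of a morphism. -/
def EltHom.src (a : EltHom F) : Elt F := ⟨a.p⟩
/-- The target of a morphism. -/
def EltHom.tgt (a : EltHom F) : Elt F := ⟨a.q⟩
/-- The source of a cell. -/
def EltCell.src (a : EltCell F) : Elt F := ⟨a.p⟩
/-- The target of a cell. -/
def EltCell.tgt (a : EltCell F) : Elt F := ⟨a.q⟩
/-- The identity morphism of an element. -/
def Elt.id (p : Elt F) : EltHom F := ⟨𝟙 p.obj⟩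

namespace EltCell

/-- The third cell is the composite of the first two. -/
inductive Comp : EltCell F → EltCell F → EltCell F → Prop
  | mk {m n k : ℕ} (α : T.ob m ⟶ T.ob n) (β : T.ob n ⟶ T.ob k) {p : F.O m} {q : F.O n} {r : F.O k}
    (σ : WHom ((F.fn α).obj p) q w) (τ : WHom ((F.fn β).obj q) r w) :
    Comp ⟨α, σ⟩ ⟨β, τ⟩
      ⟨α ≫ β, (WHom.ofEq (congrArg (fun G => G.obj p) (F.act.map_comp α β))).comp
        ((σ.map (F.fn β)).comp τ)⟩

/-- The first cell is the composite of the second one with the `w`-cell of the theory. -/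
inductive Pull : WCell T w → EltCell F → EltCell F → Prop
  | mk {m n : ℕ} {α β : T.ob m ⟶ T.ob n} (τ : WHom α β w) {p : F.O m} {q : F.O n}
    (σ : WHom ((F.fn β).obj p) q w) :
    Pull ⟨τ⟩ ⟨α, ((τ.map (F.act.hom m n)).appAt p).comp σ⟩ ⟨β, σ⟩

/-- Two cells form a square with a 2-cell of the theory and with two morphisms. -/
inductive Sq : EltCell F → EltCell F → TwoCell T → EltHom F → EltHom F → Prop
  | mk {m n : ℕ} {α β : T.ob m ⟶ T.ob n} (η : α ⟶ β) {p p' : F.O m} {q q' : F.O n}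
    {σ : WHom ((F.fn α).obj p) q w} {σ' : WHom ((F.fn β).obj p') q' w} {a : p ⟶ p'} {b : q ⟶ q'}
    (h : σ.Sq σ' ((F.tr η).app p ≫ (F.fn β).map a) b) : Sq ⟨α, σ⟩ ⟨β, σ'⟩ ⟨η⟩ ⟨a⟩ ⟨b⟩

/-- Four cells fill a square up to a `w`-cell of the theory. -/
def Gray (W : WCell T w) (u v' v u' : EltCell F) : Prop :=
  ∃ U V, Comp u v' U ∧ Comp v u' V ∧ Pull W U V

theorem mk_congr {m n : ℕ} {α β : T.ob m ⟶ T.ob n} (hα : α = β) {p p' : F.O m} {q q' : F.O n}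
    (hp : p = p') (hq : q = q') {σ : WHom ((F.fn α).obj p) q w} {σ' : WHom ((F.fn β).obj p') q' w}
    (h : WEq σ σ') : (⟨α, σ⟩ : EltCell F) = ⟨β, σ'⟩ := by
  subst hα hp hq
  rw [h.eq]

theorem Comp.of_wEq {m n k : ℕ} {α : T.ob m ⟶ T.ob n} {β : T.ob n ⟶ T.ob k} {γ : T.ob m ⟶ T.ob k}
    (hγ : γ = α ≫ β) {p : F.O m} {q : F.O n} {r : F.O k}
    {σ : WHom ((F.fn α).obj p) q w} {τ : WHom ((F.fn β).obj q) r w}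
    {ρ : WHom ((F.fn γ).obj p) r w} (h : WEq ρ ((σ.map (F.fn β)).comp τ)) :
    Comp ⟨α, σ⟩ ⟨β, τ⟩ ⟨γ, ρ⟩ := by
  subst hγ
  rw [show ρ = _ from (h.trans (WEq.ofEq_comp _ _).symm).eq]
  exact .mk α β σ τ

theorem Comp.wEq {m n k : ℕ} {α : T.ob m ⟶ T.ob n} {β : T.ob n ⟶ T.ob k} {γ : T.ob m ⟶ T.ob k}
    {p : F.O m} {q : F.O n} {r r' : F.O k}
    {σ : WHom ((F.fn α).obj p) q w} {τ : WHom ((F.fn β).obj q) r w}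
    {ρ : WHom ((F.fn γ).obj p) r' w}
    (h : Comp ⟨α, σ⟩ ⟨β, τ⟩ ⟨γ, ρ⟩) : WEq ρ ((σ.map (F.fn β)).comp τ) := by
  cases h
  exact WEq.ofEq_comp _ _

theorem Pull.of_wEq {m n : ℕ} {α β : T.ob m ⟶ T.ob n} {τ : WHom α β w} {p : F.O m} {q : F.O n}
    {ρ : WHom ((F.fn α).obj p) q w} {σ : WHom ((F.fn β).obj p) q w}
    (h : WEq ρ (((τ.map (F.act.hom m n)).appAt p).comp σ)) : Pull ⟨τ⟩ ⟨α, ρ⟩ ⟨β, σ⟩ := by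
  rw [h.eq]
  exact .mk τ σ

theorem Sq.sq {m n : ℕ} {α β : T.ob m ⟶ T.ob n} {η : α ⟶ β} {p p' : F.O m} {q q' : F.O n}
    {σ : WHom ((F.fn α).obj p) q w} {σ' : WHom ((F.fn β).obj p') q' w} {a : p ⟶ p'} {b : q ⟶ q'}
    (h : Sq ⟨α, σ⟩ ⟨β, σ'⟩ ⟨η⟩ ⟨a⟩ ⟨b⟩) : σ.Sq σ' ((F.tr η).app p ≫ (F.fn β).map a) b := by
  cases h; assumption

theorem Gray.of_wEq {m n n' k : ℕ} {α : T.ob m ⟶ T.ob n} {β : T.ob n ⟶ T.ob k}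
    {γ : T.ob m ⟶ T.ob n'} {δ : T.ob n' ⟶ T.ob k} {W : WHom (α ≫ β) (γ ≫ δ) w}
    {p : F.O m} {q : F.O n} {q' : F.O n'} {r : F.O k}
    {σ : WHom ((F.fn α).obj p) q w} {τ' : WHom ((F.fn β).obj q) r w}
    {τ : WHom ((F.fn γ).obj p) q' w} {σ' : WHom ((F.fn δ).obj q') r w}
    (h : WEq ((σ.map (F.fn β)).comp τ') (((W.map (F.act.hom m k)).appAt p).compEq
      (congrArg (fun G => G.obj p) (F.act.map_comp γ δ)) ((τ.map (F.fn δ)).comp σ'))) :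
    Gray ⟨W⟩ ⟨α, σ⟩ ⟨β, τ'⟩ ⟨γ, τ⟩ ⟨δ, σ'⟩ := by
  refine ⟨_, _, .mk α β σ τ', .mk γ δ τ σ', .of_wEq ?_⟩
  refine (WEq.ofEq_comp _ _).trans (h.trans (.of_eq ?_))
  rw [WHom.compEq, WHom.assoc]

theorem Gray.wEq {m n n' k : ℕ} {α : T.ob m ⟶ T.ob n} {β : T.ob n ⟶ T.ob k}
    {γ : T.ob m ⟶ T.ob n'} {δ : T.ob n' ⟶ T.ob k} {W : WHom (α ≫ β) (γ ≫ δ) w}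
    {p : F.O m} {q : F.O n} {q' : F.O n'} {r r' : F.O k}
    {σ : WHom ((F.fn α).obj p) q w} {τ' : WHom ((F.fn β).obj q) r w}
    {τ : WHom ((F.fn γ).obj p) q' w} {σ' : WHom ((F.fn δ).obj q') r' w}
    (h : Gray ⟨W⟩ ⟨α, σ⟩ ⟨β, τ'⟩ ⟨γ, τ⟩ ⟨δ, σ'⟩) :
    WEq ((σ.map (F.fn β)).comp τ') (((W.map (F.act.hom m k)).appAt p).compEq
      (congrArg (fun G => G.obj p) (F.act.map_comp γ δ)) ((τ.map (F.fn δ)).comp σ')) := by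
  obtain ⟨U, V, h₁, h₂, h₃⟩ := h
  cases h₁
  cases h₂
  generalize hU : EltCell.mk (F := F) (α ≫ β) _ = U at h₃
  generalize hV : EltCell.mk (F := F) (γ ≫ δ) _ = V at h₃
  obtain ⟨_, ρ⟩ := h₃
  simp only [EltCell.mk.injEq, heq_eq_eq, true_and] at hU hV
  obtain ⟨rfl, rfl, rfl⟩ := hV
  obtain ⟨-, rfl, hU⟩ := hU
  refine (WEq.ofEq_comp _ _).symm.trans (.trans (.of_eq (eq_of_heq hU)) (.of_eq ?_))
  rw [WHom.compEq, WHom.assoc]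

end EltCell

/-- Reindexing along an equality of numbers does not change a family. -/
theorem Elt.reindex {X : Model T w} {n n' : ℕ} (h : n' = n) {p : X.toFun.O n} {p' : X.toFun.O n'}
    (hp : p' = (Pi.comap (fun _ => X.carrier) (Fin.cast h)).obj p) :
    (⟨p'⟩ : Elt X.toFun) = ⟨p⟩ := by
  subst h; subst hp; rfl

theorem EltHom.reindex {X : Model T w} {n n' : ℕ} (h : n' = n) {p q : X.toFun.O n} {f : p ⟶ q}
    {p' q' : X.toFun.O n'} {f' : p' ⟶ q'}
    (hf : HomEq f' ((Pi.comap (fun _ => X.carrier) (Fin.cast h)).map f)) :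
    (⟨f'⟩ : EltHom X.toFun) = ⟨f⟩ := by
  subst h
  have : HomEq f' f := hf
  cases this
  rfl

theorem EltCell.reindex {X : Model T w} {m n m' n' : ℕ} (hm : m' = m) (hn : n' = n)
    {α : T.ob m ⟶ T.ob n} {α' : T.ob m' ⟶ T.ob n'} (hα : OneCell.mk α' = OneCell.mk α)
    {p : X.toFun.O m} {q : X.toFun.O n} {σ : WHom ((X.toFun.fn α).obj p) q w}
    {p' : X.toFun.O m'} {q' : X.toFun.O n'} {σ' : WHom ((X.toFun.fn α').obj p') q' w}
    (hp : p' = (Pi.comap (fun _ => X.carrier) (Fin.cast hm)).obj p)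
    (hq : q' = (Pi.comap (fun _ => X.carrier) (Fin.cast hn)).obj q)
    (h : WEq σ' (σ.map (Pi.comap (fun _ => X.carrier) (Fin.cast hn)))) :
    (⟨α', σ'⟩ : EltCell X.toFun) = ⟨α, σ⟩ := by
  subst hm hn
  simp only [OneCell.mk.injEq, heq_eq_eq, true_and] at hα
  refine EltCell.mk_congr hα hp hq (h.trans ?_)
  exact .of_eq (by cases σ <;> rfl)

end Elements

/-! ### Points of a product of models and the cells between them -/

section Points

variable {T : LawvereTwoTheory 𝕋} {w : Weakness}

/-- A family of elements of the models in a list. -/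
structure Pt (Γ : List (Model T w)) where
  {a : Ar Γ.length}
  x : Dom Γ a

/-- A family of morphisms between elements of the models in a list. -/
structure PtHom (Γ : List (Model T w)) where
  {a : Ar Γ.length}
  {x y : Dom Γ a}
  hom : x ⟶ y

/-- A `w`-cell between families of elements over a 1-cell of the theory in one variable. -/
structure PtCell (Γ : List (Model T w)) where
  {a b : Ar Γ.length}
  s : Step T a b
  {x : Dom Γ a}
  {y : Dom Γ b}
  cell : WHom ((Dom.map Γ s).obj x) y w

variable {Γ Δ : List (Model T w)}

/-- The source of a family of morphisms. -/
def PtHom.src (a : PtHom Γ) : Pt Γ := ⟨a.x⟩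
/-- The target of a family of morphisms. -/
def PtHom.tgt (a : PtHom Γ) : Pt Γ := ⟨a.y⟩
/-- The family of identities. -/
def Pt.id (x : Pt Γ) : PtHom Γ := ⟨𝟙 x.x⟩
/-- The empty family. -/
def Pt.nil : Pt ([] : List (Model T w)) := Pt.mk (a := .nil) (⟨⟨⟩⟩ : Discrete PUnit)

/-- The identity cell over a 1-cell of the theory in one variable. -/
def PtCell.id {a b : Ar Γ.length} (s : Step T a b) (x : Dom Γ a) : PtCell Γ :=
  ⟨s, (.ofEq rfl : WHom ((Dom.map Γ s).obj x) _ w)⟩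

namespace PtCell

/-- The third cell is the composite of the first two. -/
inductive Comp : PtCell Γ → PtCell Γ → PtCell Γ → Prop
  | mk {a b c : Ar Γ.length} {s : Step T a b} {t : Step T b c} {r : Step T a c} (h : s.IsComp t r)
    {x : Dom Γ a} {y : Dom Γ b} {z : Dom Γ c} {σ : WHom ((Dom.map Γ s).obj x) y w}
    {τ : WHom ((Dom.map Γ t).obj y) z w} {ρ : WHom ((Dom.map Γ r).obj x) z w}
    (e : WEq ρ ((σ.map (Dom.map Γ t)).comp τ)) : Comp ⟨s, σ⟩ ⟨t, τ⟩ ⟨r, ρ⟩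

/-- Two cells form a square with a 2-cell of the theory and with two morphisms. The 2-cell is
recorded by its image under the iterated multiplication. -/
inductive Sq (μ : WCommutativity T w) :
    PtCell Γ → PtCell Γ → TwoCell T → PtHom Γ → PtHom Γ → Prop
  | mk {a b : Ar Γ.length} {s s' : Step T a b} (η : s.Two s') {x x' : Dom Γ a} {y y' : Dom Γ b}
    {σ : WHom ((Dom.map Γ s).obj x) y w} {σ' : WHom ((Dom.map Γ s').obj x') y' w} {f : x ⟶ x'}
    {g : y ⟶ y'} (h : σ.Sq σ' ((Dom.map₂ Γ η).app x ≫ (Dom.map Γ s').map f) g) :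
    Sq μ ⟨s, σ⟩ ⟨s', σ'⟩ (μ.tensU₂ η) ⟨f⟩ ⟨g⟩

/-- Four cells fill a Gray square. The Gray cell is recorded by its image under the iterated
multiplication. -/
inductive Gray (μ : WCommutativity T w) :
    WCell T w → PtCell Γ → PtCell Γ → PtCell Γ → PtCell Γ → Prop
  | mk {a b c d : Ar Γ.length} {s : Step T a b} {t : Step T a c} {s' : Step T c d}
    {t' : Step T b d} (G : Step.GraySq s t s' t') {x : Dom Γ a} {y : Dom Γ b} {y' : Dom Γ c}
    {z : Dom Γ d} {σ : WHom ((Dom.map Γ s).obj x) y w} {τ' : WHom ((Dom.map Γ t').obj y) z w}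
    {τ : WHom ((Dom.map Γ t).obj x) y' w} {σ' : WHom ((Dom.map Γ s').obj y') z w}
    (e : WEq ((σ.map (Dom.map Γ t')).comp τ') ((τ.map (Dom.map Γ s')).comp σ')) :
    Gray μ (μ.tensUG G) ⟨s, σ⟩ ⟨t', τ'⟩ ⟨t, τ⟩ ⟨s', σ'⟩

theorem mk_congr {a b : Ar Γ.length} {s s' : Step T a b} (hs : s = s') {x x' : Dom Γ a}
    {y y' : Dom Γ b} (hx : x = x') (hy : y = y') {σ : WHom ((Dom.map Γ s).obj x) y w}
    {σ' : WHom ((Dom.map Γ s').obj x') y' w}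
    (h : WEq σ σ') : (⟨s, σ⟩ : PtCell Γ) = ⟨s', σ'⟩ := by
  subst hs hx hy
  rw [h.eq]

end PtCell

end Points

/-! ### The action of a multimap on points and on cells -/

section Action

variable {T : LawvereTwoTheory 𝕋} {w : Weakness} (μ : WCommutativity T w)

/-- The components and the cells of a multimap, without the laws. -/
structure PreMultiMap (Γ : List (Model T w)) (Z : Model T w) where
  app (a : Ar Γ.length) : Dom Γ a ⥤ (∀ _ : Fin a.tens, Z.carrier)
  cell {a b : Ar Γ.length} (s : Step T a b) :
    WHom (app a ⋙ Z.toFun.fn (μ.tensMap s)) (Dom.map Γ s ⋙ app b) w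

variable {μ} {Γ : List (Model T w)} {Z : Model T w}

/-- The components and the cells of a multimap. -/
def MultiMap.toPre (f : MultiMap μ Γ Z) : PreMultiMap μ Γ Z := ⟨f.app, f.cell⟩

namespace PreMultiMap

/-- The value at a point. -/
def ev (f : PreMultiMap μ Γ Z) (x : Pt Γ) : Elt Z.toFun := ⟨(f.app x.a).obj x.x⟩

/-- The value at a cell: the cell of the multimap, followed by the image of the given cell. -/
def arr (f : PreMultiMap μ Γ Z) (U : PtCell Γ) : EltCell Z.toFun :=
  ⟨μ.tensMap U.s, ((f.cell U.s).appAt U.x).comp (U.cell.map (f.app U.b))⟩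

theorem arr_id (f : PreMultiMap μ Γ Z) {a b : Ar Γ.length} (s : Step T a b) (x : Dom Γ a) :
    f.arr (.id s x) = ⟨μ.tensMap s, (f.cell s).appAt x⟩ := by
  refine EltCell.mk_congr rfl rfl rfl ?_
  exact (WEq.comp_isId _ ((WHom.isId_ofEq rfl).map _))

end PreMultiMap

/-- The image of a composite under the iterated multiplication. -/
theorem WCommutativity.tailMap_comp : ∀ {n : ℕ} (m : ℕ) {a b c : Ar n} {s : Step T a b}
    {t : Step T b c} {r : Step T a c}, s.IsComp t r →
    μ.tailMap m r = μ.tailMap m s ≫ μ.tailMap m t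
  | _, m, _, _, _, _, _, _, .here α β a => by
    cases a with
    | nil => exact (μ.L m).map_comp _ _
    | cons k a =>
      refine (congrArg ((μ.L m).hom _ _).obj ((μ.R _).map_comp α β)).trans ?_
      exact (μ.L m).map_comp _ _
  | _, m, _, _, _, _, _, _, .there k h =>
    (congrArg ((μ.L m).hom _ _).obj (tailMap_comp k h)).trans ((μ.L m).map_comp _ _)

theorem WCommutativity.tensMap_comp {n : ℕ} {a b c : Ar n} {s : Step T a b}
    {t : Step T b c} {r : Step T a c} (h : s.IsComp t r) :
    μ.tensMap r = μ.tensMap s ≫ μ.tensMap t := by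
  cases h with
  | here α β a =>
    cases a with
    | nil => rfl
    | cons k a => exact (μ.R _).map_comp α β
  | there m h => exact μ.tailMap_comp m h

namespace MultiMap

/-- The value at a point. -/
abbrev ev (f : MultiMap μ Γ Z) (x : Pt Γ) : Elt Z.toFun := f.toPre.ev x

/-- The value at a cell. -/
abbrev arr (f : MultiMap μ Γ Z) (U : PtCell Γ) : EltCell Z.toFun := f.toPre.arr U

/-- The value of a modification at a family of morphisms. -/
def tr {f g : MultiMap μ Γ Z} (φ : f ⟶ g) (t : PtHom Γ) : EltHom Z.toFun :=
  ⟨(f.app t.a).map t.hom ≫ (Modif.app φ t.a).app t.y⟩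

theorem arr_pair (f : MultiMap μ Γ Z) {a b c : Ar Γ.length} (s : Step T a b) (t : Step T b c)
    {x : Dom Γ a} {y : Dom Γ b} {z : Dom Γ c} (σ : WHom ((Dom.map Γ s).obj x) y w)
    (τ : WHom ((Dom.map Γ t).obj y) z w) :
    ((((f.cell s).appAt x).comp (σ.map (f.app b))).map (Z.toFun.fn (μ.tensMap t))).comp
        (((f.cell t).appAt y).comp (τ.map (f.app c))) =
      ((((f.cell s).whR (Z.toFun.fn (μ.tensMap t))).comp ((f.cell t).whL (Dom.map Γ s))).appAt
        x).comp (((σ.map (Dom.map Γ t)).comp τ).map (f.app c)) := by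
  rw [WHom.appAt_comp, WHom.appAt_whR, WHom.appAt_whL]
  have := WHom.appAt_comp_map (f.cell t) σ
  rw [WHom.map_comp, WHom.map_comp, WHom.map_map, WHom.map_map, ← WHom.assoc,
    WHom.assoc _ _ ((f.cell t).appAt y)]
  erw [← this]
  simp only [WHom.assoc]

theorem arr_comp (f : MultiMap μ Γ Z) {U V W : PtCell Γ} (h : U.Comp V W) :
    (f.arr U).Comp (f.arr V) (f.arr W) := by
  obtain ⟨h, e⟩ := h
  rename_i x y z σ τ ρ
  exact .of_wEq (μ.tensMap_comp h) ((((f.cell_comp h).appAt x).comp (e.map _)).trans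
    (.of_eq (f.arr_pair _ _ σ τ).symm))

theorem arr_sq {f f' : MultiMap μ Γ Z} (φ : f ⟶ f') {U U' : PtCell Γ} {E : TwoCell T}
    {a b : PtHom Γ} (h : PtCell.Sq μ U U' E a b) :
    EltCell.Sq (f.arr U) (f'.arr U') E (tr φ a) (tr φ b) := by
  obtain ⟨η, h⟩ := h
  rename_i a b s s' x x' y y' σ σ' t t'
  refine .mk _ ?_
  have h₁ := (f.cell_nat η).appAt x
  have h₂ := (f.cell s').appAt_nat t
  have h₃ := (Modif.sq φ s').appAt x'
  have h₄ := (h.map (f.app b)).comp (WHom.Sq.nat (Modif.app φ b) σ')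
  rw [Functor.map_comp, Category.assoc] at h₄
  have e : (Z.toFun.fn (μ.tensMap s')).map ((f.app a).map t ≫ (Modif.app φ a).app x') = _ :=
    Functor.map_comp _ _ _
  have := (h₁.comp (h₂.comp h₃)).hcomp h₄
  refine Eq.mpr (congrArg (fun k => WHom.Sq _ _ (_ ≫ k) _) e) this

theorem arr_gray (f : MultiMap μ Γ Z) {W : WCell T w} {u v' v u' : PtCell Γ}
    (h : PtCell.Gray μ W u v' v u') :
    EltCell.Gray W (f.arr u) (f.arr v') (f.arr v) (f.arr u') := by
  obtain ⟨G, e⟩ := h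
  rename_i x y y' z σ τ' τ σ'
  refine .of_wEq ?_
  have hc := (f.cell_gray G).appAt x
  refine (WEq.of_eq (f.arr_pair _ _ σ τ')).trans ?_
  refine .trans ?_ (.of_eq (congrArg (WHom.compEq _ _) (f.arr_pair _ _ τ σ').symm))
  refine (hc.comp (e.map _)).trans (.of_eq ?_)
  refine (congrArg (WHom.comp · _) (WHom.appAt_compEq _ _ _ x)).trans ?_
  rw [WHom.appAt_whL]
  exact WHom.assoc _ _ _

end MultiMap

end Action


/-! ### Lists of elements, and multimaps as functions of such lists -/

section Lists

variable {T : LawvereTwoTheory 𝕋} {w : Weakness}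

/-- An element of a model. -/
abbrev Point (T : LawvereTwoTheory 𝕋) (w : Weakness) := Σ X : Model T w, Elt X.toFun

/-- A morphism between elements of a model. -/
abbrev Arrow (T : LawvereTwoTheory 𝕋) (w : Weakness) := Σ X : Model T w, EltHom X.toFun

/-- The source of a morphism. -/
abbrev Arrow.src (a : Arrow T w) : Point T w := ⟨a.1, a.2.src⟩
/-- The target of a morphism. -/
abbrev Arrow.tgt (a : Arrow T w) : Point T w := ⟨a.1, a.2.tgt⟩
/-- The identity morphism of an element. -/
abbrev Point.id (a : Point T w) : Arrow T w := ⟨a.1, a.2.id⟩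

@[simp] theorem fst_comp_src : Sigma.fst ∘ Arrow.src (T := T) (w := w) = Sigma.fst := rfl
@[simp] theorem fst_comp_tgt : Sigma.fst ∘ Arrow.tgt (T := T) (w := w) = Sigma.fst := rfl
@[simp] theorem fst_comp_id : Sigma.fst ∘ Point.id (T := T) (w := w) = Sigma.fst := rfl
@[simp] theorem src_comp_id : Arrow.src (T := T) (w := w) ∘ Point.id = _root_.id := rfl
@[simp] theorem tgt_comp_id : Arrow.tgt (T := T) (w := w) ∘ Point.id = _root_.id := rfl

/-- The product of the numbers to which the elements of a list belong. -/
def num (l : List (Point T w)) : ℕ := (l.map fun p => p.2.n).prod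

@[simp] theorem num_nil : num ([] : List (Point T w)) = 1 := rfl
@[simp] theorem num_cons (p : Point T w) (l : List (Point T w)) :
    num (p :: l) = p.2.n * num l := rfl
@[simp] theorem num_append (l l' : List (Point T w)) : num (l ++ l') = num l * num l' := by
  simp [num]

/-- A list of elements of models with a cell in one place. -/
structure MultiCell (T : LawvereTwoTheory 𝕋) (w : Weakness) where
  left : List (Point T w)
  {X : Model T w}
  cell : EltCell X.toFun
  right : List (Point T w)

namespace MultiCell

/-- The list of models to which the elements and the cell belong. -/
@[simp]
abbrev sources (U : MultiCell T w) : List (Model T w) :=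
  U.left.map Sigma.fst ++ U.X :: U.right.map Sigma.fst
/-- The source of the cell, together with the other elements. -/
@[simp]
abbrev src (U : MultiCell T w) : List (Point T w) := U.left ++ ⟨U.X, U.cell.src⟩ :: U.right
/-- The target of the cell, together with the other elements. -/
@[simp]
abbrev tgt (U : MultiCell T w) : List (Point T w) := U.left ++ ⟨U.X, U.cell.tgt⟩ :: U.right
/-- The 1-cell of the theory under a cell in one place. -/
def oneCell (μ : WCommutativity T w) (U : MultiCell T w) : OneCell T :=
  μ.left (num U.left) (μ.right (num U.right) ⟨U.cell.α⟩)

end MultiCell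

variable {Γ : List (Model T w)} {X : Model T w}

/-- Adding an element to a family. -/
def Pt.cons (p : Elt X.toFun) (z : Pt Γ) : Pt (X :: Γ) :=
  Pt.mk (Γ := X :: Γ) (a := .cons p.n z.a) (p.obj, z.x)

/-- Adding a morphism to a family. -/
def PtHom.cons (p : EltHom X.toFun) (z : PtHom Γ) : PtHom (X :: Γ) :=
  PtHom.mk (Γ := X :: Γ) (a := .cons p.n z.a) (x := (p.p, z.x)) (y := (p.q, z.y)) (p.hom, z.hom)

/-- The list of the elements of a family. -/
def Pt.toList : {Γ : List (Model T w)} → Pt Γ → List (Point T w)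
  | [], _ => []
  | X :: _, .mk (a := .cons _ _) x => ⟨X, ⟨x.1⟩⟩ :: toList ⟨x.2⟩

/-- The list of the morphisms of a family. -/
def PtHom.toList : {Γ : List (Model T w)} → PtHom Γ → List (Arrow T w)
  | [], _ => []
  | X :: _, .mk (a := .cons _ _) f => ⟨X, ⟨f.1⟩⟩ :: toList ⟨f.2⟩

theorem Pt.exists_cons : ∀ (x : Pt (X :: Γ)), ∃ p z, x = Pt.cons p z
  | .mk (a := .cons _ _) x => ⟨⟨x.1⟩, ⟨x.2⟩, rfl⟩

theorem PtHom.exists_cons : ∀ (x : PtHom (X :: Γ)), ∃ p z, x = PtHom.cons p z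
  | .mk (a := .cons _ _) f => ⟨⟨f.1⟩, ⟨f.2⟩, rfl⟩

theorem Pt.eq_nil : ∀ x : Pt ([] : List (Model T w)), x = Pt.nil
  | .mk (a := .nil) _ => rfl

theorem PtHom.eq_nil : ∀ x : PtHom ([] : List (Model T w)), x = Pt.nil.id
  | .mk (a := .nil) (x := ⟨⟨⟩⟩) (y := ⟨⟨⟩⟩) ⟨⟨_⟩⟩ => rfl

theorem Pt.toList_cons (p : Elt X.toFun) (z : Pt Γ) :
    (Pt.cons p z).toList = ⟨X, p⟩ :: z.toList := rfl
theorem PtHom.toList_cons (p : EltHom X.toFun) (z : PtHom Γ) :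
    (PtHom.cons p z).toList = ⟨X, p⟩ :: z.toList := rfl

theorem Pt.map_fst_toList : ∀ {Γ : List (Model T w)} (x : Pt Γ), x.toList.map Sigma.fst = Γ
  | [], _ => rfl
  | _ :: _, x => by
    obtain ⟨p, z, rfl⟩ := x.exists_cons
    rw [toList_cons, List.map_cons, map_fst_toList z]

theorem PtHom.map_fst_toList : ∀ {Γ : List (Model T w)} (x : PtHom Γ),
    x.toList.map Sigma.fst = Γ
  | [], _ => rfl
  | _ :: _, x => by
    obtain ⟨p, z, rfl⟩ := x.exists_cons
    rw [toList_cons, List.map_cons, map_fst_toList z]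

theorem Pt.toList_injective : ∀ {Γ : List (Model T w)},
    Function.Injective (Pt.toList : Pt Γ → List (Point T w))
  | [], x, y, _ => by rw [x.eq_nil, y.eq_nil]
  | _ :: _, x, y, h => by
    obtain ⟨p, z, rfl⟩ := x.exists_cons
    obtain ⟨q, t, rfl⟩ := y.exists_cons
    rw [toList_cons, toList_cons] at h
    obtain ⟨h, h'⟩ := List.cons.inj h
    obtain rfl : p = q := by simpa using h
    rw [toList_injective h']

theorem PtHom.toList_injective : ∀ {Γ : List (Model T w)},
    Function.Injective (PtHom.toList : PtHom Γ → List (Arrow T w))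
  | [], x, y, _ => by rw [x.eq_nil, y.eq_nil]
  | _ :: _, x, y, h => by
    obtain ⟨p, z, rfl⟩ := x.exists_cons
    obtain ⟨q, t, rfl⟩ := y.exists_cons
    rw [toList_cons, toList_cons] at h
    obtain ⟨h, h'⟩ := List.cons.inj h
    obtain rfl : p = q := by simpa using h
    rw [toList_injective h']

theorem Pt.exists_toList (l : List (Point T w)) (h : l.map Sigma.fst = Γ) :
    ∃ x : Pt Γ, x.toList = l := by
  subst h
  induction l with
  | nil => exact ⟨.nil, rfl⟩
  | cons p l ih =>
    obtain ⟨x, hx⟩ := ih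
    exact ⟨.cons p.2 x, (Pt.toList_cons _ _).trans (congrArg _ hx)⟩

theorem PtHom.exists_toList (l : List (Arrow T w)) (h : l.map Sigma.fst = Γ) :
    ∃ x : PtHom Γ, x.toList = l := by
  subst h
  induction l with
  | nil => exact ⟨Pt.nil.id, rfl⟩
  | cons p l ih =>
    obtain ⟨x, hx⟩ := ih
    exact ⟨.cons p.2 x, (PtHom.toList_cons _ _).trans (congrArg _ hx)⟩

theorem Pt.num_toList : ∀ {Γ : List (Model T w)} (x : Pt Γ), num x.toList = x.a.tens
  | [], .mk (a := .nil) _ => rfl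
  | _ :: _, x => by
    obtain ⟨p, z, rfl⟩ := x.exists_cons
    rw [toList_cons, num_cons, num_toList z]
    exact (Ar.tens_cons _ _).symm

theorem PtHom.toList_src : ∀ {Γ : List (Model T w)} (x : PtHom Γ),
    x.src.toList = x.toList.map Arrow.src
  | [], _ => rfl
  | _ :: _, x => by
    obtain ⟨p, z, rfl⟩ := x.exists_cons
    rw [toList_cons, List.map_cons, ← toList_src z]
    rfl

theorem PtHom.toList_tgt : ∀ {Γ : List (Model T w)} (x : PtHom Γ),
    x.tgt.toList = x.toList.map Arrow.tgt
  | [], _ => rfl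
  | _ :: _, x => by
    obtain ⟨p, z, rfl⟩ := x.exists_cons
    rw [toList_cons, List.map_cons, ← toList_tgt z]
    rfl

theorem Pt.toList_id : ∀ {Γ : List (Model T w)} (x : Pt Γ),
    x.id.toList = x.toList.map Point.id
  | [], _ => rfl
  | _ :: _, x => by
    obtain ⟨p, z, rfl⟩ := x.exists_cons
    rw [toList_cons, List.map_cons, ← toList_id z]
    rfl

namespace PtCell

/-- The source of a cell. -/
def src (U : PtCell Γ) : Pt Γ := ⟨U.x⟩
/-- The target of a cell. -/
def tgt (U : PtCell Γ) : Pt Γ := ⟨U.y⟩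

/-- A cell in the first place. -/
def slot (u : EltCell X.toFun) (z : Pt Γ) : PtCell (X :: Γ) :=
  PtCell.mk (Γ := X :: Γ) (.here u.α z.a) (x := (u.p, z.x)) (y := (u.q, z.x))
    (u.cell.map (CategoryTheory.Prod.sectL _ z.x))

/-- A cell in one of the further places. -/
def there (p : Elt X.toFun) (U : PtCell Γ) : PtCell (X :: Γ) :=
  PtCell.mk (Γ := X :: Γ) (.there p.n U.s) (x := (p.obj, U.x)) (y := (p.obj, U.y))
    (U.cell.map (CategoryTheory.Prod.sectR p.obj _))

/-- The list of elements with a cell in one place, as a cell between families of elements. -/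
inductive Represents : MultiCell T w → ∀ {Γ : List (Model T w)}, PtCell Γ → Prop
  | here {X : Model T w} {Γ : List (Model T w)} (u : EltCell X.toFun) (z : Pt Γ) :
    Represents ⟨[], u, z.toList⟩ (slot u z)
  | there {X : Model T w} {Γ : List (Model T w)} (p : Elt X.toFun) {U : MultiCell T w}
    {V : PtCell Γ} (h : Represents U V) :
    Represents ⟨⟨X, p⟩ :: U.left, U.cell, U.right⟩ (there p V)

theorem Represents.src {U : MultiCell T w} {V : PtCell Γ} (h : Represents U V) :
    V.src.toList = U.src := by
  induction h with
  | here u z => rfl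
  | there p h ih => exact (Pt.toList_cons _ _).trans (congrArg _ ih)

theorem Represents.tgt {U : MultiCell T w} {V : PtCell Γ} (h : Represents U V) :
    V.tgt.toList = U.tgt := by
  induction h with
  | here u z => rfl
  | there p h ih => exact (Pt.toList_cons _ _).trans (congrArg _ ih)

theorem Represents.sources {U : MultiCell T w} {V : PtCell Γ} (h : Represents U V) :
    U.sources = Γ := by
  have := h.src ▸ V.src.map_fst_toList
  simpa using this

theorem Represents.oneCell (μ : WCommutativity T w) {U : MultiCell T w} {V : PtCell Γ}
    (h : Represents U V) : μ.tensU V.s = U.oneCell μ := by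
  induction h with
  | here u z =>
    refine (μ.tensU_here _ _).trans ?_
    rw [MultiCell.oneCell, num_nil, μ.left_one, z.num_toList]
  | there p h ih =>
    refine (μ.tensU_there _ _).trans ?_
    rw [ih, MultiCell.oneCell, MultiCell.oneCell, μ.left_left]
    rfl

/-- Every list of elements with a cell in one place is a cell between families of elements. -/
theorem exists_represents (U : MultiCell T w) (h : U.sources = Γ) :
    ∃ V : PtCell Γ, Represents U V := by
  subst h
  obtain ⟨l, u, l'⟩ := U
  induction l with
  | nil =>
    obtain ⟨z, hz⟩ := Pt.exists_toList l' rfl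
    have := Represents.here u z
    rw [hz] at this
    exact ⟨_, this⟩
  | cons p l ih =>
    obtain ⟨V, hV⟩ := ih
    exact ⟨_, .there p.2 hV⟩

theorem Represents.heq {U U' : MultiCell T w} (hU : U = U') {V : PtCell Γ}
    {Γ' : List (Model T w)} {V' : PtCell Γ'} (h : Represents U V) (h' : Represents U' V') :
    V ≍ V' := by
  have hΓ : Γ = Γ' := by rw [← h.sources, ← h'.sources, hU]
  induction h generalizing U' Γ' with
  | here u z =>
    cases h' with
    | here u' z' =>
      obtain ⟨rfl, rfl⟩ := List.cons.inj hΓ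
      simp only [MultiCell.mk.injEq, heq_eq_eq, true_and] at hU
      obtain ⟨rfl, hz⟩ := hU
      obtain rfl := Pt.toList_injective hz
      rfl
    | there p h' => simp at hU
  | @there X Γ p U V h ih =>
    cases h' with
    | here u' z' => simp at hU
    | @there X' Γ'' p' U'' V'' h' =>
      obtain ⟨rfl, rfl⟩ := List.cons.inj hΓ
      obtain ⟨l, u, r⟩ := U
      obtain ⟨l, u, r⟩ := U''
      simp only [MultiCell.mk.injEq, List.cons.injEq, Sigma.mk.injEq, heq_eq_eq, true_and] at hU
      obtain ⟨⟨rfl, rfl⟩, rfl, hu, rfl⟩ := hU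
      cases hu
      rw [eq_of_heq (ih rfl h' rfl)]

theorem Represents.unique {U : MultiCell T w} {V V' : PtCell Γ} (h : Represents U V)
    (h' : Represents U V') : V = V' :=
  eq_of_heq (h.heq rfl h')

end PtCell

end Lists


section Prod

variable {w : Weakness} {A : Type u₁} [Category.{v₁} A] {B : Type u₂} [Category.{v₂} B]

theorem WHom.Sq.sectL {x y x' y' : A} {s : WHom x y w} {s' : WHom x' y' w} {f : x ⟶ x'}
    {g : y ⟶ y'} (h : s.Sq s' f g) {z z' : B} {k k' : z ⟶ z'} (hk : k = k') :
    (s.map (Prod.sectL A z)).Sq (s'.map (Prod.sectL A z')) (Prod.mkHom f k) (Prod.mkHom g k') := by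
  subst hk
  cases s <;> cases s' <;> simp only [Sq, WHom.map] at h ⊢
  · rename_i a b
    cases a; cases b
    simp only [eqToHom_refl, Category.comp_id, Category.id_comp] at h ⊢
    rw [h]
    exact (Category.comp_id _).trans (Category.id_comp _).symm
  all_goals
    refine Prod.ext h ?_
    first
    | exact (Category.comp_id _).trans (Category.id_comp _).symm
    | exact (Category.id_comp _).trans (Category.comp_id _).symm

theorem WHom.Sq.sectR {x y x' y' : A} {s : WHom x y w} {s' : WHom x' y' w} {f : x ⟶ x'}
    {g : y ⟶ y'} (h : s.Sq s' f g) {z z' : B} {k k' : z ⟶ z'} (hk : k = k') :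
    (s.map (Prod.sectR z A)).Sq (s'.map (Prod.sectR z' A)) (Prod.mkHom k f) (Prod.mkHom k' g) := by
  subst hk
  cases s <;> cases s' <;> simp only [Sq, WHom.map] at h ⊢
  · rename_i a b
    cases a; cases b
    simp only [eqToHom_refl, Category.comp_id, Category.id_comp] at h ⊢
    rw [h]
    exact (Category.comp_id _).trans (Category.id_comp _).symm
  all_goals
    refine Prod.ext ?_ h
    first
    | exact (Category.comp_id _).trans (Category.id_comp _).symm
    | exact (Category.id_comp _).trans (Category.comp_id _).symm

/-- Cells in the two factors of a product commute. -/
theorem WHom.sectL_comp_sectR {x y : A} {x' y' : B} (s : WHom x y w) (s' : WHom x' y' w) :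
    (s.map (Prod.sectL A x')).comp (s'.map (Prod.sectR y B)) =
      (s'.map (Prod.sectR x B)).comp (s.map (Prod.sectL A y')) := by
  cases s <;> cases s' <;> simp only [WHom.map, WHom.comp]
  · rfl
  · refine congrArg WHom.pseudo ?_
    refine Iso.ext ?_
    refine Prod.ext ?_ ?_
    · exact (Category.comp_id _).trans (Category.id_comp _).symm
    · exact (Category.id_comp _).trans (Category.comp_id _).symm
  · refine congrArg WHom.lax ?_
    refine Prod.ext ?_ ?_
    · exact (Category.comp_id _).trans (Category.id_comp _).symm
    · exact (Category.id_comp _).trans (Category.comp_id _).symm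
  · refine congrArg WHom.colax ?_
    refine Prod.ext ?_ ?_
    · exact (Category.id_comp _).trans (Category.comp_id _).symm
    · exact (Category.comp_id _).trans (Category.id_comp _).symm

theorem WHom.map_sectR_comp {C : Type u₃} [Category.{v₃} C] (p : A) {x y : B} {z : C}
    (s : WHom x y w) (F : B ⥤ C) (t : WHom (F.obj y) z w) :
    WEq (((s.map (Prod.sectR p B)).map ((𝟭 A).prod F)).comp (t.map (Prod.sectR p C)))
      (((s.map F).comp t).map (Prod.sectR p C)) := by
  rw [WHom.map_comp]
  exact WEq.comp (WHom.map_congr' s rfl) .refl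

end Prod

section Laws

variable {T : LawvereTwoTheory 𝕋} {w : Weakness} (μ : WCommutativity T w)
  {Γ : List (Model T w)} {X : Model T w}

namespace PtCell

theorem Comp.slot {u v t : EltCell X.toFun} (h : u.Comp v t) (z : Pt Γ) :
    Comp (slot u z) (slot v z) (slot t z) := by
  obtain ⟨α, β, σ, τ⟩ := h
  refine .mk (.here α β z.a) ?_
  refine ((WEq.ofEq_comp _ _).map _).trans ?_
  refine (WEq.of_eq (WHom.map_comp _ _ _)).trans (WEq.comp ?_ .refl)
  exact WHom.map_congr' σ rfl

theorem Comp.there (p : Elt X.toFun) {U V W : PtCell Γ} (h : U.Comp V W) :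
    Comp (there p U) (there p V) (there p W) := by
  obtain ⟨h, e⟩ := h
  rename_i σ τ ρ
  refine .mk (.there p.n h) ((e.map _).trans ?_)
  refine (WEq.of_eq (WHom.map_comp _ _ _)).trans (WEq.comp ?_ .refl)
  exact WHom.map_congr' σ rfl

theorem Sq.slot {u u' : EltCell X.toFun} {E : TwoCell T} {a b : EltHom X.toFun}
    (h : EltCell.Sq u u' E a b) (t : PtHom Γ) :
    Sq μ (slot u t.src) (slot u' t.tgt) (μ.right₂ t.a.tens E) (.cons a t) (.cons b t) := by
  obtain ⟨η, h⟩ := h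
  rw [← μ.tensU₂_here]
  exact Sq.mk (Γ := X :: Γ) (.here η t.a) (h.sectL (Category.id_comp _))

theorem Sq.there {U U' : PtCell Γ} {E : TwoCell T} {t t' : PtHom Γ}
    (h : Sq μ U U' E t t') (a : EltHom X.toFun) :
    Sq μ (PtCell.there a.src U) (PtCell.there a.tgt U') (μ.left₂ a.n E) (.cons a t)
      (.cons a t') := by
  obtain ⟨η, h⟩ := h
  rw [← μ.tensU₂_there]
  exact Sq.mk (Γ := X :: Γ) (.there a.n η) (h.sectR (Category.id_comp _))

theorem Gray.cross (u : EltCell X.toFun) (V : PtCell Γ) :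
    Gray μ (μ.grayW ⟨u.α⟩ (μ.tensU V.s)) (slot u V.src) (PtCell.there u.tgt V)
      (PtCell.there u.src V) (slot u V.tgt) := by
  rw [← μ.tensUG_here]
  refine Gray.mk (Γ := X :: Γ) (.here u.α V.s) ?_
  have h := WHom.sectL_comp_sectR u.cell V.cell
  have h₁ := WHom.map_congr' (w := w) (F := Prod.sectL _ V.x)
    (G := (𝟭 _).prod (Dom.map Γ V.s)) (F' := 𝟭 _) (G' := Prod.sectL _ ((Dom.map Γ V.s).obj V.x))
    u.cell (Functor.hext (fun _ => rfl)
      fun _ _ _ => heq_of_eq (Prod.ext rfl ((Dom.map Γ V.s).map_id V.x)))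
  have h₂ := WHom.map_congr' (w := w) (F := Prod.sectR u.p _)
    (G := (X.toFun.fn u.α).prod (𝟭 _)) (F' := 𝟭 _)
    (G' := Prod.sectR ((X.toFun.fn u.α).obj u.p) _)
    V.cell (Functor.hext (fun _ => rfl)
      fun _ _ _ => heq_of_eq (Prod.ext ((X.toFun.fn u.α).map_id u.p) rfl))
  have e₁ : u.cell.map (𝟭 _) = u.cell := by cases u.cell <;> rfl
  have e₂ : V.cell.map (𝟭 _) = V.cell := by cases V.cell <;> rfl
  rw [e₁] at h₁
  rw [e₂] at h₂
  exact (WEq.comp h₁ .refl).trans ((WEq.of_eq h).trans (WEq.comp h₂.symm .refl))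

theorem Gray.there {W : WCell T w} {U V' V U' : PtCell Γ} (h : Gray μ W U V' V U')
    (p : Elt X.toFun) :
    Gray μ (μ.leftW p.n W) (there p U) (there p V') (there p V) (there p U') := by
  obtain ⟨G, e⟩ := h
  rename_i σ τ' τ σ'
  rw [← μ.tensUG_there]
  refine Gray.mk (Γ := X :: Γ) (.there p.n G) ?_
  exact (WHom.map_sectR_comp _ σ _ τ').trans ((e.map _).trans (WHom.map_sectR_comp _ τ _ σ').symm)

end PtCell

variable {μ} {Z : Model T w}

namespace MultiMap

/-- The value of a multimap at a list of elements. -/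
noncomputable def val (f : MultiMap μ Γ Z) (l : List (Point T w)) (h : l.map Sigma.fst = Γ) :
    Elt Z.toFun :=
  f.ev (Pt.exists_toList l h).choose

/-- The value of a modification at a list of morphisms. -/
noncomputable def valHom {f g : MultiMap μ Γ Z} (φ : f ⟶ g) (l : List (Arrow T w))
    (h : l.map Sigma.fst = Γ) : EltHom Z.toFun :=
  tr φ (PtHom.exists_toList l h).choose

/-- The value of a multimap at a list of elements with a cell in one place. -/
noncomputable def valCell (f : MultiMap μ Γ Z) (U : MultiCell T w) (h : U.sources = Γ) :
    EltCell Z.toFun :=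
  f.arr (PtCell.exists_represents U h).choose

theorem val_eq (f : MultiMap μ Γ Z) {l : List (Point T w)} (h : l.map Sigma.fst = Γ) {x : Pt Γ}
    (hx : x.toList = l) : f.val l h = f.ev x := by
  have := (Pt.exists_toList l h).choose_spec
  rw [val, Pt.toList_injective (this.trans hx.symm)]

theorem valHom_eq {f g : MultiMap μ Γ Z} (φ : f ⟶ g) {l : List (Arrow T w)}
    (h : l.map Sigma.fst = Γ) {x : PtHom Γ} (hx : x.toList = l) : valHom φ l h = tr φ x := by
  have := (PtHom.exists_toList l h).choose_spec
  rw [valHom, PtHom.toList_injective (this.trans hx.symm)]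

theorem valCell_eq (f : MultiMap μ Γ Z) {U : MultiCell T w} (h : U.sources = Γ) {V : PtCell Γ}
    (hV : PtCell.Represents U V) : f.valCell U h = f.arr V := by
  have := (PtCell.exists_represents U h).choose_spec
  rw [valCell, this.unique hV]

end MultiMap

end Laws


section Laws

variable {T : LawvereTwoTheory 𝕋} {w : Weakness} (μ : WCommutativity T w)
  {Γ : List (Model T w)} {X : Model T w}

/-- The third morphism is the composite of the first two. -/
inductive EltHom.Comp {F : TwoFun T w} : EltHom F → EltHom F → EltHom F → Prop
  | mk {n : ℕ} {p q r : F.O n} (f : p ⟶ q) (g : q ⟶ r) : Comp ⟨f⟩ ⟨g⟩ ⟨f ≫ g⟩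

theorem EltHom.Comp.unique {F : TwoFun T w} {a b c c' : EltHom F} (h : a.Comp b c)
    (h' : a.Comp b c') : c = c' := by
  cases h
  cases h'
  rfl

theorem EltHom.Comp.eq {F : TwoFun T w} {n : ℕ} {p q r : F.O n} {f : p ⟶ q} {g : q ⟶ r}
    {h : p ⟶ r} (e : EltHom.Comp (F := F) ⟨f⟩ ⟨g⟩ ⟨h⟩) : h = f ≫ g := by
  cases e
  rfl

/-- A composable pair of morphisms. -/
structure EltPair (F : TwoFun T w) where
  {n : ℕ}
  {p q r : F.O n}
  f : p ⟶ q
  g : q ⟶ r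

/-- A composable pair of morphisms in a model. -/
abbrev ArrowPair (T : LawvereTwoTheory 𝕋) (w : Weakness) := Σ X : Model T w, EltPair X.toFun

/-- The first morphism of a composable pair. -/
abbrev ArrowPair.fst (a : ArrowPair T w) : Arrow T w := ⟨a.1, ⟨a.2.f⟩⟩
/-- The second morphism of a composable pair. -/
abbrev ArrowPair.snd (a : ArrowPair T w) : Arrow T w := ⟨a.1, ⟨a.2.g⟩⟩
/-- The composite of a composable pair. -/
abbrev ArrowPair.comp (a : ArrowPair T w) : Arrow T w := ⟨a.1, ⟨a.2.f ≫ a.2.g⟩⟩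

@[simp] theorem fst_comp_pair_fst : Sigma.fst ∘ ArrowPair.fst (T := T) (w := w) = Sigma.fst := rfl
@[simp] theorem fst_comp_pair_snd : Sigma.fst ∘ ArrowPair.snd (T := T) (w := w) = Sigma.fst := rfl
@[simp] theorem fst_comp_pair_comp :
    Sigma.fst ∘ ArrowPair.comp (T := T) (w := w) = Sigma.fst := rfl

theorem PtHom.exists_pair (c : List (ArrowPair T w)) (h : c.map Sigma.fst = Γ) :
    ∃ (a : Ar Γ.length) (x y z : Dom Γ a) (f : x ⟶ y) (g : y ⟶ z),
      (PtHom.mk f).toList = c.map ArrowPair.fst ∧ (PtHom.mk g).toList = c.map ArrowPair.snd ∧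
      (PtHom.mk (f ≫ g)).toList = c.map ArrowPair.comp := by
  subst h
  induction c with
  | nil => exact ⟨.nil, _, _, _, Pt.nil.id.hom, Pt.nil.id.hom, rfl, rfl, rfl⟩
  | cons c l ih =>
    obtain ⟨a, x, y, z, f, g, h₁, h₂, h₃⟩ := ih
    obtain ⟨X, f', g'⟩ := c
    refine ⟨_, _, _, _, (PtHom.cons ⟨f'⟩ ⟨f⟩).hom, (PtHom.cons ⟨g'⟩ ⟨g⟩).hom, ?_, ?_, ?_⟩
    · exact (PtHom.toList_cons ⟨f'⟩ ⟨f⟩).trans (congrArg _ h₁)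
    · exact (PtHom.toList_cons ⟨g'⟩ ⟨g⟩).trans (congrArg _ h₂)
    · exact (PtHom.toList_cons ⟨f' ≫ g'⟩ ⟨f ≫ g⟩).trans (congrArg _ h₃)

theorem PtHom.exists_pairs : ∀ {Γ : List (Model T w)} {a : Ar Γ.length} {x y z : Dom Γ a}
    (f : x ⟶ y) (g : y ⟶ z), ∃ c : List (ArrowPair T w),
      (PtHom.mk f).toList = c.map ArrowPair.fst ∧ (PtHom.mk g).toList = c.map ArrowPair.snd ∧
      (PtHom.mk (f ≫ g)).toList = c.map ArrowPair.comp
  | [], _, _, _, _, _, _ => ⟨[], rfl, rfl, rfl⟩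
  | X :: Γ, .cons m a, x, y, z, f, g => by
    obtain ⟨c, h₁, h₂, h₃⟩ := exists_pairs f.2 g.2
    refine ⟨⟨X, f.1, g.1⟩ :: c, ?_, ?_, ?_⟩
    · exact (PtHom.toList_cons ⟨f.1⟩ ⟨f.2⟩).trans (congrArg _ h₁)
    · exact (PtHom.toList_cons ⟨g.1⟩ ⟨g.2⟩).trans (congrArg _ h₂)
    · exact (PtHom.toList_cons ⟨f.1 ≫ g.1⟩ ⟨f.2 ≫ g.2⟩).trans (congrArg _ h₃)

namespace PtCell

theorem Represents.of_eq {U : MultiCell T w} {V : PtCell Γ} (h : Represents U V)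
    {U' : MultiCell T w} (e : U = U') : Represents U' V := e ▸ h

theorem exists_comp (l l' : List (Point T w)) {u v t : EltCell X.toFun} (h : u.Comp v t)
    (hΓ : l.map Sigma.fst ++ X :: l'.map Sigma.fst = Γ) :
    ∃ U V W : PtCell Γ, Represents ⟨l, u, l'⟩ U ∧ Represents ⟨l, v, l'⟩ V ∧
      Represents ⟨l, t, l'⟩ W ∧ U.Comp V W := by
  subst hΓ
  induction l with
  | nil =>
    obtain ⟨z, hz⟩ := Pt.exists_toList l' rfl
    refine ⟨slot u z, slot v z, slot t z, (Represents.here u z).of_eq ?_,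
      (Represents.here v z).of_eq ?_, (Represents.here t z).of_eq ?_, Comp.slot h z⟩ <;> rw [hz]
  | cons p l ih =>
    obtain ⟨U, V, W, h₁, h₂, h₃, h⟩ := ih
    exact ⟨_, _, _, .there p.2 h₁, .there p.2 h₂, .there p.2 h₃, h.there p.2⟩

theorem exists_sq (l l' : List (Arrow T w)) {u u' : EltCell X.toFun} {E : TwoCell T}
    {a b : EltHom X.toFun} (h : EltCell.Sq u u' E a b)
    (hΓ : l.map Sigma.fst ++ X :: l'.map Sigma.fst = Γ) :
    ∃ (U U' : PtCell Γ) (s t : PtHom Γ),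
      Represents ⟨l.map Arrow.src, u, l'.map Arrow.src⟩ U ∧
      Represents ⟨l.map Arrow.tgt, u', l'.map Arrow.tgt⟩ U' ∧
      s.toList = l ++ ⟨X, a⟩ :: l' ∧ t.toList = l ++ ⟨X, b⟩ :: l' ∧
      Sq μ U U' (μ.left₂ (num (l.map Arrow.src)) (μ.right₂ (num (l'.map Arrow.src)) E)) s t := by
  subst hΓ
  induction l with
  | nil =>
    obtain ⟨t, ht⟩ := PtHom.exists_toList l' rfl
    refine ⟨_, _, .cons a t, .cons b t, (Represents.here u t.src).of_eq ?_,
      (Represents.here u' t.tgt).of_eq ?_, ?_, ?_, ?_⟩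
    · rw [t.toList_src, ht]
      rfl
    · rw [t.toList_tgt, ht]
      rfl
    · rw [PtHom.toList_cons, ht]
      rfl
    · rw [PtHom.toList_cons, ht]
      rfl
    · have := Sq.slot μ h t
      have e : num (l'.map Arrow.src) = t.a.tens := by
        have := t.src.num_toList
        rwa [t.toList_src, ht] at this
      have e' : μ.left₂ (num (List.map (Arrow.src (T := T) (w := w)) [])) (μ.right₂ (num (l'.map Arrow.src)) E) =
          μ.right₂ t.a.tens E := by
        rw [e]
        exact μ.left₂_one _
      exact e' ▸ this
  | cons p l ih =>
    obtain ⟨U, U', s, t, h₁, h₂, h₃, h₄, h⟩ := ih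
    refine ⟨_, _, .cons p.2 s, .cons p.2 t, .there p.2.src h₁, .there p.2.tgt h₂,
      (PtHom.toList_cons _ _).trans (congrArg _ h₃), (PtHom.toList_cons _ _).trans (congrArg _ h₄),
      ?_⟩
    have := h.there μ p.2
    rw [μ.left₂_left₂] at this
    exact this

theorem exists_cell (l : List (Point T w)) (u : EltCell X.toFun) (l' : List (Point T w))
    (hΓ : l.map Sigma.fst ++ X :: l'.map Sigma.fst = Γ) :
    ∃ V : PtCell Γ, Represents ⟨l, u, l'⟩ V :=
  exists_represents ⟨l, u, l'⟩ hΓ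

theorem exists_gray (l : List (Point T w)) (u : EltCell X.toFun) (l' : List (Point T w))
    {Y : Model T w} (v : EltCell Y.toFun) (l'' : List (Point T w))
    (hΓ : l.map Sigma.fst ++ X :: (l'.map Sigma.fst ++ Y :: l''.map Sigma.fst) = Γ) :
    ∃ U V' V U' : PtCell Γ, Represents ⟨l, u, l' ++ ⟨Y, v.src⟩ :: l''⟩ U ∧
      Represents ⟨l ++ ⟨X, u.tgt⟩ :: l', v, l''⟩ V' ∧
      Represents ⟨l ++ ⟨X, u.src⟩ :: l', v, l''⟩ V ∧
      Represents ⟨l, u, l' ++ ⟨Y, v.tgt⟩ :: l''⟩ U' ∧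
      Gray μ (μ.leftW (num l) (μ.rightW (num l'') (μ.grayW (μ.right (num l') ⟨u.α⟩) ⟨v.α⟩)))
        U V' V U' := by
  subst hΓ
  induction l with
  | nil =>
    obtain ⟨V, hV⟩ := exists_cell l' v l'' rfl
    refine ⟨_, _, _, _, (Represents.here u V.src).of_eq ?_, .there _ hV, .there _ hV,
      (Represents.here u V.tgt).of_eq ?_, ?_⟩
    · rw [hV.src]
    · rw [hV.tgt]
    · have := Gray.cross μ u V
      rw [hV.oneCell μ, MultiCell.oneCell, ← μ.grayW_right, ← μ.rightW_grayW] at this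
      rw [num_nil, μ.leftW_one]
      exact this
  | cons p l ih =>
    obtain ⟨U, V', V, U', h₁, h₂, h₃, h₄, h⟩ := ih
    refine ⟨_, _, _, _, .there p.2 h₁, .there p.2 h₂, .there p.2 h₃, .there p.2 h₄, ?_⟩
    have := h.there μ p.2
    rw [μ.leftW_leftW] at this
    exact this

end PtCell

variable {μ} {Z : Model T w}

namespace MultiMap

theorem val_n (f : MultiMap μ Γ Z) {l : List (Point T w)} (h : l.map Sigma.fst = Γ) :
    (f.val l h).n = num l := by
  obtain ⟨x, hx⟩ := Pt.exists_toList l h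
  rw [f.val_eq h hx, ← hx, x.num_toList]
  rfl

theorem valHom_src {f g : MultiMap μ Γ Z} (φ : f ⟶ g) {t : List (Arrow T w)}
    (h : t.map Sigma.fst = Γ) : (valHom φ t h).src = f.val (t.map Arrow.src) (by simpa) := by
  obtain ⟨x, rfl⟩ := PtHom.exists_toList t h
  rw [valHom_eq φ h rfl, f.val_eq _ x.toList_src]
  rfl

theorem valHom_tgt {f g : MultiMap μ Γ Z} (φ : f ⟶ g) {t : List (Arrow T w)}
    (h : t.map Sigma.fst = Γ) : (valHom φ t h).tgt = g.val (t.map Arrow.tgt) (by simpa) := by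
  obtain ⟨x, rfl⟩ := PtHom.exists_toList t h
  rw [valHom_eq φ h rfl, g.val_eq _ x.toList_tgt]
  rfl

theorem valHom_id (f : MultiMap μ Γ Z) {l : List (Point T w)} (h : l.map Sigma.fst = Γ) :
    valHom (𝟙 f) (l.map Point.id) (by simpa) = (f.val l h).id := by
  obtain ⟨x, rfl⟩ := Pt.exists_toList l h
  rw [valHom_eq _ _ x.toList_id, f.val_eq _ rfl]
  change (⟨(f.app x.a).map (𝟙 x.x) ≫ 𝟙 _⟩ : EltHom Z.toFun) = ⟨𝟙 ((f.app x.a).obj x.x)⟩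
  rw [CategoryTheory.Functor.map_id, Category.comp_id]

theorem valHom_comp {f g k : MultiMap μ Γ Z} (φ : f ⟶ g) (ψ : g ⟶ k) (c : List (ArrowPair T w))
    (h : c.map Sigma.fst = Γ) :
    (valHom φ (c.map ArrowPair.fst) (by simpa)).Comp (valHom ψ (c.map ArrowPair.snd) (by simpa))
      (valHom (φ ≫ ψ) (c.map ArrowPair.comp) (by simpa)) := by
  obtain ⟨a, x, y, z, s, t, h₁, h₂, h₃⟩ := PtHom.exists_pair c h
  rw [valHom_eq _ _ h₁, valHom_eq _ _ h₂, valHom_eq _ _ h₃]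
  have : (f.app a).map (s ≫ t) ≫ (Modif.app (φ ≫ ψ) a).app z =
      ((f.app a).map s ≫ (Modif.app φ a).app y) ≫ (g.app a).map t ≫ (Modif.app ψ a).app z := by
    change _ ≫ (Modif.app φ a).app z ≫ (Modif.app ψ a).app z = _
    simp
  have e := EltHom.Comp.mk (F := Z.toFun) ((f.app a).map s ≫ (Modif.app φ a).app y)
    ((g.app a).map t ≫ (Modif.app ψ a).app z)
  rw [← this] at e
  exact e

theorem valCell_src (f : MultiMap μ Γ Z) {U : MultiCell T w} (h : U.sources = Γ) :
    (f.valCell U h).src = f.val U.src (by simpa) := by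
  obtain ⟨V, hV⟩ := PtCell.exists_represents U h
  rw [f.valCell_eq h hV, f.val_eq _ hV.src]
  rfl

theorem valCell_tgt (f : MultiMap μ Γ Z) {U : MultiCell T w} (h : U.sources = Γ) :
    (f.valCell U h).tgt = f.val U.tgt (by simpa) := by
  obtain ⟨V, hV⟩ := PtCell.exists_represents U h
  rw [f.valCell_eq h hV, f.val_eq _ hV.tgt]
  rfl

theorem valCell_oneCell (f : MultiMap μ Γ Z) {U : MultiCell T w} (h : U.sources = Γ) :
    ⟨(f.valCell U h).α⟩ = U.oneCell μ := by
  obtain ⟨V, hV⟩ := PtCell.exists_represents U h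
  rw [f.valCell_eq h hV, ← hV.oneCell]
  rfl

theorem valCell_comp (f : MultiMap μ Γ Z) (l l' : List (Point T w)) {u v t : EltCell X.toFun}
    (h : u.Comp v t) (hΓ : l.map Sigma.fst ++ X :: l'.map Sigma.fst = Γ) :
    (f.valCell ⟨l, u, l'⟩ hΓ).Comp (f.valCell ⟨l, v, l'⟩ hΓ) (f.valCell ⟨l, t, l'⟩ hΓ) := by
  obtain ⟨U, V, W, h₁, h₂, h₃, h⟩ := PtCell.exists_comp l l' h hΓ
  rw [f.valCell_eq _ h₁, f.valCell_eq _ h₂, f.valCell_eq _ h₃]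
  exact f.arr_comp h

theorem valCell_sq {f g : MultiMap μ Γ Z} (φ : f ⟶ g) (l l' : List (Arrow T w))
    {u u' : EltCell X.toFun} {E : TwoCell T} {a b : EltHom X.toFun} (h : EltCell.Sq u u' E a b)
    (hΓ : l.map Sigma.fst ++ X :: l'.map Sigma.fst = Γ) :
    EltCell.Sq (f.valCell ⟨l.map Arrow.src, u, l'.map Arrow.src⟩ (by simpa))
      (g.valCell ⟨l.map Arrow.tgt, u', l'.map Arrow.tgt⟩ (by simpa))
      (μ.left₂ (num (l.map Arrow.src)) (μ.right₂ (num (l'.map Arrow.src)) E))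
      (valHom φ (l ++ ⟨X, a⟩ :: l') (by simpa)) (valHom φ (l ++ ⟨X, b⟩ :: l') (by simpa)) := by
  obtain ⟨U, U', s, t, h₁, h₂, h₃, h₄, h⟩ := PtCell.exists_sq μ l l' h hΓ
  rw [f.valCell_eq _ h₁, g.valCell_eq _ h₂, valHom_eq _ _ h₃, valHom_eq _ _ h₄]
  exact arr_sq φ h

theorem valCell_gray (f : MultiMap μ Γ Z) (l : List (Point T w)) (u : EltCell X.toFun)
    (l' : List (Point T w)) {Y : Model T w} (v : EltCell Y.toFun) (l'' : List (Point T w))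
    (hΓ : l.map Sigma.fst ++ X :: (l'.map Sigma.fst ++ Y :: l''.map Sigma.fst) = Γ) :
    EltCell.Gray
      (μ.leftW (num l) (μ.rightW (num l'') (μ.grayW (μ.right (num l') ⟨u.α⟩) ⟨v.α⟩)))
      (f.valCell ⟨l, u, l' ++ ⟨Y, v.src⟩ :: l''⟩ (by simpa))
      (f.valCell ⟨l ++ ⟨X, u.tgt⟩ :: l', v, l''⟩ (by simpa))
      (f.valCell ⟨l ++ ⟨X, u.src⟩ :: l', v, l''⟩ (by simpa))
      (f.valCell ⟨l, u, l' ++ ⟨Y, v.tgt⟩ :: l''⟩ (by simpa)) := by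
  obtain ⟨U, V', V, U', h₁, h₂, h₃, h₄, h⟩ := PtCell.exists_gray μ l u l' v l'' hΓ
  rw [f.valCell_eq _ h₁, f.valCell_eq _ h₂, f.valCell_eq _ h₃, f.valCell_eq _ h₄]
  exact f.arr_gray h

end MultiMap

end Laws


/-! ### Tight cells, identity cells and images of cells -/

section Tight

variable {T : LawvereTwoTheory 𝕋} {w : Weakness} {μ : WCommutativity T w}
  {Γ : List (Model T w)} {X Z : Model T w}

/-- An identity cell over a tight 1-cell. -/
def EltCell.IsTight {F : TwoFun T w} (u : EltCell F) : Prop :=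
  (∃ p, u.α = T.θ p) ∧ u.cell.IsId

/-- A tight 1-cell of the theory. -/
def OneCell.IsTight (a : OneCell T) : Prop := ∃ p, a.hom = T.θ p

theorem MultiCell.oneCell_isTight {U : MultiCell T w} (h : U.cell.IsTight) :
    (U.oneCell μ).IsTight := by
  obtain ⟨⟨p, hp⟩, -⟩ := h
  refine ⟨mapRight (num U.left) (mapLeft (num U.right) p), ?_⟩
  change ((μ.L _).hom _ _).obj (((μ.R _).hom _ _).obj U.cell.α) = _
  rw [hp, μ.R_tight, μ.L_tight]
  rfl

theorem PtCell.Represents.isTight {U : MultiCell T w} {V : PtCell Γ} (hV : Represents U V)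
    (h : U.cell.IsTight) : V.s.IsTight ∧ V.cell.IsId := by
  induction hV with
  | here u z =>
    obtain ⟨⟨p, hp⟩, h⟩ := h
    refine ⟨?_, h.map _⟩
    have := Step.IsTight.here (T := T) p z.a
    rw [← hp] at this
    exact this
  | there p hV ih => exact ⟨.there _ (ih h).1, (ih h).2.map _⟩

theorem MultiMap.valCell_isTight (f : MultiMap μ Γ Z) {U : MultiCell T w} (h : U.sources = Γ)
    (hU : U.cell.IsTight) : (f.valCell U h).IsTight := by
  refine ⟨?_, ?_⟩
  · have := MultiCell.oneCell_isTight (μ := μ) hU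
    rw [← f.valCell_oneCell h] at this
    exact this
  · obtain ⟨V, hV⟩ := PtCell.exists_represents U h
    rw [f.valCell_eq h hV]
    have := hV.isTight hU
    exact .comp ((f.cell_tight this.1).appAt _) (this.2.map _)

theorem EltCell.pull_strict {F : TwoFun T .strict} {m n : ℕ} {α β : T.ob m ⟶ T.ob n}
    (h : α = β) {U V : EltCell F} :
    EltCell.Pull ⟨.strict h⟩ U V ↔ U = V ∧ OneCell.mk U.α = ⟨α⟩ := by
  subst h
  constructor
  · rintro ⟨_, σ⟩
    cases σ
    exact ⟨rfl, rfl⟩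
  · rintro ⟨rfl, h⟩
    obtain ⟨β, σ⟩ := U
    simp only [OneCell.mk.injEq] at h
    obtain ⟨rfl, rfl, h⟩ := h
    cases h
    exact .of_wEq (.of_eq (by cases σ; rfl))

theorem EltCell.pull_pseudo {F : TwoFun T .pseudo} {m n : ℕ} {α β : T.ob m ⟶ T.ob n} (η : α ≅ β)
    {U V : EltCell F} :
    EltCell.Pull ⟨.pseudo η⟩ U V ↔ ∃ p q, EltCell.Sq U V ⟨η.hom⟩ (Elt.id p) (Elt.id q) := by
  constructor
  · rintro ⟨_, σ⟩
    refine ⟨⟨_⟩, ⟨_⟩, .mk _ ?_⟩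
    cases σ
    simp [WHom.Sq, WHom.map, WHom.appAt, WHom.comp]
  · rintro ⟨⟨p⟩, ⟨q⟩, h⟩
    change EltCell.Sq U V ⟨η.hom⟩ ⟨𝟙 p⟩ ⟨𝟙 q⟩ at h
    cases h with
    | @mk _ _ _ _ _ _ _ _ _ σ σ' _ _ h =>
      refine .of_wEq (.of_eq ?_)
      cases σ
      cases σ'
      simp only [WHom.Sq, CategoryTheory.Functor.map_id, Category.comp_id] at h
      exact congrArg WHom.pseudo (Iso.ext h.symm)

theorem EltCell.pull_lax {F : TwoFun T .lax} {m n : ℕ} {α β : T.ob m ⟶ T.ob n} (η : α ⟶ β)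
    {U V : EltCell F} :
    EltCell.Pull ⟨.lax η⟩ U V ↔ ∃ p q, EltCell.Sq U V ⟨η⟩ (Elt.id p) (Elt.id q) := by
  constructor
  · rintro ⟨_, σ⟩
    refine ⟨⟨_⟩, ⟨_⟩, .mk _ ?_⟩
    cases σ
    simp [WHom.Sq, WHom.map, WHom.appAt, WHom.comp]
  · rintro ⟨⟨p⟩, ⟨q⟩, h⟩
    change EltCell.Sq U V ⟨η⟩ ⟨𝟙 p⟩ ⟨𝟙 q⟩ at h
    cases h with
    | @mk _ _ _ _ _ _ _ _ _ σ σ' _ _ h =>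
      refine .of_wEq (.of_eq ?_)
      cases σ
      cases σ'
      simp only [WHom.Sq, CategoryTheory.Functor.map_id, Category.comp_id] at h
      exact congrArg WHom.lax h.symm

theorem EltCell.pull_colax {F : TwoFun T .colax} {m n : ℕ} {α β : T.ob m ⟶ T.ob n} (η : β ⟶ α)
    {U V : EltCell F} :
    EltCell.Pull ⟨.colax η⟩ U V ↔ ∃ p q, EltCell.Sq V U ⟨η⟩ (Elt.id p) (Elt.id q) := by
  constructor
  · rintro ⟨_, σ⟩
    refine ⟨⟨_⟩, ⟨_⟩, .mk _ ?_⟩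
    cases σ
    simp [WHom.Sq, WHom.map, WHom.appAt, WHom.comp]
  · rintro ⟨⟨p⟩, ⟨q⟩, h⟩
    change EltCell.Sq V U ⟨η⟩ ⟨𝟙 p⟩ ⟨𝟙 q⟩ at h
    cases h with
    | @mk _ _ _ _ _ _ _ _ _ σ σ' _ _ h =>
      refine .of_wEq (.of_eq ?_)
      cases σ
      cases σ'
      simp only [WHom.Sq, CategoryTheory.Functor.map_id, Category.comp_id, Category.id_comp] at h
      exact congrArg WHom.colax h.symm

theorem MultiMap.valCell_sq_id (f : MultiMap μ Γ Z) (l l' : List (Point T w))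
    {u u' : EltCell X.toFun} {E : TwoCell T} (h : ∃ p q, EltCell.Sq u u' E (Elt.id p) (Elt.id q))
    (hΓ : l.map Sigma.fst ++ X :: l'.map Sigma.fst = Γ) :
    ∃ p q, EltCell.Sq (f.valCell ⟨l, u, l'⟩ hΓ) (f.valCell ⟨l, u', l'⟩ hΓ)
      (μ.left₂ (num l) (μ.right₂ (num l') E)) (Elt.id p) (Elt.id q) := by
  obtain ⟨p, q, h⟩ := h
  have := valCell_sq (𝟙 f) (l.map Point.id) (l'.map Point.id) h (by simpa)
  have e (p : Elt X.toFun) : l.map Point.id ++ ⟨X, p.id⟩ :: l'.map Point.id =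
      (l ++ ⟨X, p⟩ :: l').map Point.id := by simp
  simp only [e] at this
  rw [f.valHom_id (by simpa), f.valHom_id (by simpa)] at this
  simp only [List.map_map, src_comp_id, tgt_comp_id, List.map_id] at this
  exact ⟨_, _, this⟩

/-- The value at the composite with a `w`-cell of the theory is the composite with the image of this
`w`-cell under the multiplication; for each weakness this is an instance of the law for squares. -/
theorem MultiMap.valCell_pull (f : MultiMap μ Γ Z) (l l' : List (Point T w))
    {u v : EltCell X.toFun} {W : WCell T w} (h : EltCell.Pull W u v)
    (hΓ : l.map Sigma.fst ++ X :: l'.map Sigma.fst = Γ) :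
    EltCell.Pull (μ.leftW (num l) (μ.rightW (num l') W)) (f.valCell ⟨l, u, l'⟩ hΓ)
      (f.valCell ⟨l, v, l'⟩ hΓ) := by
  obtain ⟨τ⟩ := W
  cases τ with
  | strict e =>
    obtain ⟨rfl, h'⟩ := (EltCell.pull_strict e).1 h
    refine (EltCell.pull_strict _).2 ⟨rfl, ?_⟩
    rw [f.valCell_oneCell, MultiCell.oneCell, h']
    rfl
  | pseudo η =>
    exact (EltCell.pull_pseudo _).2 (f.valCell_sq_id l l' ((EltCell.pull_pseudo η).1 h) hΓ)
  | lax η => exact (EltCell.pull_lax _).2 (f.valCell_sq_id l l' ((EltCell.pull_lax η).1 h) hΓ)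
  | colax η => exact (EltCell.pull_colax _).2 (f.valCell_sq_id l l' ((EltCell.pull_colax η).1 h) hΓ)

theorem MultiMap.valCell_gray_of_gray (f : MultiMap μ Γ Z) (l l' : List (Point T w))
    {u v' v u' : EltCell X.toFun} {W : WCell T w} (h : EltCell.Gray W u v' v u')
    (hΓ : l.map Sigma.fst ++ X :: l'.map Sigma.fst = Γ) :
    EltCell.Gray (μ.leftW (num l) (μ.rightW (num l') W)) (f.valCell ⟨l, u, l'⟩ hΓ)
      (f.valCell ⟨l, v', l'⟩ hΓ) (f.valCell ⟨l, v, l'⟩ hΓ) (f.valCell ⟨l, u', l'⟩ hΓ) := by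
  obtain ⟨U, V, h₁, h₂, h₃⟩ := h
  exact ⟨_, _, f.valCell_comp l l' h₁ hΓ, f.valCell_comp l l' h₂ hΓ, f.valCell_pull l l' h₃ hΓ⟩

end Tight


/-! ### A multimap is determined by its values, and values that satisfy the laws define one -/

section Reconstruction

variable {T : LawvereTwoTheory 𝕋} {w : Weakness} {μ : WCommutativity T w}
  {Γ : List (Model T w)} {X Z : Model T w}

namespace PtCell

theorem id_here {m m' : ℕ} (α : T.ob m ⟶ T.ob m') {a : Ar Γ.length} (p : X.toFun.O m)
    (z : Dom Γ a) :
    PtCell.id (Γ := X :: Γ) (.here α a) (p, z) =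
      slot ⟨α, (.ofEq rfl : WHom ((X.toFun.fn α).obj p) _ w)⟩ ⟨z⟩ := by
  refine PtCell.mk_congr (Γ := X :: Γ) rfl rfl rfl ?_
  exact .of_eq (WHom.map_ofEq (Prod.sectL (X.toFun.O m') z) rfl).symm

theorem id_there {m : ℕ} {a b : Ar Γ.length} (s : Step T a b) (p : X.toFun.O m) (z : Dom Γ a) :
    PtCell.id (Γ := X :: Γ) (.there m s) (p, z) = PtCell.there ⟨p⟩ (.id s z) := by
  refine PtCell.mk_congr (Γ := X :: Γ) rfl rfl rfl ?_
  exact .of_eq (WHom.map_ofEq (Prod.sectR p (Dom Γ b)) rfl).symm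

/-- An identity cell of a 2-functor. -/
abbrev _root_.EltCell.one {F : TwoFun T w} {m n : ℕ} (α : T.ob m ⟶ T.ob n) (p : F.O m) : EltCell F :=
  ⟨α, (.ofEq rfl : WHom ((F.fn α).obj p) _ w)⟩

theorem represents_here {m m' : ℕ} (α : T.ob m ⟶ T.ob m') {a : Ar Γ.length} (p : X.toFun.O m)
    (z : Dom Γ a) :
    Represents ⟨[], EltCell.one (F := X.toFun) α p, (Pt.mk z).toList⟩
      (PtCell.id (Γ := X :: Γ) (.here α a) (p, z)) := by
  rw [id_here]
  exact .here _ _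

theorem represents_there {m : ℕ} {a b : Ar Γ.length} {s : Step T a b} (p : X.toFun.O m)
    {z : Dom Γ a} {U : MultiCell T w} (h : Represents U (.id s z)) :
    Represents ⟨⟨X, ⟨p⟩⟩ :: U.left, U.cell, U.right⟩
      (PtCell.id (Γ := X :: Γ) (.there m s) (p, z)) := by
  rw [id_there]
  exact .there _ h

theorem exists_represents_id : ∀ {Γ : List (Model T w)} {a b : Ar Γ.length} (s : Step T a b)
    (x : Dom Γ a), ∃ U : MultiCell T w, Represents U (.id s x)
  | _ :: _, _, _, .here α _, x => ⟨_, represents_here α x.1 x.2⟩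
  | _ :: _, _, _, .there _ s, x => by
    obtain ⟨U, hU⟩ := exists_represents_id s x.2
    exact ⟨_, represents_there x.1 hU⟩

theorem exists_of_isTight : ∀ {Γ : List (Model T w)} {a b : Ar Γ.length} {s : Step T a b}
    (_ : s.IsTight) (x : Dom Γ a), ∃ U : MultiCell T w, Represents U (.id s x) ∧ U.cell.IsTight
  | _ :: _, _, _, _, .here q _, x =>
    ⟨_, represents_here (T := T) (T.θ q) x.1 x.2, ⟨q, rfl⟩, WHom.isId_ofEq _⟩
  | _ :: _, _, _, _, .there _ h, x => by
    obtain ⟨U, hU, h'⟩ := exists_of_isTight h x.2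
    exact ⟨_, represents_there x.1 hU, h'⟩

theorem _root_.EltCell.comp_one {F : TwoFun T w} {m n k : ℕ} (α : T.ob m ⟶ T.ob n)
    (β : T.ob n ⟶ T.ob k) (p : F.O m) :
    EltCell.Comp (.one α p) (.one β ((F.fn α).obj p)) (EltCell.one (F := F) (α ≫ β) p) := by
  have h := EltCell.Comp.mk (F := F) (w := w) α β (p := p) (.ofEq rfl) (.ofEq rfl)
  refine Eq.mpr (congrArg (EltCell.Comp _ _) ?_) h
  refine EltCell.mk_congr rfl rfl (congrArg (fun G => G.obj p) (F.act.map_comp α β)) ?_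
  exact WHom.IsId.wEq (WHom.isId_ofEq _)
    (.comp (WHom.isId_ofEq _) (.comp (.map _ (WHom.isId_ofEq _)) (WHom.isId_ofEq _))) rfl

theorem exists_of_isComp : ∀ {Γ : List (Model T w)} {a b c : Ar Γ.length} {s : Step T a b}
    {t : Step T b c} {r : Step T a c} (_ : s.IsComp t r) (x : Dom Γ a),
    ∃ (l l' : List (Point T w)) (X : Model T w) (u v k : EltCell X.toFun), u.Comp v k ∧
      Represents ⟨l, u, l'⟩ (.id s x) ∧ Represents ⟨l, v, l'⟩ (.id t ((Dom.map Γ s).obj x)) ∧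
      Represents ⟨l, k, l'⟩ (.id r x)
  | _ :: _, _, _, _, _, _, _, .here α β _, x =>
    ⟨_, _, _, _, _, _, EltCell.comp_one α β x.1, represents_here α x.1 x.2,
      represents_here β _ x.2, represents_here (α ≫ β) x.1 x.2⟩
  | _ :: _, _, _, _, _, _, _, .there _ h, x => by
    obtain ⟨l, l', X, u, v, k, h, h₁, h₂, h₃⟩ := exists_of_isComp h x.2
    exact ⟨_, _, _, _, _, _, h, represents_there x.1 h₁, represents_there x.1 h₂,
      represents_there x.1 h₃⟩

theorem _root_.EltCell.sq_one {F : TwoFun T w} {m n : ℕ} {α β : T.ob m ⟶ T.ob n} (η : α ⟶ β)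
    {p q : F.O m} (f : p ⟶ q) :
    EltCell.Sq (.one α p) (.one β q) ⟨η⟩ ⟨f⟩ ⟨(F.tr η).app p ≫ (F.fn β).map f⟩ :=
  .mk η (WHom.Sq.ofEq rfl rfl .refl)

/-- A generating 2-cell, together with a morphism of families, is a square of identity cells in one
place. -/
theorem exists_of_two : ∀ {Γ : List (Model T w)} {a b : Ar Γ.length} {s s' : Step T a b}
    (σ : s.Two s') {x y : Dom Γ a} (f : x ⟶ y),
    ∃ (l l' : List (Arrow T w)) (X : Model T w) (u u' : EltCell X.toFun) (E : TwoCell T)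
      (d e : EltHom X.toFun), EltCell.Sq u u' E d e ∧
      Represents ⟨l.map Arrow.src, u, l'.map Arrow.src⟩ (.id s x) ∧
      Represents ⟨l.map Arrow.tgt, u', l'.map Arrow.tgt⟩ (.id s' y) ∧
      (PtHom.mk f).toList = l ++ ⟨X, d⟩ :: l' ∧
      (PtHom.mk ((Dom.map₂ Γ σ).app x ≫ (Dom.map Γ s').map f)).toList = l ++ ⟨X, e⟩ :: l' ∧
      μ.tensU₂ σ = μ.left₂ (num (l.map Arrow.src)) (μ.right₂ (num (l'.map Arrow.src)) E)
  | X :: Γ, _, _, _, _, .here (m := m) (m' := m') (α := α) (α' := β) η a, x, y, f => by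
    obtain ⟨p, z⟩ := x
    obtain ⟨p', z'⟩ := y
    refine ⟨[], (PtHom.mk f.2).toList, X, _, _, ⟨η⟩, _, _, EltCell.sq_one η f.1,
      ?_, ?_, rfl, ?_, ?_⟩
    · have := represents_here α p z
      rw [← PtHom.toList_src]
      exact this
    · have := represents_here β p' z'
      rw [← PtHom.toList_tgt]
      exact this
    · have : (PtHom.mk ((Dom.map₂ (X :: Γ) (.here η a)).app (p, z) ≫
          (Dom.map (X :: Γ) (.here β a)).map f)) =
          PtHom.cons ⟨(X.toFun.tr η).app p ≫ (X.toFun.fn β).map f.1⟩ ⟨𝟙 z ≫ f.2⟩ := rfl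
      rw [this, PtHom.toList_cons, Category.id_comp]
      rfl
    · rw [← PtHom.toList_src, Pt.num_toList, List.map_nil, num_nil, μ.left₂_one, μ.tensU₂_here]
      rfl
  | X :: Γ, _, _, _, _, .there (s := s) (s' := s') m σ, x, y, f => by
    obtain ⟨p, z⟩ := x
    obtain ⟨p', z'⟩ := y
    obtain ⟨l, l', Y, u, u', E, d, e, h, h₁, h₂, h₃, h₄, h₅⟩ := exists_of_two σ f.2
    refine ⟨⟨X, ⟨f.1⟩⟩ :: l, l', Y, u, u', E, d, e, h, represents_there p h₁,
      represents_there p' h₂, ?_, ?_, ?_⟩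
    · exact (PtHom.toList_cons ⟨f.1⟩ ⟨f.2⟩).trans (congrArg _ h₃)
    · have : (PtHom.mk ((Dom.map₂ (X :: Γ) (.there m σ)).app (p, z) ≫
          (Dom.map (X :: Γ) (.there m s')).map f)) =
          PtHom.cons ⟨𝟙 p ≫ f.1⟩ ⟨(Dom.map₂ Γ σ).app z ≫ (Dom.map Γ s').map f.2⟩ := rfl
      rw [this, PtHom.toList_cons, Category.id_comp, h₄]
      rfl
    · refine (μ.tensU₂_there m σ).trans ?_
      rw [h₅, μ.left₂_left₂]
      rfl

/-- A Gray square of generating 1-cells is a Gray square of identity cells in two places. -/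
theorem exists_of_graySq : ∀ {Γ : List (Model T w)} {a b c d : Ar Γ.length} {s : Step T a b}
    {t : Step T a c} {s' : Step T c d} {t' : Step T b d} (G : Step.GraySq s t s' t') (x : Dom Γ a),
    ∃ (l : List (Point T w)) (X : Model T w) (u : EltCell X.toFun) (l' : List (Point T w))
      (Y : Model T w) (v : EltCell Y.toFun) (l'' : List (Point T w)),
      Represents ⟨l, u, l' ++ ⟨Y, v.src⟩ :: l''⟩ (.id s x) ∧
      Represents ⟨l ++ ⟨X, u.tgt⟩ :: l', v, l''⟩ (.id t' ((Dom.map Γ s).obj x)) ∧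
      Represents ⟨l ++ ⟨X, u.src⟩ :: l', v, l''⟩ (.id t x) ∧
      Represents ⟨l, u, l' ++ ⟨Y, v.tgt⟩ :: l''⟩ (.id s' ((Dom.map Γ t).obj x)) ∧
      μ.tensUG G = μ.leftW (num l) (μ.rightW (num l'') (μ.grayW (μ.right (num l') ⟨u.α⟩) ⟨v.α⟩))
  | X :: Γ, _, _, _, _, _, _, _, _, .here α t, x => by
    obtain ⟨p, z⟩ := x
    obtain ⟨⟨l, v, l'⟩, hU⟩ := exists_represents_id t z
    refine ⟨[], X, .one α p, l, _, v, l', ?_, represents_there _ hU, represents_there _ hU, ?_, ?_⟩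
    · exact (represents_here α p z).of_eq (by rw [show Pt.mk z = PtCell.src (.id t z) from rfl,
        hU.src])
    · exact (represents_here α p _).of_eq (by
        rw [show Pt.mk ((Dom.map Γ t).obj z) = PtCell.tgt (.id t z) from rfl, hU.tgt])
    · rw [μ.tensUG_here, show μ.tensU t = μ.tensU (PtCell.id t z).s from rfl, hU.oneCell,
        MultiCell.oneCell, ← μ.grayW_right, ← μ.rightW_grayW, num_nil, μ.leftW_one]
  | X :: Γ, _, _, _, _, _, _, _, _, .there m G, x => by
    obtain ⟨p, z⟩ := x
    obtain ⟨l, Y, u, l', Y', v, l'', h₁, h₂, h₃, h₄, h⟩ := exists_of_graySq G z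
    refine ⟨⟨X, ⟨p⟩⟩ :: l, Y, u, l', Y', v, l'', represents_there p h₁, represents_there p h₂,
      represents_there p h₃, represents_there p h₄, ?_⟩
    refine (μ.tensUG_there m G).trans ?_
    rw [h, μ.leftW_leftW]
    rfl

end PtCell

namespace MultiMap

theorem _root_.EltCell.wEq_of_eq {F : TwoFun T w} {m n : ℕ} {α : T.ob m ⟶ T.ob n} {p p' : F.O m}
    {q q' : F.O n} {σ : WHom ((F.fn α).obj p) q w} {σ' : WHom ((F.fn α).obj p') q' w}
    (h : (⟨α, σ⟩ : EltCell F) = ⟨α, σ'⟩) : WEq σ σ' := by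
  simp only [EltCell.mk.injEq, heq_eq_eq, true_and] at h
  obtain ⟨rfl, rfl, h⟩ := h
  exact .of_eq (eq_of_heq h)

theorem appAt_eq_of_arr {f g : MultiMap μ Γ Z} {a b : Ar Γ.length}
    {s : Step T a b} {x : Dom Γ a} (h' : f.arr (.id s x) = g.arr (.id s x)) :
    WEq ((f.cell s).appAt x) ((g.cell s).appAt x) := by
  have h₁ := PreMultiMap.arr_id f.toPre s x
  have h₂ := PreMultiMap.arr_id g.toPre s x
  exact EltCell.wEq_of_eq (h₁.symm.trans (h'.trans h₂))

/-- A multimap is determined by its values at lists of morphisms and at cells: its components are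
its values at lists of morphisms, its cells are its values at identity cells. -/
theorem ext_val {f g : MultiMap μ Γ Z}
    (h : ∀ (t : List (Arrow T w)) ht, valHom (𝟙 f) t ht = valHom (𝟙 g) t ht)
    (h' : ∀ (U : MultiCell T w) hU, f.valCell U hU = g.valCell U hU) : f = g := by
  have e : f.app = g.app := by
    funext a
    have e (x y : Dom Γ a) (k : x ⟶ y) : (f.app a).obj x = (g.app a).obj x ∧
        (f.app a).map k ≍ (g.app a).map k := by
      have := h (PtHom.mk k).toList (PtHom.map_fst_toList _)
      rw [valHom_eq _ _ rfl, valHom_eq _ _ rfl] at this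
      change (⟨(f.app a).map k ≫ 𝟙 _⟩ : EltHom Z.toFun) = ⟨(g.app a).map k ≫ 𝟙 _⟩ at this
      rw [Category.comp_id, Category.comp_id] at this
      simp only [EltHom.mk.injEq, heq_eq_eq, true_and] at this
      exact ⟨this.1, this.2.2⟩
    exact Functor.hext (fun x => (e x x (𝟙 x)).1) fun x y k => (e x y k).2
  have e' {a b : Ar Γ.length} (s : Step T a b) (x : Dom Γ a) :
      WEq ((f.cell s).appAt x) ((g.cell s).appAt x) := by
    obtain ⟨U, hU⟩ := PtCell.exists_represents_id s x
    have := h' U hU.sources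
    rw [valCell_eq _ _ hU, valCell_eq _ _ hU] at this
    exact appAt_eq_of_arr this
  obtain ⟨fa, fc, _, _, _, _⟩ := f
  obtain ⟨ga, gc, _, _, _, _⟩ := g
  cases e
  obtain rfl : @fc = @gc := by
    funext a b s
    exact WHom.ext_appAt fun x => (e' s x).eq
  rfl

/-- A modification is determined by its values at lists of morphisms. -/
theorem hom_ext_val {f g : MultiMap μ Γ Z} {φ ψ : f ⟶ g}
    (h : ∀ (l : List (Point T w)) hl, valHom φ (l.map Point.id) hl = valHom ψ (l.map Point.id) hl) : φ = ψ := by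
  refine Modif.ext (funext fun a => NatTrans.ext (funext fun x => ?_))
  have := h (Pt.mk x).toList (by simpa using (Pt.mk x).map_fst_toList)
  rw [valHom_eq _ _ (Pt.toList_id _), valHom_eq _ _ (Pt.toList_id _)] at this
  change (⟨(f.app a).map (𝟙 x) ≫ (Modif.app φ a).app x⟩ : EltHom Z.toFun) =
    ⟨(f.app a).map (𝟙 x) ≫ (Modif.app ψ a).app x⟩ at this
  rw [CategoryTheory.Functor.map_id, Category.id_comp, Category.id_comp] at this
  simpa using this

theorem hom_heq_val {f g f' g' : MultiMap μ Γ Z} (hf : f = f') (hg : g = g') {φ : f ⟶ g}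
    {ψ : f' ⟶ g'}
    (h : ∀ (l : List (Point T w)) hl, valHom φ (l.map Point.id) hl = valHom ψ (l.map Point.id) hl) :
    φ ≍ ψ := by
  subst hf hg
  exact heq_of_eq (hom_ext_val h)

/-- Functors to a category of multimaps agree if they have the same values. -/
theorem functor_ext_val {C : Type*} [Category* C] {F G : C ⥤ MultiMap μ Γ Z}
    (h : ∀ {c d : C} (k : c ⟶ d) (t : List (Arrow T w)) ht,
      valHom (F.map k) t ht = valHom (G.map k) t ht)
    (h' : ∀ c (U : MultiCell T w) hU, (F.obj c).valCell U hU = (G.obj c).valCell U hU) : F = G := by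
  have obj (c : C) : F.obj c = G.obj c := by
    refine ext_val (fun t ht => ?_) (h' c)
    have := h (𝟙 c) t ht
    rwa [CategoryTheory.Functor.map_id, CategoryTheory.Functor.map_id] at this
  refine Functor.hext obj fun c d k => ?_
  exact hom_heq_val (obj c) (obj d) fun l _ => h k _ _

end MultiMap

end Reconstruction


/-! ### Functors and transformations with given values -/

section Values

variable {T : LawvereTwoTheory 𝕋} {w : Weakness} {G : TwoFun T w}

theorem Elt.exists_obj (e : Elt G) {k : ℕ} (h : e.n = k) : ∃ p : G.O k, (⟨p⟩ : Elt G) = e := by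
  subst h
  exact ⟨e.obj, rfl⟩

theorem EltHom.exists_hom (a : EltHom G) {k : ℕ} {p q : G.O k} (hp : a.src = ⟨p⟩)
    (hq : a.tgt = ⟨q⟩) : ∃ f : p ⟶ q, (⟨f⟩ : EltHom G) = a := by
  obtain ⟨f⟩ := a
  cases hp
  cases hq
  exact ⟨f, rfl⟩

theorem EltCell.exists_cell (a : EltCell G) {m n : ℕ} {α : T.ob m ⟶ T.ob n} {p : G.O m} {q : G.O n}
    (hα : OneCell.mk a.α = ⟨α⟩) (hp : a.src = ⟨p⟩)
    (hq : a.tgt = ⟨q⟩) : ∃ σ : WHom ((G.fn α).obj p) q w, (⟨α, σ⟩ : EltCell G) = a := by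
  obtain ⟨β, σ⟩ := a
  cases hp
  cases hq
  simp only [OneCell.mk.injEq, heq_eq_eq, true_and] at hα
  subst hα
  exact ⟨σ, rfl⟩

theorem Elt.obj_eq {k : ℕ} {p q : G.O k} (h : (⟨p⟩ : Elt G) = ⟨q⟩) : p = q := by
  simpa using h

theorem EltHom.homEq {k : ℕ} {p q p' q' : G.O k} {f : p ⟶ q} {f' : p' ⟶ q'}
    (h : (⟨f⟩ : EltHom G) = ⟨f'⟩) : HomEq f f' := by
  simp only [EltHom.mk.injEq, heq_eq_eq, true_and] at h
  obtain ⟨rfl, rfl, h⟩ := h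
  exact .of_eq (eq_of_heq h)

theorem EltHom.hom_eq {k : ℕ} {p q : G.O k} {f f' : p ⟶ q}
    (h : (⟨f⟩ : EltHom G) = ⟨f'⟩) : f = f' := by
  simpa using h

variable {A : Type u₁} [Category.{v₁} A]

/-- A functor with given values, where these satisfy the laws. -/
theorem exists_functor (k : ℕ) (o : A → Elt G) (ho : ∀ x, (o x).n = k)
    (h : ∀ {x y : A}, (x ⟶ y) → EltHom G) (hs : ∀ {x y : A} (f : x ⟶ y), (h f).src = o x)
    (ht : ∀ {x y : A} (f : x ⟶ y), (h f).tgt = o y) (hid : ∀ x, h (𝟙 x) = (o x).id)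
    (hc : ∀ {x y z : A} (f : x ⟶ y) (g : y ⟶ z), (h f).Comp (h g) (h (f ≫ g))) :
    ∃ F : A ⥤ G.O k, (∀ x, (⟨F.obj x⟩ : Elt G) = o x) ∧
      ∀ {x y : A} (f : x ⟶ y), (⟨F.map f⟩ : EltHom G) = h f := by
  choose p hp using fun x => (o x).exists_obj (ho x)
  choose m hm using fun (x y : A) (f : x ⟶ y) =>
    (h f).exists_hom ((hs f).trans (hp x).symm) ((ht f).trans (hp y).symm)
  refine ⟨⟨p, fun f => m _ _ f, fun x => EltHom.hom_eq (G := G) ?_, fun {x y z} f g => ?_⟩, hp,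
    fun f => hm _ _ f⟩
  · exact (hm _ _ _).trans ((hid x).trans (congrArg Elt.id (hp x).symm))
  · have := hc f g
    rw [← hm, ← hm, ← hm] at this
    exact this.eq

/-- A natural transformation with given values. -/
theorem exists_natTrans {k : ℕ} {F F' : A ⥤ G.O k} (h : A → EltHom G)
    (hs : ∀ x, (h x).src = ⟨F.obj x⟩) (ht : ∀ x, (h x).tgt = ⟨F'.obj x⟩)
    (hn : ∀ {x y : A} (f : x ⟶ y), ∃ c : EltHom G,
      EltHom.Comp ⟨F.map f⟩ (h y) c ∧ (h x).Comp ⟨F'.map f⟩ c) :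
    ∃ τ : F ⟶ F', ∀ x, (⟨τ.app x⟩ : EltHom G) = h x := by
  choose m hm using fun x => (h x).exists_hom (hs x) (ht x)
  refine ⟨⟨m, fun x y f => ?_⟩, hm⟩
  obtain ⟨c, h₁, h₂⟩ := hn f
  rw [← hm] at h₁ h₂
  exact EltHom.hom_eq (G := G) ((EltHom.Comp.mk _ _).unique h₁ |>.trans
    ((EltHom.Comp.mk _ _).unique h₂).symm)

/-- A `w`-cell between functors with given values. -/
theorem exists_wHom {m n : ℕ} (α : T.ob m ⟶ T.ob n) {F : A ⥤ G.O m} {E : A ⥤ G.O n}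
    (c : A → EltCell G) (hα : ∀ x, OneCell.mk (c x).α = ⟨α⟩) (hs : ∀ x, (c x).src = ⟨F.obj x⟩)
    (ht : ∀ x, (c x).tgt = ⟨E.obj x⟩)
    (hn : ∀ {x y : A} (f : x ⟶ y), EltCell.Sq (c x) (c y) ⟨𝟙 α⟩ ⟨F.map f⟩ ⟨E.map f⟩) :
    ∃ s : WHom (F ⋙ G.fn α) E w, ∀ x, (⟨α, s.appAt x⟩ : EltCell G) = c x := by
  choose σ hσ using fun x => (c x).exists_cell (hα x) (hs x) (ht x)
  refine ⟨WHom.ofAppAt σ fun {x y} f => ?_, fun x => ?_⟩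
  · have := hn f
    rw [← hσ, ← hσ] at this
    have := this.sq
    have e : (G.tr (𝟙 α)).app (F.obj x) = 𝟙 _ :=
      congrArg (fun t => NatTrans.app t (F.obj x)) ((G.act.hom m n).map_id α)
    rw [e, Category.id_comp] at this
    exact this
  · rw [WHom.appAt_ofAppAt]
    exact hσ x

theorem HomEq.heq {A : Type u₁} [Category.{v₁} A] {x y x' y' : A} {f : x ⟶ y} {f' : x' ⟶ y'}
    (h : HomEq f f') : f ≍ f' := by
  cases h
  rfl

theorem WHom.isId_of_appAt' {A : Type u₁} [Category.{v₁} A] {B : Type u₂} [Category.{v₂} B]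
    {F E : A ⥤ B} (s : WHom F E w) (h : ∀ x, (s.appAt x).IsId) : s.IsId := by
  refine isId_of_appAt (Functor.hext (fun x => (h x).choose) fun x y f => ?_) h
  have := HomEq.of_sq (s.appAt_nat f) (h x) (h y)
  exact this.heq

end Values


/-! ### Multimaps with given values -/

section Reconstruction

variable {T : LawvereTwoTheory 𝕋} {w : Weakness} {μ : WCommutativity T w}
  {Γ : List (Model T w)} {X Z : Model T w}

namespace PtCell

/-- The list of elements with a cell in one place that is given by a cell over a 1-cell of the
theory in one variable. -/
def toMultiOf : ∀ {Γ : List (Model T w)} {a b : Ar Γ.length} (s : Step T a b) {x : Dom Γ a}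
    {y : Dom Γ b} (_ : WHom ((Dom.map Γ s).obj x) y w), MultiCell T w
  | X :: _, _, _, .here α _, x, y, σ =>
    ⟨[], (⟨α, (σ.map (CategoryTheory.Prod.fst _ _) : WHom ((X.toFun.fn α).obj x.1) y.1 w)⟩ :
      EltCell X.toFun), Pt.toList ⟨x.2⟩⟩
  | X :: Γ, _, _, .there _ s, x, y, σ =>
    let U := toMultiOf (Γ := Γ) s (σ.map (CategoryTheory.Prod.snd _ _) :
      WHom ((Dom.map Γ s).obj x.2) y.2 w)
    ⟨⟨X, ⟨x.1⟩⟩ :: U.left, U.cell, U.right⟩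

theorem Represents.toMultiOf {U : MultiCell T w} {V : PtCell Γ} (h : Represents U V) :
    PtCell.toMultiOf V.s V.cell = U := by
  induction h with
  | here u z =>
    obtain ⟨α, σ⟩ := u
    cases σ <;> rfl
  | @there X Γ p U V h ih =>
    obtain ⟨s, σ⟩ := V
    have : PtCell.toMultiOf (PtCell.there p ⟨s, σ⟩).s (PtCell.there p ⟨s, σ⟩).cell =
        ⟨⟨X, p⟩ :: (PtCell.toMultiOf s σ).left, (PtCell.toMultiOf s σ).cell,
          (PtCell.toMultiOf s σ).right⟩ := by
      cases σ <;> rfl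
    rw [this, ih]

theorem Represents.inj {U U' : MultiCell T w} {V : PtCell Γ} (h : Represents U V)
    (h' : Represents U' V) : U = U' :=
  h.toMultiOf.symm.trans h'.toMultiOf

end PtCell

theorem PtCell.exists_represents_one (l : List (Point T w)) {m n : ℕ} (α : T.ob m ⟶ T.ob n)
    (p : X.toFun.O m) (l' : List (Point T w))
    (h : l.map Sigma.fst ++ X :: l'.map Sigma.fst = Γ) :
    ∃ (a b : Ar Γ.length) (s : Step T a b) (x : Dom Γ a),
      Represents ⟨l, EltCell.one (F := X.toFun) α p, l'⟩ (.id s x) := by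
  subst h
  induction l with
  | nil =>
    obtain ⟨z, hz⟩ := Pt.exists_toList l' rfl
    have := represents_here (X := X) α p z.x
    rw [show (Pt.mk z.x).toList = l' from hz] at this
    exact ⟨_, _, _, _, this⟩
  | cons q l ih =>
    obtain ⟨a, b, s, x, hV⟩ := ih
    exact ⟨_, _, _, _, represents_there q.2.obj hV⟩

theorem Dom.map_comp : ∀ {Γ : List (Model T w)} {a b c : Ar Γ.length} {s : Step T a b}
    {t : Step T b c} {r : Step T a c}, s.IsComp t r → map Γ r = map Γ s ⋙ map Γ t
  | X :: Γ, _, _, _, _, _, _, .here (m := m) (m'' := m'') α β a =>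
    congrArg (fun F : X.toFun.O m ⥤ X.toFun.O m'' => (F.prod (𝟭 (Dom Γ a)) :
      Dom (X :: Γ) (.cons m a) ⥤ Dom (X :: Γ) (.cons m'' a))) (X.toFun.act.map_comp α β)
  | _ :: _, _, _, _, _, _, _, .there _ h => congrArg (fun F => (𝟭 _).prod F) (map_comp h)

theorem Dom.map_gray : ∀ {Γ : List (Model T w)} {a b c d : Ar Γ.length} {s : Step T a b}
    {t : Step T a c} {s' : Step T c d} {t' : Step T b d}, Step.GraySq s t s' t' →
    map Γ s ⋙ map Γ t' = map Γ t ⋙ map Γ s'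
  | _ :: _, _, _, _, _, _, _, _, _, .here _ _ => rfl
  | _ :: _, _, _, _, _, _, _, _, _, .there _ G => congrArg (fun F => (𝟭 _).prod F) (map_gray G)

theorem Dom.map₂_refl : ∀ {Γ : List (Model T w)} {a b : Ar Γ.length} (s : Step T a b),
    map₂ Γ (.refl s) = 𝟙 (map Γ s)
  | X :: _, _, _, .here α a => by
    refine NatTrans.ext (funext fun x => Prod.ext ?_ rfl)
    exact congrArg (fun t => NatTrans.app t x.1) ((X.toFun.act.hom _ _).map_id α)
  | _ :: _, _, _, .there _ s =>
    NatTrans.ext (funext fun x => Prod.ext rfl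
      (congrArg (fun t => NatTrans.app t x.2) (map₂_refl s)))

theorem WCommutativity.left₂_id (m : ℕ) {k l : ℕ} (α : T.ob k ⟶ T.ob l) :
    μ.left₂ m ⟨𝟙 α⟩ = ⟨𝟙 (((μ.L m).hom _ _).obj α)⟩ :=
  congrArg TwoCell.mk (CategoryTheory.Functor.map_id _ _)

theorem WCommutativity.tensU₂_refl : ∀ {n : ℕ} {a b : Ar n} (s : Step T a b),
    μ.tensU₂ (.refl s) = ⟨𝟙 (μ.tensMap s)⟩
  | _, _, _, .here α .nil => rfl
  | _, _, _, .here α (.cons k a) => congrArg TwoCell.mk (CategoryTheory.Functor.map_id _ _)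
  | _, _, _, .there m s => by
    refine (μ.tensU₂_there m _).trans ?_
    rw [tensU₂_refl s, left₂_id]
    cases s <;> rfl

namespace MultiMap

/-- A family of values that satisfies the laws of a multimap. -/
structure Values (μ : WCommutativity T w) (Γ : List (Model T w)) (Z : Model T w) where
  obj (l : List (Point T w)) (h : l.map Sigma.fst = Γ) : Elt Z.toFun
  hom (t : List (Arrow T w)) (h : t.map Sigma.fst = Γ) : EltHom Z.toFun
  cell (U : MultiCell T w) (h : U.sources = Γ) : EltCell Z.toFun
  obj_n (l : List (Point T w)) (h : l.map Sigma.fst = Γ) : (obj l h).n = num l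
  hom_src (t : List (Arrow T w)) (h : t.map Sigma.fst = Γ) :
    (hom t h).src = obj (t.map Arrow.src) (by simpa)
  hom_tgt (t : List (Arrow T w)) (h : t.map Sigma.fst = Γ) :
    (hom t h).tgt = obj (t.map Arrow.tgt) (by simpa)
  hom_id (l : List (Point T w)) (h : l.map Sigma.fst = Γ) :
    hom (l.map Point.id) (by simpa) = (obj l h).id
  hom_comp (c : List (ArrowPair T w)) (h : c.map Sigma.fst = Γ) :
    (hom (c.map ArrowPair.fst) (by simpa)).Comp (hom (c.map ArrowPair.snd) (by simpa))
      (hom (c.map ArrowPair.comp) (by simpa))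
  cell_oneCell (U : MultiCell T w) (h : U.sources = Γ) : ⟨(cell U h).α⟩ = U.oneCell μ
  cell_src (U : MultiCell T w) (h : U.sources = Γ) : (cell U h).src = obj U.src (by simpa)
  cell_tgt (U : MultiCell T w) (h : U.sources = Γ) : (cell U h).tgt = obj U.tgt (by simpa)
  cell_tight (U : MultiCell T w) (h : U.sources = Γ) : U.cell.IsTight → (cell U h).cell.IsId
  cell_comp (l l' : List (Point T w)) {X : Model T w} {u v t : EltCell X.toFun} :
    u.Comp v t → ∀ hΓ : l.map Sigma.fst ++ X :: l'.map Sigma.fst = Γ,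
      (cell ⟨l, u, l'⟩ hΓ).Comp (cell ⟨l, v, l'⟩ hΓ) (cell ⟨l, t, l'⟩ hΓ)
  cell_sq (l l' : List (Arrow T w)) {X : Model T w} {u u' : EltCell X.toFun} {E : TwoCell T}
    {a b : EltHom X.toFun} : EltCell.Sq u u' E a b →
    ∀ hΓ : l.map Sigma.fst ++ X :: l'.map Sigma.fst = Γ,
    EltCell.Sq (cell ⟨l.map Arrow.src, u, l'.map Arrow.src⟩ (by simpa))
      (cell ⟨l.map Arrow.tgt, u', l'.map Arrow.tgt⟩ (by simpa))
      (μ.left₂ (num (l.map Arrow.src)) (μ.right₂ (num (l'.map Arrow.src)) E))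
      (hom (l ++ ⟨X, a⟩ :: l') (by simpa)) (hom (l ++ ⟨X, b⟩ :: l') (by simpa))
  cell_gray (l : List (Point T w)) {X : Model T w} (u : EltCell X.toFun)
    (l' : List (Point T w)) {Y : Model T w} (v : EltCell Y.toFun) (l'' : List (Point T w))
    (hΓ : l.map Sigma.fst ++ X :: (l'.map Sigma.fst ++ Y :: l''.map Sigma.fst) = Γ) :
    EltCell.Gray
      (μ.leftW (num l) (μ.rightW (num l'') (μ.grayW (μ.right (num l') ⟨u.α⟩) ⟨v.α⟩)))
      (cell ⟨l, u, l' ++ ⟨Y, v.src⟩ :: l''⟩ (by simpa))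
      (cell ⟨l ++ ⟨X, u.tgt⟩ :: l', v, l''⟩ (by simpa))
      (cell ⟨l ++ ⟨X, u.src⟩ :: l', v, l''⟩ (by simpa))
      (cell ⟨l, u, l' ++ ⟨Y, v.tgt⟩ :: l''⟩ (by simpa))

/-- The values of a multimap. -/
noncomputable def values (f : MultiMap μ Γ Z) : Values μ Γ Z where
  obj l h := f.val l h
  hom t h := valHom (𝟙 f) t h
  cell U h := f.valCell U h
  obj_n _ h := f.val_n h
  hom_src _ h := valHom_src _ h
  hom_tgt _ h := valHom_tgt _ h
  hom_id _ h := f.valHom_id h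
  hom_comp c h := by
    have := valHom_comp (𝟙 f) (𝟙 f) c h
    rwa [Category.comp_id] at this
  cell_oneCell _ h := f.valCell_oneCell h
  cell_src _ h := f.valCell_src h
  cell_tgt _ h := f.valCell_tgt h
  cell_tight _ h hU := (f.valCell_isTight h hU).2
  cell_comp l l' _ _ _ _ h hΓ := f.valCell_comp l l' h hΓ
  cell_sq l l' _ _ _ _ _ _ h hΓ := valCell_sq (𝟙 f) l l' h hΓ
  cell_gray l _ u l' _ v l'' hΓ := f.valCell_gray l u l' v l'' hΓ

namespace Values

section Determined

theorem _root_.EltCell.Sq.eq_lax {F : TwoFun T .lax} {c c' c'' : EltCell F} {m n : ℕ}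
    {γ : T.ob m ⟶ T.ob n} {p : Elt F} {b : EltHom F} (h : EltCell.Sq c c' ⟨𝟙 γ⟩ p.id b)
    (h' : EltCell.Sq c c'' ⟨𝟙 γ⟩ p.id b) : c' = c'' := by
  obtain ⟨p⟩ := p
  change EltCell.Sq c c' ⟨𝟙 γ⟩ ⟨𝟙 p⟩ b at h
  change EltCell.Sq c c'' ⟨𝟙 γ⟩ ⟨𝟙 p⟩ b at h'
  cases h with
  | @mk _ _ _ _ _ _ _ _ _ σ σ' _ _ h =>
  cases h' with
  | @mk _ _ _ _ _ _ _ _ _ _ σ'' _ _ h' =>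
  cases σ; cases σ'; cases σ''
  simp only [WHom.Sq, CategoryTheory.Functor.map_id, Category.comp_id, NatTrans.id_app,
    Category.id_comp] at h h'
  rw [h, h']

theorem _root_.EltCell.Sq.eq_pseudo {F : TwoFun T .pseudo} {c c' c'' : EltCell F} {m n : ℕ}
    {γ : T.ob m ⟶ T.ob n} {p : Elt F} {b : EltHom F} (h : EltCell.Sq c c' ⟨𝟙 γ⟩ p.id b)
    (h' : EltCell.Sq c c'' ⟨𝟙 γ⟩ p.id b) : c' = c'' := by
  obtain ⟨p⟩ := p
  change EltCell.Sq c c' ⟨𝟙 γ⟩ ⟨𝟙 p⟩ b at h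
  change EltCell.Sq c c'' ⟨𝟙 γ⟩ ⟨𝟙 p⟩ b at h'
  cases h with
  | @mk _ _ _ _ _ _ _ _ _ σ σ' _ _ h =>
  cases h' with
  | @mk _ _ _ _ _ _ _ _ _ _ σ'' _ _ h' =>
  cases σ; cases σ'; cases σ''
  simp only [WHom.Sq, CategoryTheory.Functor.map_id, Category.comp_id, NatTrans.id_app,
    Category.id_comp] at h h'
  congr 2
  exact Iso.ext (h.trans h'.symm)

theorem _root_.EltCell.Sq.eq_colax {F : TwoFun T .colax} {c c' c'' : EltCell F} {m n : ℕ}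
    {γ : T.ob m ⟶ T.ob n} {p : Elt F} {b : EltHom F} (h : EltCell.Sq c c' ⟨𝟙 γ⟩ p.id b)
    (h' : EltCell.Sq c'' c' ⟨𝟙 γ⟩ p.id b) : c = c'' := by
  obtain ⟨p⟩ := p
  change EltCell.Sq c c' ⟨𝟙 γ⟩ ⟨𝟙 p⟩ b at h
  change EltCell.Sq c'' c' ⟨𝟙 γ⟩ ⟨𝟙 p⟩ b at h'
  cases h with
  | @mk _ _ _ _ _ _ _ _ _ σ σ' _ _ h =>
  cases h' with
  | @mk _ _ _ _ _ _ _ _ _ σ'' _ _ _ h' =>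
  cases σ; cases σ'; cases σ''
  simp only [WHom.Sq, CategoryTheory.Functor.map_id, Category.comp_id, NatTrans.id_app] at h h'
  rw [h, h']

/-- Two maps on cells that respect squares over identity 2-cells agree if they agree on identity
cells, because a cell forms such a square with an identity cell. -/
theorem _root_.EltCell.eq_of_sq {F G : TwoFun T w} {c c' : EltCell F → EltCell G}
    (h : ∀ {m n : ℕ} {α : T.ob m ⟶ T.ob n} {u u' : EltCell F} {p : Elt F} {b : EltHom F},
      EltCell.Sq u u' ⟨𝟙 α⟩ p.id b → ∃ (m' n' : ℕ) (γ : T.ob m' ⟶ T.ob n') (q : Elt G)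
        (d : EltHom G), EltCell.Sq (c u) (c u') ⟨𝟙 γ⟩ q.id d ∧ EltCell.Sq (c' u) (c' u') ⟨𝟙 γ⟩ q.id d)
    (h' : ∀ {m n : ℕ} (α : T.ob m ⟶ T.ob n) (p : F.O m),
      c (EltCell.one α p) = c' (EltCell.one α p)) (u : EltCell F) : c u = c' u := by
  obtain ⟨α, σ⟩ := u
  rename_i m n p q
  cases σ with
  | strict e =>
    subst e
    exact h' α p
  | pseudo e =>
    have hs : EltCell.Sq (EltCell.one (F := F) α p) ⟨α, .pseudo e⟩ ⟨𝟙 α⟩ (Elt.id ⟨p⟩)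
        ⟨e.hom⟩ := .mk _ (by simp [WHom.Sq, WHom.ofEq])
    obtain ⟨_, _, _, _, _, h₁, h₂⟩ := h hs
    rw [← h'] at h₂
    exact h₁.eq_pseudo h₂
  | lax e =>
    have hs : EltCell.Sq (EltCell.one (F := F) α p) ⟨α, .lax e⟩ ⟨𝟙 α⟩ (Elt.id ⟨p⟩)
        ⟨e⟩ := .mk _ (by simp [WHom.Sq, WHom.ofEq])
    obtain ⟨_, _, _, _, _, h₁, h₂⟩ := h hs
    rw [← h'] at h₂
    exact h₁.eq_lax h₂
  | colax e =>
    have hs : EltCell.Sq ⟨α, .colax e⟩ (EltCell.one (F := F) α p) ⟨𝟙 α⟩ (Elt.id ⟨p⟩)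
        ⟨e⟩ := .mk _ (by simp [WHom.Sq, WHom.ofEq])
    obtain ⟨_, _, _, _, _, h₁, h₂⟩ := h hs
    rw [← h'] at h₂
    exact h₁.eq_colax h₂

theorem cell_sq_id (D : Values μ Γ Z) (l l' : List (Point T w)) {m n : ℕ} {α : T.ob m ⟶ T.ob n}
    {u u' : EltCell X.toFun} {p : Elt X.toFun} {b : EltHom X.toFun}
    (hs : EltCell.Sq u u' ⟨𝟙 α⟩ p.id b) (hΓ : l.map Sigma.fst ++ X :: l'.map Sigma.fst = Γ) :
    EltCell.Sq (D.cell ⟨l, u, l'⟩ hΓ) (D.cell ⟨l, u', l'⟩ hΓ)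
      ⟨𝟙 (((μ.L (num l)).hom _ _).obj (((μ.R (num l')).hom _ _).obj α))⟩
      (D.hom (l ++ ⟨X, p⟩ :: l' |>.map Point.id) (by simpa)).src.id
      (D.hom (l.map Point.id ++ ⟨X, b⟩ :: l'.map Point.id) (by simpa)) := by
  have := D.cell_sq (l.map Point.id) (l'.map Point.id) hs (by simpa)
  have e : l.map Point.id ++ ⟨X, p.id⟩ :: l'.map Point.id =
      (l ++ ⟨X, p⟩ :: l').map Point.id := by simp
  simp only [e] at this
  rw [D.hom_id _ (by simpa)] at this ⊢
  simp only [List.map_map, src_comp_id, tgt_comp_id, List.map_id] at this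
  have e' : μ.left₂ (num l) (μ.right₂ (num l') ⟨𝟙 α⟩) =
      ⟨𝟙 (((μ.L (num l)).hom _ _).obj (((μ.R (num l')).hom _ _).obj α))⟩ := by
    change TwoCell.mk _ = _
    congr 1
    change ((μ.L (num l)).hom _ _).map (((μ.R (num l')).hom _ _).map (𝟙 α)) = _
    rw [CategoryTheory.Functor.map_id, CategoryTheory.Functor.map_id]
  rw [e'] at this
  exact this

/-- The values at cells are determined by those at morphisms and at identity cells. -/
theorem cell_ext {D D' : Values μ Γ Z} (h : ∀ t ht, D.hom t ht = D'.hom t ht)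
    (h' : ∀ (l : List (Point T w)) {X : Model T w} {m n : ℕ} (α : T.ob m ⟶ T.ob n)
      (p : X.toFun.O m) (l' : List (Point T w)) hU,
      D.cell ⟨l, EltCell.one (F := X.toFun) α p, l'⟩ hU =
        D'.cell ⟨l, EltCell.one (F := X.toFun) α p, l'⟩ hU) (U : MultiCell T w) (hU) :
    D.cell U hU = D'.cell U hU := by
  obtain ⟨l, u, l'⟩ := U
  refine EltCell.eq_of_sq (c := fun u => D.cell ⟨l, u, l'⟩ hU) (c' := fun u => D'.cell ⟨l, u, l'⟩ hU)
    (fun {_ _ α _ _ p b} hs => ⟨_, _, _, _, _, D.cell_sq_id l l' hs hU, ?_⟩)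
    (fun α p => h' l α p l' hU) u
  rw [h, h]
  exact D'.cell_sq_id l l' hs hU

end Determined

variable (D : Values μ Γ Z)

theorem obj_congr {l l' : List (Point T w)} (e : l = l') (h) (h') : D.obj l h = D.obj l' h' := by
  subst e; rfl
theorem hom_congr {l l' : List (Arrow T w)} (e : l = l') (h) (h') : D.hom l h = D.hom l' h' := by
  subst e; rfl
theorem cell_congr {U U' : MultiCell T w} (e : U = U') (h) (h') : D.cell U h = D.cell U' h' := by
  subst e; rfl

/-- The values at lists of morphisms make up the components of a multimap. -/
theorem exists_app (a : Ar Γ.length) : ∃ F : Dom Γ a ⥤ Z.toFun.O a.tens,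
    (∀ x, (⟨F.obj x⟩ : Elt Z.toFun) = D.obj (Pt.mk x).toList (Pt.map_fst_toList _)) ∧
    ∀ {x y} (f : x ⟶ y),
      (⟨F.map f⟩ : EltHom Z.toFun) = D.hom (PtHom.mk f).toList (PtHom.map_fst_toList _) := by
  refine exists_functor a.tens _ (fun x => ?_) _ (fun f => ?_) (fun f => ?_) (fun x => ?_)
    (fun {x y z} f g => ?_)
  · rw [D.obj_n, Pt.num_toList]
  · rw [D.hom_src]
    exact D.obj_congr (PtHom.toList_src _).symm _ _
  · rw [D.hom_tgt]
    exact D.obj_congr (PtHom.toList_tgt _).symm _ _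
  · rw [← D.hom_id]
    exact D.hom_congr (Pt.toList_id (.mk x)) _ _
  · obtain ⟨c, h₁, h₂, h₃⟩ := PtHom.exists_pairs f g
    rw [D.hom_congr h₁ _ (h₁ ▸ PtHom.map_fst_toList _),
      D.hom_congr h₂ _ (h₂ ▸ PtHom.map_fst_toList _),
      D.hom_congr h₃ _ (h₃ ▸ PtHom.map_fst_toList _)]
    refine D.hom_comp c ?_
    have := PtHom.map_fst_toList (PtHom.mk f)
    rw [h₁] at this
    simpa using this

variable {D} {app : ∀ a : Ar Γ.length, Dom Γ a ⥤ Z.toFun.O a.tens}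
  (ho : ∀ a x, (⟨(app a).obj x⟩ : Elt Z.toFun) = D.obj (Pt.mk x).toList (Pt.map_fst_toList _))
  (hm : ∀ a {x y} (f : x ⟶ y),
      (⟨(app a).map f⟩ : EltHom Z.toFun) = D.hom (PtHom.mk f).toList (PtHom.map_fst_toList _))

include hm in
theorem cell_sq_of_two {a b : Ar Γ.length} {s s' : Step T a b} (η : s.Two s') {x y : Dom Γ a}
    (f : x ⟶ y) {U U' : MultiCell T w} (hU : PtCell.Represents U (.id s x))
    (hU' : PtCell.Represents U' (.id s' y)) :
    EltCell.Sq (D.cell U hU.sources) (D.cell U' hU'.sources) (μ.tensU₂ η) ⟨(app a).map f⟩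
      ⟨(app b).map ((Dom.map₂ Γ η).app x ≫ (Dom.map Γ s').map f)⟩ := by
  obtain ⟨l, l', X, u, u', E, d, e, h, h₁, h₂, h₃, h₄, h₅⟩ := PtCell.exists_of_two (μ := μ) η f
  have hΓ : l.map Sigma.fst ++ X :: l'.map Sigma.fst = Γ := by simpa using h₁.sources
  have := D.cell_sq l l' h hΓ
  rw [h₅, hm, hm, D.cell_congr (hU.inj h₁) _ h₁.sources, D.cell_congr (hU'.inj h₂) _ h₂.sources,
    D.hom_congr h₃ _ (by simpa using hΓ), D.hom_congr h₄ _ (by simpa using hΓ)]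
  exact this

include ho hm in
theorem exists_cell {a b : Ar Γ.length} (s : Step T a b) :
    ∃ σ : WHom (app a ⋙ Z.toFun.fn (μ.tensMap s)) (Dom.map Γ s ⋙ app b) w,
      ∀ x (U : MultiCell T w) (hU : PtCell.Represents U (.id s x)),
        (⟨μ.tensMap s, σ.appAt x⟩ : EltCell Z.toFun) = D.cell U hU.sources := by
  choose U hU using fun x => PtCell.exists_represents_id s x
  have e₁ (x) : OneCell.mk (D.cell (U x) (hU x).sources).α = ⟨μ.tensMap s⟩ :=
    (D.cell_oneCell _ _).trans ((hU x).oneCell μ).symm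
  have e₂ (x) : (D.cell (U x) (hU x).sources).src = ⟨(app a).obj x⟩ := by
    rw [D.cell_src, ho]
    exact D.obj_congr (hU x).src.symm _ _
  have e₃ (x) : (D.cell (U x) (hU x).sources).tgt = ⟨(Dom.map Γ s ⋙ app b).obj x⟩ := by
    rw [D.cell_tgt]
    exact (D.obj_congr (hU x).tgt.symm _ (Pt.map_fst_toList _)).trans (ho _ _).symm
  obtain ⟨σ, hσ⟩ := exists_wHom (μ.tensMap s) _ e₁ e₂ e₃ fun {x y} f => by
    have := cell_sq_of_two hm (.refl s) f (hU x) (hU y)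
    rw [μ.tensU₂_refl] at this
    have e : (Dom.map₂ Γ (.refl s)).app x ≫ (Dom.map Γ s).map f = (Dom.map Γ s).map f := by
      rw [Dom.map₂_refl]
      exact Category.id_comp _
    rw [e] at this
    exact this
  exact ⟨σ, fun x U' hU' => (hσ x).trans (D.cell_congr ((hU x).inj hU') _ _)⟩

/-- Every family of values that satisfies the laws consists of the values of a multimap. -/
theorem exists_multiMap (D : Values μ Γ Z) : ∃ f : MultiMap μ Γ Z,
    (∀ t h, valHom (𝟙 f) t h = D.hom t h) ∧ ∀ U h, f.valCell U h = D.cell U h := by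
  choose app ho hm using fun a => D.exists_app a
  choose cell hc using fun (a b : Ar Γ.length) (s : Step T a b) => exists_cell ho hm s
  obtain ⟨f, hf, hf'⟩ : ∃ f : MultiMap μ Γ Z, f.app = app ∧ ∀ {a b} (s : Step T a b) x,
      (⟨μ.tensMap s, (f.cell s).appAt x⟩ : EltCell Z.toFun) =
        ⟨μ.tensMap s, (cell _ _ s).appAt x⟩ := by
    refine ⟨⟨app, fun s => cell _ _ s, fun {a b s} h => ?_, fun {a b c s t r} h => ?_,
      fun {a b s s'} σ => ?_, fun {a b c d s t s' t'} G => ?_⟩, rfl, fun _ _ => rfl⟩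
    · refine WHom.isId_of_appAt' _ fun x => ?_
      obtain ⟨U, hU, h'⟩ := PtCell.exists_of_isTight h x
      have := D.cell_tight U hU.sources h'
      rw [← hc _ _ s x U hU] at this
      exact this
    · refine WEq.of_appAt ?_ ?_ fun x => ?_
      · rw [μ.tensMap_comp h]
        exact congrArg (app a ⋙ ·) (Z.str.map_comp _ _)
      · rw [Dom.map_comp h]
        rfl
      · obtain ⟨l, l', X, u, v, k, h, h₁, h₂, h₃⟩ := PtCell.exists_of_isComp h x
        have := D.cell_comp l l' h h₁.sources
        rw [← hc _ _ s x _ h₁, ← hc _ _ t _ _ h₂, ← hc _ _ r _ _ h₃] at this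
        rw [WHom.appAt_comp, WHom.appAt_whR, WHom.appAt_whL]
        exact this.wEq
    · refine WHom.sq_of_appAt fun x => ?_
      obtain ⟨U, hU⟩ := PtCell.exists_represents_id s x
      obtain ⟨U', hU'⟩ := PtCell.exists_represents_id s' x
      have := cell_sq_of_two hm σ (𝟙 x) hU hU'
      rw [← hc _ _ s x _ hU, ← hc _ _ s' x _ hU'] at this
      have := this.sq
      simp only [CategoryTheory.Functor.map_id, Category.comp_id] at this
      exact this
    · refine WEq.of_appAt ?_ ?_ fun x => ?_
      · exact congrArg (app a ⋙ ·) (Z.str.map_comp _ _).symm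
      · exact congrArg (· ⋙ app d) (Dom.map_gray G)
      · obtain ⟨l, X, u, l', Y, v, l'', h₁, h₂, h₃, h₄, h⟩ := PtCell.exists_of_graySq (μ := μ) G x
        have := D.cell_gray l u l' v l'' (by simpa using h₁.sources)
        rw [← h, ← hc _ _ s x _ h₁, ← hc _ _ t' _ _ h₂, ← hc _ _ t _ _ h₃, ← hc _ _ s' _ _ h₄] at this
        have := this.wEq
        rw [WHom.appAt_comp, WHom.appAt_whR, WHom.appAt_whL, WHom.appAt_compEq, WHom.appAt_comp,
          WHom.appAt_whR, WHom.appAt_whL, WHom.appAt_whL]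
        exact this
  have hom t h : valHom (𝟙 f) t h = D.hom t h := by
    obtain ⟨x, rfl⟩ := PtHom.exists_toList t h
    rw [valHom_eq _ h rfl]
    subst hf
    refine Eq.trans ?_ (hm _ x.hom)
    exact congrArg (EltHom.mk (F := Z.toFun)) (Category.comp_id _)
  refine ⟨f, hom, cell_ext (D := f.values) hom fun l X m n α p l' hU => ?_⟩
  have hΓ : l.map Sigma.fst ++ X :: l'.map Sigma.fst = Γ := hU
  obtain ⟨a, b, s, x, hV⟩ := PtCell.exists_represents_one l α p l' hΓ
  exact (f.valCell_eq hU hV).trans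
    ((PreMultiMap.arr_id f.toPre s x).trans ((hf' s x).trans (hc _ _ s x _ hV)))

end Values

theorem hom_congr {f g : MultiMap μ Γ Z} (φ : f ⟶ g) {l l' : List (Arrow T w)} (e : l = l') (h)
    (h') : valHom φ l h = valHom φ l' h' := by
  subst e; rfl

/-- A modification with given values, where these satisfy the laws. -/
theorem exists_modif (f g : MultiMap μ Γ Z)
    (k : ∀ t : List (Arrow T w), t.map Sigma.fst = Γ → EltHom Z.toFun)
    (hs : ∀ t h, (k t h).src = f.val (t.map Arrow.src) (by simpa))
    (ht : ∀ t h, (k t h).tgt = g.val (t.map Arrow.tgt) (by simpa))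
    (hn : ∀ (c : List (ArrowPair T w)) (h : c.map Sigma.fst = Γ),
      (valHom (𝟙 f) (c.map ArrowPair.fst) (by simpa)).Comp (k (c.map ArrowPair.snd) (by simpa))
          (k (c.map ArrowPair.comp) (by simpa)) ∧
        (k (c.map ArrowPair.fst) (by simpa)).Comp (valHom (𝟙 g) (c.map ArrowPair.snd) (by simpa))
          (k (c.map ArrowPair.comp) (by simpa)))
    (hsq : ∀ (l l' : List (Arrow T w)) {X : Model T w} {u u' : EltCell X.toFun} {E : TwoCell T}
      {a b : EltHom X.toFun} (_ : EltCell.Sq u u' E a b)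
      (hΓ : l.map Sigma.fst ++ X :: l'.map Sigma.fst = Γ),
      EltCell.Sq (f.valCell ⟨l.map Arrow.src, u, l'.map Arrow.src⟩ (by simpa))
        (g.valCell ⟨l.map Arrow.tgt, u', l'.map Arrow.tgt⟩ (by simpa))
        (μ.left₂ (num (l.map Arrow.src)) (μ.right₂ (num (l'.map Arrow.src)) E))
        (k (l ++ ⟨X, a⟩ :: l') (by simpa)) (k (l ++ ⟨X, b⟩ :: l') (by simpa))) :
    ∃ φ : f ⟶ g, ∀ t h, valHom φ t h = k t h := by
  have k_congr {l l' : List (Arrow T w)} (e : l = l') (h) (h') : k l h = k l' h' := by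
    subst e; rfl
  have hev (e : MultiMap μ Γ Z) {a : Ar Γ.length} {x y : Dom Γ a} (q : x ⟶ y) :
      (⟨(e.app a).map q⟩ : EltHom Z.toFun) =
        valHom (𝟙 e) (PtHom.mk q).toList (PtHom.map_fst_toList _) := by
    rw [valHom_eq _ _ rfl]
    exact (congrArg (EltHom.mk (F := Z.toFun)) (Category.comp_id _)).symm
  have comp {a : Ar Γ.length} {x y z : Dom Γ a} (q : x ⟶ y) (r : y ⟶ z) :
      EltHom.Comp ⟨(f.app a).map q⟩ (k (PtHom.mk r).toList (PtHom.map_fst_toList _))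
          (k (PtHom.mk (q ≫ r)).toList (PtHom.map_fst_toList _)) ∧
        EltHom.Comp (k (PtHom.mk q).toList (PtHom.map_fst_toList _)) ⟨(g.app a).map r⟩
          (k (PtHom.mk (q ≫ r)).toList (PtHom.map_fst_toList _)) := by
    obtain ⟨c, h₁, h₂, h₃⟩ := PtHom.exists_pairs q r
    have hc : c.map Sigma.fst = Γ := by
      have := PtHom.map_fst_toList (PtHom.mk q)
      rw [h₁] at this
      simpa using this
    have := hn c hc
    rw [hev f, hev g, hom_congr _ h₁ _ (by simpa), hom_congr _ h₂ _ (by simpa),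
      k_congr h₁ _ (by simpa), k_congr h₂ _ (by simpa), k_congr h₃ _ (by simpa)]
    exact this
  have app (a : Ar Γ.length) : ∃ τ : f.app a ⟶ g.app a, ∀ x : Dom Γ a,
      (⟨τ.app x⟩ : EltHom Z.toFun) = k (PtHom.mk (𝟙 x)).toList (PtHom.map_fst_toList _) := by
    refine exists_natTrans (G := Z.toFun) _ (fun x => ?_) (fun x => ?_) (fun {x y} q => ?_)
    · rw [hs]
      exact f.val_eq _ (PtHom.toList_src (PtHom.mk (𝟙 x)))
    · rw [ht]
      exact g.val_eq _ (PtHom.toList_tgt (PtHom.mk (𝟙 x)))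
    · refine ⟨_, ?_, (comp (𝟙 x) q).2⟩
      have := (comp q (𝟙 y)).1
      rw [Category.comp_id] at this
      rw [Category.id_comp]
      exact this
  choose τ hτ using app
  have tr {a : Ar Γ.length} {x y : Dom Γ a} (q : x ⟶ y) :
      (⟨(f.app a).map q ≫ (τ a).app y⟩ : EltHom Z.toFun) =
        k (PtHom.mk q).toList (PtHom.map_fst_toList _) := by
    have := (comp q (𝟙 y)).1
    rw [← hτ, Category.comp_id] at this
    exact (EltHom.Comp.mk _ _).unique this
  refine ⟨⟨τ, fun {a b} s => ?_⟩, fun t h => ?_⟩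
  · refine WHom.sq_of_appAt fun x => ?_
    obtain ⟨l, l', X, u, u', E, d, e, h, h₁, h₂, h₃, h₄, h₅⟩ :=
      PtCell.exists_of_two (μ := μ) (.refl s) (𝟙 x)
    have hΓ : l.map Sigma.fst ++ X :: l'.map Sigma.fst = Γ := by simpa using h₁.sources
    have := hsq l l' h hΓ
    rw [← h₅, μ.tensU₂_refl, f.valCell_eq _ h₁, g.valCell_eq _ h₂,
      ← k_congr h₃ (PtHom.map_fst_toList _), ← k_congr h₄ (PtHom.map_fst_toList _)] at this
    have e₁ := PreMultiMap.arr_id f.toPre s x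
    have e₂ := PreMultiMap.arr_id g.toPre s x
    have e₃ : (Dom.map₂ Γ (.refl s)).app x ≫ (Dom.map Γ s).map (𝟙 x) = 𝟙 ((Dom.map Γ s).obj x) := by
      rw [Dom.map₂_refl, CategoryTheory.Functor.map_id]
      exact Category.id_comp _
    rw [e₃, ← hτ, ← hτ] at this
    change EltCell.Sq (PreMultiMap.arr f.toPre _) (PreMultiMap.arr g.toPre _) _ _ _ at this
    rw [e₁, e₂] at this
    have := this.sq
    have e : (Z.toFun.tr (𝟙 (μ.tensMap s))).app ((f.app a).obj x) = 𝟙 _ :=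
      congrArg (fun t => NatTrans.app t ((f.app a).obj x)) ((Z.str.hom _ _).map_id _)
    refine this.congr .refl .refl ?_ .refl
    exact .of_eq ((congrArg (· ≫ _) e).trans (Category.id_comp _))
  · obtain ⟨x, rfl⟩ := PtHom.exists_toList t h
    rw [valHom_eq _ h rfl]
    exact tr x.hom

end MultiMap

end Reconstruction


/-! ### Substitution of multimaps -/

section Split

variable {S M : Type*} {p : S → M} {Γ Ξ Δ : List M}

theorem List.exists_split {l : List S} (h : l.map p = Γ ++ (Ξ ++ Δ)) :
    ∃ x y z, l = x ++ (y ++ z) ∧ x.map p = Γ ∧ y.map p = Ξ ∧ z.map p = Δ := by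
  obtain ⟨x, t, rfl, hx, ht⟩ := List.map_eq_append_iff.1 h
  obtain ⟨y, z, rfl, hy, hz⟩ := List.map_eq_append_iff.1 ht
  exact ⟨x, y, z, rfl, hx, hy, hz⟩

theorem List.split_unique {x y z x' y' z' : List S} (h : x ++ (y ++ z) = x' ++ (y' ++ z'))
    (hx : x.map p = Γ) (hy : y.map p = Ξ) (hx' : x'.map p = Γ) (hy' : y'.map p = Ξ) :
    x = x' ∧ y = y' ∧ z = z' := by
  have ex : x.length = x'.length := by
    simpa using congrArg List.length (hx.trans hx'.symm)
  have ey : y.length = y'.length := by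
    simpa using congrArg List.length (hy.trans hy'.symm)
  obtain ⟨rfl, h'⟩ := List.append_inj h ex
  obtain ⟨rfl, rfl⟩ := List.append_inj h' ey
  exact ⟨rfl, rfl, rfl⟩

theorem List.exists_split_at {l l' : List S} {X : M}
    (h : l.map p ++ X :: l'.map p = Γ ++ (Ξ ++ Δ)) :
    (∃ r y z, l' = r ++ (y ++ z) ∧ l.map p ++ X :: r.map p = Γ ∧ y.map p = Ξ ∧ z.map p = Δ) ∨
    (∃ x a b z, l = x ++ a ∧ l' = b ++ z ∧ x.map p = Γ ∧ a.map p ++ X :: b.map p = Ξ ∧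
      z.map p = Δ) ∨
    (∃ x y a, l = x ++ (y ++ a) ∧ x.map p = Γ ∧ y.map p = Ξ ∧
      a.map p ++ X :: l'.map p = Δ) := by
  rcases List.append_eq_append_iff.1 h with ⟨A, hA, h'⟩ | ⟨A, hA, h'⟩
  · rcases A with _ | ⟨X', A⟩
    · rcases Ξ with _ | ⟨X', Ξ⟩
      · right; right
        refine ⟨l, [], [], by simp, by simpa using hA.symm, rfl, by simpa using h'⟩
      · right; left
        simp only [List.nil_append, List.cons_append, List.cons.injEq] at h'
        obtain ⟨rfl, h'⟩ := h'
        obtain ⟨b, z, rfl, hb, hz⟩ := List.map_eq_append_iff.1 h'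
        exact ⟨l, [], b, z, by simp, rfl, by simpa using hA.symm, by simp [hb], hz⟩
    · left
      simp only [List.cons_append, List.cons.injEq] at h'
      obtain ⟨rfl, h'⟩ := h'
      obtain ⟨r, y, z, rfl, hr, hy, hz⟩ := List.exists_split h'
      exact ⟨r, y, z, rfl, by rw [hA, hr], hy, hz⟩
  · obtain ⟨x, a, rfl, hx, ha⟩ := List.map_eq_append_iff.1 hA
    rcases List.append_eq_append_iff.1 h' with ⟨B, hB, h''⟩ | ⟨B, hB, h''⟩
    · right; right
      subst ha
      obtain ⟨y, a, rfl, hy, ha⟩ := List.map_eq_append_iff.1 hB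
      exact ⟨x, y, a, rfl, hx, hy, by rw [ha, h'']⟩
    · rcases B with _ | ⟨X', B⟩
      · right; right
        refine ⟨x, a, [], by simp, hx, by simpa [ha] using hB.symm, by simpa using h''⟩
      · right; left
        simp only [List.cons_append, List.cons.injEq] at h''
        obtain ⟨rfl, h''⟩ := h''
        obtain ⟨b, z, rfl, hb, hz⟩ := List.map_eq_append_iff.1 h''
        exact ⟨x, a, b, z, rfl, rfl, hx, by rw [ha, hb, hB], hz⟩

end Split

section Substitution

variable {T : LawvereTwoTheory 𝕋} {w : Weakness} {μ : WCommutativity T w}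
  {Γ Ξ Δ : List (Model T w)} {Y Z : Model T w}

namespace MultiMap

variable (f f' f'' : MultiMap μ (Γ ++ Y :: Δ) Z) (g g' g'' : MultiMap μ Ξ Y)

theorem exists_substVal (l : List (Point T w)) : ∃ e : Elt Z.toFun,
    ∀ x y z, l = x ++ (y ++ z) → ∀ (hx : x.map Sigma.fst = Γ) (hy : y.map Sigma.fst = Ξ)
      (hz : z.map Sigma.fst = Δ), e = f.val (x ++ ⟨Y, g.val y hy⟩ :: z) (by simp [hx, hz]) := by
  by_cases h : l.map Sigma.fst = Γ ++ (Ξ ++ Δ)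
  · obtain ⟨x, y, z, rfl, hx, hy, hz⟩ := List.exists_split h
    refine ⟨f.val (x ++ ⟨Y, g.val y hy⟩ :: z) (by simp [hx, hz]), ?_⟩
    intro x' y' z' e hx' hy' hz'
    obtain ⟨rfl, rfl, rfl⟩ := List.split_unique e hx hy hx' hy'
    rfl
  · exact ⟨⟨(fun i : Fin 0 => i.elim0 : Z.toFun.O 0)⟩, fun x y z e hx hy hz =>
      (h (by simp [e, hx, hy, hz])).elim⟩

/-- The value of a composite at a list of elements. -/
noncomputable def substVal (l : List (Point T w)) : Elt Z.toFun := (f.exists_substVal g l).choose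

variable {f f' f'' g g' g''} in
theorem exists_substHom (φ : f ⟶ f') (γ : g ⟶ g') (l : List (Arrow T w)) : ∃ e : EltHom Z.toFun,
    ∀ x y z, l = x ++ (y ++ z) → ∀ (hx : x.map Sigma.fst = Γ) (hy : y.map Sigma.fst = Ξ)
      (hz : z.map Sigma.fst = Δ),
      e = valHom φ (x ++ ⟨Y, valHom γ y hy⟩ :: z) (by simp [hx, hz]) := by
  by_cases h : l.map Sigma.fst = Γ ++ (Ξ ++ Δ)
  · obtain ⟨x, y, z, rfl, hx, hy, hz⟩ := List.exists_split h
    refine ⟨valHom φ (x ++ ⟨Y, valHom γ y hy⟩ :: z) (by simp [hx, hz]), ?_⟩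
    intro x' y' z' e hx' hy' hz'
    obtain ⟨rfl, rfl, rfl⟩ := List.split_unique e hx hy hx' hy'
    rfl
  · exact ⟨⟨𝟙 (fun i : Fin 0 => i.elim0 : Z.toFun.O 0)⟩, fun x y z e hx hy hz =>
      (h (by simp [e, hx, hy, hz])).elim⟩

variable {f f' f'' g g' g''} in
/-- The value of a horizontal composite of modifications at a list of morphisms. -/
noncomputable def substHom (φ : f ⟶ f') (γ : g ⟶ g') (l : List (Arrow T w)) : EltHom Z.toFun :=
  (exists_substHom φ γ l).choose

theorem val_congr (f : MultiMap μ Γ Z) {l l' : List (Point T w)} (e : l = l') (h) (h') :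
    f.val l h = f.val l' h' := by
  subst e; rfl
theorem valHom_congr {f g : MultiMap μ Γ Z} (φ : f ⟶ g) {l l' : List (Arrow T w)} (e : l = l')
    (h) (h') : valHom φ l h = valHom φ l' h' := by
  subst e; rfl
theorem valCell_congr (f : MultiMap μ Γ Z) {U U' : MultiCell T w} (e : U = U') (h) (h') :
    f.valCell U h = f.valCell U' h' := by
  subst e; rfl

theorem exists_substCell (l : List (Point T w)) {X : Model T w} (u : EltCell X.toFun)
    (r : List (Point T w)) : ∃ e : EltCell Z.toFun,
    (∀ r' y z, r = r' ++ (y ++ z) →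
      ∀ (hl : l.map Sigma.fst ++ X :: r'.map Sigma.fst = Γ) (hy : y.map Sigma.fst = Ξ)
        (hz : z.map Sigma.fst = Δ),
      e = f.valCell ⟨l, u, r' ++ ⟨Y, g.val y hy⟩ :: z⟩ (by simp [← hl, hz])) ∧
    (∀ x a b z, l = x ++ a → r = b ++ z →
      ∀ (hx : x.map Sigma.fst = Γ) (hl : a.map Sigma.fst ++ X :: b.map Sigma.fst = Ξ)
        (hz : z.map Sigma.fst = Δ),
      e = f.valCell ⟨x, g.valCell ⟨a, u, b⟩ hl, z⟩ (by simp [hx, hz])) ∧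
    (∀ x y a, l = x ++ (y ++ a) →
      ∀ (hx : x.map Sigma.fst = Γ) (hy : y.map Sigma.fst = Ξ)
        (hl : a.map Sigma.fst ++ X :: r.map Sigma.fst = Δ),
      e = f.valCell ⟨x ++ ⟨Y, g.val y hy⟩ :: a, u, r⟩ (by simp [← hl, hx])) := by
  have len {a : List (Point T w)} {Γ} (h : a.map Sigma.fst = Γ) : a.length = Γ.length := by
    simpa using congrArg List.length h
  have len' {a b : List (Point T w)} {Γ} (h : a.map Sigma.fst ++ X :: b.map Sigma.fst = Γ) :
      a.length + (b.length + 1) = Γ.length := by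
    simpa using congrArg List.length h
  by_cases h : l.map Sigma.fst ++ X :: r.map Sigma.fst = Γ ++ (Ξ ++ Δ)
  · rcases List.exists_split_at h with ⟨r', y, z, rfl, hl, hy, hz⟩ | ⟨x, a, b, z, rfl, rfl, hx, hl, hz⟩ |
      ⟨x, y, a, rfl, hx, hy, hl⟩
    · refine ⟨f.valCell ⟨l, u, r' ++ ⟨Y, g.val y hy⟩ :: z⟩ (by simp [← hl, hz]), ?_, ?_, ?_⟩
      · intro r'' y' z' e hl' hy' hz'
        have : r'.map Sigma.fst = r''.map Sigma.fst := by
          simpa using hl.trans hl'.symm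
        obtain ⟨rfl, rfl, rfl⟩ := List.split_unique e this hy rfl hy'
        rfl
      · intro x a b z' e e' hx hl' hz'
        have h₁ := len hx
        have h₂ := len' hl
        have h₃ := congrArg List.length e
        simp at h₃
        omega
      · intro x y' a e hx hy' hl'
        have h₁ := len hx
        have h₂ := len' hl
        have h₃ := congrArg List.length e
        simp at h₃
        omega
    · refine ⟨f.valCell ⟨x, g.valCell ⟨a, u, b⟩ hl, z⟩ (by simp [hx, hz]), ?_, ?_, ?_⟩
      · intro r'' y' z' e hl' hy' hz'
        have h₁ := len hx
        have h₂ := len' hl'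
        simp at h₂
        omega
      · intro x' a' b' z' e e' hx' hl' hz'
        obtain ⟨rfl, rfl⟩ := List.append_inj e ((len hx).trans (len hx').symm)
        obtain ⟨rfl, rfl⟩ := List.append_inj' e' ((len hz).trans (len hz').symm)
        rfl
      · intro x' y' a' e hx' hy' hl'
        have h₁ := len hx
        have h₁' := len hx'
        have h₂ := len' hl
        have h₂' := len hy'
        have h₃ := congrArg List.length e
        simp at h₃
        omega
    · refine ⟨f.valCell ⟨x ++ ⟨Y, g.val y hy⟩ :: a, u, r⟩ (by simp [← hl, hx]), ?_, ?_, ?_⟩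
      · intro r'' y' z' e hl' hy' hz'
        have h₁ := len hx
        have h₂ := len' hl'
        simp at h₂
        omega
      · intro x' a' b' z' e e' hx' hl' hz'
        have h₁ := len hx
        have h₁' := len hx'
        have h₂ := len' hl'
        have h₂' := len hy
        have h₃ := congrArg List.length e
        simp at h₃
        omega
      · intro x' y' a' e hx' hy' hl'
        obtain ⟨rfl, rfl, rfl⟩ := List.split_unique e hx hy hx' hy'
        rfl
  · refine ⟨⟨𝟙 (T.ob 0), WHom.ofEq (y := (Z.toFun.fn (𝟙 (T.ob 0))).obj fun i => i.elim0) rfl⟩,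
      ?_, ?_, ?_⟩
    · intro r'' y' z' e hl' hy' hz'
      exact (h (by simp [← hl', ← hy', ← hz', e])).elim
    · intro x' a' b' z' e e' hx' hl' hz'
      exact (h (by simp [← hl', ← hx', ← hz', e, e'])).elim
    · intro x' y' a' e hx' hy' hl'
      exact (h (by simp [← hl', ← hy', ← hx', e])).elim

/-- The value of a composite at a list of elements with a cell in one place. -/
noncomputable def substCell (U : MultiCell T w) : EltCell Z.toFun :=
  (f.exists_substCell g U.left U.cell U.right).choose

variable {x y z l r r' a b : List (Point T w)}

theorem substVal_eq (e : l = x ++ (y ++ z)) (hx : x.map Sigma.fst = Γ) (hy : y.map Sigma.fst = Ξ)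
    (hz : z.map Sigma.fst = Δ) :
    f.substVal g l = f.val (x ++ ⟨Y, g.val y hy⟩ :: z) (by simp [hx, hz]) :=
  (f.exists_substVal g l).choose_spec x y z e hx hy hz

variable {f f' f'' g g' g''} in
theorem substHom_eq (φ : f ⟶ f') (γ : g ⟶ g') {l x y z : List (Arrow T w)} (e : l = x ++ (y ++ z))
    (hx : x.map Sigma.fst = Γ) (hy : y.map Sigma.fst = Ξ) (hz : z.map Sigma.fst = Δ) :
    substHom φ γ l = valHom φ (x ++ ⟨Y, valHom γ y hy⟩ :: z) (by simp [hx, hz]) :=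
  (exists_substHom φ γ l).choose_spec x y z e hx hy hz

theorem substCell_left {X : Model T w} (u : EltCell X.toFun) (e : r = r' ++ (y ++ z))
    (hl : l.map Sigma.fst ++ X :: r'.map Sigma.fst = Γ) (hy : y.map Sigma.fst = Ξ)
    (hz : z.map Sigma.fst = Δ) :
    f.substCell g ⟨l, u, r⟩ =
      f.valCell ⟨l, u, r' ++ ⟨Y, g.val y hy⟩ :: z⟩ (by simp [← hl, hz]) :=
  (f.exists_substCell g l u r).choose_spec.1 r' y z e hl hy hz

theorem substCell_mid {X : Model T w} (u : EltCell X.toFun) (e : l = x ++ a) (e' : r = b ++ z)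
    (hx : x.map Sigma.fst = Γ) (hl : a.map Sigma.fst ++ X :: b.map Sigma.fst = Ξ)
    (hz : z.map Sigma.fst = Δ) :
    f.substCell g ⟨l, u, r⟩ = f.valCell ⟨x, g.valCell ⟨a, u, b⟩ hl, z⟩ (by simp [hx, hz]) :=
  (f.exists_substCell g l u r).choose_spec.2.1 x a b z e e' hx hl hz

theorem substCell_right {X : Model T w} (u : EltCell X.toFun) (e : l = x ++ (y ++ a))
    (hx : x.map Sigma.fst = Γ) (hy : y.map Sigma.fst = Ξ)
    (hl : a.map Sigma.fst ++ X :: r.map Sigma.fst = Δ) :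
    f.substCell g ⟨l, u, r⟩ =
      f.valCell ⟨x ++ ⟨Y, g.val y hy⟩ :: a, u, r⟩ (by simp [← hl, hx]) :=
  (f.exists_substCell g l u r).choose_spec.2.2 x y a e hx hy hl

theorem num_val (hy : y.map Sigma.fst = Ξ) :
    num (x ++ ⟨Y, g.val y hy⟩ :: z) = num (x ++ (y ++ z)) := by
  simp [val_n]

variable {f f' f'' g g' g''}

theorem substHom_src (φ : f ⟶ f') (γ : g ⟶ g') (t : List (Arrow T w))
    (h : t.map Sigma.fst = Γ ++ (Ξ ++ Δ)) : (substHom φ γ t).src = f.substVal g (t.map Arrow.src) := by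
  obtain ⟨x, y, z, rfl, hx, hy, hz⟩ := List.exists_split h
  rw [substHom_eq φ γ rfl hx hy hz, valHom_src, f.substVal_eq g (x := x.map Arrow.src)
    (y := y.map Arrow.src) (z := z.map Arrow.src) (by simp) (by simpa) (by simpa) (by simpa)]
  refine val_congr _ ?_ _ _
  simp [Arrow.src, valHom_src]

theorem substHom_tgt (φ : f ⟶ f') (γ : g ⟶ g') (t : List (Arrow T w))
    (h : t.map Sigma.fst = Γ ++ (Ξ ++ Δ)) :
    (substHom φ γ t).tgt = f'.substVal g' (t.map Arrow.tgt) := by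
  obtain ⟨x, y, z, rfl, hx, hy, hz⟩ := List.exists_split h
  rw [substHom_eq φ γ rfl hx hy hz, valHom_tgt, f'.substVal_eq g' (x := x.map Arrow.tgt)
    (y := y.map Arrow.tgt) (z := z.map Arrow.tgt) (by simp) (by simpa) (by simpa) (by simpa)]
  refine val_congr _ ?_ _ _
  simp [Arrow.tgt, valHom_tgt]

theorem _root_.EltHom.Comp.exists_pair {F : TwoFun T w} {p q r : EltHom F} (h : p.Comp q r) :
    ∃ c : EltPair F, p = ⟨c.f⟩ ∧ q = ⟨c.g⟩ ∧ r = ⟨c.f ≫ c.g⟩ := by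
  obtain ⟨s, t⟩ := h
  exact ⟨⟨s, t⟩, rfl, rfl, rfl⟩

theorem substHom_comp (φ : f ⟶ f') (φ' : f' ⟶ f'') (γ : g ⟶ g') (γ' : g' ⟶ g'')
    (c : List (ArrowPair T w)) (h : c.map Sigma.fst = Γ ++ (Ξ ++ Δ)) :
    (substHom φ γ (c.map ArrowPair.fst)).Comp (substHom φ' γ' (c.map ArrowPair.snd))
      (substHom (φ ≫ φ') (γ ≫ γ') (c.map ArrowPair.comp)) := by
  obtain ⟨x, y, z, rfl, hx, hy, hz⟩ := List.exists_split h
  obtain ⟨d, h₁, h₂, h₃⟩ := (valHom_comp γ γ' y hy).exists_pair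
  have := valHom_comp φ φ' (x ++ ⟨Y, d⟩ :: z) (by simp [hx, hz])
  rw [substHom_eq φ γ (x := x.map ArrowPair.fst) (y := y.map ArrowPair.fst)
      (z := z.map ArrowPair.fst) (by simp) (by simpa) (by simpa) (by simpa),
    substHom_eq φ' γ' (x := x.map ArrowPair.snd) (y := y.map ArrowPair.snd)
      (z := z.map ArrowPair.snd) (by simp) (by simpa) (by simpa) (by simpa),
    substHom_eq (φ ≫ φ') (γ ≫ γ') (x := x.map ArrowPair.comp) (y := y.map ArrowPair.comp)
      (z := z.map ArrowPair.comp) (by simp) (by simpa) (by simpa) (by simpa)]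
  simp only [h₁, h₂, h₃]
  simpa using this

theorem substHom_id (l : List (Point T w)) (h : l.map Sigma.fst = Γ ++ (Ξ ++ Δ)) :
    substHom (𝟙 f) (𝟙 g) (l.map Point.id) = (f.substVal g l).id := by
  obtain ⟨x, y, z, rfl, hx, hy, hz⟩ := List.exists_split h
  rw [substHom_eq _ _ (x := x.map Point.id) (y := y.map Point.id)
      (z := z.map Point.id) (by simp) (by simpa) (by simpa) (by simpa),
    f.substVal_eq g rfl hx hy hz, ← f.valHom_id]
  refine valHom_congr _ ?_ _ _
  simp [valHom_id g hy]

theorem substCell_oneCell (U : MultiCell T w) (h : U.sources = Γ ++ (Ξ ++ Δ)) :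
    ⟨(f.substCell g U).α⟩ = U.oneCell μ := by
  obtain ⟨l, u, r⟩ := U
  rcases List.exists_split_at h with ⟨r', y, z, rfl, hl, hy, hz⟩ | ⟨x, a, b, z, rfl, rfl, hx, hl, hz⟩ |
      ⟨x, y, a, rfl, hx, hy, hl⟩
  · rw [f.substCell_left g u rfl hl hy hz, valCell_oneCell]
    simp only [MultiCell.oneCell, num_val]
  · rw [f.substCell_mid g u rfl rfl hx hl hz, valCell_oneCell]
    simp only [MultiCell.oneCell, valCell_oneCell, num_append]
    rw [μ.right_left, μ.left_left, μ.right_right]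
  · rw [f.substCell_right g u rfl hx hy hl, valCell_oneCell]
    simp only [MultiCell.oneCell, num_val]

theorem substCell_src (U : MultiCell T w) (h : U.sources = Γ ++ (Ξ ++ Δ)) :
    (f.substCell g U).src = f.substVal g U.src := by
  obtain ⟨l, u, r⟩ := U
  rcases List.exists_split_at h with ⟨r', y, z, rfl, hl, hy, hz⟩ | ⟨x, a, b, z, rfl, rfl, hx, hl, hz⟩ |
      ⟨x, y, a, rfl, hx, hy, hl⟩
  · rw [f.substCell_left g u rfl hl hy hz, valCell_src,
      f.substVal_eq g (x := l ++ ⟨_, u.src⟩ :: r') (y := y) (z := z) (by simp) (by simpa) hy hz]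
    exact val_congr _ (by simp) _ _
  · rw [f.substCell_mid g u rfl rfl hx hl hz, valCell_src,
      f.substVal_eq g (x := x) (y := a ++ ⟨_, u.src⟩ :: b) (z := z) (by simp) hx (by simpa) hz]
    exact val_congr _ (by simp [valCell_src]) _ _
  · rw [f.substCell_right g u rfl hx hy hl, valCell_src,
      f.substVal_eq g (x := x) (y := y) (z := a ++ ⟨_, u.src⟩ :: r) (by simp) hx hy (by simpa)]
    exact val_congr _ (by simp) _ _

theorem substCell_tgt (U : MultiCell T w) (h : U.sources = Γ ++ (Ξ ++ Δ)) :
    (f.substCell g U).tgt = f.substVal g U.tgt := by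
  obtain ⟨l, u, r⟩ := U
  rcases List.exists_split_at h with ⟨r', y, z, rfl, hl, hy, hz⟩ | ⟨x, a, b, z, rfl, rfl, hx, hl, hz⟩ |
      ⟨x, y, a, rfl, hx, hy, hl⟩
  · rw [f.substCell_left g u rfl hl hy hz, valCell_tgt,
      f.substVal_eq g (x := l ++ ⟨_, u.tgt⟩ :: r') (y := y) (z := z) (by simp) (by simpa) hy hz]
    exact val_congr _ (by simp) _ _
  · rw [f.substCell_mid g u rfl rfl hx hl hz, valCell_tgt,
      f.substVal_eq g (x := x) (y := a ++ ⟨_, u.tgt⟩ :: b) (z := z) (by simp) hx (by simpa) hz]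
    exact val_congr _ (by simp [valCell_tgt]) _ _
  · rw [f.substCell_right g u rfl hx hy hl, valCell_tgt,
      f.substVal_eq g (x := x) (y := y) (z := a ++ ⟨_, u.tgt⟩ :: r) (by simp) hx hy (by simpa)]
    exact val_congr _ (by simp) _ _

theorem substCell_isTight (U : MultiCell T w) (h : U.sources = Γ ++ (Ξ ++ Δ))
    (hU : U.cell.IsTight) : (f.substCell g U).cell.IsId := by
  obtain ⟨l, u, r⟩ := U
  rcases List.exists_split_at h with ⟨r', y, z, rfl, hl, hy, hz⟩ | ⟨x, a, b, z, rfl, rfl, hx, hl, hz⟩ |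
      ⟨x, y, a, rfl, hx, hy, hl⟩
  · rw [f.substCell_left g u rfl hl hy hz]
    refine (f.valCell_isTight _ ?_).2
    exact hU
  · rw [f.substCell_mid g u rfl rfl hx hl hz]
    exact (f.valCell_isTight (by simp [hx, hz]) (g.valCell_isTight (U := ⟨a, u, b⟩) hl hU)).2
  · rw [f.substCell_right g u rfl hx hy hl]
    refine (f.valCell_isTight _ ?_).2
    exact hU

theorem substCell_comp (l r : List (Point T w)) {X : Model T w} {u v t : EltCell X.toFun}
    (hu : u.Comp v t) (h : l.map Sigma.fst ++ X :: r.map Sigma.fst = Γ ++ (Ξ ++ Δ)) :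
    (f.substCell g ⟨l, u, r⟩).Comp (f.substCell g ⟨l, v, r⟩) (f.substCell g ⟨l, t, r⟩) := by
  rcases List.exists_split_at h with ⟨r', y, z, rfl, hl, hy, hz⟩ | ⟨x, a, b, z, rfl, rfl, hx, hl, hz⟩ |
      ⟨x, y, a, rfl, hx, hy, hl⟩
  · simp only [f.substCell_left g _ rfl hl hy hz]
    exact f.valCell_comp _ _ hu _
  · simp only [f.substCell_mid g _ rfl rfl hx hl hz]
    exact f.valCell_comp _ _ (g.valCell_comp _ _ hu _) _
  · simp only [f.substCell_right g _ rfl hx hy hl]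
    exact f.valCell_comp _ _ hu _

/-- The law of squares over 2-cells of the theory for a composite. -/
theorem substCell_sq (φ : f ⟶ f') (γ : g ⟶ g') (l r : List (Arrow T w)) {X : Model T w}
    {u u' : EltCell X.toFun} {E : TwoCell T} {s t : EltHom X.toFun} (hu : EltCell.Sq u u' E s t)
    (h : l.map Sigma.fst ++ X :: r.map Sigma.fst = Γ ++ (Ξ ++ Δ)) :
    EltCell.Sq (f.substCell g ⟨l.map Arrow.src, u, r.map Arrow.src⟩)
      (f'.substCell g' ⟨l.map Arrow.tgt, u', r.map Arrow.tgt⟩)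
      (μ.left₂ (num (l.map Arrow.src)) (μ.right₂ (num (r.map Arrow.src)) E))
      (substHom φ γ (l ++ ⟨X, s⟩ :: r)) (substHom φ γ (l ++ ⟨X, t⟩ :: r)) := by
  rcases List.exists_split_at h with ⟨r', y, z, rfl, hl, hy, hz⟩ | ⟨x, a, b, z, rfl, rfl, hx, hl, hz⟩ |
      ⟨x, y, a, rfl, hx, hy, hl⟩
  · have := valCell_sq φ l (r' ++ ⟨Y, valHom γ y hy⟩ :: z) hu (by simp [← hl, hz])
    rw [f.substCell_left g u (r' := r'.map Arrow.src) (y := y.map Arrow.src) (z := z.map Arrow.src)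
        (by simp) (by simpa) (by simpa) (by simpa),
      f'.substCell_left g' u' (r' := r'.map Arrow.tgt) (y := y.map Arrow.tgt)
        (z := z.map Arrow.tgt) (by simp) (by simpa) (by simpa) (by simpa),
      substHom_eq φ γ (x := l ++ ⟨X, s⟩ :: r') (y := y) (z := z) (by simp) (by simpa) hy hz,
      substHom_eq φ γ (x := l ++ ⟨X, t⟩ :: r') (y := y) (z := z) (by simp) (by simpa) hy hz]
    have e : num ((r' ++ ⟨Y, valHom γ y hy⟩ :: z).map Arrow.src) =
        num ((r' ++ (y ++ z)).map Arrow.src) := by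
      simp [Arrow.src, valHom_src, val_n]
    rw [← e]
    simpa [Arrow.src, Arrow.tgt, valHom_src, valHom_tgt] using this
  · have := valCell_sq φ x z (valCell_sq γ a b hu hl) (by simp [hx, hz])
    rw [f.substCell_mid g u (x := x.map Arrow.src) (a := a.map Arrow.src) (b := b.map Arrow.src)
        (z := z.map Arrow.src) (by simp) (by simp) (by simpa) (by simpa) (by simpa),
      f'.substCell_mid g' u' (x := x.map Arrow.tgt) (a := a.map Arrow.tgt) (b := b.map Arrow.tgt)
        (z := z.map Arrow.tgt) (by simp) (by simp) (by simpa) (by simpa) (by simpa),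
      substHom_eq φ γ (x := x) (y := a ++ ⟨X, s⟩ :: b) (z := z) (by simp) hx (by simpa) hz,
      substHom_eq φ γ (x := x) (y := a ++ ⟨X, t⟩ :: b) (z := z) (by simp) hx (by simpa) hz]
    simp only [List.map_append, num_append]
    rw [← μ.left₂_left₂, ← μ.right₂_right₂, ← μ.right₂_left₂]
    exact this
  · have := valCell_sq φ (x ++ ⟨Y, valHom γ y hy⟩ :: a) r hu (by simp [← hl, hx])
    rw [f.substCell_right g u (x := x.map Arrow.src) (y := y.map Arrow.src) (a := a.map Arrow.src)
        (by simp) (by simpa) (by simpa) (by simpa),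
      f'.substCell_right g' u' (x := x.map Arrow.tgt) (y := y.map Arrow.tgt)
        (a := a.map Arrow.tgt) (by simp) (by simpa) (by simpa) (by simpa),
      substHom_eq φ γ (x := x) (y := y) (z := a ++ ⟨X, s⟩ :: r) (by simp) hx hy (by simpa),
      substHom_eq φ γ (x := x) (y := y) (z := a ++ ⟨X, t⟩ :: r) (by simp) hx hy (by simpa)]
    have e : num ((x ++ ⟨Y, valHom γ y hy⟩ :: a).map Arrow.src) =
        num ((x ++ (y ++ a)).map Arrow.src) := by
      simp [Arrow.src, valHom_src, val_n]
    rw [← e]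
    simpa [Arrow.src, Arrow.tgt, valHom_src, valHom_tgt] using this

end MultiMap

end Substitution


section Substitution

variable {T : LawvereTwoTheory 𝕋} {w : Weakness} {μ : WCommutativity T w}
  {Γ Ξ Δ : List (Model T w)} {Y Z : Model T w}

theorem List.exists_split_cons {S : Type*} {l l' x a : List S} {p : S} (h : l ++ p :: l' = x ++ a) :
    (∃ c, x = l ++ p :: c ∧ l' = c ++ a) ∨ ∃ c, l = x ++ c ∧ a = c ++ p :: l' := by
  rcases List.append_eq_append_iff.1 h with ⟨A, rfl, h'⟩ | ⟨A, rfl, h'⟩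
  · rcases A with _ | ⟨q, A⟩
    · exact .inr ⟨[], by simp, by simpa using h'.symm⟩
    · simp only [List.cons_append, List.cons.injEq] at h'
      obtain ⟨rfl, rfl⟩ := h'
      exact .inl ⟨A, rfl, rfl⟩
  · exact .inr ⟨A, rfl, h'⟩

namespace MultiMap

variable {f f' f'' : MultiMap μ (Γ ++ Y :: Δ) Z} {g g' g'' : MultiMap μ Ξ Y}

/-- The law of Gray squares for a composite. There are six cases, according to which of the three
parts of the list the two variables belong to. -/
theorem substCell_gray (l : List (Point T w)) {X : Model T w} (u : EltCell X.toFun)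
    (l' : List (Point T w)) {V : Model T w} (v : EltCell V.toFun) (l'' : List (Point T w))
    (h : l.map Sigma.fst ++ X :: (l'.map Sigma.fst ++ V :: l''.map Sigma.fst) = Γ ++ (Ξ ++ Δ)) :
    EltCell.Gray
      (μ.leftW (num l) (μ.rightW (num l'') (μ.grayW (μ.right (num l') ⟨u.α⟩) ⟨v.α⟩)))
      (f.substCell g ⟨l, u, l' ++ ⟨V, v.src⟩ :: l''⟩)
      (f.substCell g ⟨l ++ ⟨X, u.tgt⟩ :: l', v, l''⟩)
      (f.substCell g ⟨l ++ ⟨X, u.src⟩ :: l', v, l''⟩)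
      (f.substCell g ⟨l, u, l' ++ ⟨V, v.tgt⟩ :: l''⟩) := by
  have h' : (l ++ ⟨X, u.src⟩ :: l').map Sigma.fst ++ V :: l''.map Sigma.fst = Γ ++ (Ξ ++ Δ) := by
    simpa using h
  rcases List.exists_split_at h' with ⟨r', y, z, rfl, hl, hy, hz⟩ |
      ⟨x, a, b, z, e, rfl, hx, hl, hz⟩ | ⟨x, y, a, e, hx, hy, hl⟩
  -- both variables belong to `Γ`
  · simp only [List.map_append, List.map_cons] at hl
    rw [f.substCell_left g u (r' := l' ++ ⟨V, v.src⟩ :: r') (y := y) (z := z) (by simp)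
        (by simpa using hl) hy hz,
      f.substCell_left g v (r' := r') (y := y) (z := z) (by simp) (by simpa using hl) hy hz,
      f.substCell_left g v (r' := r') (y := y) (z := z) (by simp) (by simpa using hl) hy hz,
      f.substCell_left g u (r' := l' ++ ⟨V, v.tgt⟩ :: r') (y := y) (z := z) (by simp)
        (by simpa using hl) hy hz]
    have := f.valCell_gray l u l' v (r' ++ ⟨Y, g.val y hy⟩ :: z) (by simp [← hl, hz])
    rw [num_val] at this
    simpa using this
  · rcases List.exists_split_cons e with ⟨c, rfl, rfl⟩ | ⟨c, rfl, rfl⟩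
    -- the first variable belongs to `Γ` and the second one to `Ξ`: the Gray law of `f` for the cell
    -- of `g`
    · simp only [List.map_append, List.map_cons] at hx hl
      rw [f.substCell_left g u (r' := c) (y := a ++ ⟨V, v.src⟩ :: b) (z := z) (by simp)
          (by simpa using hx) (by simpa) hz,
        f.substCell_mid g v (x := l ++ ⟨X, u.tgt⟩ :: c) (a := a) (b := b) (z := z) (by simp) rfl
          (by simpa using hx) hl hz,
        f.substCell_mid g v (x := l ++ ⟨X, u.src⟩ :: c) (a := a) (b := b) (z := z) (by simp) rfl
          (by simpa using hx) hl hz,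
        f.substCell_left g u (r' := c) (y := a ++ ⟨V, v.tgt⟩ :: b) (z := z) (by simp)
          (by simpa using hx) (by simpa) hz]
      have := f.valCell_gray l u c (g.valCell ⟨a, v, b⟩ hl) z (by simp [← hx, hz])
      simp only [valCell_oneCell, MultiCell.oneCell, valCell_src, valCell_tgt, μ.rightW_grayW,
        ← μ.grayW_right, μ.right_right, num_append] at this ⊢
      exact this
    -- both variables belong to `Ξ`: `f` preserves the Gray squares of `g`
    · simp only [List.map_append, List.map_cons] at hx hl
      have hl' : c.map Sigma.fst ++ X :: (l'.map Sigma.fst ++ V :: b.map Sigma.fst) = Ξ := by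
        simpa using hl
      rw [f.substCell_mid g u (x := x) (a := c) (b := l' ++ ⟨V, v.src⟩ :: b) (z := z) rfl (by simp)
          hx (by simpa) hz,
        f.substCell_mid g v (x := x) (a := c ++ ⟨X, u.tgt⟩ :: l') (b := b) (z := z) (by simp) rfl
          hx (by simpa) hz,
        f.substCell_mid g v (x := x) (a := c ++ ⟨X, u.src⟩ :: l') (b := b) (z := z) (by simp) rfl
          hx (by simpa) hz,
        f.substCell_mid g u (x := x) (a := c) (b := l' ++ ⟨V, v.tgt⟩ :: b) (z := z) rfl (by simp)
          hx (by simpa) hz]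
      have := f.valCell_gray_of_gray x z (g.valCell_gray c u l' v b hl') (by simp [hx, hz])
      simp only [μ.rightW_leftW, μ.leftW_leftW, μ.rightW_grayW, μ.right_right, num_append] at this ⊢
      exact this
  · rcases List.exists_split_cons e with ⟨c, rfl, rfl⟩ | ⟨c, rfl, e'⟩
    -- the first variable belongs to `Γ` and the second one to `Δ`
    · simp only [List.map_append, List.map_cons] at hx
      rw [f.substCell_left g u (r' := c) (y := y) (z := a ++ ⟨V, v.src⟩ :: l'') (by simp)
          (by simpa using hx) hy (by simpa),
        f.substCell_right g v (x := l ++ ⟨X, u.tgt⟩ :: c) (y := y) (a := a) (by simp)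
          (by simpa using hx) hy hl,
        f.substCell_right g v (x := l ++ ⟨X, u.src⟩ :: c) (y := y) (a := a) (by simp)
          (by simpa using hx) hy hl,
        f.substCell_left g u (r' := c) (y := y) (z := a ++ ⟨V, v.tgt⟩ :: l'') (by simp)
          (by simpa using hx) hy (by simpa)]
      have := f.valCell_gray l u (c ++ ⟨Y, g.val y hy⟩ :: a) v l'' (by simp [← hx, ← hl])
      rw [num_val] at this
      simpa using this
    · rcases List.exists_split_cons e'.symm with ⟨d, rfl, rfl⟩ | ⟨d, rfl, rfl⟩
      -- the first variable belongs to `Ξ` and the second one to `Δ`: the Gray law of `f` for the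
      -- cell of `g`
      · simp only [List.map_append, List.map_cons] at hy
        rw [f.substCell_mid g u (x := x) (a := c) (b := d) (z := a ++ ⟨V, v.src⟩ :: l'') rfl
            (by simp) hx hy (by simpa),
          f.substCell_right g v (x := x) (y := c ++ ⟨X, u.tgt⟩ :: d) (a := a) (by simp)
            hx (by simpa) hl,
          f.substCell_right g v (x := x) (y := c ++ ⟨X, u.src⟩ :: d) (a := a) (by simp)
            hx (by simpa) hl,
          f.substCell_mid g u (x := x) (a := c) (b := d) (z := a ++ ⟨V, v.tgt⟩ :: l'') rfl
            (by simp) hx hy (by simpa)]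
        have := f.valCell_gray x (g.valCell ⟨c, u, d⟩ hy) a v l'' (by simp [hx, ← hl])
        simp only [valCell_oneCell, MultiCell.oneCell, valCell_src, valCell_tgt, μ.rightW_grayW,
          μ.rightW_leftW, μ.grayW_left, μ.leftW_leftW, μ.right_right, μ.right_left, num_append] at this ⊢
        exact this
      -- both variables belong to `Δ`
      · simp only [List.map_append, List.map_cons] at hl
        have hl' : d.map Sigma.fst ++ X :: (l'.map Sigma.fst ++ V :: l''.map Sigma.fst) = Δ := by
          simpa using hl
        rw [f.substCell_right g u (x := x) (y := y) (a := d) (by simp) hx hy (by simpa),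
          f.substCell_right g v (x := x) (y := y) (a := d ++ ⟨X, u.tgt⟩ :: l') (by simp) hx hy
            (by simpa),
          f.substCell_right g v (x := x) (y := y) (a := d ++ ⟨X, u.src⟩ :: l') (by simp) hx hy
            (by simpa),
          f.substCell_right g u (x := x) (y := y) (a := d) (by simp) hx hy (by simpa)]
        have := f.valCell_gray (x ++ ⟨Y, g.val y hy⟩ :: d) u l' v l'' (by simp [hx, ← hl'])
        rw [num_val] at this
        simpa using this

theorem substVal_n (l : List (Point T w)) (h : l.map Sigma.fst = Γ ++ (Ξ ++ Δ)) :
    (f.substVal g l).n = num l := by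
  obtain ⟨x, y, z, rfl, hx, hy, hz⟩ := List.exists_split h
  rw [f.substVal_eq g rfl hx hy hz, val_n, num_val]

variable (f g) in
/-- The values of a composite. -/
noncomputable def substValues : Values μ (Γ ++ (Ξ ++ Δ)) Z where
  obj l _ := f.substVal g l
  hom t _ := substHom (𝟙 f) (𝟙 g) t
  cell U _ := f.substCell g U
  obj_n l h := substVal_n l h
  hom_src t h := substHom_src _ _ t h
  hom_tgt t h := substHom_tgt _ _ t h
  hom_id l h := substHom_id l h
  hom_comp c h := by
    have := substHom_comp (𝟙 f) (𝟙 f) (𝟙 g) (𝟙 g) c h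
    rwa [Category.comp_id, Category.comp_id] at this
  cell_oneCell U h := substCell_oneCell U h
  cell_src U h := substCell_src U h
  cell_tgt U h := substCell_tgt U h
  cell_tight U h := substCell_isTight U h
  cell_comp l l' _ _ _ _ hu h := substCell_comp l l' hu h
  cell_sq l l' _ _ _ _ _ _ hu h := substCell_sq _ _ l l' hu h
  cell_gray l _ u l' _ v l'' h := substCell_gray l u l' v l'' h

variable (f g) in
/-- The composite of multimaps in the middle variable. -/
noncomputable def subst : MultiMap μ (Γ ++ (Ξ ++ Δ)) Z := (f.substValues g).exists_multiMap.choose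

theorem valHom_subst (t : List (Arrow T w)) (h : t.map Sigma.fst = Γ ++ (Ξ ++ Δ)) :
    valHom (𝟙 (f.subst g)) t h = substHom (𝟙 f) (𝟙 g) t :=
  (f.substValues g).exists_multiMap.choose_spec.1 t h

theorem valCell_subst (U : MultiCell T w) (h : U.sources = Γ ++ (Ξ ++ Δ)) :
    (f.subst g).valCell U h = f.substCell g U :=
  (f.substValues g).exists_multiMap.choose_spec.2 U h

theorem val_eq_src (f : MultiMap μ Γ Z) (l : List (Point T w)) (h : l.map Sigma.fst = Γ) :
    f.val l h = (valHom (𝟙 f) (l.map Point.id) (by simpa)).src := by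
  rw [valHom_src]
  exact f.val_congr (by simp) _ _

/-- Composition of multimaps is substitution of values. -/
theorem val_subst (l : List (Point T w)) (h : l.map Sigma.fst = Γ ++ (Ξ ++ Δ)) :
    (f.subst g).val l h = f.substVal g l := by
  rw [val_eq_src, valHom_subst, substHom_id l h]
  rfl

theorem exists_subst₂ (φ : f ⟶ f') (γ : g ⟶ g') : ∃ χ : f.subst g ⟶ f'.subst g',
    ∀ t h, valHom χ t h = substHom φ γ t := by
  refine exists_modif _ _ (fun t _ => substHom φ γ t) (fun t h => ?_) (fun t h => ?_)
    (fun c h => ⟨?_, ?_⟩) (fun l l' X u u' E a b hu h => ?_)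
  · rw [val_subst, substHom_src φ γ t h]
  · rw [val_subst, substHom_tgt φ γ t h]
  · have := substHom_comp (𝟙 f) φ (𝟙 g) γ c h
    rw [Category.id_comp, Category.id_comp] at this
    rwa [valHom_subst]
  · have := substHom_comp φ (𝟙 f') γ (𝟙 g') c h
    rw [Category.comp_id, Category.comp_id] at this
    rwa [valHom_subst]
  · rw [valCell_subst, valCell_subst]
    exact substCell_sq φ γ l l' hu h

/-- The horizontal composite of modifications in the middle variable. -/
noncomputable def subst₂ (φ : f ⟶ f') (γ : g ⟶ g') : f.subst g ⟶ f'.subst g' :=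
  (exists_subst₂ φ γ).choose

theorem valHom_subst₂ (φ : f ⟶ f') (γ : g ⟶ g') (t : List (Arrow T w))
    (h : t.map Sigma.fst = Γ ++ (Ξ ++ Δ)) : valHom (subst₂ φ γ) t h = substHom φ γ t :=
  (exists_subst₂ φ γ).choose_spec t h

/-- The pair of two identities of an element. -/
abbrev _root_.Point.pair (a : Point T w) : ArrowPair T w := ⟨a.1, ⟨𝟙 a.2.obj, 𝟙 a.2.obj⟩⟩

@[simp] theorem fst_comp_pair : Sigma.fst ∘ Point.pair (T := T) (w := w) = Sigma.fst := rfl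
@[simp] theorem pairFst_comp_pair : ArrowPair.fst ∘ Point.pair (T := T) (w := w) = Point.id := rfl
@[simp] theorem pairSnd_comp_pair : ArrowPair.snd ∘ Point.pair (T := T) (w := w) = Point.id := rfl
@[simp] theorem pairComp_comp_pair :
    ArrowPair.comp ∘ Point.pair (T := T) (w := w) = Point.id := by
  funext p
  change (⟨p.1, ⟨𝟙 p.2.obj ≫ 𝟙 p.2.obj⟩⟩ : Arrow T w) = ⟨p.1, ⟨𝟙 p.2.obj⟩⟩
  rw [Category.comp_id]

theorem valHom_comp_id {f g k : MultiMap μ Γ Z} (φ : f ⟶ g) (ψ : g ⟶ k) (l : List (Point T w)) (h) :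
    (valHom φ (l.map Point.id) h).Comp (valHom ψ (l.map Point.id) h)
      (valHom (φ ≫ ψ) (l.map Point.id) h) := by
  have := valHom_comp φ ψ (l.map Point.pair) (by simpa using h)
  simpa only [List.map_map, pairFst_comp_pair, pairSnd_comp_pair, pairComp_comp_pair] using this

variable (μ) in
/-- The composition functor of multimaps. -/
@[simps]
noncomputable def substFunctor (Γ Ξ Δ : List (Model T w)) (Y Z : Model T w) :
    MultiMap μ (Γ ++ Y :: Δ) Z × MultiMap μ Ξ Y ⥤ MultiMap μ (Γ ++ (Ξ ++ Δ)) Z where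
  obj p := p.1.subst p.2
  map φ := subst₂ φ.1 φ.2
  map_id p := hom_ext_val fun l h => by
    rw [valHom_subst₂, valHom_subst]
    rfl
  map_comp {p q r} φ ψ := hom_ext_val fun l h => by
    refine EltHom.Comp.unique ?_ (valHom_comp_id _ _ l h)
    rw [valHom_subst₂, valHom_subst₂, valHom_subst₂]
    have := substHom_comp φ.1 ψ.1 φ.2 ψ.2 (l.map Point.pair) (by simpa using h)
    simp only [List.map_map, pairFst_comp_pair, pairSnd_comp_pair, pairComp_comp_pair] at this
    exact this

end MultiMap

end Substitution


section TransValues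

variable {T : LawvereTwoTheory 𝕋} {w : Weakness} {F G K : TwoFun T w}

namespace WTrans

/-- The value of a transformation at an element. -/
def val (f : WTrans F G) (p : Elt F) : Elt G := ⟨(f.app p.n).obj p.obj⟩

/-- The value of a modification at a morphism. -/
def valHom {f g : WTrans F G} (η : f ⟶ g) (a : EltHom F) : EltHom G :=
  ⟨(f.app a.n).map a.hom ≫ (Modif.app η a.n).app a.q⟩

/-- The value of a transformation at a cell. -/
def valCell (f : WTrans F G) (u : EltCell F) : EltCell G :=
  ⟨u.α, ((f.cell u.α).appAt u.p).comp (u.cell.map (f.app u.n))⟩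

theorem valHom_id_id (a : EltHom F) : valHom (𝟙 (WTrans.id F)) a = a :=
  congrArg EltHom.mk (Category.comp_id _)

theorem valCell_id (u : EltCell F) : valCell (WTrans.id F) u = u := by
  obtain ⟨α, σ⟩ := u
  refine EltCell.mk_congr rfl rfl rfl ?_
  refine (WEq.comp (WEq.of_eq (WHom.appAt_ofEq rfl _)) .refl).trans ?_
  refine (WEq.ofEq_comp _ _).trans ?_
  cases σ <;> exact .refl

end WTrans

end TransValues

section Unary

variable {T : LawvereTwoTheory 𝕋} {w : Weakness} {μ : WCommutativity T w}
  {Γ Ξ Δ : List (Model T w)} {X Y Z : Model T w}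

theorem List.exists_singleton_of_map {M : Type*} {A : M → Type*} {l : List (Σ X, A X)} {X : M}
    (h : l.map Sigma.fst = [X]) : ∃ a : A X, l = [⟨X, a⟩] := by
  obtain ⟨⟨X', a⟩, rfl, rfl⟩ := List.map_eq_singleton_iff.1 h
  exact ⟨a, rfl⟩

namespace MultiMap

theorem val_ofHom (f : X ⟶ Z) (p : Elt X.toFun) (h) :
    (ofHom (μ := μ) f).val [⟨X, p⟩] h = WTrans.val f p :=
  val_eq _ _ (Pt.toList_cons p .nil)

theorem valHom_unary {f g : X ⟶ Z} (η : f ⟶ g) (a : EltHom X.toFun) (h) :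
    valHom ((unary μ X Z).map η) [⟨X, a⟩] h = WTrans.valHom η a :=
  valHom_eq _ _ (PtHom.toList_cons a Pt.nil.id)

theorem valHom_id_ofHom (f : X ⟶ Z) (a : EltHom X.toFun) (h) :
    valHom (𝟙 (ofHom (μ := μ) f)) [⟨X, a⟩] h = WTrans.valHom (𝟙 f) a := by
  rw [← valHom_unary (μ := μ) (𝟙 f) a h, CategoryTheory.Functor.map_id]
  rfl

theorem valCell_ofHom (f : X ⟶ Z) (u : EltCell X.toFun) (h) :
    (ofHom (μ := μ) f).valCell ⟨[], u, []⟩ h = WTrans.valCell f u := by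
  rw [valCell_eq _ h (PtCell.Represents.here u .nil)]
  obtain ⟨α, σ⟩ := u
  refine EltCell.mk_congr rfl rfl rfl ?_
  refine WEq.comp (WEq.of_eq (WHom.appAt_whL _ _ _)) ?_
  cases σ <;> exact .refl

theorem valHom_castSources (h : Γ = Δ) {f g : MultiMap μ Γ Z} (φ : f ⟶ g) (t : List (Arrow T w))
    (ht) : valHom ((castSources (Mul := MultiMap μ) h Z).map φ) t ht =
      valHom φ t (ht.trans h.symm) := by
  subst h; rfl

theorem valCell_castSources (h : Γ = Δ) (f : MultiMap μ Γ Z) (U : MultiCell T w) (hU) :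
    ((castSources (Mul := MultiMap μ) h Z).obj f).valCell U hU =
      f.valCell U (hU.trans h.symm) := by
  subst h; rfl

theorem val_one (p : Elt X.toFun) (h) : (ofHom (μ := μ) (𝟙 X)).val [⟨X, p⟩] h = p :=
  val_ofHom _ _ _

theorem valHom_one (a : EltHom X.toFun) (h) : valHom (𝟙 (ofHom (μ := μ) (𝟙 X))) [⟨X, a⟩] h = a :=
  (valHom_id_ofHom _ _ _).trans (WTrans.valHom_id_id a)

theorem valCell_one (u : EltCell X.toFun) (h) :
    (ofHom (μ := μ) (𝟙 X)).valCell ⟨[], u, []⟩ h = u :=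
  (valCell_ofHom _ _ _).trans (WTrans.valCell_id u)

end MultiMap

end Unary

section Multicategory

variable {T : LawvereTwoTheory 𝕋} {w : Weakness} (μ : WCommutativity T w)

namespace MultiMap

theorem substFunctor_one (Γ Δ : List (Model T w)) (Y Z : Model T w) :
    Functor.prod' (𝟭 _) ((Functor.const _).obj (ofHom (𝟙 Y))) ⋙ substFunctor μ Γ [Y] Δ Y Z =
      𝟭 (MultiMap μ (Γ ++ Y :: Δ) Z) := by
  refine functor_ext_val (fun {c d} k t ht => ?_) fun c U hU => ?_
  · obtain ⟨x, y, z, rfl, hx, hy, hz⟩ := List.exists_split (Γ := Γ) (Ξ := [Y]) (Δ := Δ) ht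
    obtain ⟨a, rfl⟩ := List.exists_singleton_of_map hy
    refine (valHom_subst₂ _ _ _ _).trans ?_
    rw [substHom_eq _ _ rfl hx hy hz]
    refine valHom_congr _ ?_ _ _
    have := valHom_one (μ := μ) a hy
    simp only [List.singleton_append]
    congr 2
    exact congrArg (Sigma.mk Y) this
  · obtain ⟨l, u, r⟩ := U
    refine (valCell_subst _ _).trans ?_
    rcases List.exists_split_at (Γ := Γ) (Ξ := [Y]) (Δ := Δ) hU with
      ⟨r', y, z, rfl, hl, hy, hz⟩ | ⟨x, a, b, z, rfl, rfl, hx, hl, hz⟩ | ⟨x, y, a, rfl, hx, hy, hl⟩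
    · obtain ⟨p, rfl⟩ := List.exists_singleton_of_map hy
      refine (substCell_left _ _ u rfl hl hy hz).trans ?_
      refine valCell_congr _ ?_ _ _
      simp only [Functor.prod'_obj, Functor.const_obj_obj, val_one, List.singleton_append]
    · obtain ⟨rfl, rfl, rfl⟩ : a = [] ∧ b = [] ∧ _ = Y := by
        rcases a with _ | ⟨a, _⟩ <;> simp at hl
        exact ⟨rfl, hl.2, hl.1⟩
      refine (substCell_mid _ _ u rfl rfl hx hl hz).trans ?_
      refine valCell_congr _ ?_ _ _
      simp only [Functor.prod'_obj, Functor.const_obj_obj, valCell_one, List.append_nil,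
        List.nil_append]
    · obtain ⟨p, rfl⟩ := List.exists_singleton_of_map hy
      refine (substCell_right _ _ u rfl hx hy hl).trans ?_
      refine valCell_congr _ ?_ _ _
      simp only [Functor.prod'_obj, Functor.const_obj_obj, val_one, List.singleton_append]

theorem one_substFunctor (Ξ : List (Model T w)) (Z : Model T w) :
    Functor.prod' ((Functor.const _).obj (ofHom (𝟙 Z))) (𝟭 _) ⋙ substFunctor μ [] Ξ [] Z Z =
      castSources (Mul := MultiMap μ) (List.append_nil Ξ).symm Z := by
  refine functor_ext_val (fun {c d} k t ht => ?_) fun c U hU => ?_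
  · rw [valHom_castSources]
    refine (valHom_subst₂ _ _ _ _).trans ?_
    have ht' : t.map Sigma.fst = Ξ := by simpa using ht
    refine (substHom_eq _ _ (x := []) (y := t) (z := []) (by simp) rfl ht' rfl).trans ?_
    exact valHom_one _ _
  · obtain ⟨l, u, r⟩ := U
    rw [valCell_castSources]
    refine (valCell_subst _ _).trans ?_
    have hU' := (List.append_nil Ξ) ▸ hU
    refine (substCell_mid _ _ u (x := []) (a := l) (b := r) (z := []) (by simp) (by simp) rfl hU'
      rfl).trans ?_
    exact valCell_one _ _

variable {μ}

theorem subst_assoc_hom {Γ Δ Ξ Θ Λ : List (Model T w)} {X Y Z : Model T w}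
    {f f' : MultiMap μ (Γ ++ Y :: Δ) Z} {g g' : MultiMap μ (Ξ ++ X :: Θ) Y} {k k' : MultiMap μ Λ X}
    (φ : f ⟶ f') (γ : g ⟶ g') (κ : k ⟶ k') (t : List (Arrow T w))
    (h : t.map Sigma.fst = Γ ++ ((Ξ ++ (Λ ++ Θ)) ++ Δ)) :
    substHom ((castSources (Mul := MultiMap μ) (by simp : _ = (Γ ++ Ξ) ++ X :: (Θ ++ Δ)) Z).map
      (subst₂ φ γ)) κ t = substHom φ (subst₂ γ κ) t := by
  obtain ⟨x, s, z, rfl, hx, hs, hz⟩ := List.exists_split h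
  obtain ⟨y₁, y₂, y₃, rfl, h₁, h₂, h₃⟩ := List.exists_split hs
  rw [substHom_eq _ κ (x := x ++ y₁) (y := y₂) (z := y₃ ++ z) (by simp) (by simp [hx, h₁]) h₂
      (by simp [hz, h₃]), valHom_castSources, valHom_subst₂,
    substHom_eq φ γ (x := x) (y := y₁ ++ ⟨X, valHom κ y₂ h₂⟩ :: y₃) (z := z) (by simp) hx
      (by simp [h₁, h₃]) hz,
    substHom_eq φ _ (x := x) (y := y₁ ++ (y₂ ++ y₃)) (z := z) (by simp) hx (by simp [h₁, h₂, h₃]) hz]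
  refine valHom_congr _ ?_ _ _
  congr 3
  rw [valHom_subst₂, substHom_eq γ κ rfl h₁ h₂ h₃]

theorem subst_assoc_cell {Γ Δ Ξ Θ Λ : List (Model T w)} {X Y Z : Model T w}
    (f : MultiMap μ (Γ ++ Y :: Δ) Z) (g : MultiMap μ (Ξ ++ X :: Θ) Y) (k : MultiMap μ Λ X)
    (U : MultiCell T w) (h : U.sources = Γ ++ ((Ξ ++ (Λ ++ Θ)) ++ Δ)) :
    substCell ((castSources (Mul := MultiMap μ) (by simp : _ = (Γ ++ Ξ) ++ X :: (Θ ++ Δ)) Z).obj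
      (f.subst g)) k U = f.substCell (g.subst k) U := by
  obtain ⟨l, u, r⟩ := U
  have inner {y₁ y₂ y₃ : List (Point T w)} (h₁ : y₁.map Sigma.fst = Ξ) (h₂ : y₂.map Sigma.fst = Λ)
      (h₃ : y₃.map Sigma.fst = Θ) (h') : g.val (y₁ ++ ⟨X, k.val y₂ h₂⟩ :: y₃) (by simp [h₁, h₃]) =
        (g.subst k).val (y₁ ++ (y₂ ++ y₃)) h' := by
    rw [val_subst, g.substVal_eq k rfl h₁ h₂ h₃]
  rcases List.exists_split_at h with ⟨r', s, z, rfl, hl, hs, hz⟩ |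
      ⟨x, a, b, z, rfl, rfl, hx, hl, hz⟩ | ⟨x, s, a, rfl, hx, hs, hl⟩
  · obtain ⟨y₁, y₂, y₃, rfl, h₁, h₂, h₃⟩ := List.exists_split hs
    rw [substCell_left _ k u (r' := r' ++ y₁) (y := y₂) (z := y₃ ++ z) (by simp)
        (by simp [← hl, h₁]) h₂ (by simp [hz, h₃]), valCell_castSources, valCell_subst,
      f.substCell_left g u (r' := r') (y := y₁ ++ ⟨X, k.val y₂ h₂⟩ :: y₃) (z := z) (by simp) hl
        (by simp [h₁, h₃]) hz,
      f.substCell_left _ u (r' := r') (y := y₁ ++ (y₂ ++ y₃)) (z := z) (by simp) hl hs hz]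
    refine valCell_congr _ ?_ _ _
    rw [inner h₁ h₂ h₃]
  · rw [f.substCell_mid (g.subst k) u rfl rfl hx hl hz]
    rcases List.exists_split_at hl with ⟨r', y₂, y₃, rfl, h₁, h₂, h₃⟩ |
        ⟨y₁, a, b, y₃, rfl, rfl, h₁, h₂, h₃⟩ | ⟨y₁, y₂, a, rfl, h₁, h₂, h₃⟩
    · rw [substCell_left _ k u (r' := r') (y := y₂) (z := y₃ ++ z) (by simp)
          (by simp [hx, ← h₁]) h₂ (by simp [hz, h₃]), valCell_castSources, valCell_subst,
        f.substCell_mid g u (x := x) (a := a) (b := r' ++ ⟨X, k.val y₂ h₂⟩ :: y₃) (z := z) rfl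
          (by simp) hx (by simp [← h₁, h₃]) hz]
      refine valCell_congr _ ?_ _ _
      congr 1
      rw [valCell_subst, g.substCell_left k u rfl h₁ h₂ h₃]
    · rw [substCell_mid _ k u (x := x ++ y₁) (a := a) (b := b) (z := y₃ ++ z) (by simp) (by simp)
          (by simp [hx, h₁]) h₂ (by simp [hz, h₃]), valCell_castSources, valCell_subst,
        f.substCell_mid g _ (x := x) (a := y₁) (b := y₃) (z := z) rfl rfl hx (by simp [h₁, h₃]) hz]
      refine valCell_congr _ ?_ _ _
      congr 1
      rw [valCell_subst, g.substCell_mid k u rfl rfl h₁ h₂ h₃]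
    · rw [substCell_right _ k u (x := x ++ y₁) (y := y₂) (a := a) (by simp)
          (by simp [hx, h₁]) h₂ (by simp [hz, ← h₃]), valCell_castSources, valCell_subst,
        f.substCell_mid g u (x := x) (a := y₁ ++ ⟨X, k.val y₂ h₂⟩ :: a) (b := b) (z := z)
          (by simp) rfl hx (by simp [h₁, ← h₃]) hz]
      refine valCell_congr _ ?_ _ _
      congr 1
      rw [valCell_subst, g.substCell_right k u rfl h₁ h₂ h₃]
  · obtain ⟨y₁, y₂, y₃, rfl, h₁, h₂, h₃⟩ := List.exists_split hs
    rw [substCell_right _ k u (x := x ++ y₁) (y := y₂) (a := y₃ ++ a) (by simp)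
        (by simp [hx, h₁]) h₂ (by simp [← hl, h₃]), valCell_castSources, valCell_subst,
      f.substCell_right g u (x := x) (y := y₁ ++ ⟨X, k.val y₂ h₂⟩ :: y₃) (a := a) (by simp) hx
        (by simp [h₁, h₃]) hl,
      f.substCell_right _ u (x := x) (y := y₁ ++ (y₂ ++ y₃)) (a := a) (by simp) hx hs hl]
    refine valCell_congr _ ?_ _ _
    rw [inner h₁ h₂ h₃]

theorem subst_exchange_hom {Γ Δ Θ Ξ Ξ' : List (Model T w)} {Y Y' Z : Model T w}
    {f f' : MultiMap μ (Γ ++ Y :: (Δ ++ Y' :: Θ)) Z} {g g' : MultiMap μ Ξ Y} {k k' : MultiMap μ Ξ' Y'}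
    (φ : f ⟶ f') (γ : g ⟶ g') (κ : k ⟶ k') (t : List (Arrow T w))
    (h : t.map Sigma.fst = Γ ++ (Ξ ++ (Δ ++ (Ξ' ++ Θ)))) :
    substHom ((castSources (Mul := MultiMap μ) (by simp : _ = (Γ ++ (Ξ ++ Δ)) ++ Y' :: Θ) Z).map
        (subst₂ φ γ)) κ t =
      substHom ((castSources (Mul := MultiMap μ)
        (by simp : _ = Γ ++ Y :: (Δ ++ (Ξ' ++ Θ))) Z).map (subst₂ ((castSources (Mul := MultiMap μ)
          (by simp : _ = (Γ ++ Y :: Δ) ++ Y' :: Θ) Z).map φ) κ)) γ t := by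
  obtain ⟨x, y, s, rfl, hx, hy, hs⟩ := List.exists_split h
  obtain ⟨d, y', z, rfl, hd, hy', hz⟩ := List.exists_split hs
  rw [substHom_eq _ κ (x := x ++ (y ++ d)) (y := y') (z := z) (by simp) (by simp [hx, hy, hd]) hy'
      hz, valHom_castSources, valHom_subst₂,
    substHom_eq φ γ (x := x) (y := y) (z := d ++ ⟨Y', valHom κ y' hy'⟩ :: z) (by simp) hx hy
      (by simp [hd, hz]),
    substHom_eq _ γ (x := x) (y := y) (z := d ++ (y' ++ z)) rfl hx hy hs,
    valHom_castSources, valHom_subst₂,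
    substHom_eq _ κ (x := x ++ ⟨Y, valHom γ y hy⟩ :: d) (y := y') (z := z) (by simp)
      (by simp [hx, hd]) hy' hz, valHom_castSources]
  exact valHom_congr _ (by simp) _ _

theorem subst_exchange_cell {Γ Δ Θ Ξ Ξ' : List (Model T w)} {Y Y' Z : Model T w}
    (f : MultiMap μ (Γ ++ Y :: (Δ ++ Y' :: Θ)) Z) (g : MultiMap μ Ξ Y) (k : MultiMap μ Ξ' Y')
    (U : MultiCell T w) (h : U.sources = Γ ++ (Ξ ++ (Δ ++ (Ξ' ++ Θ)))) :
    substCell ((castSources (Mul := MultiMap μ) (by simp : _ = (Γ ++ (Ξ ++ Δ)) ++ Y' :: Θ) Z).obj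
        (f.subst g)) k U =
      substCell ((castSources (Mul := MultiMap μ)
        (by simp : _ = Γ ++ Y :: (Δ ++ (Ξ' ++ Θ))) Z).obj (subst ((castSources (Mul := MultiMap μ)
          (by simp : _ = (Γ ++ Y :: Δ) ++ Y' :: Θ) Z).obj f) k)) g U := by
  obtain ⟨l, u, r⟩ := U
  rcases List.exists_split_at h with ⟨r', y, s, rfl, hl, hy, hs⟩ |
      ⟨x, a, b, s, rfl, rfl, hx, hl, hs⟩ | ⟨x, y, s, rfl, hx, hy, hs⟩
  · obtain ⟨d, y', z, rfl, hd, hy', hz⟩ := List.exists_split hs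
    rw [substCell_left _ k u (r' := r' ++ (y ++ d)) (y := y') (z := z) (by simp)
        (by simp [← hl, hy, hd]) hy' hz, valCell_castSources, valCell_subst,
      f.substCell_left g u (r' := r') (y := y) (z := d ++ ⟨Y', k.val y' hy'⟩ :: z) (by simp) hl hy
        (by simp [hd, hz]),
      substCell_left _ g u (r' := r') (y := y) (z := d ++ (y' ++ z)) rfl hl hy hs,
      valCell_castSources, valCell_subst,
      substCell_left _ k u (r' := r' ++ ⟨Y, g.val y hy⟩ :: d) (y := y') (z := z) (by simp)
        (by simp [← hl, hd]) hy' hz, valCell_castSources]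
    exact valCell_congr _ (by simp) _ _
  · obtain ⟨d, y', z, rfl, hd, hy', hz⟩ := List.exists_split hs
    rw [substCell_left _ k u (r' := b ++ d) (y := y') (z := z) (by simp)
        (by simp [hx, ← hl, hd]) hy' hz, valCell_castSources, valCell_subst,
      f.substCell_mid g u (x := x) (a := a) (b := b) (z := d ++ ⟨Y', k.val y' hy'⟩ :: z) rfl
        (by simp) hx hl (by simp [hd, hz]),
      substCell_mid _ g u (x := x) (a := a) (b := b) (z := d ++ (y' ++ z)) rfl rfl hx hl hs,
      valCell_castSources, valCell_subst,
      substCell_left _ k _ (r' := d) (y := y') (z := z) rfl (by simp [hx, hd]) hy' hz,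
      valCell_castSources]
  · rcases List.exists_split_at hs with ⟨d, y', z, rfl, hd, hy', hz⟩ |
        ⟨d, a, b, z, rfl, rfl, hd, hy', hz⟩ | ⟨d, y', a, rfl, hd, hy', hz⟩
    · rw [substCell_left _ k u (r' := d) (y := y') (z := z) (by simp)
          (by simp [hx, hy, ← hd]) hy' hz, valCell_castSources, valCell_subst,
        f.substCell_right g u (x := x) (y := y) (a := s) rfl hx hy (by simp [← hd, hz]),
        substCell_right _ g u (x := x) (y := y) (a := s) rfl hx hy hs,
        valCell_castSources, valCell_subst,
        substCell_left _ k _ (r' := d) (y := y') (z := z) rfl (by simp [hx, ← hd]) hy' hz,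
        valCell_castSources]
    · rw [substCell_mid _ k u (x := x ++ (y ++ d)) (a := a) (b := b) (z := z) (by simp) rfl
          (by simp [hx, hy, hd]) hy' hz, valCell_castSources, valCell_subst,
        f.substCell_right g _ (x := x) (y := y) (a := d) rfl hx hy (by simp [hd, hz]),
        substCell_right _ g u (x := x) (y := y) (a := d ++ a) rfl hx hy hs,
        valCell_castSources, valCell_subst,
        substCell_mid _ k _ (x := x ++ ⟨Y, g.val y hy⟩ :: d) (a := a) (b := b) (z := z) (by simp) rfl
          (by simp [hx, hd]) hy' hz, valCell_castSources]
    · rw [substCell_right _ k u (x := x ++ (y ++ d)) (y := y') (a := a) (by simp)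
          (by simp [hx, hy, hd]) hy' hz, valCell_castSources, valCell_subst,
        f.substCell_right g _ (x := x) (y := y) (a := d ++ ⟨Y', k.val y' hy'⟩ :: a) (by simp) hx hy
          (by simp [hd, ← hz]),
        substCell_right _ g u (x := x) (y := y) (a := d ++ (y' ++ a)) rfl hx hy hs,
        valCell_castSources, valCell_subst,
        substCell_right _ k _ (x := x ++ ⟨Y, g.val y hy⟩ :: d) (y := y') (a := a) (by simp)
          (by simp [hx, hd]) hy' hz, valCell_castSources]
      exact valCell_congr _ (by simp) _ _

variable (μ) in
/-- The 2-multicategory of models and multimaps. -/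
noncomputable def multicategory : TwoMulticategory (MultiMap μ) where
  one X := ofHom (𝟙 X)
  comp := substFunctor μ
  comp_one := substFunctor_one μ
  one_comp := one_substFunctor μ
  assoc Γ Δ Ξ Θ Λ X Y Z := by
    refine functor_ext_val (fun {c d} k t ht => ?_) fun c U hU => ?_
    · refine (valHom_castSources _ _ _ _).trans ((valHom_subst₂ _ _ _ _).trans ?_)
      refine Eq.trans ?_ (valHom_subst₂ _ _ _ ht).symm
      exact subst_assoc_hom k.1.1 k.1.2 k.2 t ht
    · refine (valCell_castSources _ _ _ _).trans ((valCell_subst _ _).trans ?_)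
      refine Eq.trans ?_ (valCell_subst _ hU).symm
      exact subst_assoc_cell c.1.1 c.1.2 c.2 U hU
  exchange Γ Δ Θ Ξ Ξ' Y Y' Z := by
    refine functor_ext_val (fun {c d} k t ht => ?_) fun c U hU => ?_
    · refine (valHom_castSources _ _ _ _).trans ((valHom_subst₂ _ _ _ _).trans ?_)
      refine Eq.trans ?_ (valHom_subst₂ _ _ _ ht).symm
      exact subst_exchange_hom k.1.1 k.1.2 k.2 t ht
    · refine (valCell_castSources _ _ _ _).trans ((valCell_subst _ _).trans ?_)
      refine Eq.trans ?_ (valCell_subst _ hU).symm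
      exact subst_exchange_cell c.1.1 c.1.2 c.2 U hU

end MultiMap

end Multicategory


section Pasting

variable {T : LawvereTwoTheory 𝕋} {w : Weakness} {μ : WCommutativity T w}

theorem EltCell.wEq_reindex {X : Model T w} {m n m' n' : ℕ} (hn : n' = n)
    {α : T.ob m ⟶ T.ob n} {α' : T.ob m' ⟶ T.ob n'}
    {p : X.toFun.O m} {q : X.toFun.O n} {σ : WHom ((X.toFun.fn α).obj p) q w}
    {p' : X.toFun.O m'} {q' : X.toFun.O n'} {σ' : WHom ((X.toFun.fn α').obj p') q' w}
    (h : (⟨α, σ⟩ : EltCell X.toFun) = ⟨α', σ'⟩) :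
    WEq (σ.map (Pi.comap (fun _ => X.carrier) (Fin.cast hn))) σ' := by
  simp only [EltCell.mk.injEq] at h
  obtain ⟨rfl, -, h, h₁, h₂, h₃⟩ := h
  subst hn
  cases h; cases h₁; cases h₂; cases h₃
  cases σ' <;> exact .refl

theorem OneCell.reindex {X : Model T w} {m n m' n' : ℕ} (hm : m' = m) (hn : n' = n)
    {α : T.ob m ⟶ T.ob n} {α' : T.ob m' ⟶ T.ob n'} (h : OneCell.mk α = OneCell.mk α') :
    X.toFun.fn α ⋙ Pi.comap (fun _ => X.carrier) (Fin.cast hn) =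
      Pi.comap (fun _ => X.carrier) (Fin.cast hm) ⋙ X.toFun.fn α' := by
  subst hm hn
  simp only [OneCell.mk.injEq, heq_eq_eq, true_and] at h
  subst h
  rfl

theorem HomEq.natTrans {A : Type u₁} [Category.{v₁} A] {B : Type u₂} [Category.{v₂} B]
    {F G F' G' : A ⥤ B} {τ : F ⟶ G} {τ' : F' ⟶ G'} (hF : F = F') (hG : G = G')
    (h : ∀ x, HomEq (τ.app x) (τ'.app x)) : HomEq τ τ' := by
  subst hF hG
  exact .of_eq (NatTrans.ext (funext fun x => by
    have := h x
    exact eq_of_heq this.heq))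

namespace Dom

theorem toList_join : ∀ {Γ Δ : List (Model T w)} {a : Ar Γ.length} {d : Ar Δ.length} (x : Dom Γ a)
    (y : Dom Δ d),
    (Pt.mk ((join Γ a d).obj (x, y))).toList = (Pt.mk x).toList ++ (Pt.mk y).toList
  | [], _, _, _, _, _ => rfl
  | X :: _, _, .cons _ _, _, x, y => by
    have h := congrArg (List.cons (⟨X, ⟨x.1⟩⟩ : Point T w)) (toList_join x.2 y)
    exact h

theorem toList_join_map : ∀ {Γ Δ : List (Model T w)} {a : Ar Γ.length} {d : Ar Δ.length}
    {x x' : Dom Γ a} {y y' : Dom Δ d} (f : x ⟶ x') (g : y ⟶ y'),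
    (PtHom.mk ((join Γ a d).map (Prod.mkHom f g))).toList =
      (PtHom.mk f).toList ++ (PtHom.mk g).toList
  | [], _, _, _, _, _, _, _, _, _ => rfl
  | X :: _, _, .cons _ _, _, _, _, _, _, f, g => by
    have h := congrArg (List.cons (⟨X, ⟨f.1⟩⟩ : _root_.Arrow T w)) (toList_join_map f.2 g)
    exact h

theorem join_inl : (Γ : List (Model T w)) → {Δ : List (Model T w)} → {a b : Ar Γ.length} →
    (s : Step T a b) → (d : Ar Δ.length) →
    join Γ a d ⋙ map (Γ ++ Δ) (Step.inl Γ s d) = (map Γ s).prod (𝟭 _) ⋙ join Γ b d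
  | _ :: _, _, _, _, .here _ _, _ => rfl
  | X :: Γ, Δ, .cons m a, .cons _ b, .there _ s, d => by
    have h := join_inl Γ s d
    change CategoryTheory.prod.associator (∀ _ : Fin m, X.carrier) (Dom Γ a) (Dom Δ d) ⋙
      (𝟭 _).prod (join Γ a d ⋙ map (Γ ++ Δ) (Step.inl Γ s d)) = _
    rw [h]
    rfl

end Dom

namespace PtCell

variable {Γ Δ : List (Model T w)}

theorem exists_represents_inl : ∀ {Γ : List (Model T w)} {a b : Ar Γ.length} (s : Step T a b)
    (x : Dom Γ a) {d : Ar Δ.length} (y : Dom Δ d), ∃ U : MultiCell T w, Represents U (.id s x) ∧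
      Represents ⟨U.left, U.cell, U.right ++ (Pt.mk y).toList⟩
        (.id (s.inl Γ d) ((Dom.join Γ a d).obj (x, y)))
  | X :: Γ, .cons _ a, _, .here α _, x, d, y => by
    refine ⟨_, represents_here α x.1 x.2, ?_⟩
    have := represents_here α x.1 ((Dom.join Γ a d).obj (x.2, y))
    rw [Dom.toList_join] at this
    exact this
  | _ :: _, .cons _ _, .cons _ _, .there _ s, x, d, y => by
    obtain ⟨U, h, h'⟩ := exists_represents_inl s x.2 y
    exact ⟨_, represents_there x.1 h, represents_there x.1 h'⟩

theorem exists_represents_inr : ∀ {Γ : List (Model T w)} {a : Ar Γ.length} (x : Dom Γ a)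
    {d e : Ar Δ.length} (s : Step T d e) (y : Dom Δ d), ∃ U : MultiCell T w,
      Represents U (.id s y) ∧
      Represents ⟨(Pt.mk x).toList ++ U.left, U.cell, U.right⟩
        (.id (s.inr Γ a) ((Dom.join Γ a d).obj (x, y)))
  | [], _, _, _, _, s, y => by
    obtain ⟨U, h⟩ := exists_represents_id s y
    exact ⟨U, h, h⟩
  | _ :: _, .cons _ _, x, _, _, s, y => by
    obtain ⟨U, h, h'⟩ := exists_represents_inr x.2 s y
    exact ⟨U, h, represents_there x.1 h'⟩

/-- A cell in a place in the middle. -/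
theorem exists_represents_at {Y : Model T w} (u : EltCell Y.toFun) {d : Ar Δ.length}
    (z : Dom Δ d) : ∀ {Γ : List (Model T w)} {a : Ar Γ.length} (x : Dom Γ a),
    ∃ σ : WHom ((Dom.map (Γ ++ Y :: Δ) (Step.inr Γ (Δ := Y :: Δ) a (.here u.α d))).obj
        ((Dom.joinAt Γ Δ Y a u.m d).obj (x, (u.p, z))))
        ((Dom.joinAt Γ Δ Y a u.n d).obj (x, (u.q, z))) w,
      Represents ⟨(Pt.mk x).toList, u, (Pt.mk z).toList⟩ ⟨_, σ⟩ ∧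
        WEq σ (u.cell.map (Prod.sectL _ z ⋙ Prod.sectR x _ ⋙ Dom.joinAt Γ Δ Y a u.n d))
  | [], a, x => by
    refine ⟨_, Represents.here u (.mk z), ?_⟩
    cases u.cell <;> exact .refl
  | X :: Γ, .cons m a, x => by
    obtain ⟨σ, h, h'⟩ := exists_represents_at u z x.2
    refine ⟨_, h.there ⟨x.1⟩, (h'.map _).trans (.of_eq ?_)⟩
    cases u.cell <;> rfl

end PtCell

namespace MultiMap

section

variable {Γ : List (Model T w)} {Z : Model T w}

theorem mk_obj (f : MultiMap μ Γ Z) {a : Ar Γ.length} (x : Dom Γ a) :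
    (⟨(f.app a).obj x⟩ : Elt Z.toFun) = f.val (Pt.mk x).toList (Pt.map_fst_toList _) :=
  (f.val_eq _ (x := .mk x) rfl).symm

theorem mk_map (f : MultiMap μ Γ Z) {a : Ar Γ.length} {x y : Dom Γ a} (q : x ⟶ y) :
    (⟨(f.app a).map q⟩ : EltHom Z.toFun) =
      valHom (𝟙 f) (PtHom.mk q).toList (PtHom.map_fst_toList _) := by
  rw [valHom_eq (𝟙 f) _ (x := .mk q) rfl]
  exact (congrArg (EltHom.mk (F := Z.toFun)) (Category.comp_id _)).symm

theorem mk_map_comp {f g : MultiMap μ Γ Z} (φ : f ⟶ g) {a : Ar Γ.length} {x y : Dom Γ a}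
    (q : x ⟶ y) : (⟨(f.app a).map q ≫ (Modif.app φ a).app y⟩ : EltHom Z.toFun) =
      valHom φ (PtHom.mk q).toList (PtHom.map_fst_toList _) :=
  (valHom_eq φ _ (x := .mk q) rfl).symm

theorem mk_app {f g : MultiMap μ Γ Z} (φ : f ⟶ g) {a : Ar Γ.length} (x : Dom Γ a) :
    (⟨(Modif.app φ a).app x⟩ : EltHom Z.toFun) =
      valHom φ (PtHom.mk (𝟙 x)).toList (PtHom.map_fst_toList _) := by
  rw [← mk_map_comp, CategoryTheory.Functor.map_id, Category.id_comp]

theorem mk_cell (f : MultiMap μ Γ Z) {a b : Ar Γ.length} {s : Step T a b} {x : Dom Γ a}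
    {U : MultiCell T w} (hU : PtCell.Represents U (.id s x)) :
    (⟨μ.tensMap s, (f.cell s).appAt x⟩ : EltCell Z.toFun) = f.valCell U hU.sources := by
  rw [f.valCell_eq _ hU]
  exact (PreMultiMap.arr_id f.toPre s x).symm

end

variable {Γ Ξ Δ : List (Model T w)} {Y Z : Model T w} {f f' : MultiMap μ (Γ ++ Y :: Δ) Z}
  {g g' : MultiMap μ Ξ Y}

/-- The components of a composite, up to reindexing along `(a b) c = a (b c)`. -/
theorem subst_app (f : MultiMap μ (Γ ++ Y :: Δ) Z) (g : MultiMap μ Ξ Y) (a : Ar Γ.length)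
    (x : Ar Ξ.length) (d : Ar Δ.length) :
    Dom.join₃ Γ Ξ Δ a x d ⋙ (f.subst g).app _ ⋙ reindex Γ Ξ Δ Y Z a x d =
      inner Γ Δ g a x d ⋙ f.app _ := by
  refine Functor.hext (fun ⟨p, q, r⟩ => ?_) (fun ⟨p, q, r⟩ ⟨p', q', r'⟩ k => ?_)
  · refine Elt.obj_eq (G := Z.toFun) ?_
    refine (Elt.reindex (Ar.tens_subst Γ Ξ Δ Y a x d) rfl).trans ?_
    refine (mk_obj _ _).trans (.trans ?_ (mk_obj _ _).symm)
    rw [val_subst, f.substVal_eq g (x := (Pt.mk p).toList) (y := (Pt.mk q).toList)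
      (z := (Pt.mk r).toList) ?_ (Pt.map_fst_toList _) (Pt.map_fst_toList _) (Pt.map_fst_toList _)]
    · refine val_congr _ ?_ _ _
      refine Eq.trans ?_ (Dom.toList_join (Δ := Y :: Δ) (d := .cons x.tens d) p ((g.app x).obj q, r)).symm
      exact congrArg (fun e => (Pt.mk p).toList ++ ⟨Y, e⟩ :: (Pt.mk r).toList) (mk_obj g q).symm
    · exact (Dom.toList_join _ _).trans (congrArg _ (Dom.toList_join _ _))
  · obtain ⟨k₁, k₂, k₃⟩ := k
    refine (EltHom.homEq (G := Z.toFun) ?_).heq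
    refine (EltHom.reindex (Ar.tens_subst Γ Ξ Δ Y a x d) .refl).trans ?_
    refine (mk_map _ _).trans (.trans ?_ (mk_map _ _).symm)
    rw [valHom_subst, substHom_eq _ _ (x := (PtHom.mk k₁).toList) (y := (PtHom.mk k₂).toList)
      (z := (PtHom.mk k₃).toList) ?_ (PtHom.map_fst_toList _) (PtHom.map_fst_toList _)
      (PtHom.map_fst_toList _)]
    · refine valHom_congr _ ?_ _ _
      refine Eq.trans ?_ (Dom.toList_join_map (Δ := Y :: Δ) (d := .cons x.tens d) k₁
        (Prod.mkHom ((g.app x).map k₂) k₃)).symm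
      exact congrArg (fun e => (PtHom.mk k₁).toList ++ ⟨Y, e⟩ :: (PtHom.mk k₃).toList)
        (mk_map g k₂).symm
    · exact (Dom.toList_join_map k₁ ((Dom.join Ξ x d).map (Prod.mkHom k₂ k₃))).trans
        (congrArg _ (Dom.toList_join_map k₂ k₃))

/-- The horizontal composite that is defined by values is the one by pasting. -/
theorem isSubst₂_subst₂ (φ : f ⟶ f') (γ : g ⟶ g') : IsSubst₂ φ γ (subst₂ φ γ) := by
  intro a x d
  refine HomEq.natTrans (subst_app f g a x d) (subst_app f' g' a x d) fun ⟨p, q, r⟩ => ?_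
  refine EltHom.homEq (G := Z.toFun) ?_
  refine (EltHom.reindex (Ar.tens_subst Γ Ξ Δ Y a x d) .refl).trans ?_
  refine (mk_app _ _).trans ?_
  have e : (PtHom.mk (𝟙 ((Dom.join₃ Γ Ξ Δ a x d).obj (p, q, r)))).toList =
      (PtHom.mk (𝟙 p)).toList ++ ((PtHom.mk (𝟙 q)).toList ++ (PtHom.mk (𝟙 r)).toList) := by
    rw [← CategoryTheory.Functor.map_id]
    exact (Dom.toList_join_map (𝟙 p) ((Dom.join Ξ x d).map (Prod.mkHom (𝟙 q) (𝟙 r)))).trans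
        (congrArg _ (Dom.toList_join_map (𝟙 q) (𝟙 r)))
  rw [valHom_subst₂, substHom_eq φ γ e (PtHom.map_fst_toList _) (PtHom.map_fst_toList _)
    (PtHom.map_fst_toList _)]
  have e' := mk_map_comp φ ((Dom.joinAt Γ Δ Y a x.tens d).map
    (Prod.mkHom (𝟙 p) (Prod.mkHom ((Modif.app γ x).app q) (𝟙 r))))
  refine Eq.trans ?_ (e'.symm.trans (congrArg (EltHom.mk (F := Z.toFun)) ?_))
  · refine valHom_congr _ ?_ _ _
    refine Eq.trans ?_ (Dom.toList_join_map (Δ := Y :: Δ) (d := .cons x.tens d) (𝟙 p)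
      (Prod.mkHom ((Modif.app γ x).app q) (𝟙 r))).symm
    exact congrArg (fun e => (PtHom.mk (𝟙 p)).toList ++ ⟨Y, e⟩ :: (PtHom.mk (𝟙 r)).toList)
      (mk_app γ q).symm
  · exact (Modif.app φ _).naturality _

/-- The composite that is defined by values is the composite by pasting. -/
theorem isSubst_subst (f : MultiMap μ (Γ ++ Y :: Δ) Z) (g : MultiMap μ Ξ Y) :
    IsSubst f g (f.subst g) where
  app := subst_app f g
  cell_left {a b} s x d := by
    have hα : μ.tensU (s.inl Γ (Ar.append Ξ x d)) =
        μ.tensU (s.inl Γ (Δ := Y :: Δ) (.cons x.tens d)) := by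
      rw [μ.tensU_inl, μ.tensU_inl, Ar.tens_append, Ar.tens_cons]
    have hF : Dom.join₃ Γ Ξ Δ a x d ⋙ Dom.map (Γ ++ (Ξ ++ Δ)) (s.inl Γ (Ar.append Ξ x d)) =
        (Dom.map Γ s).prod (𝟭 _) ⋙ Dom.join₃ Γ Ξ Δ b x d :=
      congrArg ((𝟭 _).prod (Dom.join Ξ x d) ⋙ ·) (Dom.join_inl Γ s (Ar.append Ξ x d))
    have hG : inner Γ Δ g a x d ⋙ Dom.map (Γ ++ Y :: Δ) (s.inl Γ (Δ := Y :: Δ) (.cons x.tens d)) =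
        (Dom.map Γ s).prod (𝟭 _) ⋙ inner Γ Δ g b x d :=
      congrArg ((Dom.mid _ _ _ _).obj (g.app x) ⋙ ·)
        (Dom.join_inl Γ (Δ := Y :: Δ) s (.cons x.tens d))
    refine WEq.of_appAt ?_ ?_ fun ⟨p, q, r⟩ => ?_
    · refine (congrArg (fun F => Dom.join₃ Γ Ξ Δ a x d ⋙ (f.subst g).app _ ⋙ F)
        (OneCell.reindex (X := Z) (Ar.tens_subst Γ Ξ Δ Y a x d) (Ar.tens_subst Γ Ξ Δ Y b x d)
          hα)).trans ?_
      exact congrArg (· ⋙ Z.toFun.fn _) (subst_app f g a x d)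
    · refine (congrArg (fun F => F ⋙ (f.subst g).app _ ⋙ reindex Γ Ξ Δ Y Z b x d) hF).trans ?_
      refine (congrArg ((Dom.map Γ s).prod (𝟭 _) ⋙ ·) (subst_app f g b x d)).trans ?_
      exact congrArg (· ⋙ f.app _) hG.symm
    · rw [WHom.appAt_whL, WHom.appAt_whL, WHom.appAt_whR]
      refine EltCell.wEq_reindex (Ar.tens_subst Γ Ξ Δ Y b x d) ?_
      obtain ⟨U, h, h₁⟩ := PtCell.exists_represents_inl s p ((Dom.join Ξ x d).obj (q, r))
      obtain ⟨U', h', h₂⟩ := PtCell.exists_represents_inl (Δ := Y :: Δ) s p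
        (d := .cons x.tens d) ((g.app x).obj q, r)
      obtain rfl := h.inj h'
      refine (mk_cell _ h₁).trans (.trans ?_ (mk_cell _ h₂).symm)
      rw [valCell_subst, f.substCell_left g _ (congrArg _ (Dom.toList_join q r)) h.sources
        (Pt.map_fst_toList _) (Pt.map_fst_toList _)]
      refine valCell_congr _ ?_ _ _
      exact congrArg (fun e => MultiCell.mk U.left U.cell (U.right ++ ⟨Y, e⟩ :: (Pt.mk r).toList))
        (mk_obj g q).symm
  cell_right a x {d e} s := by
    have hα : μ.tensU (Step.inr Γ a (.inr Ξ x s)) =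
        μ.tensU (Step.inr Γ (Δ := Y :: Δ) a (.there x.tens s)) := by
      rw [μ.tensU_inr, μ.tensU_inr, μ.tensU_inr, μ.tensU_there]
    have hF : Dom.join₃ Γ Ξ Δ a x d ⋙ Dom.map (Γ ++ (Ξ ++ Δ)) (.inr Γ a (.inr Ξ x s)) =
        (𝟭 _).prod ((𝟭 _).prod (Dom.map Δ s)) ⋙ Dom.join₃ Γ Ξ Δ a x e := by
      refine (congrArg ((𝟭 _).prod (Dom.join Ξ x d) ⋙ ·)
        (Dom.join_inr Γ a (.inr Ξ x s))).trans ?_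
      exact congrArg (fun F => (𝟭 _).prod F ⋙ Dom.join Γ a _) (Dom.join_inr Ξ x s)
    have hG : inner Γ Δ g a x d ⋙ Dom.map (Γ ++ Y :: Δ) (.inr Γ (Δ := Y :: Δ) a (.there x.tens s)) =
        (𝟭 _).prod ((𝟭 _).prod (Dom.map Δ s)) ⋙ inner Γ Δ g a x e :=
      congrArg ((Dom.mid _ _ _ _).obj (g.app x) ⋙ ·)
        (Dom.join_inr Γ (Δ := Y :: Δ) a (.there x.tens s))
    refine WEq.of_appAt ?_ ?_ fun ⟨p, q, r⟩ => ?_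
    · refine (congrArg (fun F => Dom.join₃ Γ Ξ Δ a x d ⋙ (f.subst g).app _ ⋙ F)
        (OneCell.reindex (X := Z) (Ar.tens_subst Γ Ξ Δ Y a x d) (Ar.tens_subst Γ Ξ Δ Y a x e)
          hα)).trans ?_
      exact congrArg (· ⋙ Z.toFun.fn _) (subst_app f g a x d)
    · refine (congrArg (fun F => F ⋙ (f.subst g).app _ ⋙ reindex Γ Ξ Δ Y Z a x e) hF).trans ?_
      refine (congrArg ((𝟭 _).prod ((𝟭 _).prod (Dom.map Δ s)) ⋙ ·) (subst_app f g a x e)).trans ?_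
      exact congrArg (· ⋙ f.app _) hG.symm
    · rw [WHom.appAt_whL, WHom.appAt_whL, WHom.appAt_whR]
      refine EltCell.wEq_reindex (Ar.tens_subst Γ Ξ Δ Y a x e) ?_
      obtain ⟨V, h, h₀⟩ := PtCell.exists_represents_inr q s r
      obtain ⟨V', h', h₁⟩ := PtCell.exists_represents_inr p (.inr Ξ x s)
        ((Dom.join Ξ x d).obj (q, r))
      obtain rfl := h₀.inj h'
      obtain ⟨U', h', h₂⟩ := PtCell.exists_represents_inr (Δ := Y :: Δ) p (.there x.tens s)
        ((g.app x).obj q, r)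
      have h₃ := PtCell.represents_there (X := Y) ((g.app x).obj q) h
      obtain rfl := h₃.inj h'
      refine (mk_cell _ h₁).trans (.trans ?_ (mk_cell _ h₂).symm)
      rw [valCell_subst, f.substCell_right g _ rfl (Pt.map_fst_toList _) (Pt.map_fst_toList _)
        h.sources]
      refine valCell_congr _ ?_ _ _
      exact congrArg (fun e => MultiCell.mk ((Pt.mk p).toList ++ ⟨Y, e⟩ :: V.left) V.cell V.right)
        (mk_obj g q).symm
  cell_mid a {x y} s d := by
    have hα : μ.tensU (Step.inr Γ a (s.inl Ξ d)) =
        μ.tensU (Step.inr Γ (Δ := Y :: Δ) a (.here (μ.tensMap s) d)) := by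
      rw [μ.tensU_inr, μ.tensU_inr, μ.tensU_inl, μ.tensU_here]
      rfl
    have hF : Dom.join₃ Γ Ξ Δ a x d ⋙ Dom.map (Γ ++ (Ξ ++ Δ)) (.inr Γ a (s.inl Ξ d)) =
        (Dom.mid _ _ _ _).obj (Dom.map Ξ s) ⋙ Dom.join₃ Γ Ξ Δ a y d := by
      refine (congrArg ((𝟭 _).prod (Dom.join Ξ x d) ⋙ ·)
        (Dom.join_inr Γ a (s.inl Ξ d))).trans ?_
      exact congrArg (fun F => (𝟭 _).prod F ⋙ Dom.join Γ a _) (Dom.join_inl Ξ s d)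
    refine WEq.of_appAt ?_ ?_ fun ⟨p, q, r⟩ => ?_
    · refine (congrArg (fun F => Dom.join₃ Γ Ξ Δ a x d ⋙ (f.subst g).app _ ⋙ F)
        (OneCell.reindex (X := Z) (Ar.tens_subst Γ Ξ Δ Y a x d) (Ar.tens_subst Γ Ξ Δ Y a y d)
          hα)).trans ?_
      exact congrArg (· ⋙ Z.toFun.fn _) (subst_app f g a x d)
    · refine (congrArg (fun F => F ⋙ (f.subst g).app _ ⋙ reindex Γ Ξ Δ Y Z a y d) hF).trans ?_
      exact congrArg ((Dom.mid _ _ _ _).obj (Dom.map Ξ s) ⋙ ·) (subst_app f g a y d)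
    · rw [WHom.appAt_whL, WHom.appAt_whR]
      refine EltCell.wEq_reindex (α' := μ.tensMap (Step.inr Γ (Δ := Y :: Δ) a
        (.here (μ.tensMap s) d))) (p' := (inner Γ Δ g a x d ⋙ f.app _).obj (p, q, r))
        (Ar.tens_subst Γ Ξ Δ Y a y d) ?_
      obtain ⟨V, h, h₀⟩ := PtCell.exists_represents_inl s q r
      obtain ⟨V', h', h₁⟩ := PtCell.exists_represents_inr p (s.inl Ξ d)
        ((Dom.join Ξ x d).obj (q, r))
      obtain rfl := h₀.inj h'
      obtain ⟨σ, h₂, h₃⟩ := PtCell.exists_represents_at (Y := Y)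
        (⟨μ.tensMap s, (g.cell s).appAt q⟩ : EltCell Y.toFun) r p
      refine (mk_cell _ h₁).trans ?_
      rw [valCell_subst, f.substCell_mid g _ rfl rfl (Pt.map_fst_toList _) h.sources
        (Pt.map_fst_toList _)]
      have h₄ := f.valCell_eq (PtCell.Represents.sources h₂) h₂
      refine Eq.trans ?_ (h₄.trans (EltCell.mk_congr rfl rfl rfl ?_))
      · refine valCell_congr _ ?_ _ _
        exact congrArg (fun e => MultiCell.mk (Pt.mk p).toList e (Pt.mk r).toList)
          (mk_cell g h).symm
      · rw [WHom.appAt_compEq, WHom.appAt_whL]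
        refine WEq.comp (WEq.comp_ofEq _ _).symm ?_
        refine (h₃.map _).trans ?_
        rw [WHom.map_map, WHom.appAt_whR]
        refine .of_eq ?_
        cases g.cell s <;> rfl

variable (μ) in
theorem multicategory_isModels : (multicategory μ).IsModels where
  one _ := rfl
  comp f g := isSubst_subst f g
  comp₂ φ γ := isSubst₂_subst₂ φ γ

end MultiMap

end Pasting


/-! ### The power of a model, and the model structure on homomorphisms -/

section Joint

variable {w : Weakness} {A : Type u₁} [Category.{v₁} A] {ι : Type*} {E : ι → Type*}
  [∀ i, Category* (E i)] {K : ∀ i, A ⥤ E i}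

namespace JointIso

theorem detectsEquality (h : (Functor.pi' K).IsIso) : DetectsEquality K := fun _ _ _ _ e =>
  (Functor.pi' K).map_injective (funext e)

theorem obj_ext (h : (Functor.pi' K).IsIso) {x y : A} (e : ∀ i, (K i).obj x = (K i).obj y) :
    x = y :=
  h.bijective_obj.1 (funext e)

theorem exists_obj (h : (Functor.pi' K).IsIso) (z : ∀ i, E i) :
    ∃ x, ∀ i, (K i).obj x = z i := by
  obtain ⟨x, hx⟩ := h.bijective_obj.2 z
  exact ⟨x, congrFun hx⟩

theorem exists_cell (h : (Functor.pi' K).IsIso) {x y : A}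
    (s : ∀ i, WHom ((K i).obj x) ((K i).obj y) w) : ∃ t : WHom x y w, ∀ i, t.map (K i) = s i := by
  refine ⟨(WHom.ofPi s).unmap (Functor.pi' K) (x := x) (y := y), fun i => ?_⟩
  have := congrArg (WHom.map (Pi.eval E i)) (WHom.map_unmap (Functor.pi' K) (x := x) (y := y)
    (WHom.ofPi s))
  rw [WHom.map_map] at this
  exact this.trans (WHom.ofPi_map_eval s i)

theorem isId (h : (Functor.pi' K).IsIso) {x y : A} {s : WHom x y w}
    (e : ∀ i, (s.map (K i)).IsId) : s.IsId := by
  obtain rfl := obj_ext h fun i => (e i).choose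
  exact ⟨rfl, WHom.ext_of_joint (detectsEquality h) fun i => by
    rw [WHom.map_ofEq]; exact (e i).choose_spec⟩

theorem wEq (h : (Functor.pi' K).IsIso) {x y x' y' : A} {s : WHom x y w} {s' : WHom x' y' w}
    (hx : x = x') (hy : y = y') (e : ∀ i, WEq (s.map (K i)) (s'.map (K i))) : WEq s s' := by
  subst hx hy
  exact .of_eq (WHom.ext_of_joint (detectsEquality h) fun i => (e i).eq)

end JointIso

theorem HomEq.map_congr {B : Type u₂} [Category.{v₂} B] {F G : A ⥤ B} (h : F = G) {x y : A}
    (f : x ⟶ y) : HomEq (F.map f) (G.map f) := by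
  subst h; exact .refl

end Joint

section Blocks

variable {A : Type u₁} [Category.{v₁} A] {C : Type u₂} [Category.{v₂} C]

open WCommutativity in
/-- The power `C ^ (m k)` is the power `(C ^ k) ^ m`, by projecting onto blocks. -/
theorem isIso_blocks (m k : ℕ) : (Functor.pi' fun i : Fin m =>
    (Functor.whiskeringRight A (∀ _ : Fin (m * k), C) (∀ _ : Fin k, C)).obj
      (Pi.comap (fun _ => C) (block i k))).IsIso where
  faithful := ⟨fun {F G a b} h => by
    ext x j
    obtain ⟨⟨i, j⟩, rfl⟩ := finProdFinEquiv.surjective j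
    exact congrFun (NatTrans.congr_app (congrFun h i) x) j⟩
  full := ⟨fun {F G} τ => by
    let τ' : ∀ i, F ⋙ Pi.comap (fun _ => C) (block i k) ⟶ G ⋙ Pi.comap (fun _ => C) (block i k) := τ
    refine ⟨⟨fun x => Equiv.piCongrLeft (fun j => F.obj x j ⟶ G.obj x j) finProdFinEquiv
      fun p => (τ' p.1).app x p.2, fun x y f => ?_⟩, ?_⟩
    · funext j
      obtain ⟨⟨i, j⟩, rfl⟩ := finProdFinEquiv.surjective j
      have := congrFun ((τ' i).naturality f) j
      have e (x) : Equiv.piCongrLeft (fun j => F.obj x j ⟶ G.obj x j) finProdFinEquiv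
          (fun p => (τ' p.1).app x p.2) (finProdFinEquiv (i, j)) = (τ' i).app x j :=
        Equiv.piCongrLeft_apply_apply _ _ _ _
      change F.map f _ ≫ _ = _ ≫ G.map f _
      rw [e, e]
      exact this
    · funext i
      refine NatTrans.ext (funext fun x => funext fun j => ?_)
      exact Equiv.piCongrLeft_apply_apply (fun j => F.obj x j ⟶ G.obj x j) finProdFinEquiv
        (fun p => (τ' p.1).app x p.2) (i, j)⟩
  bijective_obj := by
    constructor
    · intro F G h
      have e (j) : F ⋙ Pi.eval (fun _ => C) j = G ⋙ Pi.eval (fun _ => C) j := by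
        obtain ⟨⟨i, j⟩, rfl⟩ := finProdFinEquiv.surjective j
        exact congrArg (· ⋙ Pi.eval (fun _ => C) j) (congrFun h i)
      exact congrArg Functor.pi' (funext e)
    · intro F
      let G (p : Fin m × Fin k) : A ⥤ C := F p.1 ⋙ Pi.eval (fun _ => C) p.2
      refine ⟨Functor.pi' fun j => G (finProdFinEquiv.symm j), funext fun i => ?_⟩
      change Functor.pi' (fun j => G (finProdFinEquiv.symm (finProdFinEquiv (i, j)))) = F i
      simp only [Equiv.symm_apply_apply]
      rfl

end Blocks

namespace WCommutativity

variable {T : LawvereTwoTheory 𝕋} {w : Weakness} (μ : WCommutativity T w) (Y Z : Model T w)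

theorem tensorL_block {m : ℕ} (i : Fin m) {k l : ℕ} (β : T.ob k ⟶ T.ob l) :
    (μ.tensorL Z m).fn β ⋙ Pi.comap (fun _ => Z.carrier) (block i l) =
      Pi.comap (fun _ => Z.carrier) (block i k) ⋙ Z.toFun.fn β := by
  rw [← Z.str.tight, ← Z.str.tight]
  refine Eq.trans ?_ ((congrArg (Z.str.hom _ _).obj (μ.block_comm i β)).symm.trans
    (Z.str.map_comp _ _))
  exact (Z.str.map_comp _ _).symm

variable {Y Z}

theorem comp_proj_cell {m : ℕ} (f : Y.toFun ⟶ μ.tensorL Z m) (i : Fin m) {k l : ℕ}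
    (β : T.ob k ⟶ T.ob l) :
    WEq (WTrans.cell (f ≫ μ.proj Z i) β)
      ((WTrans.cell f β).whR (Pi.comap (fun _ => Z.carrier) (block i l))) :=
  WEq.isId_comp (s := (WTrans.cell (μ.proj Z i) β).whL (WTrans.app f k)) (.map _ ⟨_, rfl⟩) _

variable (Y Z)

/-- Homomorphisms to a power of `Z` are families of homomorphisms to `Z`, because `Z^(m k)` is the
power `(Z^k)^m` by projecting onto blocks and the projections are strict. -/
instance isIso_powerComparison (m : ℕ) : (μ.powerComparison Y Z m).IsIso where
  faithful := ⟨fun {f g a b} h => WTrans.hom_ext fun k =>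
    JointIso.detectsEquality (isIso_blocks m k) _ _ fun i =>
      congrArg (fun η => WTrans.Modif.app η k) (congrFun h i)⟩
  full := ⟨fun {f g} τ => by
    let τ' : ∀ i, f ≫ μ.proj Z i ⟶ g ≫ μ.proj Z i := τ
    have h (k) : ∃ a : WTrans.app f k ⟶ WTrans.app g k, ∀ i,
        Functor.whiskerRight a (Pi.comap (fun _ => Z.carrier) (block i k)) =
          WTrans.Modif.app (τ' i) k := by
      obtain ⟨a, ha⟩ := (isIso_blocks (A := ∀ _ : Fin k, Y.carrier) (C := Z.carrier) m k).full.map_surjective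
        (X := WTrans.app f k) (Y := WTrans.app g k) fun i => WTrans.Modif.app (τ' i) k
      exact ⟨a, congrFun ha⟩
    choose a ha using h
    refine ⟨⟨a, fun {k l} β => ?_⟩, funext fun i => WTrans.hom_ext fun k => ha k i⟩
    refine WHom.sq_of_joint (JointIso.detectsEquality (isIso_blocks m l)) fun i => ?_
    refine (WTrans.Modif.sq (τ' i) β).congr (μ.comp_proj_cell f i β) (μ.comp_proj_cell g i β)
      ?_ ?_
    · rw [← ha]
      exact HomEq.map_congr (congrArg (Functor.whiskeringRight _ _ _).obj
        (μ.tensorL_block Z i β).symm) (a k)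
    · rw [← ha]
      exact .refl⟩
  bijective_obj := by
    constructor
    · intro f g h
      have e (k) : WTrans.app f k = WTrans.app g k := JointIso.obj_ext (isIso_blocks m k)
        fun i => congrArg (fun t => WTrans.app t k) (congrFun h i)
      refine WTrans.ext' (funext e) fun {k l} β => ?_
      refine JointIso.wEq (isIso_blocks m l) ?_ ?_ fun i => ?_
      · rw [e]
      · rw [e]
      · refine (μ.comp_proj_cell f i β).symm.trans (.trans ?_ (μ.comp_proj_cell g i β))
        have := congrFun h i
        change f ≫ μ.proj Z i = g ≫ μ.proj Z i at this
        rw [this]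
        exact .refl
    · intro t
      let t' : ∀ _ : Fin m, Y.toFun ⟶ Z.toFun := t
      choose a ha using fun k => JointIso.exists_obj
        (isIso_blocks (A := ∀ _ : Fin k, Y.carrier) (C := Z.carrier) m k) fun i => WTrans.app (t' i) k
      replace ha : ∀ k i, a k ⋙ Pi.comap (fun _ => Z.carrier) (block i k) = WTrans.app (t' i) k := ha
      have hs {k l} (i) (β : T.ob k ⟶ T.ob l) :
          (a k ⋙ (μ.tensorL Z m).fn β) ⋙ Pi.comap (fun _ => Z.carrier) (block i l) =
            WTrans.app (t' i) k ⋙ Z.toFun.fn β := by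
        rw [← ha]
        exact congrArg (a k ⋙ ·) (μ.tensorL_block Z i β)
      have ht {k l} (i) (β : T.ob k ⟶ T.ob l) :
          Y.toFun.fn β ⋙ WTrans.app (t' i) l =
            (Y.toFun.fn β ⋙ a l) ⋙ Pi.comap (fun _ => Z.carrier) (block i l) := by
        rw [← ha]
        rfl
      have hc {k l} (β : T.ob k ⟶ T.ob l) :
          ∃ c : WHom (a k ⋙ (μ.tensorL Z m).fn β) (Y.toFun.fn β ⋙ a l) w, ∀ i,
            WEq (c.whR (Pi.comap (fun _ => Z.carrier) (block i l))) (WTrans.cell (t' i) β) := by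
        obtain ⟨c, hc⟩ := JointIso.exists_cell (isIso_blocks m l)
          (x := a k ⋙ (μ.tensorL Z m).fn β) (y := Y.toFun.fn β ⋙ a l) fun i =>
            ((WHom.ofEq (hs i β)).comp (WTrans.cell (t' i) β)).comp (WHom.ofEq (ht i β))
        exact ⟨c, fun i => (WEq.of_eq (hc i)).trans ((WEq.comp_ofEq _ _).trans (WEq.ofEq_comp _ _))⟩
      choose c hc using @hc
      have key : ∃ f : Y.toFun ⟶ μ.tensorL Z m, WTrans.app f = a ∧
          ∀ {k l} (β : T.ob k ⟶ T.ob l), WEq (WTrans.cell f β) (c β) :=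
        ⟨{  app := a
            cell := c
            cell_tight := fun {k l} p => JointIso.isId (isIso_blocks m l) fun i =>
              (hc _ i).isId (WTrans.cell_tight (t' i) p)
            cell_comp := fun {k l j} α β => by
              refine JointIso.wEq (isIso_blocks m j) ?_ ?_ fun i => ?_
              · exact congrArg (a k ⋙ ·) ((μ.tensorL Z m).act.map_comp α β)
              · exact congrArg (· ⋙ a j) (Y.str.map_comp α β)
              · refine (hc _ i).trans ((WTrans.cell_comp (t' i) α β).trans ?_)
                refine WEq.trans ?_ (WEq.of_eq (WHom.map_comp _ _ _)).symm
                refine .comp ?_ ?_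
                · refine ((hc α i).symm.map _).trans ?_
                  exact WHom.map_congr' _ (congrArg (Functor.whiskeringRight _ _ _).obj
                    (μ.tensorL_block Z i β).symm)
                · refine ((hc β i).symm.map _).trans ?_
                  exact WHom.map_congr' _ rfl
            cell_nat := fun {k l α β} η => by
              refine WHom.sq_of_joint (JointIso.detectsEquality (isIso_blocks m l)) fun i => ?_
              refine (WTrans.cell_nat (t' i) η).congr (hc α i).symm (hc β i).symm ?_ ?_
              · have h := WTrans.cell_nat (μ.proj Z i) η
                have h' := HomEq.of_sq h ⟨_, rfl⟩ ⟨_, rfl⟩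
                refine HomEq.trans ?_ (h'.map ((Functor.whiskeringLeft _ _ _).obj (a k)))
                rw [← ha]
                exact .refl
              · rw [← ha]
                exact .refl }, rfl, fun _ => .refl⟩
      obtain ⟨f, hf, hf'⟩ := key
      refine ⟨f, funext fun i => WTrans.ext' (funext fun k => ?_) fun β => ?_⟩
      · refine Eq.trans ?_ (ha k i)
        exact congrArg (· ⋙ Pi.comap (fun _ => Z.carrier) (block i k)) (congrFun hf k)
      · exact (μ.comp_proj_cell f i β).trans (((hf' β).map _).trans (hc β i))

end WCommutativity


section

variable {T : LawvereTwoTheory 𝕋} {w : Weakness}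

theorem HomEq.modif {F G : TwoFun T w} {f g f' g' : F ⟶ G} {a : f ⟶ g} {b : f' ⟶ g'}
    (hf : f = f') (hg : g = g')
    (h : ∀ n, HomEq (WTrans.Modif.app a n) (WTrans.Modif.app b n)) : HomEq a b := by
  subst hf hg
  exact .of_eq (WTrans.hom_ext fun n => eq_of_heq (h n).heq)

namespace CatAction

variable {O P : ℕ → Type u} [∀ n, Category.{u} (O n)] [∀ n, Category.{u} (P n)]

theorem strictInv_comp {A : Type u} [Category.{u} A] {B : Type u} [Category.{u} B] (Q : A ⥤ B)
    [Q.IsIso] : Q.strictInv ⋙ Q = 𝟭 B ∧ Q ⋙ Q.strictInv = 𝟭 A :=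
  ⟨Q.asIsomorphism.counit_eq, Q.asIsomorphism.unit_eq.symm⟩

/-- Transport of an action along isomorphisms of categories. -/
noncomputable def transport (F : CatAction T O) (Q : ∀ n, O n ⥤ P n) [∀ n, (Q n).IsIso] :
    CatAction T P where
  hom m n := F.hom m n ⋙ (Functor.whiskeringLeft _ _ _).obj (Q m).strictInv ⋙
    (Functor.whiskeringRight _ _ _).obj (Q n)
  map_id m := by
    change (Q m).strictInv ⋙ (F.hom m m).obj (𝟙 _) ⋙ Q m = _
    rw [F.map_id]
    exact (strictInv_comp (Q m)).1
  map_comp {m n k} α β := by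
    change (Q m).strictInv ⋙ (F.hom m k).obj _ ⋙ Q k =
      (Q m).strictInv ⋙ (F.hom m n).obj α ⋙ (Q n ⋙ (Q n).strictInv) ⋙ (F.hom n k).obj β ⋙ Q k
    rw [F.map_comp, (strictInv_comp (Q n)).2]
    rfl
  map_whiskerLeft {m n k} α β β' η := by
    refine ((F.map_whiskerLeft α η).map ((Functor.whiskeringLeft _ _ _).obj (Q m).strictInv ⋙
      (Functor.whiskeringRight _ _ _).obj (Q k))).trans ?_
    have h := HomEq.map_congr (congrArg (fun G => (Functor.whiskeringLeft _ _ _).obj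
      ((Q m).strictInv ⋙ (F.hom m n).obj α ⋙ G) ⋙ (Functor.whiskeringRight _ _ _).obj (Q k))
        (strictInv_comp (Q n)).2.symm) ((F.hom n k).map η)
    exact h
  map_whiskerRight {m n k} α α' η β := by
    refine ((F.map_whiskerRight η β).map ((Functor.whiskeringLeft _ _ _).obj (Q m).strictInv ⋙
      (Functor.whiskeringRight _ _ _).obj (Q k))).trans ?_
    have h := HomEq.map_congr (congrArg (fun G => (Functor.whiskeringLeft _ _ _).obj
      (Q m).strictInv ⋙ (Functor.whiskeringRight _ _ _).obj (G ⋙ (F.hom n k).obj β ⋙ Q k))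
        (strictInv_comp (Q n)).2.symm) ((F.hom m n).map η)
    exact h

theorem transport_obj (F : CatAction T O) (Q : ∀ n, O n ⥤ P n) [∀ n, (Q n).IsIso] {m n : ℕ}
    (α : T.ob m ⟶ T.ob n) :
    Q m ⋙ ((F.transport Q).hom m n).obj α = (F.hom m n).obj α ⋙ Q n := by
  change (Q m ⋙ (Q m).strictInv) ⋙ (F.hom m n).obj α ⋙ Q n = _
  rw [(strictInv_comp (Q m)).2]
  rfl

theorem transport_map (F : CatAction T O) (Q : ∀ n, O n ⥤ P n) [∀ n, (Q n).IsIso] {m n : ℕ}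
    {α α' : T.ob m ⟶ T.ob n} (η : α ⟶ α') :
    HomEq (Functor.whiskerLeft (Q m) (((F.transport Q).hom m n).map η))
      (Functor.whiskerRight ((F.hom m n).map η) (Q n)) := by
  have h := HomEq.map_congr (congrArg (fun G => (Functor.whiskeringLeft _ _ _).obj
      G ⋙ (Functor.whiskeringRight _ _ _).obj (Q n)) (strictInv_comp (Q m)).2) ((F.hom m n).map η)
  exact h

end CatAction

namespace WCommutativity

variable (μ : WCommutativity T w) (Y Z : Model T w)

theorem lift_cell {m n : ℕ} (α : T.ob m ⟶ T.ob n) {k l : ℕ} (β : T.ob k ⟶ T.ob l) :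
    WEq (WTrans.cell (μ.lift Z α) β) ((μ.gray α β).map (Z.str.hom (m * k) (n * l))) :=
  (WEq.comp_ofEq _ _).trans (WEq.ofEq_comp _ _)

theorem lift_id (m : ℕ) : μ.lift Z (𝟙 (T.ob m)) = 𝟙 (μ.tensorL Z m) := by
  refine WTrans.ext' (funext fun k => ?_) fun {k l} β => ?_
  · change (Z.str.hom _ _).obj (((μ.R k).hom m m).obj (𝟙 _)) = _
    rw [(μ.R k).map_id, Z.str.map_id]
    rfl
  · refine WHom.IsId.wEq ((μ.lift_cell Z _ β).isId ?_) ⟨rfl, rfl⟩ ?_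
    · rw [← T.θ_id]
      exact (μ.gray_tight_left _ β).map _
    · change (Z.str.hom _ _).obj (((μ.R k).hom m m).obj (𝟙 _)) ⋙ _ = _
      rw [(μ.R k).map_id, Z.str.map_id]
      rfl

/-- `Z(α ≫ α' ⊗ -)` is the composite of `Z(α ⊗ -)` and `Z(α' ⊗ -)`, by the law for Gray cells of
composites. -/
theorem lift_comp {m n o : ℕ} (α : T.ob m ⟶ T.ob n) (α' : T.ob n ⟶ T.ob o) :
    μ.lift Z (α ≫ α') = μ.lift Z α ≫ μ.lift Z α' := by
  refine WTrans.ext' (funext fun k => ?_) fun {k l} β => ?_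
  · change (Z.str.hom _ _).obj (((μ.R k).hom m o).obj (α ≫ α')) = _
    rw [(μ.R k).map_comp, Z.str.map_comp]
    rfl
  · refine (μ.lift_cell Z _ β).trans (((μ.gray_comp_left α α' β).map _).trans ?_)
    refine (WEq.of_eq (WHom.map_compEq _ _ _ _)).trans (.compEq ?_ ?_)
    · exact (Z.str.map_whiskerL _ _).trans ((μ.lift_cell Z α' β).symm.map _)
    · exact (Z.str.map_whiskerR _ _).trans ((μ.lift_cell Z α β).symm.map _)

/-- The functor `α ↦ Z(α ⊗ -)`, `η ↦ Z(η ⊗ -)`. -/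
def liftFunctor (m n : ℕ) : (T.ob m ⟶ T.ob n) ⥤ (μ.tensorL Z m ⟶ μ.tensorL Z n) where
  obj α := μ.lift Z α
  map η := μ.liftMap Z η
  map_id α := WTrans.hom_ext fun k => by
    change (Z.str.hom _ _).map (((μ.R k).hom m n).map (𝟙 α)) = _
    rw [CategoryTheory.Functor.map_id, CategoryTheory.Functor.map_id]
    rfl
  map_comp η θ := WTrans.hom_ext fun k => by
    change (Z.str.hom _ _).map (((μ.R k).hom m n).map (η ≫ θ)) = _
    rw [CategoryTheory.Functor.map_comp, CategoryTheory.Functor.map_comp]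
    rfl

open Bicategory in
theorem liftMap_whiskerLeft {m n k : ℕ} (α : T.ob m ⟶ T.ob n) {β β' : T.ob n ⟶ T.ob k}
    (η : β ⟶ β') : HomEq (μ.liftMap Z (α ◁ η)) (μ.lift Z α ◁ μ.liftMap Z η) :=
  .modif (μ.lift_comp Z α β) (μ.lift_comp Z α β') fun l =>
    (((μ.R l).map_whiskerLeft α η).map (Z.str.hom _ _)).trans (Z.str.map_whiskerLeft _ _)

open Bicategory in
theorem liftMap_whiskerRight {m n k : ℕ} {α α' : T.ob m ⟶ T.ob n} (η : α ⟶ α')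
    (β : T.ob n ⟶ T.ob k) : HomEq (μ.liftMap Z (η ▷ β)) (μ.liftMap Z η ▷ μ.lift Z β) :=
  .modif (μ.lift_comp Z α β) (μ.lift_comp Z α' β) fun l =>
    (((μ.R l).map_whiskerRight η β).map (Z.str.hom _ _)).trans (Z.str.map_whiskerRight _ _)

theorem postcomp_comp {F G K : TwoFun T w} (f : F ⟶ G) (g : G ⟶ K) (E : TwoFun T w) :
    Bicategory.postcomp E (f ≫ g) = Bicategory.postcomp E f ⋙ Bicategory.postcomp E g :=
  Functor.hext (fun h => (WTrans.comp_assoc h f g).symm) fun h h' _ =>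
    (HomEq.modif (WTrans.comp_assoc h f g).symm (WTrans.comp_assoc h' f g).symm
      fun _ => .refl).heq

theorem postcomp_id (F E : TwoFun T w) : Bicategory.postcomp E (𝟙 F) = 𝟭 _ :=
  Functor.hext (fun h => WTrans.comp_id h) fun h h' _ =>
    (HomEq.modif (WTrans.comp_id h) (WTrans.comp_id h') fun _ => .refl).heq

/-- The 2-functor `n ↦ Hom_w(Y, Zⁿ)`. -/
def homAct : CatAction T fun n => (Y.toFun ⟶ μ.tensorL Z n) where
  hom m n := μ.liftFunctor Z m n ⋙ Bicategory.postcomposing Y.toFun _ _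
  map_id m := (congrArg (Bicategory.postcomp Y.toFun) (μ.lift_id Z m)).trans (postcomp_id _ _)
  map_comp α β := (congrArg (Bicategory.postcomp Y.toFun) (μ.lift_comp Z α β)).trans
    (postcomp_comp _ _ _)
  map_whiskerLeft α β β' η := by
    refine ((μ.liftMap_whiskerLeft Z α η).map (Bicategory.postcomposing Y.toFun _ _)).trans ?_
    exact HomEq.natTrans (postcomp_comp _ _ _) (postcomp_comp _ _ _) fun f =>
      .modif (WTrans.comp_assoc _ _ _).symm (WTrans.comp_assoc _ _ _).symm fun _ => .refl
  map_whiskerRight {m n k α α'} η β := by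
    refine ((μ.liftMap_whiskerRight Z η β).map (Bicategory.postcomposing Y.toFun _ _)).trans ?_
    exact HomEq.natTrans (postcomp_comp _ _ _) (postcomp_comp _ _ _) fun f =>
      .modif (WTrans.comp_assoc _ _ _).symm (WTrans.comp_assoc _ _ _).symm fun _ => .refl

theorem mapLeft_block (k : ℕ) {m n : ℕ} (p : Fin n → Fin m) (i : Fin n) :
    mapLeft k p ∘ block i k = block (p i) k := by
  funext j
  simp [mapLeft, block]

theorem lift_proj {m n : ℕ} (p : Fin n → Fin m) (i : Fin n) :
    μ.lift Z (T.θ p) ≫ μ.proj Z i = μ.proj Z (p i) := by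
  have e (k : ℕ) : (Z.str.hom _ _).obj (((μ.R k).hom m n).obj (T.θ p)) ⋙
      Pi.comap (fun _ => Z.carrier) (block i k) = Pi.comap (fun _ => Z.carrier) (block (p i) k) := by
    rw [μ.R_tight, Z.str.tight, ← mapLeft_block]
    rfl
  refine WTrans.ext' (funext e) fun {k l} β => ?_
  refine WHom.IsId.wEq (.comp (.map _ ⟨_, rfl⟩) (.map _ ?_)) ⟨_, rfl⟩ (congrArg (· ⋙ _) (e k))
  exact (μ.lift_cell Z _ β).isId ((μ.gray_tight_left _ β).map _)

/-- The internal hom of models. -/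
noncomputable def internalHom : ModelOn T (Y ⟶ Z) where
  toCatAction := (μ.homAct Y Z).transport (μ.powerComparison Y Z)
  tight {m n} p := by
    have h : μ.powerComparison Y Z m ⋙ (((μ.homAct Y Z).transport (μ.powerComparison Y Z)).hom
        m n).obj (T.θ p) = μ.powerComparison Y Z m ⋙ Pi.comap (fun _ => (Y ⟶ Z)) p := by
      rw [CatAction.transport_obj]
      have hi (i : Fin n) : Bicategory.postcomp Y.toFun (μ.lift Z (T.θ p)) ⋙
          Bicategory.postcomp Y.toFun (μ.proj Z i) = Bicategory.postcomp Y.toFun (μ.proj Z (p i)) :=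
        (postcomp_comp _ _ _).symm.trans
          (congrArg (Bicategory.postcomp Y.toFun) (μ.lift_proj Z p i))
      exact congrArg (fun F : Fin n → ((Y.toFun ⟶ μ.tensorL Z m) ⥤ (Y.toFun ⟶ Z.toFun)) =>
        Functor.pi' F) (funext hi)
    have e (G : (∀ _ : Fin m, Y ⟶ Z) ⥤ (∀ _ : Fin n, Y ⟶ Z)) :
        G = (μ.powerComparison Y Z m).strictInv ⋙ μ.powerComparison Y Z m ⋙ G :=
      congrArg (· ⋙ G) (CatAction.strictInv_comp (μ.powerComparison Y Z m)).1.symm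
    exact (e _).trans ((congrArg ((μ.powerComparison Y Z m).strictInv ⋙ ·) h).trans (e _).symm)

theorem isInternalHom : μ.IsInternalHom (μ.internalHom Y Z) where
  obj α := (μ.homAct Y Z).transport_obj (μ.powerComparison Y Z) α
  map η := (μ.homAct Y Z).transport_map (μ.powerComparison Y Z) η

end WCommutativity

end


/-! ### The evaluation multimap -/

section Evaluation

variable {T : LawvereTwoTheory 𝕋} {w : Weakness}

/-- The component at `l` of transformations and of modifications. -/
def WTrans.component (F G : TwoFun T w) (l : ℕ) : (F ⟶ G) ⥤ (F.O l ⥤ G.O l) where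
  obj f := WTrans.app f l
  map η := WTrans.Modif.app η l

theorem uncurry_comp {A : Type u₁} [Category.{v₁} A] {B : Type u₂} [Category.{v₂} B]
    {C : Type u₃} [Category.{v₃} C] {D : Type*} [Category* D] (F : A ⥤ B ⥤ C) (K : C ⥤ D) :
    Functor.uncurry.obj F ⋙ K =
      Functor.uncurry.obj (F ⋙ (Functor.whiskeringRight B C D).obj K) :=
  Functor.hext (fun _ => rfl) fun _ _ _ => heq_of_eq (K.map_comp _ _)

namespace WCommutativity

variable (μ : WCommutativity T w) (Y Z : Model T w)

/-- The internal hom as a model. -/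
noncomputable abbrev homObj : Model T w := homModel (μ.internalHom Y Z)

/-- Families of homomorphisms as transformations to a power. -/
noncomputable def transpose (k : ℕ) : (∀ _ : Fin k, (Y ⟶ Z)) ⥤ (Y.toFun ⟶ μ.tensorL Z k) :=
  (μ.powerComparison Y Z k).strictInv

instance (k : ℕ) : (μ.transpose Y Z k).IsIso :=
  inferInstanceAs (μ.powerComparison Y Z k).strictInv.IsIso

theorem transpose_powerComparison (k : ℕ) :
    μ.transpose Y Z k ⋙ μ.powerComparison Y Z k = 𝟭 _ :=
  (CatAction.strictInv_comp (μ.powerComparison Y Z k)).1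

theorem transpose_fn {m n : ℕ} (α : T.ob m ⟶ T.ob n) :
    (μ.homObj Y Z).toFun.fn α ⋙ μ.transpose Y Z n =
      μ.transpose Y Z m ⋙ Bicategory.postcomp Y.toFun (μ.lift Z α) :=
  congrArg (fun G => μ.transpose Y Z m ⋙ Bicategory.postcomp Y.toFun (μ.lift Z α) ⋙ G)
    (CatAction.strictInv_comp (μ.powerComparison Y Z n)).2

theorem transpose_tr {m n : ℕ} {α α' : T.ob m ⟶ T.ob n} (η : α ⟶ α') :
    HomEq (Functor.whiskerRight ((μ.homObj Y Z).toFun.tr η) (μ.transpose Y Z n))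
      (Functor.whiskerLeft (μ.transpose Y Z m)
        ((Bicategory.postcomposing Y.toFun _ _).map (μ.liftMap Z η))) := by
  have h := HomEq.map_congr (congrArg (fun G => (Functor.whiskeringLeft _ _ _).obj
      (μ.transpose Y Z m) ⋙ (Functor.whiskeringRight _ _ _).obj G)
    (CatAction.strictInv_comp (μ.powerComparison Y Z n)).2)
    ((Bicategory.postcomposing Y.toFun _ _).map (μ.liftMap Z η))
  exact h

/-- The components of the evaluation. -/
noncomputable def evApp (k l : ℕ) :
    (∀ _ : Fin k, (Y ⟶ Z)) × ((∀ _ : Fin l, Y.carrier) × Dom (T := T) (w := w) [] .nil) ⥤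
      (∀ _ : Fin (k * l), Z.carrier) :=
  (𝟭 _).prod (CategoryTheory.Prod.fst _ _) ⋙
    Functor.uncurry.obj (μ.transpose Y Z k ⋙ WTrans.component Y.toFun (μ.tensorL Z k) l)

theorem evApp_here {m n : ℕ} (α : T.ob m ⟶ T.ob n) (l : ℕ) :
    μ.evApp Y Z m l ⋙ Z.toFun.fn (((μ.R l).hom m n).obj α) =
      ((μ.homObj Y Z).toFun.fn α).prod (𝟭 _) ⋙ μ.evApp Y Z n l := by
  have h := congrArg (fun G : (∀ _ : Fin m, (Y ⟶ Z)) ⥤ (Y.toFun ⟶ μ.tensorL Z n) =>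
    (𝟭 _).prod (CategoryTheory.Prod.fst (∀ _ : Fin l, Y.carrier) (Dom (T := T) (w := w) [] .nil)) ⋙
      Functor.uncurry.obj (G ⋙ WTrans.component Y.toFun (μ.tensorL Z n) l)) (μ.transpose_fn Y Z α)
  refine .trans ?_ h.symm
  exact congrArg (fun G => (𝟭 (∀ _ : Fin m, (Y ⟶ Z))).prod (CategoryTheory.Prod.fst
    (∀ _ : Fin l, Y.carrier) (Dom (T := T) (w := w) [] .nil)) ⋙ G) (uncurry_comp _ _)

theorem evApp_tr {m n : ℕ} {α α' : T.ob m ⟶ T.ob n} (η : α ⟶ α') (l : ℕ) :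
    HomEq (Functor.whiskerLeft (μ.evApp Y Z m l) (Z.toFun.tr (((μ.R l).hom m n).map η)))
      (Functor.whiskerRight (NatTrans.prod ((μ.homObj Y Z).toFun.tr η) (𝟙 (𝟭 _)))
        (μ.evApp Y Z n l)) := by
  refine HomEq.natTrans (μ.evApp_here Y Z α l) (μ.evApp_here Y Z α' l) fun x => ?_
  have h := ((μ.transpose_tr Y Z η).symm.map ((evaluation _ _).obj x.1)).map
    (WTrans.component Y.toFun (μ.tensorL Z n) l ⋙ (evaluation _ _).obj x.2.1)
  refine HomEq.trans h (.of_eq ?_)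
  refine (Category.comp_id _).symm.trans ?_
  exact congrArg (_ ≫ ·) (CategoryTheory.Functor.map_id (WTrans.app ((μ.transpose Y Z n).obj
    (((μ.homObj Y Z).toFun.fn α').obj x.1)) l) x.2.1).symm

theorem evThere_nat (k : ℕ) {l l' : ℕ} (β : T.ob l ⟶ T.ob l')
    {x y : (∀ _ : Fin k, (Y ⟶ Z)) × ((∀ _ : Fin l, Y.carrier) × Dom (T := T) (w := w) [] .nil)}
    (f : x ⟶ y) : WHom.Sq ((WTrans.cell ((μ.transpose Y Z k).obj x.1) β).appAt x.2.1)
      ((WTrans.cell ((μ.transpose Y Z k).obj y.1) β).appAt y.2.1)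
      ((μ.evApp Y Z k l ⋙ Z.toFun.fn (((μ.L k).hom l l').obj β)).map f)
      (((𝟭 _).prod ((Y.toFun.fn β).prod (𝟭 _)) ⋙ μ.evApp Y Z k l').map f) := by
  have h₁ := (WTrans.Modif.sq ((μ.transpose Y Z k).map f.1) β).appAt x.2.1
  have h₂ := (WTrans.cell ((μ.transpose Y Z k).obj y.1) β).appAt_nat f.2.1
  exact (h₁.comp h₂).congr .refl .refl (.of_eq (CategoryTheory.Functor.map_comp _ _ _).symm) .refl

/-- The cells of the evaluation in the second variable. -/
noncomputable def evThere (k : ℕ) {l l' : ℕ} (β : T.ob l ⟶ T.ob l') :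
    WHom (μ.evApp Y Z k l ⋙ Z.toFun.fn (((μ.L k).hom l l').obj β))
      ((𝟭 _).prod ((Y.toFun.fn β).prod (𝟭 _)) ⋙ μ.evApp Y Z k l') w :=
  WHom.ofAppAt (fun x => (WTrans.cell ((μ.transpose Y Z k).obj x.1) β).appAt x.2.1)
    (μ.evThere_nat Y Z k β)

theorem evThere_appAt (k : ℕ) {l l' : ℕ} (β : T.ob l ⟶ T.ob l')
    (x : (∀ _ : Fin k, (Y ⟶ Z)) × ((∀ _ : Fin l, Y.carrier) × Dom (T := T) (w := w) [] .nil)) :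
    (μ.evThere Y Z k β).appAt x = (WTrans.cell ((μ.transpose Y Z k).obj x.1) β).appAt x.2.1 := by
  exact WHom.appAt_ofAppAt (F := μ.evApp Y Z k l ⋙ Z.toFun.fn (((μ.L k).hom l l').obj β))
    (G := (𝟭 _).prod ((Y.toFun.fn β).prod (𝟭 _)) ⋙ μ.evApp Y Z k l') _
    (μ.evThere_nat Y Z k β) x

theorem evThere_tight (k : ℕ) {l l' : ℕ} (q : Fin l' → Fin l) :
    (μ.evThere Y Z k (T.θ q)).IsId :=
  WHom.isId_of_appAt' _ fun x => by
    rw [evThere_appAt]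
    exact (WTrans.cell_tight _ q).appAt _

theorem evThere_comp (k : ℕ) {l l' l'' : ℕ} (β : T.ob l ⟶ T.ob l') (β' : T.ob l' ⟶ T.ob l'') :
    WEq (μ.evThere Y Z k (β ≫ β')) (((μ.evThere Y Z k β).whR
      (Z.toFun.fn (((μ.L k).hom _ _).obj β'))).comp ((μ.evThere Y Z k β').whL
        ((𝟭 _).prod ((Y.toFun.fn β).prod (𝟭 _))))) := by
  refine WEq.of_appAt ?_ ?_ fun x => ?_
  · exact congrArg (μ.evApp Y Z k _ ⋙ ·) ((μ.tensorL Z k).act.map_comp β β')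
  · exact congrArg (fun F => (𝟭 _).prod (F.prod (𝟭 _)) ⋙ μ.evApp Y Z k _)
      (Y.str.map_comp β β')
  · have h := (WTrans.cell_comp ((μ.transpose Y Z k).obj x.1) β β').appAt x.2.1
    rw [WHom.appAt_comp, WHom.appAt_whL, WHom.appAt_whR] at h ⊢
    refine (WEq.of_eq (μ.evThere_appAt Y Z k (β ≫ β') x)).trans (h.trans ?_)
    exact .of_eq (congrArg₂ WHom.comp (congrArg (WHom.map _) (μ.evThere_appAt Y Z k β x).symm)
      (μ.evThere_appAt Y Z k β' (x.1, ((Y.toFun.fn β).obj x.2.1, x.2.2))).symm)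

theorem evThere_tr (k : ℕ) {l l' : ℕ} {β β' : T.ob l ⟶ T.ob l'} (η : β ⟶ β') :
    (μ.evThere Y Z k β).Sq (μ.evThere Y Z k β')
      (Functor.whiskerLeft (μ.evApp Y Z k l) (Z.toFun.tr (((μ.L k).hom _ _).map η)))
      (Functor.whiskerRight (NatTrans.prod (𝟙 (𝟭 _)) (NatTrans.prod (Y.toFun.tr η) (𝟙 (𝟭 _))))
        (μ.evApp Y Z k l')) := by
  refine WHom.sq_of_appAt fun x => ?_
  have h := (WTrans.cell_nat ((μ.transpose Y Z k).obj x.1) η).appAt x.2.1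
  refine h.congr (.of_eq (μ.evThere_appAt Y Z k β x).symm)
    (.of_eq (μ.evThere_appAt Y Z k β' x).symm) .refl (.of_eq ?_)
  refine (Category.id_comp _).symm.trans ?_
  refine congrArg (· ≫ _) ?_
  have h : (μ.transpose Y Z k).map (𝟙 x.1) = 𝟙 _ := CategoryTheory.Functor.map_id _ _
  exact (congrArg (fun t => (WTrans.Modif.app t l').app ((Y.toFun.fn β).obj x.2.1)) h).symm

/-- The Gray law of the evaluation: the cells of `t ≫ Z(α ⊗ -)` are those of `t`, preceded by the
Gray cells. -/
theorem evThere_gray {m n : ℕ} (α : T.ob m ⟶ T.ob n) {k l : ℕ} (β : T.ob k ⟶ T.ob l) :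
    WEq ((μ.evThere Y Z n β).whL (((μ.homObj Y Z).toFun.fn α).prod (𝟭 _)))
      ((((μ.gray α β).map (Z.str.hom _ _)).whL (μ.evApp Y Z m k)).compEq
        (congrArg (μ.evApp Y Z m k ⋙ ·) (Z.str.map_comp _ _))
        ((μ.evThere Y Z m β).whR (Z.toFun.fn (((μ.R l).hom m n).obj α)))) := by
  refine WEq.of_appAt ?_ ?_ fun x => ?_
  · refine (congrArg (· ⋙ Z.toFun.fn _) (μ.evApp_here Y Z α k).symm).trans ?_
    exact congrArg (μ.evApp Y Z m k ⋙ ·) (Z.str.map_comp _ _).symm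
  · exact congrArg ((𝟭 _).prod ((Y.toFun.fn β).prod (𝟭 _)) ⋙ ·) (μ.evApp_here Y Z α l).symm
  · have h : (μ.transpose Y Z n).obj (((μ.homObj Y Z).toFun.fn α).obj x.1) =
        (μ.transpose Y Z m).obj x.1 ≫ μ.lift Z α :=
      congrArg (fun G => G.obj x.1) (μ.transpose_fn Y Z α)
    rw [WHom.appAt_compEq, WHom.appAt_whL, WHom.appAt_whL, WHom.appAt_whR, evThere_appAt,
      evThere_appAt]
    change WEq ((WTrans.cell ((μ.transpose Y Z n).obj
      (((μ.homObj Y Z).toFun.fn α).obj x.1)) β).appAt x.2.1) _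
    rw [h]
    refine (WEq.of_eq (WHom.appAt_comp ((WTrans.cell (μ.lift Z α) β).whL _)
      ((WTrans.cell ((μ.transpose Y Z m).obj x.1) β).whR _) _)).trans ?_
    refine .comp ?_ (.of_eq (WHom.appAt_whR _ _ _))
    refine (WEq.of_eq (WHom.appAt_whL _ _ _)).trans ?_
    exact ((μ.lift_cell Z α β).appAt _).trans (WEq.comp_ofEq _ _).symm

theorem evHere_comp {m n k : ℕ} (α : T.ob m ⟶ T.ob n) (α' : T.ob n ⟶ T.ob k) (l : ℕ) :
    WEq (WHom.ofEq (w := w) (μ.evApp_here Y Z (α ≫ α') l))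
      (((WHom.ofEq (μ.evApp_here Y Z α l)).whR (Z.toFun.fn (((μ.R l).hom _ _).obj α'))).comp
        ((WHom.ofEq (μ.evApp_here Y Z α' l)).whL (((μ.homObj Y Z).toFun.fn α).prod (𝟭 _)))) :=
  WHom.IsId.wEq (WHom.isId_ofEq _) (.comp (.map _ (WHom.isId_ofEq _)) (.map _ (WHom.isId_ofEq _)))
    (congrArg (μ.evApp Y Z _ l ⋙ ·) ((congrArg (Z.str.hom _ _).obj ((μ.R l).map_comp α α')).trans
      (Z.str.map_comp _ _)))

theorem ev_gray {m n : ℕ} (α : T.ob m ⟶ T.ob n) {k l : ℕ} (β : T.ob k ⟶ T.ob l) :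
    WEq (((WHom.ofEq (μ.evApp_here Y Z α k)).whR (Z.toFun.fn (((μ.L n).hom _ _).obj β))).comp
        ((μ.evThere Y Z n β).whL (((μ.homObj Y Z).toFun.fn α).prod (𝟭 _))))
      ((((μ.gray α β).map (Z.str.hom _ _)).whL (μ.evApp Y Z m k)).compEq
        (congrArg (μ.evApp Y Z m k ⋙ ·) (Z.str.map_comp _ _))
        (((μ.evThere Y Z m β).whR (Z.toFun.fn (((μ.R l).hom m n).obj α))).comp
          ((WHom.ofEq (μ.evApp_here Y Z α l)).whL
            ((𝟭 _).prod ((Y.toFun.fn β).prod (𝟭 _)))))) := by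
  refine .trans (.isId_comp (.map _ (WHom.isId_ofEq _)) _) ((μ.evThere_gray Y Z α β).trans ?_)
  exact .comp .refl (.symm (WEq.comp_isId _ (.map _ (WHom.isId_ofEq _))))

set_option maxHeartbeats 400000 in
/-- The evaluation. -/
noncomputable def ev : MultiMap μ [μ.homObj Y Z, Y] Z where
  app
    | .cons k (.cons l .nil) => μ.evApp Y Z k l
  cell
    | .here α (.cons l .nil) => .ofEq (μ.evApp_here Y Z α l)
    | .there k (.here β .nil) => μ.evThere Y Z k β
  cell_tight
    | .here p (.cons l .nil) => ⟨_, rfl⟩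
    | .there k (.here q .nil) => μ.evThere_tight Y Z k q
  cell_comp
    | .here α α' (.cons l .nil) => μ.evHere_comp Y Z α α' l
    | .there k (.here β β' .nil) => μ.evThere_comp Y Z k β β'
  cell_nat
    | .here η (.cons l .nil) => WHom.Sq.ofEq _ _ (μ.evApp_tr Y Z η l)
    | .there k (.here η .nil) => μ.evThere_tr Y Z k η
  cell_gray
    | .here α (.here β .nil) => μ.ev_gray Y Z α β

end WCommutativity

end Evaluation


section EvaluationValues

variable {T : LawvereTwoTheory 𝕋} {w : Weakness}

namespace WCommutativity

variable (μ : WCommutativity T w) (Y Z : Model T w)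

variable {Y Z} in
/-- The transformation to a power given by a family of homomorphisms has the members of the family
as its components. -/
theorem transpose_comp_proj {k : ℕ} (t : ∀ _ : Fin k, (Y ⟶ Z)) (i : Fin k) :
    (μ.transpose Y Z k).obj t ≫ μ.proj Z i = t i :=
  congrArg (fun G => G.obj t i) (μ.transpose_powerComparison Y Z k)

theorem evApp_right {k : ℕ} (t : ∀ _ : Fin k, (Y ⟶ Z)) (l : ℕ) :
    (Functor.prod' ((Functor.const _).obj t)
      (Functor.prod' (𝟭 _) ((Functor.const _).obj ⟨⟨⟩⟩)) : (∀ _ : Fin l, Y.carrier) ⥤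
        (∀ _ : Fin k, (Y ⟶ Z)) × ((∀ _ : Fin l, Y.carrier) × Dom (T := T) (w := w) [] .nil)) ⋙
      μ.evApp Y Z k l = WTrans.app ((μ.transpose Y Z k).obj t) l := by
  refine Functor.hext (fun _ => rfl) fun x y f => heq_of_eq ?_
  have h : (μ.transpose Y Z k).map (𝟙 t) = 𝟙 _ := CategoryTheory.Functor.map_id _ _
  exact (congrArg (fun f' => (WTrans.Modif.app f' l).app x ≫ (WTrans.app _ l).map f) h).trans
    (Category.id_comp _)

theorem evApp_left {l : ℕ} (p : ∀ _ : Fin l, Y.carrier) (k : ℕ) :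
    (Functor.prod' (𝟭 _) ((Functor.const _).obj (p, ⟨⟨⟩⟩)) : (∀ _ : Fin k, (Y ⟶ Z)) ⥤
        (∀ _ : Fin k, (Y ⟶ Z)) × ((∀ _ : Fin l, Y.carrier) × Dom (T := T) (w := w) [] .nil)) ⋙
      μ.evApp Y Z k l =
    μ.transpose Y Z k ⋙ WTrans.component Y.toFun (μ.tensorL Z k) l ⋙ (evaluation _ _).obj p := by
  refine Functor.hext (fun _ => rfl) fun x y f => heq_of_eq ?_
  refine (congrArg ((WTrans.Modif.app ((μ.transpose Y Z k).map f) l).app p ≫ ·)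
    (CategoryTheory.Functor.map_id _ p)).trans (Category.comp_id _)

theorem isEvaluation_ev : IsEvaluation (μ.ev Y Z) where
  app k l i := by
    have h := congrArg (fun G : (∀ _ : Fin k, (Y ⟶ Z)) ⥤ (∀ _ : Fin k, (Y ⟶ Z)) =>
      (𝟭 (∀ _ : Fin k, (Y ⟶ Z))).prod (CategoryTheory.Prod.fst (∀ _ : Fin l, Y.carrier)
        (Dom (T := T) (w := w) [] .nil)) ⋙
      Functor.uncurry.obj (G ⋙ Pi.eval (fun _ => (Y ⟶ Z)) i ⋙ WTrans.component Y.toFun Z.toFun l))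
      (μ.transpose_powerComparison Y Z k)
    refine .trans ?_ h
    exact congrArg (fun G => (𝟭 (∀ _ : Fin k, (Y ⟶ Z))).prod (CategoryTheory.Prod.fst
      (∀ _ : Fin l, Y.carrier) (Dom (T := T) (w := w) [] .nil)) ⋙ G) (uncurry_comp
        (μ.transpose Y Z k ⋙ WTrans.component Y.toFun (μ.tensorL Z k) l)
        (Pi.comap (fun _ => Z.carrier) (block i l)))
  cell_left _ _ := ⟨_, rfl⟩
  cell_right k {l l'} β t i := by
    have ht := μ.transpose_comp_proj t i
    have h := (μ.comp_proj_cell ((μ.transpose Y Z k).obj t) i β).symm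
    rw [ht] at h
    refine .trans ?_ h
    have e (l : ℕ) := μ.evApp_right Y Z t l
    refine WEq.of_appAt ?_ ?_ fun x => ?_
    · exact congrArg (· ⋙ Z.toFun.fn (((μ.L k).hom l l').obj β) ⋙
        Pi.comap (fun _ => Z.carrier) (block i l')) (e l)
    · exact congrArg (Y.toFun.fn β ⋙ · ⋙ Pi.comap (fun _ => Z.carrier) (block i l')) (e l')
    refine (WEq.of_eq (WHom.appAt_whL _ _ _)).trans ?_
    refine (WEq.of_eq (WHom.appAt_whR _ _ _)).trans ?_
    refine .trans ?_ (WEq.of_eq (WHom.appAt_whR (A := ∀ _ : Fin l, Y.carrier)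
      (B := ∀ _ : Fin (k * l'), Z.carrier)
      (F := WTrans.app ((μ.transpose Y Z k).obj t) l ⋙ (μ.tensorL Z k).fn β)
      (G := Y.toFun.fn β ⋙ WTrans.app ((μ.transpose Y Z k).obj t) l')
      (WTrans.cell ((μ.transpose Y Z k).obj t) β) (Pi.comap (fun _ => Z.carrier) (block i l')) x).symm)
    exact .of_eq (congrArg (WHom.map _) (μ.evThere_appAt Y Z k β _))

variable {Y Z}

open MultiMap

/-- A morphism of the power `Zᵏ` as a morphism of `Z`. -/
def unfoldHom {k : ℕ} (a : EltHom (μ.tensorL Z k)) : EltHom Z.toFun :=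
  EltHom.mk (F := Z.toFun) (n := k * a.n) a.hom

/-- A cell of the power `Zᵏ` as a cell of `Z`. -/
def unfoldCell {k : ℕ} (c : EltCell (μ.tensorL Z k)) : EltCell Z.toFun :=
  EltCell.mk (F := Z.toFun) (((μ.L k).hom _ _).obj c.α) c.cell

theorem valHom_ev (a : EltHom (μ.homObj Y Z).toFun) (b : EltHom Y.toFun) (h) :
    valHom (𝟙 (μ.ev Y Z)) [⟨_, a⟩, ⟨_, b⟩] h = μ.unfoldHom (k := a.n) (EltHom.mk (F := μ.tensorL Z a.n)
      ((WTrans.Modif.app ((μ.transpose Y Z a.n).map a.hom) b.n).app b.p ≫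
        (WTrans.app ((μ.transpose Y Z a.n).obj a.q) b.n).map b.hom)) := by
  refine (valHom_eq _ _ (show (PtHom.cons a (PtHom.cons b Pt.nil.id)).toList = _ from rfl)).trans ?_
  exact congrArg (EltHom.mk (F := Z.toFun)) (Category.comp_id _)

theorem valHom_ev_id (t : Elt (μ.homObj Y Z).toFun) (b : EltHom Y.toFun) (h) :
    valHom (𝟙 (μ.ev Y Z)) [⟨_, t.id⟩, ⟨_, b⟩] h =
      μ.unfoldHom (WTrans.valHom (𝟙 ((μ.transpose Y Z t.n).obj t.obj)) b) := by
  rw [valHom_ev]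
  have h : (μ.transpose Y Z t.n).map (𝟙 t.obj) = 𝟙 _ := CategoryTheory.Functor.map_id _ _
  refine congrArg (fun f => EltHom.mk (F := Z.toFun) (n := t.n * b.n) f) ?_
  refine (congrArg (fun f => (WTrans.Modif.app f b.n).app b.p ≫ _) h).trans ?_
  exact (Category.id_comp _).trans (Category.comp_id _).symm

theorem valHom_ev_point (a : EltHom (μ.homObj Y Z).toFun) (p : Elt Y.toFun) (h) :
    valHom (𝟙 (μ.ev Y Z)) [⟨_, a⟩, ⟨_, p.id⟩] h = EltHom.mk (F := Z.toFun) (n := a.n * p.n)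
      ((WTrans.Modif.app ((μ.transpose Y Z a.n).map a.hom) p.n).app p.obj) := by
  rw [valHom_ev]
  refine congrArg (fun f => EltHom.mk (F := Z.toFun) (n := a.n * p.n) f) ?_
  refine (congrArg (_ ≫ ·) (CategoryTheory.Functor.map_id _ _)).trans ?_
  exact Category.comp_id _

theorem valCell_ev_right (t : Elt (μ.homObj Y Z).toFun) (u : EltCell Y.toFun) (h) :
    (μ.ev Y Z).valCell ⟨[⟨_, t⟩], u, []⟩ h =
      μ.unfoldCell (WTrans.valCell ((μ.transpose Y Z t.n).obj t.obj) u) := by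
  refine (valCell_eq _ h (.there t (.here u .nil))).trans ?_
  refine EltCell.mk_congr rfl rfl rfl ?_
  refine WEq.comp (WEq.of_eq (μ.evThere_appAt Y Z t.n u.α _)) ?_
  refine (WEq.of_eq (WHom.map_map _ (μ.evApp Y Z t.n u.n) _)).trans ?_
  refine (WEq.of_eq (WHom.map_map (Prod.sectL _ _) _ u.cell)).trans ?_
  exact WEq.map_congr (μ.evApp_right Y Z t.obj u.n) u.cell

/-- The functor that applies a family of homomorphisms to an element. -/
noncomputable def applyAt (k : ℕ) (p : Elt Y.toFun) :
    (∀ _ : Fin k, (Y ⟶ Z)) ⥤ (∀ _ : Fin (k * p.n), Z.carrier) :=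
  μ.transpose Y Z k ⋙ WTrans.component Y.toFun (μ.tensorL Z k) p.n ⋙ (evaluation _ _).obj p.obj

theorem valCell_ev_left (c : EltCell (μ.homObj Y Z).toFun) (p : Elt Y.toFun) (h) :
    ∃ e, (μ.ev Y Z).valCell ⟨[], c, [⟨_, p⟩]⟩ h =
      EltCell.mk (F := Z.toFun) (p := (μ.applyAt c.m p).obj c.p) (((μ.R p.n).hom _ _).obj c.α)
        ((WHom.ofEq e).comp (c.cell.map (μ.applyAt c.n p))) := by
  refine ⟨congrArg (fun G => G.obj (c.p, p.obj, ⟨⟨⟩⟩)) (μ.evApp_here Y Z c.α p.n), ?_⟩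
  refine (valCell_eq _ h (.here c (Pt.cons p .nil))).trans ?_
  refine EltCell.mk_congr rfl rfl rfl ?_
  refine WEq.comp (WEq.of_eq (WHom.appAt_ofEq _ _)) ?_
  exact (WEq.of_eq (WHom.map_map _ _ _)).trans (WEq.map_congr (μ.evApp_left Y Z p.obj c.n) c.cell)

end WCommutativity

end EvaluationValues


/-! ### Cells between transformations -/

section TransCells

variable {w : Weakness}

theorem WHom.Sq.inv {C : Type u₁} [Category.{v₁} C] {x y x' y' : C} {s : WHom x y w}
    {s' : WHom x' y' w} {a : x ≅ x'} {b : y ≅ y'} (h : s.Sq s' a.hom b.hom) :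
    s'.Sq s a.inv b.inv := by
  cases s <;> cases s' <;> simp only [WHom.Sq] at h ⊢
  all_goals
    first
    | rw [Iso.inv_comp_eq, ← Category.assoc, Iso.eq_comp_inv, h]
    | rw [Iso.comp_inv_eq, Category.assoc, h, Iso.inv_hom_id_assoc]

variable {T : LawvereTwoTheory 𝕋} {F G : TwoFun T w}

namespace WTrans

/-- A multimap is determined by its values at lists of morphisms and at cells: its components are
its values at lists of morphisms, its cells are its values at identity cells. -/
theorem ext_val {f g : F ⟶ G} (h : ∀ b, valHom (𝟙 f) b = valHom (𝟙 g) b)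
    (h' : ∀ u, valCell f u = valCell g u) : f = g := by
  have e (n : ℕ) : app f n = app g n := by
    have e {x y : F.O n} (k : x ⟶ y) : (app f n).obj x = (app g n).obj x ∧
        (app f n).map k ≍ (app g n).map k := by
      have := h ⟨k⟩
      change (⟨(app f n).map k ≫ 𝟙 _⟩ : EltHom G) = ⟨(app g n).map k ≫ 𝟙 _⟩ at this
      rw [Category.comp_id, Category.comp_id] at this
      simp only [EltHom.mk.injEq, heq_eq_eq, true_and] at this
      exact ⟨this.1, this.2.2⟩
    exact Functor.hext (fun x => (e (𝟙 x)).1) fun x y k => (e k).2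
  refine ext' (funext e) fun {m n} α => ?_
  refine WEq.of_appAt (congrArg (· ⋙ G.fn α) (e m)) (congrArg (F.fn α ⋙ ·) (e n)) fun x => ?_
  have := h' (.one α x)
  have k (f : F ⟶ G) : valCell f (.one α x) = ⟨α, (cell f α).appAt x⟩ :=
    EltCell.mk_congr rfl rfl rfl (WEq.comp_isId _ ((WHom.isId_ofEq rfl).map _))
  rw [k, k] at this
  exact EltCell.wEq_of_eq this

/-- A cell between transformations is a cell between their components that is compatible with
their cells. -/
theorem cell_comm {f g : F ⟶ G} (s : WHom f g w) {m n : ℕ} (α : T.ob m ⟶ T.ob n) :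
    ((s.map (component F G m)).whR (G.fn α)).comp (cell g α) =
      (cell f α).comp ((s.map (component F G n)).whL (F.fn α)) := by
  cases s with
  | strict h =>
    subst h
    cases cell f α
    rfl
  | pseudo e =>
    have h := Modif.sq e.hom α
    revert h
    cases cell f α
    cases cell g α
    intro h
    exact congrArg WHom.pseudo (Iso.ext h)
  | lax e =>
    have h := Modif.sq e α
    revert h
    cases cell f α
    cases cell g α
    intro h
    exact congrArg WHom.lax h
  | colax e =>
    have h := Modif.sq e α
    revert h
    cases cell f α
    cases cell g α
    intro h
    exact congrArg WHom.colax h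

/-- Cells between the components that are compatible with the cells of the transformations make up a
cell between the transformations. -/
theorem exists_wHom {f g : F ⟶ G} (c : ∀ n, WHom (app f n) (app g n) w)
    (h : ∀ {m n : ℕ} (α : T.ob m ⟶ T.ob n), ((c m).whR (G.fn α)).comp (cell g α) =
      (cell f α).comp ((c n).whL (F.fn α))) :
    ∃ s : WHom f g w, ∀ n, s.map (component F G n) = c n := by
  cases w with
  | strict =>
    have e (n : ℕ) : app f n = app g n := by
      cases c n; assumption
    obtain rfl : f = g := ext' (funext e) fun {m n} α => by
      have h₁ := e m
      have h₂ := e n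
      cases cell f α
      cases cell g α
      exact .of_strict _ _ (congrArg (· ⋙ G.fn α) h₁)
    exact ⟨.strict rfl, fun n => by cases c n; rfl⟩
  | pseudo =>
    have hc : ∀ n, ∃ e, c n = .pseudo e := fun n => by
      cases c n; exact ⟨_, rfl⟩
    choose e he using hc
    have sq {m n : ℕ} (α : T.ob m ⟶ T.ob n) : (cell f α).Sq (cell g α)
        (Functor.whiskerRight (e m).hom (G.fn α)) (Functor.whiskerLeft (F.fn α) (e n).hom) := by
      have h := h α
      rw [he, he] at h
      revert h
      cases cell f α
      cases cell g α
      intro h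
      exact congrArg (fun s => match s with | .pseudo e => e.hom) h
    refine ⟨.pseudo ⟨⟨fun n => (e n).hom, sq⟩, ⟨fun n => (e n).inv, fun {m n} α => ?_⟩,
      Modif.ext (funext fun n => (e n).hom_inv_id), Modif.ext (funext fun n => (e n).inv_hom_id)⟩,
      fun n => ?_⟩
    · exact WHom.Sq.inv (a := Functor.isoWhiskerRight (e m) (G.fn α))
        (b := Functor.isoWhiskerLeft (F.fn α) (e n)) (sq α)
    · rw [he]
      exact congrArg WHom.pseudo (Iso.ext rfl)
  | lax =>
    have hc : ∀ n, ∃ e, c n = .lax e := fun n => by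
      cases c n; exact ⟨_, rfl⟩
    choose e he using hc
    have sq {m n : ℕ} (α : T.ob m ⟶ T.ob n) : (cell f α).Sq (cell g α)
        (Functor.whiskerRight (e m) (G.fn α)) (Functor.whiskerLeft (F.fn α) (e n)) := by
      have h := h α
      rw [he, he] at h
      revert h
      cases cell f α
      cases cell g α
      intro h
      exact congrArg (fun s => match s with | .lax e => e) h
    refine ⟨.lax ⟨e, sq⟩, fun n => ?_⟩
    rw [he]
    exact congrArg WHom.lax rfl
  | colax =>
    have hc : ∀ n, ∃ e, c n = .colax e := fun n => by
      cases c n; exact ⟨_, rfl⟩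
    choose e he using hc
    have sq {m n : ℕ} (α : T.ob m ⟶ T.ob n) : (cell g α).Sq (cell f α)
        (Functor.whiskerRight (e m) (G.fn α)) (Functor.whiskerLeft (F.fn α) (e n)) := by
      have h := h α
      rw [he, he] at h
      revert h
      cases cell f α
      cases cell g α
      intro h
      exact congrArg (fun s => match s with | .colax e => e) h
    refine ⟨.colax ⟨e, sq⟩, fun n => ?_⟩
    rw [he]
    exact congrArg WHom.colax rfl

theorem isId_of_component {f g : F ⟶ G} (s : WHom f g w)
    (h : ∀ n, (s.map (component F G n)).IsId) : s.IsId := by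
  obtain rfl : f = g := ext' (funext fun n => (h n).choose) fun {m n} α => by
    have h₁ : ((s.map (component F G m)).whR (G.fn α)).IsId := (h m).map _
    have h₂ : ((s.map (component F G n)).whL (F.fn α)).IsId := (h n).map _
    exact (WEq.comp_isId _ h₂).symm.trans
      ((WEq.of_eq (cell_comm s α).symm).trans (WEq.isId_comp h₁ _))
  refine ⟨rfl, WHom.ext_of_joint (K := component F G)
    (fun _ _ a b e => Modif.ext (funext e)) fun n => ?_⟩
  rw [WHom.map_ofEq]
  exact (h n).choose_spec

end WTrans

end TransCells


/-! ### Elements of the internal hom are determined by the evaluation -/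

section Separation

theorem HomEq.comp {C : Type u₁} [Category.{v₁} C] {x y z x' y' z' : C} {f : x ⟶ y} {g : y ⟶ z}
    {f' : x' ⟶ y'} {g' : y' ⟶ z'} (h : HomEq f f') (h' : HomEq g g') :
    HomEq (f ≫ g) (f' ≫ g') := by
  cases h; cases h'; exact .refl

theorem WHom.isId_of_map {w : Weakness} {A : Type u₁} [Category.{v₁} A] {B : Type u₂}
    [Category.{v₂} B] (K : A ⥤ B) [K.IsIso] {x y : A} {s : WHom x y w} (h : (s.map K).IsId) :
    s.IsId := by
  obtain ⟨e, h⟩ := h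
  obtain rfl := K.bijective_obj.1 e
  exact ⟨rfl, ext_map K (h.trans (map_ofEq K rfl).symm)⟩

variable {T : LawvereTwoTheory 𝕋} {w : Weakness}

namespace WCommutativity

variable (μ : WCommutativity T w) {Y Z : Model T w}

open MultiMap

theorem unfoldHom_inj {k : ℕ} {a a' : EltHom (μ.tensorL Z k)} (hn : a.n = a'.n)
    (h : μ.unfoldHom a = μ.unfoldHom a') : a = a' := by
  obtain ⟨f⟩ := a
  obtain ⟨f'⟩ := a'
  dsimp only at hn
  subst hn
  cases h
  rfl

theorem unfoldCell_inj {k : ℕ} {c c' : EltCell (μ.tensorL Z k)} (hα : OneCell.mk c.α = ⟨c'.α⟩)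
    (h : μ.unfoldCell c = μ.unfoldCell c') : c = c' := by
  obtain @⟨m, n, α, p, q, σ⟩ := c
  obtain @⟨m', n', α', p', q', σ'⟩ := c'
  simp only [OneCell.mk.injEq] at hα
  obtain ⟨rfl, rfl, hα⟩ := hα
  obtain rfl := eq_of_heq hα
  have hs := congrArg EltCell.src h
  have ht := congrArg EltCell.tgt h
  have h₁ : p = p' := Elt.obj_eq (G := Z.toFun) hs
  have h₂ : q = q' := Elt.obj_eq (G := Z.toFun) ht
  have h₃ : WEq σ σ' := EltCell.wEq_of_eq (F := Z.toFun) h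
  exact EltCell.mk_congr (F := μ.tensorL Z k) rfl h₁ h₂ h₃

variable {μ}

/-- An element of the internal hom, that is, a family of homomorphisms, is determined by the values
of the evaluation in the second variable. -/
theorem elt_ext {t t' : Elt (μ.homObj Y Z).toFun} (hn : t.n = t'.n)
    (h : ∀ b : EltHom Y.toFun, valHom (𝟙 (μ.ev Y Z)) [⟨_, t.id⟩, ⟨_, b⟩] rfl =
      valHom (𝟙 (μ.ev Y Z)) [⟨_, t'.id⟩, ⟨_, b⟩] rfl)
    (h' : ∀ u : EltCell Y.toFun, (μ.ev Y Z).valCell ⟨[⟨_, t⟩], u, []⟩ rfl =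
      (μ.ev Y Z).valCell ⟨[⟨_, t'⟩], u, []⟩ rfl) : t = t' := by
  obtain ⟨t⟩ := t
  obtain ⟨t'⟩ := t'
  dsimp only at hn
  subst hn
  rename_i k
  refine congrArg Elt.mk ((Functor.IsIso.bijective_obj (F := μ.transpose Y Z k)).1
    (WTrans.ext_val (fun b => ?_) fun u => ?_))
  · have := h b
    rw [valHom_ev_id, valHom_ev_id] at this
    exact μ.unfoldHom_inj rfl this
  · have := h' u
    rw [valCell_ev_right, valCell_ev_right] at this
    exact μ.unfoldCell_inj rfl this

variable (μ) in
theorem detectsEquality_applyAt (k : ℕ) :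
    DetectsEquality fun p : Elt Y.toFun => μ.applyAt (Z := Z) k p :=
  fun _ _ _ _ h => (μ.transpose Y Z k).map_injective
    (WTrans.Modif.ext (funext fun _ => NatTrans.ext (funext fun x => h ⟨x⟩)))

/-- A morphism of the internal hom is determined by the values of the evaluation at elements of the
second variable. -/
theorem eltHom_ext {a a' : EltHom (μ.homObj Y Z).toFun} (hs : a.src = a'.src) (ht : a.tgt = a'.tgt)
    (h : ∀ p : Elt Y.toFun, valHom (𝟙 (μ.ev Y Z)) [⟨_, a⟩, ⟨_, p.id⟩] rfl =
      valHom (𝟙 (μ.ev Y Z)) [⟨_, a'⟩, ⟨_, p.id⟩] rfl) : a = a' := by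
  obtain ⟨f', rfl⟩ := a'.exists_hom hs.symm ht.symm
  refine congrArg EltHom.mk (μ.detectsEquality_applyAt _ _ _ fun p => ?_)
  have := h p
  rw [valHom_ev_point, valHom_ev_point] at this
  exact EltHom.hom_eq (G := Z.toFun) this

/-- A cell of the internal hom is determined by the values of the evaluation at elements of the
second variable. -/
theorem eltCell_ext {c c' : EltCell (μ.homObj Y Z).toFun} (hα : OneCell.mk c.α = ⟨c'.α⟩)
    (hs : c.src = c'.src) (ht : c.tgt = c'.tgt)
    (h : ∀ p : Elt Y.toFun, (μ.ev Y Z).valCell ⟨[], c, [⟨_, p⟩]⟩ rfl =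
      (μ.ev Y Z).valCell ⟨[], c', [⟨_, p⟩]⟩ rfl) : c = c' := by
  obtain ⟨σ, rfl⟩ := c'.exists_cell hα.symm hs.symm ht.symm
  refine EltCell.mk_congr rfl rfl rfl (.of_eq (WHom.ext_of_joint (μ.detectsEquality_applyAt _)
    fun p => ?_))
  have := h p
  obtain ⟨_, e₁⟩ := μ.valCell_ev_left c p rfl
  obtain ⟨_, e₂⟩ := μ.valCell_ev_left ⟨c.α, σ⟩ p rfl
  rw [e₁, e₂] at this
  exact ((WEq.ofEq_comp _ _).symm.trans ((EltCell.wEq_of_eq this).trans (WEq.ofEq_comp _ _))).eq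

variable (μ) in
theorem fn_comp_applyAt {m n : ℕ} (α : T.ob m ⟶ T.ob n) (p : Elt Y.toFun) :
    (μ.homObj Y Z).toFun.fn α ⋙ μ.applyAt n p =
      μ.applyAt m p ⋙ Z.toFun.fn (((μ.R p.n).hom _ _).obj α) :=
  congrArg (fun G => G ⋙ WTrans.component Y.toFun (μ.tensorL Z n) p.n ⋙
    (evaluation _ _).obj p.obj) (μ.transpose_fn Y Z α)

variable (μ) in
theorem applyAt_map_tr {m n : ℕ} {α α' : T.ob m ⟶ T.ob n} (η : α ⟶ α')
    (t : ∀ _ : Fin m, (Y ⟶ Z)) (p : Elt Y.toFun) :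
    HomEq ((μ.applyAt n p).map (((μ.homObj Y Z).toFun.tr η).app t))
      ((Z.toFun.tr (((μ.R p.n).hom _ _).map η)).app ((μ.applyAt m p).obj t)) :=
  ((μ.transpose_tr Y Z η).map ((evaluation _ _).obj t)).map
    (WTrans.component Y.toFun (μ.tensorL Z n) p.n ⋙ (evaluation _ _).obj p.obj)

/-- Morphisms and cells of the internal hom form a square over a 2-cell of the theory if they do so
after evaluation at every element. -/
theorem sq_of_apply {m n : ℕ} {α α' : T.ob m ⟶ T.ob n} (η : α ⟶ α')
    {c c' : EltCell (μ.homObj Y Z).toFun} (hc : OneCell.mk c.α = ⟨α⟩) (hc' : OneCell.mk c'.α = ⟨α'⟩)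
    {a b : EltHom (μ.homObj Y Z).toFun} (has : a.src = c.src) (hat : a.tgt = c'.src)
    (hbs : b.src = c.tgt) (hbt : b.tgt = c'.tgt)
    (h : ∀ p : Elt Y.toFun, EltCell.Sq ((μ.ev Y Z).valCell ⟨[], c, [⟨_, p⟩]⟩ rfl)
      ((μ.ev Y Z).valCell ⟨[], c', [⟨_, p⟩]⟩ rfl) (μ.right₂ p.n ⟨η⟩)
      (valHom (𝟙 (μ.ev Y Z)) [⟨_, a⟩, ⟨_, p.id⟩] rfl)
      (valHom (𝟙 (μ.ev Y Z)) [⟨_, b⟩, ⟨_, p.id⟩] rfl)) : EltCell.Sq c c' ⟨η⟩ a b := by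
  obtain ⟨α, σ⟩ := c
  simp only [OneCell.mk.injEq] at hc
  obtain ⟨rfl, rfl, hc⟩ := hc
  obtain rfl := eq_of_heq hc
  obtain ⟨α', σ'⟩ := c'
  simp only [OneCell.mk.injEq] at hc'
  obtain ⟨rfl, rfl, hc'⟩ := hc'
  obtain rfl := eq_of_heq hc'
  obtain ⟨f, rfl⟩ := a.exists_hom has hat
  obtain ⟨g, rfl⟩ := b.exists_hom hbs hbt
  refine .mk η (WHom.sq_of_joint (μ.detectsEquality_applyAt _) fun p => ?_)
  have := h p
  obtain ⟨_, e₁⟩ := μ.valCell_ev_left ⟨_, σ⟩ p rfl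
  obtain ⟨_, e₂⟩ := μ.valCell_ev_left ⟨_, σ'⟩ p rfl
  rw [e₁, e₂, valHom_ev_point, valHom_ev_point] at this
  refine (EltCell.Sq.sq (F := Z.toFun) this).congr (WEq.ofEq_comp _ _) (WEq.ofEq_comp _ _) ?_ .refl
  rw [CategoryTheory.Functor.map_comp]
  exact .comp (μ.applyAt_map_tr η _ p).symm (HomEq.map_congr (μ.fn_comp_applyAt _ p).symm f)

/-- A cell of the internal hom is an identity if it is one after evaluation at every element. -/
theorem isId_of_apply {c : EltCell (μ.homObj Y Z).toFun}
    (h : ∀ p : Elt Y.toFun, ((μ.ev Y Z).valCell ⟨[], c, [⟨_, p⟩]⟩ rfl).cell.IsId) :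
    c.cell.IsId := by
  refine WHom.isId_of_map (μ.transpose Y Z c.n) (WTrans.isId_of_component _ fun l =>
    WHom.isId_of_appAt' _ fun x => ?_)
  have := h ⟨x⟩
  obtain ⟨_, e⟩ := μ.valCell_ev_left c ⟨x⟩ rfl
  rw [e] at this
  have := (WEq.ofEq_comp _ _).symm.isId this
  rw [WHom.appAt, WHom.map_map, WHom.map_map]
  exact this

end WCommutativity

end Separation


/-! ### Multimaps as functions of their last variable -/

section LastVariable

variable {T : LawvereTwoTheory 𝕋} {w : Weakness} {μ : WCommutativity T w}
  {Γ : List (Model T w)} {Y Z : Model T w}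

namespace MultiMap

/-- An identity, followed by the given morphism. -/
abbrev _root_.Arrow.idPair (a : _root_.Arrow T w) : ArrowPair T w := ⟨a.1, ⟨𝟙 a.2.p, a.2.hom⟩⟩
/-- The given morphism, followed by an identity. -/
abbrev _root_.Arrow.pairId (a : _root_.Arrow T w) : ArrowPair T w := ⟨a.1, ⟨a.2.hom, 𝟙 a.2.q⟩⟩

@[simp] theorem fst_comp_idPair : Sigma.fst ∘ Arrow.idPair (T := T) (w := w) = Sigma.fst := rfl
@[simp] theorem fst_comp_pairId : Sigma.fst ∘ Arrow.pairId (T := T) (w := w) = Sigma.fst := rfl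
@[simp] theorem pairFst_comp_idPair :
    ArrowPair.fst ∘ Arrow.idPair (T := T) (w := w) = Point.id ∘ Arrow.src := rfl
@[simp] theorem pairSnd_comp_idPair : ArrowPair.snd ∘ Arrow.idPair (T := T) (w := w) = id := rfl
@[simp] theorem pairComp_comp_idPair : ArrowPair.comp ∘ Arrow.idPair (T := T) (w := w) = id := by
  funext ⟨X, a⟩
  exact congrArg (fun f => (⟨X, ⟨f⟩⟩ : _root_.Arrow T w)) (Category.id_comp a.hom)
@[simp] theorem pairFst_comp_pairId : ArrowPair.fst ∘ Arrow.pairId (T := T) (w := w) = id := rfl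
@[simp] theorem pairSnd_comp_pairId :
    ArrowPair.snd ∘ Arrow.pairId (T := T) (w := w) = Point.id ∘ Arrow.tgt := rfl
@[simp] theorem pairComp_comp_pairId : ArrowPair.comp ∘ Arrow.pairId (T := T) (w := w) = id := by
  funext ⟨X, a⟩
  exact congrArg (fun f => (⟨X, ⟨f⟩⟩ : _root_.Arrow T w)) (Category.comp_id a.hom)

variable {F F' F'' : MultiMap μ (Γ ++ [Y]) Z}

/-- The value of a multimap at elements of its first variables and of its last one. -/
noncomputable def lastVal (F : MultiMap μ (Γ ++ [Y]) Z) (l : List (Point T w))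
    (h : l.map Sigma.fst = Γ) (p : Elt Y.toFun) : Elt Z.toFun :=
  F.val (l ++ [⟨Y, p⟩]) (by simp [h])

/-- The value of a modification at morphisms in its first variables and in its last one. -/
noncomputable def lastHom (ψ : F ⟶ F') (t : List (_root_.Arrow T w)) (h : t.map Sigma.fst = Γ)
    (b : EltHom Y.toFun) : EltHom Z.toFun :=
  valHom ψ (t ++ [⟨Y, b⟩]) (by simp [h])

/-- The value of a multimap at a cell in its last variable. -/
noncomputable def lastCell (F : MultiMap μ (Γ ++ [Y]) Z) (l : List (Point T w))
    (h : l.map Sigma.fst = Γ) (u : EltCell Y.toFun) : EltCell Z.toFun :=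
  F.valCell ⟨l, u, []⟩ (by simp [h])

/-- The value of a multimap at a cell in one of its first variables. -/
noncomputable def initCell (F : MultiMap μ (Γ ++ [Y]) Z) (U : MultiCell T w) (h : U.sources = Γ)
    (p : Elt Y.toFun) : EltCell Z.toFun :=
  F.valCell ⟨U.left, U.cell, U.right ++ [⟨Y, p⟩]⟩ (by simp [← h])

theorem lastVal_n (l : List (Point T w)) (h : l.map Sigma.fst = Γ) (p : Elt Y.toFun) :
    (F.lastVal l h p).n = num l * p.n :=
  (F.val_n _).trans (by simp)

theorem lastVal_congr {l l' : List (Point T w)} (e : l = l') (h h') (p : Elt Y.toFun) :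
    F.lastVal l h p = F.lastVal l' h' p := by subst e; rfl

theorem lastHom_src (ψ : F ⟶ F') (t : List (_root_.Arrow T w)) (h : t.map Sigma.fst = Γ)
    (b : EltHom Y.toFun) : (lastHom ψ t h b).src = F.lastVal (t.map Arrow.src) (by simpa) b.src :=
  (valHom_src ψ _).trans (F.val_congr (by simp) _ _)

theorem lastHom_tgt (ψ : F ⟶ F') (t : List (_root_.Arrow T w)) (h : t.map Sigma.fst = Γ)
    (b : EltHom Y.toFun) : (lastHom ψ t h b).tgt = F'.lastVal (t.map Arrow.tgt) (by simpa) b.tgt :=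
  (valHom_tgt ψ _).trans (F'.val_congr (by simp) _ _)

theorem lastHom_id (l : List (Point T w)) (h : l.map Sigma.fst = Γ) (p : Elt Y.toFun) :
    lastHom (𝟙 F) (l.map Point.id) (by simpa) p.id = (F.lastVal l h p).id :=
  (valHom_congr _ (by simp) _ (by simp [h])).trans (F.valHom_id _)

theorem lastHom_comp (ψ : F ⟶ F') (χ : F' ⟶ F'') (c : List (ArrowPair T w))
    (h : c.map Sigma.fst = Γ) (e : EltPair Y.toFun) :
    (lastHom ψ (c.map ArrowPair.fst) (by simpa) ⟨e.f⟩).Comp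
      (lastHom χ (c.map ArrowPair.snd) (by simpa) ⟨e.g⟩)
      (lastHom (ψ ≫ χ) (c.map ArrowPair.comp) (by simpa) ⟨e.f ≫ e.g⟩) := by
  have := valHom_comp ψ χ (c ++ [⟨Y, e⟩]) (by simp [h])
  simp only [List.map_append, List.map_cons, List.map_nil] at this
  exact this

theorem lastHom_comp_of_id (l : List (Point T w)) (h : l.map Sigma.fst = Γ) {n : ℕ}
    {x y z : Y.toFun.O n} (f : x ⟶ y) (g : y ⟶ z) :
    (lastHom (𝟙 F) (l.map Point.id) (by simpa) ⟨f⟩).Comp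
      (lastHom (𝟙 F) (l.map Point.id) (by simpa) ⟨g⟩)
      (lastHom (𝟙 F) (l.map Point.id) (by simpa) ⟨f ≫ g⟩) := by
  have := lastHom_comp (𝟙 F) (𝟙 F) (l.map Point.pair) (by simpa) ⟨f, g⟩
  simp only [List.map_map, pairFst_comp_pair, pairSnd_comp_pair, pairComp_comp_pair,
    Category.comp_id] at this
  exact this

theorem lastHom_id_comp (ψ : F ⟶ F') (t : List (_root_.Arrow T w)) (h : t.map Sigma.fst = Γ)
    {n : ℕ} {x y : Y.toFun.O n} (f : x ⟶ y) :
    (lastHom (𝟙 F) ((t.map Arrow.src).map Point.id) (by simpa) ⟨f⟩).Comp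
      (lastHom ψ t h ⟨𝟙 y⟩) (lastHom ψ t h ⟨f⟩) := by
  have := lastHom_comp (𝟙 F) ψ (t.map Arrow.idPair) (by simpa) ⟨f, 𝟙 y⟩
  simp only [List.map_map, pairFst_comp_idPair, pairSnd_comp_idPair, pairComp_comp_idPair,
    Category.id_comp, Category.comp_id, List.map_id] at this
  simp only [List.map_map]
  exact this

theorem lastHom_comp_id (ψ : F ⟶ F') (t : List (_root_.Arrow T w)) (h : t.map Sigma.fst = Γ)
    {n : ℕ} {x y : Y.toFun.O n} (f : x ⟶ y) :
    (lastHom ψ t h ⟨𝟙 x⟩).Comp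
      (lastHom (𝟙 F') ((t.map Arrow.tgt).map Point.id) (by simpa) ⟨f⟩) (lastHom ψ t h ⟨f⟩) := by
  have := lastHom_comp ψ (𝟙 F') (t.map Arrow.pairId) (by simpa) ⟨𝟙 x, f⟩
  simp only [List.map_map, pairFst_comp_pairId, pairSnd_comp_pairId, pairComp_comp_pairId,
    Category.id_comp, Category.comp_id, List.map_id] at this
  simp only [List.map_map]
  exact this

section Last

variable (l : List (Point T w)) (h : l.map Sigma.fst = Γ)

theorem lastCell_oneCell (u : EltCell Y.toFun) :
    (⟨(F.lastCell l h u).α⟩ : OneCell T) = μ.left (num l) ⟨u.α⟩ :=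
  (F.valCell_oneCell _).trans (congrArg (μ.left (num l)) (μ.right_one _))

theorem lastCell_src (u : EltCell Y.toFun) : (F.lastCell l h u).src = F.lastVal l h u.src :=
  F.valCell_src _

theorem lastCell_tgt (u : EltCell Y.toFun) : (F.lastCell l h u).tgt = F.lastVal l h u.tgt :=
  F.valCell_tgt _

theorem lastCell_isId {u : EltCell Y.toFun} (hu : u.IsTight) : (F.lastCell l h u).cell.IsId :=
  (F.valCell_isTight (U := ⟨l, u, []⟩) _ hu).2

theorem lastCell_comp {u v t : EltCell Y.toFun} (e : u.Comp v t) :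
    (F.lastCell l h u).Comp (F.lastCell l h v) (F.lastCell l h t) :=
  F.valCell_comp l [] e (by simp [h])

end Last

theorem lastCell_sq (ψ : F ⟶ F') (t : List (_root_.Arrow T w)) (h : t.map Sigma.fst = Γ)
    {u u' : EltCell Y.toFun} {E : TwoCell T} {a b : EltHom Y.toFun} (e : EltCell.Sq u u' E a b) :
    EltCell.Sq (F.lastCell (t.map Arrow.src) (by simpa) u)
      (F'.lastCell (t.map Arrow.tgt) (by simpa) u') (μ.left₂ (num (t.map Arrow.src)) E)
      (lastHom ψ t h a) (lastHom ψ t h b) := by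
  have := valCell_sq ψ t [] e (by simp [h])
  rwa [show μ.right₂ (num (([] : List (_root_.Arrow T w)).map Arrow.src)) E = E from μ.right₂_one E]
    at this

theorem lastCell_sq_id (l : List (Point T w)) (h : l.map Sigma.fst = Γ)
    {u u' : EltCell Y.toFun} {E : TwoCell T} {a b : EltHom Y.toFun} (e : EltCell.Sq u u' E a b) :
    EltCell.Sq (F.lastCell l h u) (F.lastCell l h u') (μ.left₂ (num l) E)
      (lastHom (𝟙 F) (l.map Point.id) (by simpa) a)
      (lastHom (𝟙 F) (l.map Point.id) (by simpa) b) := by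
  have := lastCell_sq (𝟙 F) (l.map Point.id) (by simpa) e
  simp only [List.map_map, src_comp_id, tgt_comp_id, List.map_id] at this
  exact this

section Init

variable (U : MultiCell T w) (h : U.sources = Γ) (p : Elt Y.toFun)

theorem initCell_oneCell : (⟨(F.initCell U h p).α⟩ : OneCell T) = μ.right p.n (U.oneCell μ) := by
  refine (F.valCell_oneCell _).trans ?_
  simp only [MultiCell.oneCell, num_append, num_cons, num_nil, mul_one]
  rw [← μ.right_right, μ.right_left]

theorem initCell_src : (F.initCell U h p).src = F.lastVal U.src (by simpa) p :=
  (F.valCell_src _).trans (F.val_congr (by simp) _ _)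

theorem initCell_tgt : (F.initCell U h p).tgt = F.lastVal U.tgt (by simpa) p :=
  (F.valCell_tgt _).trans (F.val_congr (by simp) _ _)

theorem initCell_isId (hU : U.cell.IsTight) : (F.initCell U h p).cell.IsId :=
  (F.valCell_isTight (U := ⟨U.left, U.cell, U.right ++ [(⟨Y, p⟩ : Point T w)]⟩)
    (by simp [← h]) hU).2

/-- The Gray law for a variable among the first ones and the last variable. -/
theorem initCell_gray_last (v : EltCell Y.toFun) :
    EltCell.Gray (μ.grayW (U.oneCell μ) ⟨v.α⟩) (F.initCell U h v.src)
      (F.lastCell U.tgt (by simpa) v) (F.lastCell U.src (by simpa) v) (F.initCell U h v.tgt) := by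
  have := F.valCell_gray U.left U.cell U.right v [] (by simp [← h])
  rwa [num_nil, μ.rightW_grayW, μ.right_one, ← μ.grayW_left] at this

end Init

theorem initCell_comp (l l' : List (Point T w)) {X : Model T w} {u v t : EltCell X.toFun}
    (e : u.Comp v t) (h : l.map Sigma.fst ++ X :: l'.map Sigma.fst = Γ) (p : Elt Y.toFun) :
    (F.initCell ⟨l, u, l'⟩ h p).Comp (F.initCell ⟨l, v, l'⟩ h p) (F.initCell ⟨l, t, l'⟩ h p) :=
  F.valCell_comp l (l' ++ [(⟨Y, p⟩ : Point T w)]) e (by simp [← h])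

theorem initCell_sq (ψ : F ⟶ F') (l l' : List (_root_.Arrow T w)) {X : Model T w}
    {u u' : EltCell X.toFun} {E : TwoCell T} {a b : EltHom X.toFun} (e : EltCell.Sq u u' E a b)
    (h : l.map Sigma.fst ++ X :: l'.map Sigma.fst = Γ) (c : EltHom Y.toFun) :
    EltCell.Sq (F.initCell ⟨l.map Arrow.src, u, l'.map Arrow.src⟩ (by simpa) c.src)
      (F'.initCell ⟨l.map Arrow.tgt, u', l'.map Arrow.tgt⟩ (by simpa) c.tgt)
      (μ.right₂ c.n (μ.left₂ (num (l.map Arrow.src)) (μ.right₂ (num (l'.map Arrow.src)) E)))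
      (lastHom ψ (l ++ ⟨X, a⟩ :: l') (by simpa) c) (lastHom ψ (l ++ ⟨X, b⟩ :: l') (by simpa) c) := by
  have := valCell_sq ψ l (l' ++ [⟨Y, c⟩]) e (by simp [← h])
  simp only [List.map_append, List.map_cons, List.map_nil, num_append, num_cons, num_nil,
    mul_one] at this
  rw [μ.right₂_left₂, μ.right₂_right₂]
  have e' (a : EltHom X.toFun) : lastHom ψ (l ++ ⟨X, a⟩ :: l') (by simpa) c =
      valHom ψ (l ++ ⟨X, a⟩ :: (l' ++ [⟨Y, c⟩])) (by simp [← h]) :=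
    valHom_congr _ (by simp) _ _
  rw [e', e']
  exact this

theorem initCell_gray (l : List (Point T w)) {X : Model T w} (u : EltCell X.toFun)
    (l' : List (Point T w)) {V : Model T w} (v : EltCell V.toFun) (l'' : List (Point T w))
    (h : l.map Sigma.fst ++ X :: (l'.map Sigma.fst ++ V :: l''.map Sigma.fst) = Γ)
    (p : Elt Y.toFun) :
    EltCell.Gray
      (μ.rightW p.n
        (μ.leftW (num l) (μ.rightW (num l'') (μ.grayW (μ.right (num l') ⟨u.α⟩) ⟨v.α⟩))))
      (F.initCell ⟨l, u, l' ++ ⟨V, v.src⟩ :: l''⟩ (by simpa) p)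
      (F.initCell ⟨l ++ ⟨X, u.tgt⟩ :: l', v, l''⟩ (by simpa) p)
      (F.initCell ⟨l ++ ⟨X, u.src⟩ :: l', v, l''⟩ (by simpa) p)
      (F.initCell ⟨l, u, l' ++ ⟨V, v.tgt⟩ :: l''⟩ (by simpa) p) := by
  have := F.valCell_gray l u l' v (l'' ++ [⟨Y, p⟩]) (by simp [← h])
  simp only [num_append, num_cons, num_nil, mul_one] at this
  rw [μ.rightW_leftW, μ.rightW_grayW, μ.rightW_grayW, μ.right_right]
  rw [μ.rightW_grayW] at this
  have e₁ (q : Elt V.toFun) : F.initCell ⟨l, u, l' ++ ⟨V, q⟩ :: l''⟩ (by simpa) p =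
      F.valCell ⟨l, u, l' ++ ⟨V, q⟩ :: (l'' ++ [⟨Y, p⟩])⟩ (by simp [← h]) :=
    F.valCell_congr (by simp) _ _
  rw [e₁, e₁]
  exact this

end MultiMap

end LastVariable


/-! ### Currying one value of a multimap -/

section Currying

variable {T : LawvereTwoTheory 𝕋} {w : Weakness} {μ : WCommutativity T w}
  {Γ : List (Model T w)} {Y Z : Model T w}

namespace MultiMap

/-- The element `t` of the internal hom is the multimap `F` as a function of its last variable, at
the given values of the first variables. -/
structure IsCurry (F : MultiMap μ (Γ ++ [Y]) Z) (l : List (Point T w))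
    (h : l.map Sigma.fst = Γ) (t : Elt (μ.homObj Y Z).toFun) : Prop where
  n : t.n = num l
  hom (b : EltHom Y.toFun) : valHom (𝟙 (μ.ev Y Z)) [⟨_, t.id⟩, ⟨_, b⟩] rfl =
    lastHom (𝟙 F) (l.map Point.id) (by simpa) b
  cell (u : EltCell Y.toFun) : (μ.ev Y Z).valCell ⟨[⟨_, t⟩], u, []⟩ rfl = F.lastCell l h u

/-- For the cells it is enough to compare values at identity cells. -/
theorem IsCurry.of_one {F : MultiMap μ (Γ ++ [Y]) Z} {l : List (Point T w)}
    {h : l.map Sigma.fst = Γ} {t : Elt (μ.homObj Y Z).toFun} (hn : t.n = num l)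
    (hh : ∀ b : EltHom Y.toFun, valHom (𝟙 (μ.ev Y Z)) [⟨_, t.id⟩, ⟨_, b⟩] rfl =
      lastHom (𝟙 F) (l.map Point.id) (by simpa) b)
    (hc : ∀ {m n : ℕ} (α : T.ob m ⟶ T.ob n) (p : Y.toFun.O m),
      (μ.ev Y Z).valCell ⟨[⟨_, t⟩], EltCell.one (F := Y.toFun) α p, []⟩ rfl =
        F.lastCell l h (EltCell.one (F := Y.toFun) α p)) : IsCurry F l h t := by
  refine ⟨hn, hh, EltCell.eq_of_sq (c := fun u => (μ.ev Y Z).valCell ⟨[⟨_, t⟩], u, []⟩ rfl)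
    (c' := fun u => F.lastCell l h u) (fun {m n α u u' p b} hs =>
      ⟨_, _, ((μ.L (num l)).hom _ _).obj α, F.lastVal l h p,
        lastHom (𝟙 F) (l.map Point.id) (by simpa) b, ?_, ?_⟩) hc⟩
  · have := lastCell_sq_id (Γ := [μ.homObj Y Z]) (F := μ.ev Y Z) [⟨_, t⟩] rfl hs
    rw [num_cons, num_nil, mul_one, hn, μ.left₂_id] at this
    rw [← lastHom_id, ← hh, ← hh]
    exact this
  · have := F.lastCell_sq_id l h hs
    rw [μ.left₂_id] at this
    rw [← lastHom_id]
    exact this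

/-- Every multimap is, at given values of its first variables, a family of homomorphisms in its last
variable. -/
theorem exists_isCurry (F : MultiMap μ (Γ ++ [Y]) Z) (l : List (Point T w))
    (h : l.map Sigma.fst = Γ) : ∃ t, IsCurry F l h t := by
  have app (n : ℕ) : ∃ K : Y.toFun.O n ⥤ Z.toFun.O (num l * n),
      (∀ x, (⟨K.obj x⟩ : Elt Z.toFun) = F.lastVal l h ⟨x⟩) ∧
      ∀ {x y} (f : x ⟶ y), (⟨K.map f⟩ : EltHom Z.toFun) =
        lastHom (𝟙 F) (l.map Point.id) (by simpa) ⟨f⟩ := by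
    refine exists_functor _ _ (fun x => F.lastVal_n l h ⟨x⟩) _ (fun f => ?_) (fun f => ?_)
      (fun x => F.lastHom_id l h ⟨x⟩) (fun f g => F.lastHom_comp_of_id l h f g)
    · exact (lastHom_src _ _ _ _).trans (F.lastVal_congr (by simp) _ _ _)
    · exact (lastHom_tgt _ _ _ _).trans (F.lastVal_congr (by simp) _ _ _)
  choose K ho hm using app
  have cell {m n : ℕ} (β : T.ob m ⟶ T.ob n) :
      ∃ σ : WHom (K m ⋙ Z.toFun.fn (((μ.L (num l)).hom _ _).obj β)) (Y.toFun.fn β ⋙ K n) w,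
        ∀ x, (⟨((μ.L (num l)).hom _ _).obj β, σ.appAt x⟩ : EltCell Z.toFun) =
          F.lastCell l h (EltCell.one (F := Y.toFun) β x) := by
    refine exists_wHom _ _ (fun x => F.lastCell_oneCell l h _)
      (fun x => (F.lastCell_src l h _).trans (ho _ _).symm)
      (fun x => (F.lastCell_tgt l h _).trans (ho _ _).symm) (fun {x y} f => ?_)
    have := F.lastCell_sq_id l h (EltCell.sq_one (F := Y.toFun) (𝟙 β) f)
    rw [μ.left₂_id] at this
    rw [hm m f]
    have e : (Y.toFun.tr (𝟙 β)).app x ≫ (Y.toFun.fn β).map f = (Y.toFun.fn β).map f := by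
      rw [TwoFun.tr, CategoryTheory.Functor.map_id]
      exact Category.id_comp _
    rw [e, ← hm n] at this
    exact this
  choose σ hσ using @cell
  let f : WTrans Y.toFun (μ.tensorL Z (num l)) :=
    { app := K
      cell := σ
      cell_tight := fun p => WHom.isId_of_appAt' _ fun x => by
        have := F.lastCell_isId l h (u := EltCell.one (F := Y.toFun) (T.θ p) x)
          ⟨⟨p, rfl⟩, WHom.isId_ofEq _⟩
        rw [← hσ] at this
        exact this
      cell_comp := fun {m n k} α β => by
        refine WEq.of_appAt ?_ ?_ fun x => ?_
        · exact congrArg (K m ⋙ ·) ((μ.tensorL Z (num l)).act.map_comp _ _)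
        · exact congrArg (· ⋙ K k) (Y.toFun.act.map_comp _ _)
        · have := F.lastCell_comp l h (EltCell.comp_one (F := Y.toFun) α β x)
          rw [← hσ, ← hσ, ← hσ] at this
          rw [WHom.appAt_comp]
          exact this.wEq.trans (WEq.comp
            (.of_eq (WHom.appAt_whR (σ α) (Z.toFun.fn (((μ.L (num l)).hom _ _).obj β)) x))
            (.of_eq (WHom.appAt_whL (Y.toFun.fn α) (σ β) x))).symm
      cell_nat := fun {m n α β} η => WHom.sq_of_appAt fun x => by
        have := F.lastCell_sq_id l h (EltCell.sq_one (F := Y.toFun) η (𝟙 x))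
        rw [← hσ, ← hσ, ← hm, ← hm] at this
        have := this.sq
        simp only [CategoryTheory.Functor.map_id, Category.comp_id] at this
        exact this }
  obtain ⟨t, ht⟩ := (Functor.IsIso.bijective_obj (F := μ.transpose Y Z (num l))).2 f
  refine ⟨⟨t⟩, .of_one rfl (fun b => ?_) fun α p => ?_⟩
  · rw [μ.valHom_ev_id]
    dsimp only
    rw [ht, ← hm]
    exact congrArg (EltHom.mk (F := Z.toFun)) (Category.comp_id _)
  · rw [μ.valCell_ev_right]
    dsimp only
    rw [ht, ← hσ]
    refine EltCell.mk_congr rfl rfl rfl ?_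
    exact WEq.comp_isId _ ((WHom.isId_ofEq rfl).map _)

end MultiMap

end Currying


section Currying

variable {T : LawvereTwoTheory 𝕋} {w : Weakness} {μ : WCommutativity T w}
  {Γ : List (Model T w)} {Y Z : Model T w}

theorem EltCell.sq_one_id {F : TwoFun T w} {m n : ℕ} (α : T.ob m ⟶ T.ob n) {p q : F.O m}
    (f : p ⟶ q) : EltCell.Sq (.one α p) (.one α q) ⟨𝟙 α⟩ ⟨f⟩ ⟨(F.fn α).map f⟩ := by
  have := EltCell.sq_one (F := F) (𝟙 α) f
  rwa [show (F.tr (𝟙 α)).app p ≫ (F.fn α).map f = (F.fn α).map f by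
    rw [TwoFun.tr, CategoryTheory.Functor.map_id]; exact Category.id_comp _] at this

theorem num_src (t : List (_root_.Arrow T w)) : num (t.map Arrow.src) = num (t.map Arrow.tgt) := by
  simp only [num, List.map_map]
  rfl

namespace MultiMap

variable {F F' : MultiMap μ (Γ ++ [Y]) Z} {l : List (Point T w)} {h : l.map Sigma.fst = Γ}

theorem IsCurry.map_eq {k : ℕ} {t : (μ.homObj Y Z).toFun.O k} (ht : IsCurry F l h ⟨t⟩) {n : ℕ}
    {x y : Y.toFun.O n} (f : x ⟶ y) :
    EltHom.mk (F := Z.toFun) (n := k * n) ((WTrans.app ((μ.transpose Y Z k).obj t) n).map f) =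
      lastHom (𝟙 F) (l.map Point.id) (by simpa) ⟨f⟩ := by
  refine .trans ?_ (ht.hom ⟨f⟩)
  rw [μ.valHom_ev_id]
  exact congrArg (EltHom.mk (F := Z.toFun)) (Category.comp_id _).symm

theorem IsCurry.obj_eq {k : ℕ} {t : (μ.homObj Y Z).toFun.O k} (ht : IsCurry F l h ⟨t⟩) {n : ℕ}
    (x : Y.toFun.O n) :
    Elt.mk (F := Z.toFun) (n := k * n) ((WTrans.app ((μ.transpose Y Z k).obj t) n).obj x) =
      F.lastVal l h ⟨x⟩ :=
  ((congrArg EltHom.src (ht.map_eq (𝟙 x))).trans (lastHom_src _ _ _ _)).trans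
    (F.lastVal_congr (by simp) _ _ _)

theorem IsCurry.cell_eq {k : ℕ} {t : (μ.homObj Y Z).toFun.O k} (ht : IsCurry F l h ⟨t⟩) {m n : ℕ}
    (β : T.ob m ⟶ T.ob n) (x : Y.toFun.O m) :
    EltCell.mk (F := Z.toFun) (((μ.L k).hom _ _).obj β)
        ((WTrans.cell ((μ.transpose Y Z k).obj t) β).appAt x) =
      F.lastCell l h (EltCell.one (F := Y.toFun) β x) := by
  refine .trans ?_ (ht.cell _)
  rw [μ.valCell_ev_right]
  refine (EltCell.mk_congr (F := Z.toFun) rfl rfl rfl ?_).symm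
  exact WEq.comp_isId _ ((WHom.isId_ofEq rfl).map _)

/-- A modification of multimaps, at given morphisms in the first variables, is a modification of the
homomorphisms in the last variable. -/
theorem IsCurry.exists_hom (ψ : F ⟶ F') (t : List (_root_.Arrow T w)) (h : t.map Sigma.fst = Γ)
    {e e' : Elt (μ.homObj Y Z).toFun} (he : IsCurry F (t.map Arrow.src) (by simpa) e)
    (he' : IsCurry F' (t.map Arrow.tgt) (by simpa) e') :
    ∃ a : EltHom (μ.homObj Y Z).toFun, a.src = e ∧ a.tgt = e' ∧
      ∀ b, valHom (𝟙 (μ.ev Y Z)) [⟨_, a⟩, ⟨_, b⟩] rfl = lastHom ψ t h b := by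
  obtain @⟨k, e⟩ := e
  obtain @⟨k', e'⟩ := e'
  obtain rfl : k = k' := he.n.trans ((num_src t).trans he'.n.symm)
  obtain rfl : k = num (t.map Arrow.src) := he.n
  have app (n : ℕ) : ∃ τ : WTrans.app ((μ.transpose Y Z _).obj e) n ⟶
      WTrans.app ((μ.transpose Y Z _).obj e') n, ∀ x : Y.toFun.O n,
      EltHom.mk (F := Z.toFun) (τ.app x) = lastHom ψ t h ⟨𝟙 x⟩ := by
    refine exists_natTrans (G := Z.toFun) _ (fun x => ?_) (fun x => ?_) (fun {x y} f => ?_)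
    · exact (lastHom_src ψ t h _).trans (he.obj_eq x).symm
    · exact (lastHom_tgt ψ t h _).trans (he'.obj_eq x).symm
    · refine ⟨lastHom ψ t h ⟨f⟩, ?_, ?_⟩
      · have := lastHom_id_comp ψ t h f
        rw [← he.map_eq] at this
        exact this
      · have := lastHom_comp_id ψ t h f
        rw [← he'.map_eq] at this
        exact this
  choose τ hτ using app
  let φ : (μ.transpose Y Z _).obj e ⟶ (μ.transpose Y Z _).obj e' :=
    WTrans.Modif.mk τ fun {m n} α => WHom.sq_of_appAt fun x => by
      have := lastCell_sq ψ t h (EltCell.sq_one_id (F := Y.toFun) α (𝟙 x))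
      rw [μ.left₂_id, ← he.cell_eq, ← he'.cell_eq, CategoryTheory.Functor.map_id, ← hτ, ← hτ] at this
      refine (EltCell.Sq.sq (F := Z.toFun) this).congr .refl .refl (.of_eq ?_) .refl
      refine .trans (congrArg (· ≫ _) ?_) (Category.id_comp _)
      exact congrArg (fun t => NatTrans.app t _)
        (CategoryTheory.Functor.map_id (Z.toFun.act.hom _ _) (((μ.L _).hom _ _).obj α))
  obtain ⟨f, hf⟩ := (μ.transpose Y Z _).map_surjective φ
  refine ⟨⟨f⟩, rfl, rfl, fun b => ?_⟩
  rw [μ.valHom_ev]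
  dsimp only
  rw [hf]
  have := lastHom_comp_id ψ t h b.hom
  rw [← hτ, ← he'.map_eq] at this
  exact (EltHom.Comp.mk _ _).unique this

theorem _root_.EltCell.Sq.refl {F : TwoFun T w} (u : EltCell F) :
    EltCell.Sq u u ⟨𝟙 u.α⟩ u.src.id u.tgt.id := by
  obtain @⟨m, n, α, p, q, σ⟩ := u
  change EltCell.Sq _ _ ⟨𝟙 α⟩ ⟨𝟙 p⟩ ⟨𝟙 q⟩
  refine .mk _ ((WHom.Sq.id σ).congr .refl .refl (.of_eq ?_) .refl)
  rw [CategoryTheory.Functor.map_id, TwoFun.tr, CategoryTheory.Functor.map_id]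
  exact (Category.comp_id _).symm

theorem _root_.WCommutativity.right₂_id (n : ℕ) {k l : ℕ} (α : T.ob k ⟶ T.ob l) :
    μ.right₂ n ⟨𝟙 α⟩ = ⟨𝟙 (((μ.R n).hom _ _).obj α)⟩ :=
  congrArg TwoCell.mk (CategoryTheory.Functor.map_id _ _)

theorem _root_.OneCell.exists_hom (a : OneCell T) {k l : ℕ} (hk : a.m = k) (hl : a.n = l) :
    ∃ α : T.ob k ⟶ T.ob l, OneCell.mk α = a := by
  obtain ⟨α⟩ := a
  subst hk hl
  exact ⟨α, rfl⟩

theorem initCell_sq_id (F : MultiMap μ (Γ ++ [Y]) Z) (U : MultiCell T w) (h : U.sources = Γ)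
    {k l : ℕ} {α : T.ob k ⟶ T.ob l} (hα : OneCell.mk α = U.oneCell μ) (c : EltHom Y.toFun) :
    EltCell.Sq (F.initCell U h c.src) (F.initCell U h c.tgt) ⟨𝟙 (((μ.R c.n).hom _ _).obj α)⟩
      (lastHom (𝟙 F) (U.src.map Point.id) (by simpa) c)
      (lastHom (𝟙 F) (U.tgt.map Point.id) (by simpa) c) := by
  have := initCell_sq (𝟙 F) (U.left.map Point.id) (U.right.map Point.id) (.refl U.cell) (by simpa) c
  simp only [List.map_map, src_comp_id, tgt_comp_id, List.map_id] at this
  rw [μ.right₂_id, μ.left₂_id] at this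
  change EltCell.Sq _ _ (μ.right₂ c.n ⟨𝟙 (U.oneCell μ).hom⟩) _ _ at this
  rw [← hα, μ.right₂_id] at this
  simp only [MultiCell.src, MultiCell.tgt, List.map_append, List.map_cons]
  exact this

theorem _root_.WCommutativity.comp_lift_cell {k k' : ℕ} (f : Y.toFun ⟶ μ.tensorL Z k)
    (α : T.ob k ⟶ T.ob k') {m n : ℕ} (β : T.ob m ⟶ T.ob n) (x : Y.toFun.O m) :
    WEq ((WTrans.cell (f ≫ μ.lift Z α) β).appAt x)
      ((((μ.gray α β).map (Z.toFun.act.hom _ _)).appAt ((WTrans.app f m).obj x)).compEq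
        (congrArg (fun K : Z.toFun.O (k * m) ⥤ Z.toFun.O (k' * n) => K.obj ((WTrans.app f m).obj x))
          (Z.toFun.act.map_comp (((μ.L k).hom _ _).obj β) (((μ.R n).hom _ _).obj α)))
        (((WTrans.cell f β).appAt x).map (Z.toFun.fn (((μ.R n).hom _ _).obj α)))) := by
  change WEq ((WHom.comp (WHom.whL (WTrans.app f m) (WTrans.cell (μ.lift Z α) β))
    (WHom.whR (WTrans.cell f β) (WTrans.app (μ.lift Z α) n))).appAt x) _
  rw [WHom.appAt_comp, WHom.appAt_whL, WHom.appAt_whR]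
  refine WEq.symm (WEq.compEq ?_ ?_)
  · exact ((μ.lift_cell Z α β).appAt ((WTrans.app f m).obj x)).symm
  · exact WEq.refl (s := ((WTrans.cell f β).appAt x).map (Z.toFun.fn (((μ.R n).hom _ _).obj α)))

/-- The value of a multimap at a cell in one of its first variables is a cell of the internal hom.
The Gray law for this variable and the last one is what makes it compatible with the cells of the
homomorphisms. -/
theorem IsCurry.exists_cell (F : MultiMap μ (Γ ++ [Y]) Z) (U : MultiCell T w) (h : U.sources = Γ)
    {e e' : Elt (μ.homObj Y Z).toFun} (he : IsCurry F U.src (by simpa) e)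
    (he' : IsCurry F U.tgt (by simpa) e') :
    ∃ c : EltCell (μ.homObj Y Z).toFun, OneCell.mk c.α = U.oneCell μ ∧ c.src = e ∧ c.tgt = e' ∧
      ∀ p, (μ.ev Y Z).valCell ⟨[], c, [⟨_, p⟩]⟩ rfl = F.initCell U h p := by
  obtain @⟨k, e⟩ := e
  obtain @⟨k', e'⟩ := e'
  obtain ⟨α, hα⟩ := (U.oneCell μ).exists_hom (k := k) (l := k')
    (he.n.trans (num_append _ _)).symm (he'.n.trans (num_append _ _)).symm
  have cell (n : ℕ) : ∃ s : WHom (WTrans.app ((μ.transpose Y Z k).obj e) n ⋙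
        Z.toFun.fn (((μ.R n).hom _ _).obj α)) (WTrans.app ((μ.transpose Y Z k').obj e') n) w,
      ∀ x, EltCell.mk (F := Z.toFun) (((μ.R n).hom _ _).obj α) (s.appAt x) =
        F.initCell U h ⟨x⟩ := by
    refine exists_wHom _ _ (fun x => ?_) (fun x => ?_) (fun x => ?_) (fun {x y} f => ?_)
    · rw [F.initCell_oneCell, ← hα]
      rfl
    · exact (F.initCell_src U h _).trans (he.obj_eq x).symm
    · exact (F.initCell_tgt U h _).trans (he'.obj_eq x).symm
    · have := F.initCell_sq_id U h hα ⟨f⟩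
      rw [← he.map_eq, ← he'.map_eq] at this
      exact this
  choose s hs using cell
  -- the cells of `e ≫ Z(α ⊗ -)` contain the Gray cells, so the compatibility is the Gray law of `F`
  obtain ⟨r, hr⟩ := WTrans.exists_wHom (f := (μ.transpose Y Z k).obj e ≫ μ.lift Z α)
    (g := (μ.transpose Y Z k').obj e') s (fun {m n} β => by
      refine WEq.eq (.of_appAt rfl rfl fun x => ?_)
      have := F.initCell_gray_last U h (EltCell.one (F := Y.toFun) β x)
      rw [← hα, ← he.cell_eq, ← he'.cell_eq] at this
      change EltCell.Gray _ (F.initCell U h ⟨x⟩) _ _ (F.initCell U h ⟨(Y.toFun.fn β).obj x⟩) at this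
      rw [← hs, ← hs] at this
      have := EltCell.Gray.wEq (F := Z.toFun) this
      rw [WHom.appAt_comp, WHom.appAt_comp]
      refine .trans (WEq.comp (.of_eq (WHom.appAt_whR (s m)
        (Z.toFun.fn (((μ.L k').hom _ _).obj β)) x)) .refl) (this.trans ?_)
      refine .trans (.of_eq (WHom.assoc _ _ _).symm) ?_
      exact WEq.comp (μ.comp_lift_cell _ α β x).symm
        (.of_eq (WHom.appAt_whL (Y.toFun.fn β) (s n) x).symm))
  have hsrc : (μ.transpose Y Z k').obj (((μ.homObj Y Z).toFun.fn α).obj e) =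
      (μ.transpose Y Z k).obj e ≫ μ.lift Z α :=
    congrArg (fun K => K.obj e) (μ.transpose_fn Y Z α)
  refine ⟨⟨α, ((WHom.ofEq hsrc).comp r).unmap (μ.transpose Y Z k')⟩, hα, rfl, rfl, fun p => ?_⟩
  obtain ⟨_, e₁⟩ := μ.valCell_ev_left
    ⟨α, ((WHom.ofEq hsrc).comp r).unmap (μ.transpose Y Z k')⟩ p rfl
  rw [e₁]
  refine .trans ?_ (hs p.n p.obj)
  refine EltCell.mk_congr (F := Z.toFun) rfl rfl rfl ((WEq.ofEq_comp _ _).trans ?_)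
  rw [← hr]
  refine .trans (.of_eq (WHom.map_map (μ.transpose Y Z k') (WTrans.component Y.toFun
    (μ.tensorL Z k') p.n ⋙ (evaluation _ _).obj p.obj) _).symm) ?_
  rw [WHom.map_unmap]
  exact ((WEq.ofEq_comp hsrc r).map _).trans (.of_eq (WHom.map_map _ _ r).symm)

end MultiMap

end Currying


/-! ### Laws in the internal hom hold if they hold after evaluation -/

section Detection

variable {T : LawvereTwoTheory 𝕋} {w : Weakness}

/-- The third 1-cell is the composite of the first two. -/
inductive OneCell.Comp : OneCell T → OneCell T → OneCell T → Prop
  | mk {m n k : ℕ} (α : T.ob m ⟶ T.ob n) (β : T.ob n ⟶ T.ob k) : Comp ⟨α⟩ ⟨β⟩ ⟨α ≫ β⟩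

namespace OneCell.Comp

variable {a b c : OneCell T}

theorem unique {c' : OneCell T} (h : a.Comp b c) (h' : a.Comp b c') : c = c' := by
  cases h; cases h'; rfl

theorem left (μ : WCommutativity T w) (m : ℕ) (h : a.Comp b c) :
    (μ.left m a).Comp (μ.left m b) (μ.left m c) := by
  obtain ⟨α, β⟩ := h
  rw [show μ.left m ⟨α ≫ β⟩ = ⟨((μ.L m).hom _ _).obj α ≫ ((μ.L m).hom _ _).obj β⟩ from
    congrArg OneCell.mk ((μ.L m).map_comp α β)]
  exact .mk _ _

theorem right (μ : WCommutativity T w) (m : ℕ) (h : a.Comp b c) :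
    (μ.right m a).Comp (μ.right m b) (μ.right m c) := by
  obtain ⟨α, β⟩ := h
  rw [show μ.right m ⟨α ≫ β⟩ = ⟨((μ.R m).hom _ _).obj α ≫ ((μ.R m).hom _ _).obj β⟩ from
    congrArg OneCell.mk ((μ.R m).map_comp α β)]
  exact .mk _ _

end OneCell.Comp

namespace EltCell

variable {F : TwoFun T w} {u v t t' : EltCell F} {W : WCell T w}

theorem Comp.unique (h : u.Comp v t) (h' : u.Comp v t') : t = t' := by
  cases h; cases h'; rfl

theorem exists_comp (h : u.tgt = v.src) : ∃ t, u.Comp v t := by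
  obtain ⟨α, σ⟩ := u
  obtain ⟨β, τ⟩ := v
  cases h
  exact ⟨_, .mk α β σ τ⟩

theorem Comp.src (h : u.Comp v t) : t.src = u.src := by cases h; rfl

theorem Comp.tgt (h : u.Comp v t) : t.tgt = v.tgt := by cases h; rfl

theorem Comp.oneCell (h : u.Comp v t) : OneCell.Comp ⟨u.α⟩ ⟨v.α⟩ ⟨t.α⟩ := by cases h; exact .mk _ _

theorem Pull.unique (h : Pull W t u) (h' : Pull W t' u) : t = t' := by
  cases h; cases h'; rfl

theorem exists_pull (h : OneCell.mk u.α = ⟨W.β⟩) : ∃ t, Pull W t u := by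
  obtain ⟨α, σ⟩ := u
  obtain ⟨τ⟩ := W
  cases h
  exact ⟨_, .mk τ σ⟩

theorem Pull.src (h : Pull W t u) : t.src = u.src := by cases h; rfl

theorem Pull.tgt (h : Pull W t u) : t.tgt = u.tgt := by cases h; rfl

theorem Pull.oneCell (h : Pull W t u) : OneCell.mk t.α = ⟨W.α⟩ := by cases h; rfl

theorem Sq.oneCell {E : TwoCell T} {a b : EltHom F} (h : Sq u v E a b) :
    OneCell.mk u.α = ⟨E.α⟩ ∧ OneCell.mk v.α = ⟨E.β⟩ := by cases h; exact ⟨rfl, rfl⟩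

end EltCell

theorem EltHom.exists_comp {F : TwoFun T w} {a b : EltHom F} (h : a.tgt = b.src) :
    ∃ c, a.Comp b c ∧ c.src = a.src ∧ c.tgt = b.tgt := by
  obtain ⟨f⟩ := a
  obtain ⟨g⟩ := b
  cases h
  exact ⟨_, .mk f g, rfl, rfl⟩

namespace WCommutativity

open MultiMap

variable {μ : WCommutativity T w} {Y Z : Model T w}

theorem hom_comp_of_apply {a b c : EltHom (μ.homObj Y Z).toFun} (h₁ : a.tgt = b.src)
    (h₂ : c.src = a.src) (h₃ : c.tgt = b.tgt)
    (h : ∀ p : Elt Y.toFun, EltHom.Comp (valHom (𝟙 (μ.ev Y Z)) [⟨_, a⟩, ⟨_, p.id⟩] rfl)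
      (valHom (𝟙 (μ.ev Y Z)) [⟨_, b⟩, ⟨_, p.id⟩] rfl)
      (valHom (𝟙 (μ.ev Y Z)) [⟨_, c⟩, ⟨_, p.id⟩] rfl)) : a.Comp b c := by
  obtain ⟨d, hd, h₄, h₅⟩ := EltHom.exists_comp h₁
  have : d = c := μ.eltHom_ext (h₄.trans h₂.symm) (h₅.trans h₃.symm) fun p => by
    refine EltHom.Comp.unique ?_ (h p)
    obtain ⟨e, rfl, rfl, rfl⟩ := hd.exists_pair
    have := valHom_comp (𝟙 (μ.ev Y Z)) (𝟙 _) [⟨_, e⟩, Point.pair ⟨Y, p⟩] rfl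
    simp only [List.map_cons, List.map_nil, Category.comp_id,
      show ArrowPair.comp (Point.pair ⟨Y, p⟩) = Point.id ⟨Y, p⟩ from
        congrFun pairComp_comp_pair _] at this
    exact this
  exact this ▸ hd

theorem cell_comp_of_apply {c d e : EltCell (μ.homObj Y Z).toFun} (h₁ : c.tgt = d.src)
    (h₂ : e.src = c.src) (h₃ : e.tgt = d.tgt) (hα : OneCell.Comp ⟨c.α⟩ ⟨d.α⟩ ⟨e.α⟩)
    (h : ∀ p : Elt Y.toFun, EltCell.Comp ((μ.ev Y Z).valCell ⟨[], c, [⟨_, p⟩]⟩ rfl)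
      ((μ.ev Y Z).valCell ⟨[], d, [⟨_, p⟩]⟩ rfl) ((μ.ev Y Z).valCell ⟨[], e, [⟨_, p⟩]⟩ rfl)) :
    c.Comp d e := by
  obtain ⟨t, ht⟩ := EltCell.exists_comp h₁
  have : t = e := μ.eltCell_ext (ht.oneCell.unique hα) (ht.src.trans h₂.symm)
    (ht.tgt.trans h₃.symm) fun p => ((μ.ev Y Z).valCell_comp [] [⟨Y, p⟩] ht rfl).unique (h p)
  exact this ▸ ht

/-- The Gray law holds in the internal hom if it holds after evaluation at every element. -/
theorem gray_of_apply {W : WCell T w} {u v' v u' : EltCell (μ.homObj Y Z).toFun}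
    (h₁ : u.tgt = v'.src) (h₂ : v.tgt = u'.src) (hs : u.src = v.src) (ht : v'.tgt = u'.tgt)
    (hα : OneCell.Comp ⟨u.α⟩ ⟨v'.α⟩ ⟨W.α⟩) (hβ : OneCell.Comp ⟨v.α⟩ ⟨u'.α⟩ ⟨W.β⟩)
    (h : ∀ p : Elt Y.toFun, EltCell.Gray (μ.rightW p.n W)
      ((μ.ev Y Z).valCell ⟨[], u, [⟨_, p⟩]⟩ rfl) ((μ.ev Y Z).valCell ⟨[], v', [⟨_, p⟩]⟩ rfl)
      ((μ.ev Y Z).valCell ⟨[], v, [⟨_, p⟩]⟩ rfl) ((μ.ev Y Z).valCell ⟨[], u', [⟨_, p⟩]⟩ rfl)) :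
    EltCell.Gray W u v' v u' := by
  obtain ⟨U, hU⟩ := EltCell.exists_comp h₁
  obtain ⟨V, hV⟩ := EltCell.exists_comp h₂
  obtain ⟨U', hP⟩ := EltCell.exists_pull (hV.oneCell.unique hβ)
  have : U' = U := by
    refine μ.eltCell_ext (hP.oneCell.trans (hα.unique hU.oneCell)) ?_ ?_ fun p => ?_
    · rw [hP.src, hV.src, hU.src, hs]
    · rw [hP.tgt, hV.tgt, hU.tgt, ht]
    · obtain ⟨U'', V'', hU', hV', hP'⟩ := h p
      obtain rfl := hU'.unique ((μ.ev Y Z).valCell_comp [] [⟨Y, p⟩] hU rfl)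
      obtain rfl := hV'.unique ((μ.ev Y Z).valCell_comp [] [⟨Y, p⟩] hV rfl)
      have := (μ.ev Y Z).valCell_pull [] [⟨Y, p⟩] hP rfl
      rw [num_nil, μ.leftW_one, num_cons, num_nil, mul_one] at this
      exact this.unique hP'
  exact ⟨U, V, hU, hV, this ▸ hP⟩

end WCommutativity

end Detection


/-! ### The internal hom is closed -/

section Closed

variable {T : LawvereTwoTheory 𝕋} {w : Weakness} {μ : WCommutativity T w}
  {Γ : List (Model T w)} {Y Z : Model T w}

namespace MultiMap

section Ext

variable {F F' : MultiMap μ (Γ ++ [Y]) Z}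

theorem _root_.List.exists_concat_of_map {M : Type*} {A : M → Type*} {l : List (Σ X, A X)}
    {Γ : List M} {Y : M} (h : l.map Sigma.fst = Γ ++ [Y]) :
    ∃ l' a, l'.map Sigma.fst = Γ ∧ l = l' ++ [⟨Y, a⟩] := by
  obtain ⟨l', l'', rfl, hl', hl''⟩ := List.map_eq_append_iff.1 h
  obtain ⟨a, rfl⟩ := List.exists_singleton_of_map hl''
  exact ⟨l', a, hl', rfl⟩

theorem last_hom_ext {ψ ψ' : F ⟶ F'} (h : ∀ t ht b, lastHom ψ t ht b = lastHom ψ' t ht b) :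
    ψ = ψ' :=
  hom_ext_val fun l hl => by
    obtain ⟨l', a, hl', e⟩ := List.exists_concat_of_map hl
    rw [valHom_congr ψ e, valHom_congr ψ' e]
    exact h l' hl' a

theorem lastHom_id_of_eq (e : F = F') (t : List (_root_.Arrow T w)) (h : t.map Sigma.fst = Γ)
    (b : EltHom Y.toFun) : lastHom (𝟙 F) t h b = lastHom (𝟙 F') t h b := by
  subst e; rfl

theorem last_ext (h : ∀ t ht b, lastHom (𝟙 F) t ht b = lastHom (𝟙 F') t ht b)
    (h' : ∀ l hl u, F.lastCell l hl u = F'.lastCell l hl u)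
    (h'' : ∀ U hU p, F.initCell U hU p = F'.initCell U hU p) : F = F' := by
  refine ext_val (fun t ht => ?_) fun U hU => ?_
  · obtain ⟨t', b, ht', rfl⟩ := List.exists_concat_of_map ht
    exact h t' ht' b
  · obtain @⟨l, X, u, l'⟩ := U
    rcases List.eq_nil_or_concat l' with rfl | ⟨r, a, rfl⟩
    · have e := List.append_inj' hU rfl
      obtain ⟨e, e'⟩ := e
      cases e'
      exact h' l e u
    · obtain ⟨X', a⟩ := a
      have e : (l.map Sigma.fst ++ X :: r.map Sigma.fst) ++ [X'] = Γ ++ [Y] := by simpa using hU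
      obtain ⟨e₁, e₂⟩ := List.append_inj' e rfl
      cases e₂
      exact ((F.valCell_congr (by simp) _ _).trans (h'' ⟨l, u, r⟩ e₁ a)).trans
        (F'.valCell_congr (by simp) _ _)

end Ext

theorem _root_.ArrowPair.map_src_snd (c : List (ArrowPair T w)) :
    (c.map ArrowPair.snd).map Arrow.src = (c.map ArrowPair.fst).map Arrow.tgt := by
  simp only [List.map_map]; rfl

theorem _root_.ArrowPair.map_src_comp (c : List (ArrowPair T w)) :
    (c.map ArrowPair.comp).map Arrow.src = (c.map ArrowPair.fst).map Arrow.src := by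
  simp only [List.map_map]; rfl

theorem _root_.ArrowPair.map_tgt_comp (c : List (ArrowPair T w)) :
    (c.map ArrowPair.comp).map Arrow.tgt = (c.map ArrowPair.snd).map Arrow.tgt := by
  simp only [List.map_map]; rfl

section Square

variable {F : TwoFun T w} {u u' : EltCell F} {E : TwoCell T} {a b : EltHom F}

theorem _root_.EltCell.Sq.src_src (h : EltCell.Sq u u' E a b) : a.src = u.src := by cases h; rfl
theorem _root_.EltCell.Sq.src_tgt (h : EltCell.Sq u u' E a b) : b.src = u.tgt := by cases h; rfl
theorem _root_.EltCell.Sq.tgt_src (h : EltCell.Sq u u' E a b) : a.tgt = u'.src := by cases h; rfl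
theorem _root_.EltCell.Sq.tgt_tgt (h : EltCell.Sq u u' E a b) : b.tgt = u'.tgt := by cases h; rfl

end Square

section Unique

variable {F F' F'' : MultiMap μ (Γ ++ [Y]) Z}

theorem IsCurry.unique {l : List (Point T w)} {h : l.map Sigma.fst = Γ}
    {t t' : Elt (μ.homObj Y Z).toFun} (ht : IsCurry F l h t) (ht' : IsCurry F l h t') : t = t' :=
  μ.elt_ext (ht.n.trans ht'.n.symm) (fun b => (ht.hom b).trans (ht'.hom b).symm)
    fun u => (ht.cell u).trans (ht'.cell u).symm

theorem lastHom_comp_point (ψ : F ⟶ F') (χ : F' ⟶ F'') (c : List (ArrowPair T w))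
    (h : c.map Sigma.fst = Γ) (p : Elt Y.toFun) :
    (lastHom ψ (c.map ArrowPair.fst) (by simpa) p.id).Comp
      (lastHom χ (c.map ArrowPair.snd) (by simpa) p.id)
      (lastHom (ψ ≫ χ) (c.map ArrowPair.comp) (by simpa) p.id) := by
  have := lastHom_comp ψ χ c h ⟨𝟙 p.obj, 𝟙 p.obj⟩
  simp only [Category.comp_id] at this
  exact this

/-- The elements, morphisms and cells of the internal hom that correspond to the values of
multimaps form a square, since they do so after evaluation. -/
theorem sq_of_curry (ψ : F ⟶ F') (l l' : List (_root_.Arrow T w)) {X : Model T w}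
    {u u' : EltCell X.toFun} {E : TwoCell T} {a b : EltHom X.toFun} (e : EltCell.Sq u u' E a b)
    (h : l.map Sigma.fst ++ X :: l'.map Sigma.fst = Γ) {c c' : EltCell (μ.homObj Y Z).toFun}
    {d d' : EltHom (μ.homObj Y Z).toFun}
    (hc : OneCell.mk c.α = MultiCell.oneCell μ ⟨l.map Arrow.src, u, l'.map Arrow.src⟩)
    (hc' : OneCell.mk c'.α = MultiCell.oneCell μ ⟨l.map Arrow.tgt, u', l'.map Arrow.tgt⟩)
    (hs : d.src = c.src) (ht : d.tgt = c'.src) (hs' : d'.src = c.tgt) (ht' : d'.tgt = c'.tgt)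
    (vc : ∀ p, (μ.ev Y Z).valCell ⟨[], c, [⟨_, p⟩]⟩ rfl =
      F.initCell ⟨l.map Arrow.src, u, l'.map Arrow.src⟩ (by simpa) p)
    (vc' : ∀ p, (μ.ev Y Z).valCell ⟨[], c', [⟨_, p⟩]⟩ rfl =
      F'.initCell ⟨l.map Arrow.tgt, u', l'.map Arrow.tgt⟩ (by simpa) p)
    (vd : ∀ q, valHom (𝟙 (μ.ev Y Z)) [⟨_, d⟩, ⟨_, q⟩] rfl =
      lastHom ψ (l ++ ⟨X, a⟩ :: l') (by simpa) q)
    (vd' : ∀ q, valHom (𝟙 (μ.ev Y Z)) [⟨_, d'⟩, ⟨_, q⟩] rfl =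
      lastHom ψ (l ++ ⟨X, b⟩ :: l') (by simpa) q) :
    EltCell.Sq c c' (μ.left₂ (num (l.map Arrow.src)) (μ.right₂ (num (l'.map Arrow.src)) E)) d d' := by
  refine μ.sq_of_apply (μ.left₂ (num (l.map Arrow.src)) (μ.right₂ (num (l'.map Arrow.src)) E)).hom
    (hc.trans ?_) (hc'.trans ?_) hs ht hs' ht' fun p => ?_
  · rw [MultiCell.oneCell, e.oneCell.1]
    rfl
  · rw [MultiCell.oneCell, e.oneCell.2]
    dsimp only
    rw [← num_src l, ← num_src l']
    rfl
  · rw [vc, vc', vd, vd']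
    exact initCell_sq ψ l l' e h p.id

end Unique

section Composite

variable {g g' : MultiMap μ Γ (μ.homObj Y Z)}

/-- The functor that composes multimaps with the evaluation. -/
noncomputable abbrev applyEv (μ : WCommutativity T w) (Γ : List (Model T w)) (Y Z : Model T w) :
    MultiMap μ Γ (μ.homObj Y Z) ⥤ MultiMap μ (Γ ++ [Y]) Z :=
  (multicategory μ).curry (μ.ev Y Z) Γ

theorem lastHom_applyEv (γ : g ⟶ g') (t : List (_root_.Arrow T w)) (h : t.map Sigma.fst = Γ)
    (b : EltHom Y.toFun) : lastHom ((applyEv μ Γ Y Z).map γ) t h b =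
      valHom (𝟙 (μ.ev Y Z)) [⟨_, valHom γ t h⟩, ⟨_, b⟩] rfl :=
  (valHom_subst₂ (Γ := []) (Δ := [Y]) (𝟙 (μ.ev Y Z)) γ
    (t ++ [(⟨Y, b⟩ : _root_.Arrow T w)]) (by simp [h])).trans
    (substHom_eq (Γ := []) (Δ := [Y]) (𝟙 (μ.ev Y Z)) γ (x := []) rfl rfl h rfl)

theorem lastHom_id_applyEv (t : List (_root_.Arrow T w)) (h : t.map Sigma.fst = Γ)
    (b : EltHom Y.toFun) : lastHom (𝟙 ((applyEv μ Γ Y Z).obj g)) t h b =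
      valHom (𝟙 (μ.ev Y Z)) [⟨_, valHom (𝟙 g) t h⟩, ⟨_, b⟩] rfl := by
  rw [← CategoryTheory.Functor.map_id]
  exact lastHom_applyEv _ t h b

theorem lastCell_applyEv (l : List (Point T w)) (h : l.map Sigma.fst = Γ) (u : EltCell Y.toFun) :
    ((applyEv μ Γ Y Z).obj g).lastCell l h u =
      (μ.ev Y Z).valCell ⟨[⟨_, g.val l h⟩], u, []⟩ rfl :=
  (valCell_subst (Γ := []) (Δ := [Y]) ⟨l, u, []⟩ (by simp [h])).trans
    (substCell_right (Γ := []) (Δ := [Y]) (μ.ev Y Z) g (x := []) (a := []) u (by simp) rfl h rfl)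

theorem initCell_applyEv (U : MultiCell T w) (h : U.sources = Γ) (p : Elt Y.toFun) :
    ((applyEv μ Γ Y Z).obj g).initCell U h p =
      (μ.ev Y Z).valCell ⟨[], g.valCell U h, [⟨_, p⟩]⟩ rfl :=
  (valCell_subst (Γ := []) (Δ := [Y])
    ⟨U.left, U.cell, U.right ++ [(⟨Y, p⟩ : Point T w)]⟩ (by simp [← h])).trans
    (substCell_mid (Γ := []) (Δ := [Y]) (μ.ev Y Z) g (x := []) (a := U.left) U.cell rfl rfl rfl h
      rfl)

/-- Composing `g` with the evaluation and currying gives back the values of `g`. -/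
theorem isCurry_applyEv (l : List (Point T w)) (h : l.map Sigma.fst = Γ) :
    IsCurry ((applyEv μ Γ Y Z).obj g) l h (g.val l h) where
  n := g.val_n h
  hom b := by rw [lastHom_id_applyEv, g.valHom_id h]
  cell u := (lastCell_applyEv l h u).symm

end Composite

instance : (applyEv μ Γ Y Z).Faithful where
  map_injective {g g'} γ γ' e := hom_ext_val fun l hl => by
    refine μ.eltHom_ext ?_ ?_ fun p => ?_
    · rw [valHom_src, valHom_src]
    · rw [valHom_tgt, valHom_tgt]
    · rw [← lastHom_applyEv, ← lastHom_applyEv, e]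

theorem applyEv_injective : Function.Injective (applyEv μ Γ Y Z).obj := fun g g' e => by
  have hv (l hl) : g.val l hl = g'.val l hl :=
    (isCurry_applyEv l hl).unique (e ▸ isCurry_applyEv l hl)
  refine ext_val (fun t ht => μ.eltHom_ext ?_ ?_ fun p => ?_) fun U hU => μ.eltCell_ext ?_ ?_ ?_
    fun p => ?_
  · rw [valHom_src, valHom_src, hv]
  · rw [valHom_tgt, valHom_tgt, hv]
  · rw [← lastHom_id_applyEv, ← lastHom_id_applyEv]
    exact lastHom_id_of_eq e t ht _
  · rw [valCell_oneCell, valCell_oneCell]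
  · rw [valCell_src, valCell_src, hv]
  · rw [valCell_tgt, valCell_tgt, hv]
  · rw [← initCell_applyEv, ← initCell_applyEv, e]

instance : (applyEv μ Γ Y Z).Full where
  map_surjective {g g'} φ := by
    choose k hs ht hk using fun (t : List (_root_.Arrow T w)) (h : t.map Sigma.fst = Γ) =>
      IsCurry.exists_hom φ t h (isCurry_applyEv (g := g) (t.map Arrow.src) (by simpa))
        (isCurry_applyEv (g := g') (t.map Arrow.tgt) (by simpa))
    obtain ⟨γ, hγ⟩ : ∃ γ : g ⟶ g', ∀ t h, valHom γ t h = k t h := by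
      refine exists_modif g g' k hs ht (fun c h => ⟨?_, ?_⟩) (fun l l' {X u u' E a b} e h => ?_)
      · refine μ.hom_comp_of_apply ?_ ?_ ?_ fun p => ?_
        · rw [valHom_tgt, hs]
          exact g.val_congr (ArrowPair.map_src_snd c).symm _ _
        · rw [valHom_src, hs]
          exact g.val_congr (ArrowPair.map_src_comp c) _ _
        · rw [ht, ht]
          exact g'.val_congr (ArrowPair.map_tgt_comp c) _ _
        · rw [← lastHom_id_applyEv, hk, hk]
          have := lastHom_comp_point (𝟙 _) φ c h p
          rwa [Category.id_comp] at this
      · refine μ.hom_comp_of_apply ?_ ?_ ?_ fun p => ?_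
        · rw [valHom_src, ht]
          exact g'.val_congr (ArrowPair.map_src_snd c).symm _ _
        · rw [hs, hs]
          exact g.val_congr (ArrowPair.map_src_comp c) _ _
        · rw [valHom_tgt, ht]
          exact g'.val_congr (ArrowPair.map_tgt_comp c) _ _
        · rw [← lastHom_id_applyEv, hk, hk]
          have := lastHom_comp_point φ (𝟙 _) c h p
          rwa [Category.comp_id] at this
      · refine sq_of_curry φ l l' e h (g.valCell_oneCell _) (g'.valCell_oneCell _) ?_ ?_ ?_ ?_
          (fun p => (initCell_applyEv _ _ p).symm) (fun p => (initCell_applyEv _ _ p).symm)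
          (hk _ _) (hk _ _)
        · rw [hs, valCell_src]
          exact g.val_congr (by simp [Arrow.src, e.src_src]) _ _
        · rw [ht, valCell_src]
          exact g'.val_congr (by simp [Arrow.tgt, e.tgt_src]) _ _
        · rw [hs, valCell_tgt]
          exact g.val_congr (by simp [Arrow.src, e.src_tgt]) _ _
        · rw [ht, valCell_tgt]
          exact g'.val_congr (by simp [Arrow.tgt, e.tgt_tgt]) _ _
    refine ⟨γ, last_hom_ext fun t h b => ?_⟩
    rw [lastHom_applyEv, hγ, hk]

end MultiMap

end Closed

section Closed

variable {T : LawvereTwoTheory 𝕋} {w : Weakness} {μ : WCommutativity T w}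
  {Γ : List (Model T w)} {Y Z : Model T w}

theorem OneCell.Comp.gray (μ : WCommutativity T w) (a b : OneCell T) :
    OneCell.Comp (μ.right b.m a) (μ.left a.n b) ⟨(μ.grayW a b).α⟩ ∧
      OneCell.Comp (μ.left a.m b) (μ.right b.n a) ⟨(μ.grayW a b).β⟩ :=
  ⟨.mk _ _, .mk _ _⟩

theorem EltCell.Comp.tgt_src {F : TwoFun T w} {u v t : EltCell F} (h : u.Comp v t) :
    u.tgt = v.src := by cases h; rfl

namespace MultiMap

/-- The curried values of a multimap satisfy the laws of a multimap, as they do so after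
evaluation. -/
theorem applyEv_surjective : Function.Surjective (applyEv μ Γ Y Z).obj := fun F => by
  choose e he using F.exists_isCurry
  choose k hs ht hk using fun (t : List (_root_.Arrow T w)) (h : t.map Sigma.fst = Γ) =>
    IsCurry.exists_hom (𝟙 F) t h (he (t.map Arrow.src) (by simpa))
      (he (t.map Arrow.tgt) (by simpa))
  choose c hα cs ct hc using fun (U : MultiCell T w) (h : U.sources = Γ) =>
    IsCurry.exists_cell F U h (he U.src (by simpa)) (he U.tgt (by simpa))
  have e_congr {l l' : List (Point T w)} (h : l = l') (hl hl') : e l hl = e l' hl' := by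
    subst h; rfl
  let D : Values μ Γ (μ.homObj Y Z) :=
    { obj := e
      hom := k
      cell := c
      obj_n := fun l h => (he l h).n
      hom_src := hs
      hom_tgt := ht
      hom_id := fun l h => by
        refine μ.eltHom_ext ((hs _ _).trans (e_congr (by simp) _ _))
          ((ht _ _).trans (e_congr (by simp) _ _)) fun p => ?_
        rw [hk, (he l h).hom]
      hom_comp := fun t h => by
        refine μ.hom_comp_of_apply ?_ ?_ ?_ fun p => ?_
        · rw [ht, hs]
          exact e_congr (ArrowPair.map_src_snd t).symm _ _
        · rw [hs, hs]
          exact e_congr (ArrowPair.map_src_comp t) _ _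
        · rw [ht, ht]
          exact e_congr (ArrowPair.map_tgt_comp t) _ _
        · rw [hk, hk, hk]
          have := lastHom_comp_point (𝟙 F) (𝟙 F) t h p
          rwa [Category.comp_id] at this
      cell_oneCell := hα
      cell_src := cs
      cell_tgt := ct
      cell_tight := fun U h hU => μ.isId_of_apply fun p => by
        rw [hc]
        exact F.initCell_isId U h p hU
      cell_comp := fun l l' {X u v t} E hΓ => by
        refine μ.cell_comp_of_apply ?_ ?_ ?_ ?_ fun p => ?_
        · rw [ct, cs]
          exact e_congr (by simp [E.tgt_src]) _ _
        · rw [cs, cs]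
          exact e_congr (by simp [E.src]) _ _
        · rw [ct, ct]
          exact e_congr (by simp [E.tgt]) _ _
        · rw [hα, hα, hα]
          exact (E.oneCell.right μ _).left μ _
        · rw [hc, hc, hc]
          exact F.initCell_comp l l' E hΓ p
      cell_sq := fun l l' {X u u' E a b} S hΓ => by
        refine sq_of_curry (𝟙 F) l l' S hΓ (hα _ _) (hα _ _) ?_ ?_ ?_ ?_
          (hc _ _) (hc _ _) (hk _ _) (hk _ _)
        · rw [hs, cs]
          exact e_congr (by simp [Arrow.src, S.src_src]) _ _
        · rw [ht, cs]
          exact e_congr (by simp [Arrow.tgt, S.tgt_src]) _ _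
        · rw [hs, ct]
          exact e_congr (by simp [Arrow.src, S.src_tgt]) _ _
        · rw [ht, ct]
          exact e_congr (by simp [Arrow.tgt, S.tgt_tgt]) _ _
      cell_gray := fun l {X} u l' {V} v l'' hΓ => by
        have G := OneCell.Comp.gray μ (μ.right (num l') ⟨u.α⟩) ⟨v.α⟩
        refine μ.gray_of_apply ?_ ?_ ?_ ?_ ?_ ?_ fun p => ?_
        · rw [ct, cs]
          exact e_congr (by simp) _ _
        · rw [ct, cs]
          exact e_congr (by simp) _ _
        · rw [cs, cs]
          exact e_congr (by simp) _ _
        · rw [ct, ct]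
          exact e_congr (by simp) _ _
        · rw [hα, hα]
          have := (G.1.right μ (num l'')).left μ (num l)
          rw [μ.right_right, μ.right_right, μ.right_left, μ.left_left] at this
          simp only [MultiCell.oneCell, num_append, num_cons]
          exact this
        · rw [hα, hα]
          have := (G.2.right μ (num l'')).left μ (num l)
          rw [μ.right_right, μ.right_right, μ.right_left, μ.left_left] at this
          simp only [MultiCell.oneCell, num_append, num_cons]
          exact this
        · rw [hc, hc, hc, hc]
          exact F.initCell_gray l u l' v l'' hΓ p }
  -- the multimap with the curried values is a preimage, since it has the right values after evaluation
  obtain ⟨g, hg, hg'⟩ := D.exists_multiMap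
  have hv (l h) : g.val l h = e l h := by
    rw [val_eq_src, hg]
    exact (hs _ _).trans (e_congr (by simp) _ _)
  refine ⟨g, last_ext (fun t h b => ?_) (fun l h u => ?_) fun U h p => ?_⟩
  · rw [lastHom_id_applyEv, hg]
    exact hk t h b
  · rw [lastCell_applyEv, hv]
    exact (he l h).cell u
  · rw [initCell_applyEv, hg']
    exact hc U h p

/-- Composition with the evaluation is an isomorphism of categories. -/
instance isIso_applyEv : (applyEv μ Γ Y Z).IsIso where
  bijective_obj := ⟨applyEv_injective, applyEv_surjective⟩

end MultiMap

end Closed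

/-! ### Unary multimaps are homomorphisms -/

section UnaryIso

variable {T : LawvereTwoTheory 𝕋} {w : Weakness} {μ : WCommutativity T w} {X Z : Model T w}

namespace MultiMap

/-- The inclusion of a power of a model into its product with the empty product. -/
abbrev single (X : Model T w) (m : ℕ) :
    X.toFun.O m ⥤ Dom [X] (.cons m .nil) :=
  Functor.prod' (𝟭 _) ((Functor.const _).obj ⟨⟨⟩⟩)

/-- The homomorphism of a unary multimap. -/
def toHom (F : MultiMap μ [X] Z) : X ⟶ Z where
  app m := single X m ⋙ F.app (.cons m .nil)
  cell {m _} α := (F.cell (.here α .nil)).whL (single X m)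
  cell_tight p := .map _ (F.cell_tight (.here p .nil))
  cell_comp α β := by
    refine ((F.cell_comp (.here α β .nil)).map _).trans ((WEq.of_eq (WHom.map_comp _ _ _)).trans
      (WEq.comp (WHom.map_congr' (F.cell _) rfl) (WHom.map_congr' (F.cell _) rfl)))
  cell_nat η := WHom.Sq.map _ (F.cell_nat (.here η .nil))

theorem whL_fst_whL_single {m : ℕ} {C : Type*} [Category* C] {A B : X.toFun.O m ⥤ C}
    (σ : WHom A B w) :
    ((σ.whL (CategoryTheory.Prod.fst (X.toFun.O m) (Dom (T := T) (w := w) [] .nil))).whL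
      (single X m) : WHom A B w) = σ := by
  cases σ <;> rfl

/-- The modification of a modification between unary multimaps. -/
def toHomMap {f g : X ⟶ Z} (φ : (unary μ X Z).obj f ⟶ (unary μ X Z).obj g) : f ⟶ g where
  app m := Functor.whiskerLeft (single X m) (φ.app (.cons m .nil))
  sq {m n} α := by
    have := (φ.sq (.here α .nil)).map ((Functor.whiskeringLeft _ _ _).obj (single X m))
    have h₁ := whL_fst_whL_single (WTrans.cell f α)
    have h₂ := whL_fst_whL_single (WTrans.cell g α)
    rw [← h₁, ← h₂]
    exact this

instance : (unary μ X Z).Faithful where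
  map_injective {f g} _ _ h := WTrans.hom_ext fun m =>
    congrArg (fun φ : ofHom f ⟶ ofHom g => Functor.whiskerLeft (single X m) (Modif.app (Γ := [X]) φ (.cons m .nil))) h

instance : (unary μ X Z).Full where
  map_surjective φ := ⟨toHomMap φ, Modif.ext (funext fun a => by
    obtain _ | ⟨m, ⟨⟩⟩ := a
    rfl)⟩

theorem ofHom_toHom (F : MultiMap μ [X] Z) : ofHom (toHom F) = F := by
  refine ext_val (fun t ht => ?_) fun U hU => ?_
  · obtain ⟨a, rfl⟩ := List.exists_singleton_of_map ht
    rw [valHom_id_ofHom]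
    exact (valHom_eq (𝟙 F) ht (show (PtHom.cons a Pt.nil.id).toList = _ from rfl)).symm
  · obtain @⟨l, X', u, r⟩ := U
    obtain ⟨rfl, rfl, rfl⟩ : l = [] ∧ X' = X ∧ r = [] := by
      cases l <;> simp_all
    rw [valCell_ofHom]
    refine ((valCell_eq F hU (PtCell.Represents.here u .nil)).trans ?_).symm
    obtain ⟨α, σ⟩ := u
    refine EltCell.mk_congr rfl rfl rfl (.symm ?_)
    refine WEq.comp (WEq.of_eq (WHom.appAt_whL _ _ _)) ?_
    cases σ <;> exact .refl

/-- Unary multimaps are homomorphisms. -/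
instance isIso_unary : (unary μ X Z).IsIso where
  bijective_obj := by
    refine ⟨fun f g h => WTrans.ext_val (fun b => ?_) fun u => ?_,
      fun F => ⟨toHom F, ofHom_toHom F⟩⟩
    · rw [← valHom_id_ofHom (μ := μ) f b rfl, ← valHom_id_ofHom (μ := μ) g b rfl]
      exact congrArg (fun F : MultiMap μ [X] Z => valHom (𝟙 F) [⟨X, b⟩] rfl) h
    · rw [← valCell_ofHom (μ := μ) f u rfl, ← valCell_ofHom (μ := μ) g u rfl]
      exact congrArg (fun F : MultiMap μ [X] Z => F.valCell ⟨[], u, []⟩ rfl) h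

end MultiMap

end UnaryIso

section Whiskering

variable {T : LawvereTwoTheory 𝕋} {w : Weakness} {X Y Z : Model T w}

namespace WTrans

theorem valHom_comp_whisker {F G K : TwoFun T w} {f f' : WTrans F G} {g g' : WTrans G K}
    (η : f ⟶ f') (θ : g ⟶ g') (a : EltHom F) :
    valHom (f := f.comp g) (g := f'.comp g') (whiskerR η g ≫ whiskerL f' θ) a =
      valHom θ (valHom η a) := by
  refine congrArg (EltHom.mk (F := K) (n := a.n)) ?_
  refine Eq.trans ?_ (congrArg (· ≫ _) ((g.app a.n).map_comp _ _).symm)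
  exact (Category.assoc _ _ _).symm

theorem valHom_hcomp {f f' : X ⟶ Y} {g g' : Y ⟶ Z} (η : f ⟶ f') (θ : g ⟶ g')
    (a : EltHom X.toFun) :
    valHom (Bicategory.whiskerRight η g ≫ Bicategory.whiskerLeft f' θ) a =
      valHom θ (valHom η a) :=
  valHom_comp_whisker η θ a

theorem valHom_whiskerLeft (f : X ⟶ Y) {g g' : Y ⟶ Z} (θ : g ⟶ g') (a : EltHom X.toFun) :
    valHom (Bicategory.whiskerLeft f θ) a = valHom θ (valHom (𝟙 f) a) := by
  refine Eq.trans ?_ (valHom_hcomp (𝟙 f) θ a)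
  rw [Bicategory.id_whiskerRight, Category.id_comp]

theorem valHom_whiskerRight {f f' : X ⟶ Y} (η : f ⟶ f') (g : Y ⟶ Z) (a : EltHom X.toFun) :
    valHom (Bicategory.whiskerRight η g) a = valHom (𝟙 g) (valHom η a) := by
  refine Eq.trans ?_ (valHom_hcomp η (𝟙 g) a)
  rw [Bicategory.whiskerLeft_id, Category.comp_id]

theorem valHom_id_comp (f : X ⟶ Y) (g : Y ⟶ Z) (a : EltHom X.toFun) :
    valHom (𝟙 (f ≫ g)) a = valHom (𝟙 g) (valHom (𝟙 f) a) := by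
  rw [← valHom_whiskerLeft, Bicategory.whiskerLeft_id]

theorem val_comp (f : X ⟶ Y) (g : Y ⟶ Z) (p : Elt X.toFun) : val (f ≫ g) p = val g (val f p) := rfl

theorem valCell_comp' {F G K : TwoFun T w} (f : WTrans F G) (g : WTrans G K) (u : EltCell F) :
    valCell (f.comp g) u = valCell g (valCell f u) := by
  refine congrArg (EltCell.mk (F := K) u.α) ?_
  change WHom.comp (WHom.appAt (((g.cell u.α).whL (f.app u.m)).comp
      ((f.cell u.α).whR (g.app u.n))) u.p) (u.cell.map (f.app u.n ⋙ g.app u.n)) =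
    WHom.comp ((g.cell u.α).appAt ((f.app u.m).obj u.p))
      ((((f.cell u.α).appAt u.p).comp (u.cell.map (f.app u.n))).map (g.app u.n))
  rw [WHom.appAt_comp, WHom.appAt_whL, WHom.appAt_whR, WHom.map_comp, WHom.map_map, WHom.assoc]

theorem valCell_comp (f : X ⟶ Y) (g : Y ⟶ Z) (u : EltCell X.toFun) :
    valCell (f ≫ g) u = valCell g (valCell f u) :=
  valCell_comp' f g u

end WTrans

end Whiskering

/-! ### Functoriality of the internal hom -/

section Action

variable {T : LawvereTwoTheory 𝕋} {w : Weakness} {μ : WCommutativity T w}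
  {X Y Z Y' Z' Y'' Z'' : Model T w}

open MultiMap

namespace WCommutativity

variable (μ) in
/-- The value of the evaluation at a pair of morphisms. -/
noncomputable abbrev evHom (Y Z : Model T w) (a : EltHom (μ.homObj Y Z).toFun) (b : EltHom Y.toFun) :
    EltHom Z.toFun :=
  valHom (𝟙 (μ.ev Y Z)) [⟨_, a⟩, ⟨_, b⟩] rfl

variable (μ) in
/-- The value of the evaluation at a cell in the first variable. -/
noncomputable abbrev evLeft (Y Z : Model T w) (c : EltCell (μ.homObj Y Z).toFun) (p : Elt Y.toFun) :
    EltCell Z.toFun :=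
  (μ.ev Y Z).valCell ⟨[], c, [⟨_, p⟩]⟩ rfl

variable (μ) in
/-- The value of the evaluation at a cell in the second variable. -/
noncomputable abbrev evRight (Y Z : Model T w) (t : Elt (μ.homObj Y Z).toFun) (u : EltCell Y.toFun) :
    EltCell Z.toFun :=
  (μ.ev Y Z).valCell ⟨[⟨_, t⟩], u, []⟩ rfl

variable (μ) in
/-- The functor `Hom_w(X, Hom(Y, Z)) ⥤ Mul₂(X, Y; Z)`. -/
noncomputable abbrev toBinary (X Y Z : Model T w) : (X ⟶ μ.homObj Y Z) ⥤ MultiMap μ [X, Y] Z :=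
  homToBinary (fun Y Z => μ.internalHom Y Z) (multicategory μ) (fun Y Z => μ.ev Y Z) X Y Z

instance : (μ.toBinary X Y Z).IsIso :=
  inferInstanceAs (unary μ X (μ.homObj Y Z) ⋙ applyEv μ [X] Y Z).IsIso

theorem valHom_toBinary {f g : X ⟶ μ.homObj Y Z} (η : f ⟶ g) (a : EltHom X.toFun)
    (b : EltHom Y.toFun) : valHom ((μ.toBinary X Y Z).map η) [⟨_, a⟩, ⟨_, b⟩] rfl =
      μ.evHom Y Z (WTrans.valHom η a) b := by
  refine (lastHom_applyEv ((unary μ X (μ.homObj Y Z)).map η) [⟨_, a⟩] rfl b).trans ?_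
  rw [valHom_unary]

theorem valHom_id_toBinary (f : X ⟶ μ.homObj Y Z) (a : EltHom X.toFun)
    (b : EltHom Y.toFun) : valHom (𝟙 ((μ.toBinary X Y Z).obj f)) [⟨_, a⟩, ⟨_, b⟩] rfl =
      μ.evHom Y Z (WTrans.valHom (𝟙 f) a) b := by
  rw [← valHom_toBinary, CategoryTheory.Functor.map_id]

theorem valCell_toBinary_left (f : X ⟶ μ.homObj Y Z) (u : EltCell X.toFun) (p : Elt Y.toFun) :
    ((μ.toBinary X Y Z).obj f).valCell ⟨[], u, [⟨_, p⟩]⟩ rfl =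
      μ.evLeft Y Z (WTrans.valCell f u) p := by
  refine (initCell_applyEv (g := ofHom f) ⟨[], u, []⟩ rfl p).trans ?_
  rw [valCell_ofHom]

theorem valCell_toBinary_right (f : X ⟶ μ.homObj Y Z) (p : Elt X.toFun) (u : EltCell Y.toFun) :
    ((μ.toBinary X Y Z).obj f).valCell ⟨[⟨_, p⟩], u, []⟩ rfl =
      μ.evRight Y Z (WTrans.val f p) u := by
  refine (lastCell_applyEv (g := ofHom f) [⟨_, p⟩] rfl u).trans ?_
  rw [val_ofHom]

/-- The homomorphism `m` between internal homs is given by precomposition with `g` and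
postcomposition with `k`. The condition is stated after evaluation. -/
structure Acts (m : μ.homObj Y Z ⟶ μ.homObj Y' Z') (g : Y' ⟶ Y) (k : Z ⟶ Z') : Prop where
  hom (a : EltHom (μ.homObj Y Z).toFun) (b : EltHom Y'.toFun) :
    μ.evHom Y' Z' (WTrans.valHom (𝟙 m) a) b =
      WTrans.valHom (𝟙 k) (μ.evHom Y Z a (WTrans.valHom (𝟙 g) b))
  left (c : EltCell (μ.homObj Y Z).toFun) (p : Elt Y'.toFun) :
    μ.evLeft Y' Z' (WTrans.valCell m c) p = WTrans.valCell k (μ.evLeft Y Z c (WTrans.val g p))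
  right (t : Elt (μ.homObj Y Z).toFun) (u : EltCell Y'.toFun) :
    μ.evRight Y' Z' (WTrans.val m t) u = WTrans.valCell k (μ.evRight Y Z t (WTrans.valCell g u))

/-- The modification `ψ` between homomorphisms of internal homs is given by whiskering with `γ`
and `κ`. The condition is stated after evaluation. -/
def Acts₂ {m m' : μ.homObj Y Z ⟶ μ.homObj Y' Z'} (ψ : m ⟶ m') {g g' : Y' ⟶ Y} (γ : g ⟶ g')
    {k k' : Z ⟶ Z'} (κ : k ⟶ k') : Prop :=
  ∀ (a : EltHom (μ.homObj Y Z).toFun) (b : EltHom Y'.toFun),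
    μ.evHom Y' Z' (WTrans.valHom ψ a) b =
      WTrans.valHom κ (μ.evHom Y Z a (WTrans.valHom γ b))

theorem toBinary_obj_ext {f f' : X ⟶ μ.homObj Y Z}
    (h : ∀ a b, μ.evHom Y Z (WTrans.valHom (𝟙 f) a) b = μ.evHom Y Z (WTrans.valHom (𝟙 f') a) b)
    (h' : ∀ u p, μ.evLeft Y Z (WTrans.valCell f u) p = μ.evLeft Y Z (WTrans.valCell f' u) p)
    (h'' : ∀ p u, μ.evRight Y Z (WTrans.val f p) u = μ.evRight Y Z (WTrans.val f' p) u) :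
    f = f' := by
  refine (Functor.IsIso.bijective_obj (F := μ.toBinary X Y Z)).1
    (last_ext (Γ := [X]) (fun t ht b => ?_) (fun l hl u => ?_) fun U hU p => ?_)
  · obtain ⟨a, rfl⟩ := List.exists_singleton_of_map ht
    exact (valHom_id_toBinary f a b).trans ((h a b).trans (valHom_id_toBinary f' a b).symm)
  · obtain ⟨a, rfl⟩ := List.exists_singleton_of_map hl
    exact (valCell_toBinary_right f a u).trans
      ((h'' a u).trans (valCell_toBinary_right f' a u).symm)
  · obtain @⟨l, X', u, r⟩ := U
    obtain ⟨rfl, rfl, rfl⟩ : l = [] ∧ X' = X ∧ r = [] := by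
      cases l <;> simp_all
    exact (valCell_toBinary_left f u p).trans ((h' u p).trans (valCell_toBinary_left f' u p).symm)

/-- A homomorphism between internal homs that acts by pre- and postcomposition is determined by this. -/
theorem Acts.unique {m m' : μ.homObj Y Z ⟶ μ.homObj Y' Z'} {g : Y' ⟶ Y} {k : Z ⟶ Z'}
    (h : Acts m g k) (h' : Acts m' g k) : m = m' :=
  toBinary_obj_ext (fun a b => (h.hom a b).trans (h'.hom a b).symm)
    (fun u p => (h.left u p).trans (h'.left u p).symm)
    fun p u => (h.right p u).trans (h'.right p u).symm

/-- A modification that acts by whiskering is determined by this. -/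
theorem Acts₂.unique {m m' : μ.homObj Y Z ⟶ μ.homObj Y' Z'} {ψ ψ' : m ⟶ m'} {g g' : Y' ⟶ Y}
    {γ : g ⟶ g'} {k k' : Z ⟶ Z'} {κ : k ⟶ k'} (h : Acts₂ ψ γ κ) (h' : Acts₂ ψ' γ κ) : ψ = ψ' := by
  refine (μ.toBinary _ _ _).map_injective (last_hom_ext (Γ := [μ.homObj Y Z]) fun t ht b => ?_)
  obtain ⟨a, rfl⟩ := List.exists_singleton_of_map ht
  exact (valHom_toBinary ψ a b).trans ((h a b).trans
    ((h' a b).symm.trans (valHom_toBinary ψ' a b).symm))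

theorem Acts₂.homEq {m m' n n' : μ.homObj Y Z ⟶ μ.homObj Y' Z'} {ψ : m ⟶ m'} {ψ' : n ⟶ n'}
    {g g' : Y' ⟶ Y} {γ : g ⟶ g'} {k k' : Z ⟶ Z'} {κ : k ⟶ k'} (h : Acts₂ ψ γ κ)
    (h' : Acts₂ ψ' γ κ) (e : m = n) (e' : m' = n') : HomEq ψ ψ' := by
  subst e e'
  obtain rfl := h.unique h'
  exact .refl

theorem Acts.id : Acts (𝟙 (μ.homObj Y Z)) (𝟙 Y) (𝟙 Z) where
  hom a b := by
    rw [show WTrans.valHom (𝟙 (𝟙 Y)) b = b from WTrans.valHom_id_id b]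
    exact (congrArg (fun a => μ.evHom Y Z a b) (WTrans.valHom_id_id a)).trans
      (WTrans.valHom_id_id _).symm
  left c p := (congrArg (fun a => μ.evLeft Y Z a p) (WTrans.valCell_id c)).trans
    (WTrans.valCell_id _).symm
  right t u := by
    rw [show WTrans.valCell (𝟙 Y) u = u from WTrans.valCell_id u]
    exact (WTrans.valCell_id _).symm

section

variable {m : μ.homObj Y Z ⟶ μ.homObj Y' Z'} {g : Y' ⟶ Y} {k : Z ⟶ Z'}

theorem Acts.comp (h : Acts m g k) {m' : μ.homObj Y' Z' ⟶ μ.homObj Y'' Z''} {g' : Y'' ⟶ Y'}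
    {k' : Z' ⟶ Z''} (h' : Acts m' g' k') : Acts (m ≫ m') (g' ≫ g) (k ≫ k') where
  hom a b := by
    rw [WTrans.valHom_id_comp, WTrans.valHom_id_comp, WTrans.valHom_id_comp, h'.hom, h.hom]
  left c p := by rw [WTrans.valCell_comp, WTrans.valCell_comp, h'.left, h.left, WTrans.val_comp]
  right t u := by
    rw [WTrans.valCell_comp, WTrans.valCell_comp, WTrans.val_comp, h'.right, h.right]

theorem Acts.whiskerLeft (h : Acts m g k) {m' n' : μ.homObj Y' Z' ⟶ μ.homObj Y'' Z''}
    {ψ : m' ⟶ n'} {g' f' : Y'' ⟶ Y'} {γ : g' ⟶ f'} {k' l' : Z' ⟶ Z''} {κ : k' ⟶ l'}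
    (h' : Acts₂ ψ γ κ) : Acts₂ (Bicategory.whiskerLeft m ψ) (Bicategory.whiskerRight γ g)
      (Bicategory.whiskerLeft k κ) := fun a b => by
  rw [WTrans.valHom_whiskerLeft, h', h.hom, WTrans.valHom_whiskerLeft, WTrans.valHom_whiskerRight]

theorem Acts₂.whiskerRight {n : μ.homObj Y Z ⟶ μ.homObj Y' Z'} {f : Y' ⟶ Y} {l : Z ⟶ Z'}
    {ψ : m ⟶ n} {γ : g ⟶ f} {κ : k ⟶ l} (h : Acts₂ ψ γ κ)
    {m' : μ.homObj Y' Z' ⟶ μ.homObj Y'' Z''} {g' : Y'' ⟶ Y'}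
    {k' : Z' ⟶ Z''} (h' : Acts m' g' k') : Acts₂ (Bicategory.whiskerRight ψ m')
      (Bicategory.whiskerLeft g' γ) (Bicategory.whiskerRight κ k') := fun a b => by
  rw [WTrans.valHom_whiskerRight, h'.hom, h, WTrans.valHom_whiskerLeft,
    WTrans.valHom_whiskerRight]

end

end WCommutativity

end Action

section Natural

variable {T : LawvereTwoTheory 𝕋} {w : Weakness} {μ : WCommutativity T w}
  {X Y Z X' Y' Z' : Model T w}

namespace MultiMap

section Binary

variable {f f' : MultiMap μ [X, Y] Z} {h h' : X' ⟶ X} {g g' : Y' ⟶ Y} {k k' : Z ⟶ Z'}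

/-- The composite of a binary multimap with homomorphisms. -/
noncomputable abbrev conj (f : MultiMap μ [X, Y] Z) (h : X' ⟶ X) (g : Y' ⟶ Y) (k : Z ⟶ Z') :
    MultiMap μ [X', Y'] Z' :=
  ((multicategory μ).binary X X' Y Y' Z Z').obj (((f, ofHom h), ofHom g), ofHom k)

/-- The composite of 2-cells between binary multimaps and homomorphisms. -/
noncomputable abbrev conjMap (φ : f ⟶ f') (χ : h ⟶ h') (γ : g ⟶ g') (κ : k ⟶ k') :
    conj f h g k ⟶ conj f' h' g' k' :=
  ((multicategory μ).binary X X' Y Y' Z Z').map (X := (((f, ofHom h), ofHom g), ofHom k))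
    (Y := (((f', ofHom h'), ofHom g'), ofHom k'))
    (Prod.mkHom (Prod.mkHom (Prod.mkHom φ ((unary μ X' X).map χ)) ((unary μ Y' Y).map γ))
      ((unary μ Z Z').map κ))

theorem valHom_conjMap (φ : f ⟶ f') (χ : h ⟶ h') (γ : g ⟶ g') (κ : k ⟶ k')
    (a : EltHom X'.toFun) (b : EltHom Y'.toFun) :
    valHom (conjMap φ χ γ κ) [⟨_, a⟩, ⟨_, b⟩] rfl =
      WTrans.valHom κ (valHom φ [⟨_, WTrans.valHom χ a⟩, ⟨_, WTrans.valHom γ b⟩] rfl) := by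
  refine (valHom_subst₂ (Γ := []) (Ξ := [X', Y']) (Δ := []) ((unary μ Z Z').map κ)
    (subst₂ (Γ := [X']) (Ξ := [Y']) (Δ := [])
      (subst₂ (Γ := []) (Ξ := [X']) (Δ := [Y]) φ ((unary μ X' X).map χ))
      ((unary μ Y' Y).map γ)) _ rfl).trans ?_
  refine (substHom_eq (Γ := []) (Ξ := [X', Y']) (Δ := []) _ _ (x := [])
    (y := [⟨_, a⟩, ⟨_, b⟩]) (z := []) rfl rfl rfl rfl).trans ((valHom_unary _ _ _).trans (congrArg (WTrans.valHom κ) ?_))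
  refine (valHom_subst₂ (Γ := [X']) (Ξ := [Y']) (Δ := []) _ _ _ rfl).trans ?_
  refine (substHom_eq (Γ := [X']) (Ξ := [Y']) (Δ := []) _ _ (x := [⟨_, a⟩]) (y := [⟨_, b⟩])
    (z := []) rfl rfl rfl rfl).trans ?_
  refine (valHom_subst₂ (Γ := []) (Ξ := [X']) (Δ := [Y]) _ _ _ rfl).trans ?_
  refine (substHom_eq (Γ := []) (Ξ := [X']) (Δ := [Y]) _ _ (x := []) (y := [⟨_, a⟩]) rfl rfl rfl
    rfl).trans ?_
  refine valHom_congr _ ?_ _ _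
  rw [valHom_unary, valHom_unary]
  rfl

theorem conjMap_id : conjMap (𝟙 f) (𝟙 h) (𝟙 g) (𝟙 k) = 𝟙 (conj f h g k) := by
  rw [conjMap, CategoryTheory.Functor.map_id, CategoryTheory.Functor.map_id,
    CategoryTheory.Functor.map_id]
  exact CategoryTheory.Functor.map_id _ _

theorem valHom_id_conj (a : EltHom X'.toFun) (b : EltHom Y'.toFun) :
    valHom (𝟙 (conj f h g k)) [⟨_, a⟩, ⟨_, b⟩] rfl =
      WTrans.valHom (𝟙 k)
        (valHom (𝟙 f) [⟨_, WTrans.valHom (𝟙 h) a⟩, ⟨_, WTrans.valHom (𝟙 g) b⟩] rfl) := by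
  rw [← conjMap_id, valHom_conjMap]

theorem valCell_conj_left (u : EltCell X'.toFun) (p : Elt Y'.toFun) :
    (conj f h g k).valCell ⟨[], u, [⟨_, p⟩]⟩ rfl =
      WTrans.valCell k (f.valCell ⟨[], WTrans.valCell h u, [⟨_, WTrans.val g p⟩]⟩ rfl) := by
  refine (valCell_subst (Γ := []) (Ξ := [X', Y']) (Δ := []) _ rfl).trans ?_
  refine (substCell_mid (Γ := []) (Ξ := [X', Y']) (Δ := []) _ _ u (x := []) (a := [])
    (b := [⟨_, p⟩]) (z := []) rfl rfl rfl rfl rfl).trans ((valCell_ofHom _ _ _).trans (congrArg (WTrans.valCell k) ?_))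
  refine (valCell_subst (Γ := [X']) (Ξ := [Y']) (Δ := []) _ rfl).trans ?_
  refine (substCell_left (Γ := [X']) (Ξ := [Y']) (Δ := []) _ _ u (r' := []) (y := [⟨_, p⟩])
    (z := []) rfl rfl rfl rfl).trans ?_
  refine (valCell_subst (Γ := []) (Ξ := [X']) (Δ := [Y]) _ rfl).trans ?_
  refine (substCell_mid (Γ := []) (Ξ := [X']) (Δ := [Y]) _ _ u (x := []) (a := []) (b := []) rfl rfl
    rfl rfl rfl).trans ?_
  refine valCell_congr _ ?_ _ _
  exact congrArg₂ (fun (c : EltCell X.toFun) (q : Elt Y.toFun) =>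
    (⟨[], c, [⟨Y, q⟩]⟩ : MultiCell T w)) (valCell_ofHom h u rfl) (val_ofHom g p rfl)

theorem valCell_conj_right (p : Elt X'.toFun) (u : EltCell Y'.toFun) :
    (conj f h g k).valCell ⟨[⟨_, p⟩], u, []⟩ rfl =
      WTrans.valCell k (f.valCell ⟨[⟨_, WTrans.val h p⟩], WTrans.valCell g u, []⟩ rfl) := by
  refine (valCell_subst (Γ := []) (Ξ := [X', Y']) (Δ := []) _ rfl).trans ?_
  refine (substCell_mid (Γ := []) (Ξ := [X', Y']) (Δ := []) _ _ u (x := [])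
    (a := [⟨_, p⟩]) (b := []) (z := []) rfl rfl rfl rfl rfl).trans ((valCell_ofHom _ _ _).trans (congrArg (WTrans.valCell k) ?_))
  refine (valCell_subst (Γ := [X']) (Ξ := [Y']) (Δ := []) _ rfl).trans ?_
  refine (substCell_mid (Γ := [X']) (Ξ := [Y']) (Δ := []) _ _ u (x := [⟨_, p⟩]) (a := []) (b := [])
    (z := []) rfl rfl rfl rfl rfl).trans ?_
  refine (valCell_subst (Γ := []) (Ξ := [X']) (Δ := [Y]) _ rfl).trans ?_
  refine (substCell_right (Γ := []) (Ξ := [X']) (Δ := [Y]) _ _ _ (x := []) (y := [⟨_, p⟩])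
    (a := []) rfl rfl rfl rfl).trans ?_
  refine valCell_congr _ ?_ _ _
  exact congrArg₂ (fun (q : Elt X.toFun) (c : EltCell Y.toFun) =>
    (⟨[⟨X, q⟩], c, []⟩ : MultiCell T w)) (val_ofHom h p rfl) (valCell_ofHom g u rfl)

end Binary

end MultiMap

end Natural

section Functorial

variable {T : LawvereTwoTheory 𝕋} {w : Weakness} {μ : WCommutativity T w}
  {X Y Z X' Y' Z' : Model T w}

open MultiMap Opposite

theorem WTrans.valHom_id_one (a : EltHom X.toFun) : WTrans.valHom (𝟙 (𝟙 X)) a = a :=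
  WTrans.valHom_id_id a

theorem WTrans.valCell_one (u : EltCell X.toFun) : WTrans.valCell (𝟙 X) u = u :=
  WTrans.valCell_id u

theorem MultiMap.valHom_map_of_eq {C : Type*} [Category* C] {Γ : List (Model T w)}
    {F G : C ⥤ MultiMap μ Γ Z} (e : F = G) {c d : C} (k : c ⟶ d) (t : List (_root_.Arrow T w))
    (h : t.map Sigma.fst = Γ) : valHom (F.map k) t h = valHom (G.map k) t h := by
  subst e; rfl

namespace WCommutativity

variable (μ) in
/-- The functor `(g, k) ↦ k ∘ ev ∘ (id, g)`. -/
noncomputable def evAction (Y Y' Z Z' : Model T w) :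
    (op Y ⟶ op Y') × (Z ⟶ Z') ⥤ MultiMap μ [μ.homObj Y Z, Y'] Z' :=
  Functor.prod'
    (Functor.prod' (Functor.prod' ((Functor.const _).obj (μ.ev Y Z))
        ((Functor.const _).obj (𝟙 (μ.homObj Y Z)) ⋙ unary μ _ _))
      (CategoryTheory.Prod.fst _ _ ⋙ Bicategory.Opposite.unopFunctor (op Y) (op Y') ⋙
        unary μ Y' Y))
    (CategoryTheory.Prod.snd _ _ ⋙ unary μ Z Z') ⋙
    (multicategory μ).binary (μ.homObj Y Z) (μ.homObj Y Z) Y Y' Z Z'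

variable (μ) in
/-- The action of homomorphisms and modifications on internal homs. -/
noncomputable def homFunctor (Y Y' Z Z' : Model T w) :
    (op Y ⟶ op Y') × (Z ⟶ Z') ⥤ (μ.homObj Y Z ⟶ μ.homObj Y' Z') :=
  μ.evAction Y Y' Z Z' ⋙ (μ.toBinary (μ.homObj Y Z) Y' Z').strictInv

theorem homFunctor_comp : μ.homFunctor Y Y' Z Z' ⋙ μ.toBinary (μ.homObj Y Z) Y' Z' =
    μ.evAction Y Y' Z Z' :=
  congrArg (μ.evAction Y Y' Z Z' ⋙ ·) (CatAction.strictInv_comp (μ.toBinary _ Y' Z')).1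

/-- The currying of `k ∘ ev ∘ (id, g)` acts by precomposition with `g` and postcomposition with `k`. -/
theorem acts_homFunctor (f : (op Y ⟶ op Y') × (Z ⟶ Z')) :
    Acts ((μ.homFunctor Y Y' Z Z').obj f) f.1.unop f.2 := by
  have h : (μ.toBinary (μ.homObj Y Z) Y' Z').obj ((μ.homFunctor Y Y' Z Z').obj f) =
      conj (μ.ev Y Z) (𝟙 _) f.1.unop f.2 := CategoryTheory.Functor.congr_obj homFunctor_comp f
  refine ⟨fun a b => ?_, fun c p => ?_, fun t u => ?_⟩
  · rw [← valHom_id_toBinary, h, valHom_id_conj, WTrans.valHom_id_one]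
  · rw [← valCell_toBinary_left, h, valCell_conj_left, WTrans.valCell_one]
  · rw [← valCell_toBinary_right, h, valCell_conj_right]
    rfl

theorem acts₂_homFunctor {f f' : (op Y ⟶ op Y') × (Z ⟶ Z')} (φ : f ⟶ f') :
    Acts₂ ((μ.homFunctor Y Y' Z Z').map φ) φ.1.unop2 φ.2 := fun a b => by
  have h := valHom_map_of_eq (homFunctor_comp (μ := μ)) φ [⟨_, a⟩, ⟨_, b⟩] rfl
  refine (valHom_toBinary _ a b).symm.trans (h.trans ?_)
  refine (valHom_conjMap (𝟙 (μ.ev Y Z)) (𝟙 (𝟙 (μ.homObj Y Z))) φ.1.unop2 φ.2 a b).trans ?_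
  rw [WTrans.valHom_id_one]

variable (μ) in
/-- The 2-functor structure of the internal hom. -/
noncomputable def homTwoFunctor : TwoFunctorOn (fun P : (Model T w)ᵒᵖ × Model T w => P)
    (fun P => μ.homObj P.1.unop P.2) where
  hom P Q := μ.homFunctor P.1.unop Q.1.unop P.2 Q.2
  map_id P := (acts_homFunctor (𝟙 P)).unique Acts.id
  map_comp f g := (acts_homFunctor (f ≫ g)).unique ((acts_homFunctor f).comp (acts_homFunctor g))
  map_whiskerLeft f g g' η :=
    (acts₂_homFunctor _).homEq ((acts_homFunctor f).whiskerLeft (acts₂_homFunctor η))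
      ((acts_homFunctor (f ≫ g)).unique ((acts_homFunctor f).comp (acts_homFunctor g)))
      ((acts_homFunctor (f ≫ g')).unique ((acts_homFunctor f).comp (acts_homFunctor g')))
  map_whiskerRight {_ _ _ f f'} η g :=
    (acts₂_homFunctor _).homEq ((acts₂_homFunctor η).whiskerRight (acts_homFunctor g))
      ((acts_homFunctor (f ≫ g)).unique ((acts_homFunctor f).comp (acts_homFunctor g)))
      ((acts_homFunctor (f' ≫ g)).unique ((acts_homFunctor f').comp (acts_homFunctor g)))

/-- The currying isomorphism for binary multimaps is 2-natural. -/
theorem isNatural_homFunctor : IsNaturalHomToBinary (fun Y Z => μ.internalHom Y Z)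
    (multicategory μ) (fun Y Z => μ.ev Y Z) fun Y Y' Z Z' => μ.homFunctor Y Y' Z Z' := by
  intro X X' Y Y' Z Z'
  refine functor_ext_val (fun {c d} k t ht => ?_) fun c U hU => ?_
  · obtain ⟨t', b, ht', rfl⟩ := List.exists_concat_of_map (Γ := [X']) ht
    obtain ⟨a, rfl⟩ := List.exists_singleton_of_map ht'
    refine Eq.trans ?_ (valHom_conjMap ((μ.toBinary X Y Z).map k.2.1) k.1 k.2.2.1.unop2 k.2.2.2 a
      b).symm
    rw [valHom_toBinary]
    refine (valHom_toBinary _ a b).trans ?_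
    refine (congrArg (fun a => μ.evHom Y' Z' a b) ((WTrans.valHom_hcomp _ _ a).trans
      (WTrans.valHom_hcomp _ _ _))).trans ?_
    exact acts₂_homFunctor k.2.2 _ b
  · obtain ⟨h, m, f⟩ := c
    obtain @⟨l, V, u, r⟩ := U
    rcases l with _ | ⟨⟨_, p⟩, l⟩
    · obtain ⟨rfl, hr⟩ := List.cons_eq_cons.1 (show V :: r.map Sigma.fst = [X', Y'] from hU)
      obtain ⟨p, rfl⟩ := List.exists_singleton_of_map hr
      refine Eq.trans ?_ (valCell_conj_left (h := h) u p).symm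
      refine (valCell_toBinary_left _ u p).trans ?_
      refine (congrArg (fun c => μ.evLeft Y' Z' c p) ((WTrans.valCell_comp _ _ u).trans
        (WTrans.valCell_comp _ _ _))).trans ?_
      refine ((acts_homFunctor f).left _ p).trans (congrArg (WTrans.valCell f.2) ?_)
      exact (valCell_toBinary_left m _ _).symm
    · obtain ⟨rfl, hr⟩ := List.cons_eq_cons.1
        (show _ :: (l.map Sigma.fst ++ V :: r.map Sigma.fst) = [X', Y'] from hU)
      obtain ⟨rfl, rfl, rfl⟩ : l = [] ∧ V = Y' ∧ r = [] := by
        cases l <;> simp_all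
      refine Eq.trans ?_ (valCell_conj_right (h := h) p u).symm
      refine (valCell_toBinary_right _ p u).trans ?_
      refine ((acts_homFunctor f).right (WTrans.val m (WTrans.val h p)) u).trans (congrArg (WTrans.valCell f.2) ?_)
      exact (valCell_toBinary_right m _ _).symm

end WCommutativity

end Functorial

/-! ### The underlying functors of the internal hom -/

section Underlying

variable {T : LawvereTwoTheory 𝕋} {w : Weakness} {μ : WCommutativity T w} {Y Z Y' Z' : Model T w}

open MultiMap Opposite

theorem EltHom.homEq_of_eq {F : TwoFun T w} {n : ℕ} {p q p' q' : F.O n} {f : p ⟶ q}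
    {f' : p' ⟶ q'} (h : (⟨f⟩ : EltHom F) = ⟨f'⟩) : HomEq f f' := by
  simp only [EltHom.mk.injEq, heq_eq_eq, true_and] at h
  obtain ⟨rfl, rfl, h⟩ := h
  obtain rfl := eq_of_heq h
  exact .refl

namespace WTrans

theorem valHom_id_point {F G : TwoFun T w} (f : WTrans F G) (p : Elt F) :
    valHom (𝟙 f) p.id = (val f p).id :=
  congrArg EltHom.mk ((Category.comp_id _).trans (CategoryTheory.Functor.map_id _ _))

theorem valHom_homEq {F G : TwoFun T w} {f g f' g' : WTrans F G} {η : f ⟶ g} {η' : f' ⟶ g'}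
    (h : HomEq η η') (b : EltHom F) : valHom η b = valHom η' b := by
  cases h; rfl

theorem valHom_eq_app {F G : TwoFun T w} {f g : WTrans F G} (η : f ⟶ g) (b : EltHom F) :
    valHom η b = ⟨(Modif.app η b.n).app b.p ≫ (g.app b.n).map b.hom⟩ :=
  congrArg EltHom.mk ((Modif.app η b.n).naturality b.hom)

theorem valHom_whiskerR {F G K : TwoFun T w} {f f' : WTrans F G} (η : f ⟶ f') (g : WTrans G K)
    (a : EltHom F) : valHom (f := f.comp g) (g := f'.comp g) (whiskerR η g) a =
      valHom (𝟙 g) (valHom η a) :=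
  congrArg (EltHom.mk (F := K) (n := a.n))
    (((Category.comp_id _).trans ((g.app a.n).map_comp _ _)).symm)

end WTrans

namespace WCommutativity

theorem block_zero (k : ℕ) : block (0 : Fin 1) k = Fin.cast (one_mul k).symm := by
  rw [← mapLeft_cast]
  have : mapLeft k (fun _ : Fin 1 => (0 : Fin 1)) = _root_.id := by
    funext j
    obtain ⟨⟨i, j⟩, rfl⟩ := finProdFinEquiv.surjective j
    obtain rfl := Subsingleton.elim i 0
    simp [mapLeft]
  rw [this]
  rfl

theorem valHom_proj_zero (a : EltHom (μ.tensorL Z 1)) :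
    WTrans.valHom (𝟙 (μ.proj Z 0)) a = μ.unfoldHom a := by
  refine EltHom.reindex (one_mul a.n).symm ?_
  have e := congrArg (Pi.comap fun _ => Z.carrier) (block_zero a.n)
  exact (HomEq.of_eq (Category.comp_id _)).trans (HomEq.map_congr e a.hom)

theorem valCell_proj_zero (c : EltCell (μ.tensorL Z 1)) :
    WTrans.valCell (μ.proj Z 0) c = μ.unfoldCell c := by
  have e (k : ℕ) := congrArg (Pi.comap fun _ => Z.carrier) (block_zero k)
  refine EltCell.reindex (one_mul c.m).symm (one_mul c.n).symm (μ.left_one ⟨c.α⟩).symm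
    (congrArg (fun G => G.obj c.p) (e c.m)) (congrArg (fun G => G.obj c.q) (e c.n)) ?_
  refine (WEq.comp (WEq.of_eq (WHom.appAt_ofEq _ _)) .refl).trans ?_
  exact (WEq.ofEq_comp _ _).trans (WEq.map_congr (e c.n) c.cell)

/-- A homomorphism as an element of the internal hom. -/
abbrev point (t : Y ⟶ Z) : Elt (μ.homObj Y Z).toFun :=
  Elt.mk (F := (μ.homObj Y Z).toFun) (n := 1) fun _ => t

/-- A modification as a morphism of the internal hom. -/
abbrev single {t t' : Y ⟶ Z} (τ : t ⟶ t') : EltHom (μ.homObj Y Z).toFun :=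
  EltHom.mk (F := (μ.homObj Y Z).toFun) (n := 1) (p := fun _ => t) (q := fun _ => t') fun _ => τ

theorem evHom_single {t t' : Y ⟶ Z} (τ : t ⟶ t') (b : EltHom Y.toFun) :
    μ.evHom Y Z (single τ) b = WTrans.valHom τ b := by
  refine (valHom_ev (μ := μ) _ b rfl).trans ?_
  rw [← valHom_proj_zero]
  have h : HomEq (Bicategory.whiskerRight ((μ.transpose Y Z 1).map fun _ : Fin 1 => τ) (μ.proj Z 0))
      τ := (HomEq.map_congr (μ.transpose_powerComparison Y Z 1) (fun _ : Fin 1 => τ)).map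
    (Pi.eval (fun _ : Fin 1 => (Y ⟶ Z)) 0)
  refine Eq.trans ?_ (WTrans.valHom_homEq h b)
  refine Eq.trans ?_ (WTrans.valHom_whiskerR ((μ.transpose Y Z 1).map fun _ : Fin 1 => τ)
    (μ.proj Z 0) b).symm
  exact congrArg (WTrans.valHom (𝟙 (μ.proj Z 0))) (WTrans.valHom_eq_app _ b).symm

theorem evRight_point (t : Y ⟶ Z) (u : EltCell Y.toFun) :
    μ.evRight Y Z (point t) u = WTrans.valCell t u := by
  refine (valCell_ev_right (μ := μ) _ u rfl).trans ?_
  rw [← valCell_proj_zero, ← WTrans.valCell_comp']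
  exact congrArg (fun t => WTrans.valCell t u) (μ.transpose_comp_proj (fun _ : Fin 1 => t) 0)

theorem Acts.val_point {m : μ.homObj Y Z ⟶ μ.homObj Y' Z'} {g : Y' ⟶ Y} {k : Z ⟶ Z'}
    (h : Acts m g k) (t : Y ⟶ Z) : WTrans.val m (point t) = point ((g ≫ t) ≫ k) := by
  refine elt_ext rfl (fun b => ?_) fun u => ?_
  · refine (congrArg (fun a => μ.evHom Y' Z' a b) (WTrans.valHom_id_point m (point t)).symm).trans ?_
    refine (h.hom (point t).id b).trans ?_
    refine (congrArg (WTrans.valHom (𝟙 k)) (evHom_single (𝟙 t) _)).trans ?_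
    refine Eq.trans ?_ (evHom_single (𝟙 ((g ≫ t) ≫ k)) b).symm
    rw [WTrans.valHom_id_comp, WTrans.valHom_id_comp]
  · refine (h.right _ u).trans ((congrArg (WTrans.valCell k) (evRight_point t _)).trans ?_)
    refine Eq.trans ?_ (evRight_point ((g ≫ t) ≫ k) u).symm
    rw [WTrans.valCell_comp, WTrans.valCell_comp]

theorem Acts₂.valHom_single {m m' : μ.homObj Y Z ⟶ μ.homObj Y' Z'} {ψ : m ⟶ m'} {g g' : Y' ⟶ Y}
    {γ : g ⟶ g'} {k k' : Z ⟶ Z'} {κ : k ⟶ k'} (h : Acts₂ ψ γ κ) (hm : Acts m g k)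
    (hm' : Acts m' g' k') {t t' : Y ⟶ Z} (τ : t ⟶ t') :
    WTrans.valHom ψ (single τ) = single
      (Bicategory.whiskerRight (Bicategory.whiskerLeft g τ ≫ Bicategory.whiskerRight γ t') k ≫
        Bicategory.whiskerLeft (g' ≫ t') κ) := by
  refine eltHom_ext (hm.val_point t) (hm'.val_point t') fun p => ?_
  refine (h _ _).trans (Eq.trans ?_ (evHom_single _ _).symm)
  rw [evHom_single, WTrans.valHom_hcomp, Bicategory.whisker_exchange, WTrans.valHom_hcomp]

end WCommutativity

end Underlying

section Final

variable {T : LawvereTwoTheory 𝕋} {w : Weakness} {μ : WCommutativity T w}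
  {X Y Z Y' Z' : Model T w}

open MultiMap Opposite

theorem HomEq.src_eq {C : Type*} [Category* C] {x y x' y' : C} {f : x ⟶ y} {g : x' ⟶ y'}
    (h : HomEq f g) : x = x' := by
  cases h; rfl

theorem functor_ext_of_homEq {C A B : Type*} [Category* C] [Category* A] [Category* B]
    {F G : C ⥤ A ⥤ B} (h : ∀ {c d : C} (φ : c ⟶ d) {s t : A} (τ : s ⟶ t),
      HomEq ((F.obj c).map τ ≫ (F.map φ).app t) ((G.obj c).map τ ≫ (G.map φ).app t)) : F = G := by
  refine CategoryTheory.Functor.uncurry_obj_injective (Functor.hext (fun x => ?_) fun x y f => ?_)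
  · exact (h (𝟙 x.1) (𝟙 x.2)).src_eq
  · refine HomEq.heq ?_
    simp only [Functor.uncurry_obj_map, ← NatTrans.naturality]
    exact h f.1 f.2

/-- Precomposition with an identity does nothing to 2-cells. -/
theorem HomEq.id_whiskerLeft {B : Type*} [Bicategory B] [Bicategory.Strict B] {a b : B} {f g : a ⟶ b}
    (τ : f ⟶ g) : HomEq (Bicategory.whiskerLeft (𝟙 a) τ) τ := by
  rw [Bicategory.id_whiskerLeft, Bicategory.Strict.leftUnitor_eqToIso,
    Bicategory.Strict.leftUnitor_eqToIso]
  exact HomEq.conj (Bicategory.Strict.id_comp f) τ (Bicategory.Strict.id_comp g).symm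

theorem HomEq.id_action {B : Type*} [Bicategory B] [Bicategory.Strict B] {a b c : B} {f g : a ⟶ b}
    {h k : b ⟶ c} (τ : f ⟶ g) (κ : h ⟶ k) :
    HomEq (Bicategory.whiskerRight (Bicategory.whiskerLeft (𝟙 a) τ) h ≫
      Bicategory.whiskerRight (Bicategory.whiskerRight (𝟙 (𝟙 a)) g) h ≫
        Bicategory.whiskerLeft (𝟙 a ≫ g) κ)
      (Bicategory.whiskerRight τ h ≫ Bicategory.whiskerLeft g κ) := by
  rw [Bicategory.id_whiskerRight, Bicategory.id_whiskerRight,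
    Category.id_comp (Bicategory.whiskerLeft (𝟙 a ≫ g) κ)]
  exact .comp (.whiskerRight_congr (.id_whiskerLeft τ) rfl)
    (.whiskerLeft_congr (Bicategory.Strict.id_comp g) .refl)

namespace WCommutativity

/-- On underlying categories, the internal hom acts by pre- and postcomposition. -/
theorem homFunctor_underlying (Y Y' Z Z' : Model T w) : μ.homFunctor Y Y' Z Z' ⋙
      underlying (homModel (μ.internalHom Y Z)) (homModel (μ.internalHom Y' Z')) =
    homAction Y Y' Z Z' := by
  refine functor_ext_of_homEq fun {f f'} φ {t t'} τ => ?_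
  have h := EltHom.homEq_of_eq ((acts₂_homFunctor (μ := μ) φ).valHom_single (acts_homFunctor f)
    (acts_homFunctor f') τ)
  refine (h.map (Pi.eval (fun _ : Fin 1 => (Y' ⟶ Z')) 0)).trans (.of_eq ?_)
  exact (congrArg (· ≫ Bicategory.whiskerLeft (f'.1.unop ≫ t') φ.2)
    (Bicategory.comp_whiskerRight _ _ _)).trans (Category.assoc _ _ _)

variable (μ) in
/-- The action of homomorphisms and modifications in the second variable on internal homs. -/
noncomputable def homFrom (Y Z Z' : Model T w) : (Z ⟶ Z') ⥤ (μ.homObj Y Z ⟶ μ.homObj Y Z') :=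
  Functor.prod' ((Functor.const _).obj (𝟙 (op Y))) (𝟭 (Z ⟶ Z')) ⋙ μ.homFunctor Y Y Z Z'

theorem acts_homFrom (k : Z ⟶ Z') : Acts ((μ.homFrom Y Z Z').obj k) (𝟙 Y) k :=
  acts_homFunctor (Y := Y) (Y' := Y) (𝟙 (op Y), k)

theorem acts₂_homFrom {k k' : Z ⟶ Z'} (κ : k ⟶ k') :
    Acts₂ ((μ.homFrom Y Z Z').map κ) (𝟙 (𝟙 Y)) κ :=
  acts₂_homFunctor (Y := Y) (Y' := Y) (f := (𝟙 (op Y), k)) (f' := (𝟙 (op Y), k'))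
    (Prod.mkHom (𝟙 (𝟙 (op Y))) κ)

variable (μ) in
/-- The internal hom as a 2-functor of its second variable. -/
noncomputable def homFromTwoFunctor (Y : Model T w) :
    TwoFunctorOn (fun Z : Model T w => Z) (fun Z => μ.homObj Y Z) where
  hom Z Z' := μ.homFrom Y Z Z'
  map_id Z := (acts_homFrom (𝟙 Z)).unique Acts.id
  map_comp f g := by
    have h := (acts_homFrom (μ := μ) (Y := Y) f).comp (acts_homFrom g)
    rw [Bicategory.Strict.id_comp] at h
    exact (acts_homFrom (f ≫ g)).unique h
  map_whiskerLeft {i j k} f g g' η := by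
    have h (g : j ⟶ k) := (acts_homFrom (μ := μ) (Y := Y) f).comp (acts_homFrom g)
    simp only [Bicategory.Strict.id_comp] at h
    refine Acts₂.homEq (acts₂_homFrom _) (γ := 𝟙 (𝟙 Y)) (fun a b => ?_)
      ((acts_homFrom (f ≫ g)).unique (h g)) ((acts_homFrom (f ≫ g')).unique (h g'))
    refine ((acts_homFrom f).whiskerLeft (acts₂_homFrom η) a b).trans ?_
    rw [WTrans.valHom_whiskerRight, WTrans.valHom_id_one, WTrans.valHom_id_one]
  map_whiskerRight {i j k f f'} η g := by
    have h (f : i ⟶ j) := (acts_homFrom (μ := μ) (Y := Y) f).comp (acts_homFrom g)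
    simp only [Bicategory.Strict.id_comp] at h
    refine Acts₂.homEq (acts₂_homFrom _) (γ := 𝟙 (𝟙 Y)) (fun a b => ?_)
      ((acts_homFrom (f ≫ g)).unique (h f)) ((acts_homFrom (f' ≫ g)).unique (h f'))
    refine ((acts₂_homFrom η).whiskerRight (acts_homFrom g) a b).trans ?_
    rw [WTrans.valHom_whiskerLeft, WTrans.valHom_id_one, WTrans.valHom_id_one]

theorem homFrom_underlying (X Y : Model T w) :
    μ.homFrom (terminalModel T w) X Y ⋙ underlying (homModel (μ.internalHom (terminalModel T w) X))
        (homModel (μ.internalHom (terminalModel T w) Y)) =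
      intAlgFunctor X Y := by
  refine (congrArg (Functor.prod' ((Functor.const _).obj (𝟙 (op (terminalModel T w))))
    (𝟭 (X ⟶ Y)) ⋙ ·) (homFunctor_underlying _ _ _ _)).trans ?_
  refine functor_ext_of_homEq fun {k k'} κ {t t'} τ => ?_
  change HomEq (Bicategory.whiskerRight (Bicategory.whiskerLeft (𝟙 _) τ) k ≫
    Bicategory.whiskerRight (Bicategory.whiskerRight (𝟙 (𝟙 _)) t') k ≫
      Bicategory.whiskerLeft (𝟙 _ ≫ t') κ)
    (Bicategory.whiskerRight τ k ≫ Bicategory.whiskerLeft t' κ)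
  exact .id_action τ κ

end WCommutativity

end Final

end Theory

theorem theorem3 {𝕋 : Type*} [Bicategory.{u, u} 𝕋] [Bicategory.Strict 𝕋]
    (T : LawvereTwoTheory 𝕋) (w : Weakness) (μ : WCommutativity T w) :
    (∀ (Y Z : Model T w) (m : ℕ), (μ.powerComparison Y Z m).IsIso) ∧
    ∃ H : ∀ Y Z : Model T w, ModelOn T (Y ⟶ Z),
      (∀ Y Z : Model T w, μ.IsInternalHom (H Y Z)) ∧
      ∃ M : TwoMulticategory (MultiMap μ), M.IsModels ∧
        ∃ ev : ∀ Y Z : Model T w, MultiMap μ [homModel (H Y Z), Y] Z,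
          (∀ Y Z : Model T w, IsEvaluation (ev Y Z)) ∧
          (∀ (Γ : List (Model T w)) (Y Z : Model T w), (M.curry (ev Y Z) Γ).IsIso) ∧
          (∀ X Y Z : Model T w, (homToBinary H M ev X Y Z).IsIso) ∧
          ∃ F : TwoFunctorOn (fun P : (Model T w)ᵒᵖ × Model T w => P)
              (fun P => homModel (H P.1.unop P.2)),
            (∀ Y Y' Z Z' : Model T w,
              F.hom (Opposite.op Y, Z) (Opposite.op Y', Z') ⋙
                  underlying (homModel (H Y Z)) (homModel (H Y' Z')) =
                homAction Y Y' Z Z') ∧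
            IsNaturalHomToBinary H M ev
              (fun Y Y' Z Z' => F.hom (Opposite.op Y, Z) (Opposite.op Y', Z')) ∧
            ∃ I : TwoFunctorOn (fun X : Model T w => X)
                (fun X => homModel (H (terminalModel T w) X)),
              (∀ X Y : Model T w,
                I.hom X Y =
                  Functor.prod' ((Functor.const _).obj (𝟙 (Opposite.op (terminalModel T w))))
                      (𝟭 (X ⟶ Y)) ⋙
                    F.hom (Opposite.op (terminalModel T w), X)
                      (Opposite.op (terminalModel T w), Y)) ∧
              ∀ X Y : Model T w,
                I.hom X Y ⋙ underlying (homModel (H (terminalModel T w) X))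
                    (homModel (H (terminalModel T w) Y)) =
                  intAlgFunctor X Y := by
  exact ⟨fun Y Z m => μ.isIso_powerComparison Y Z m, fun Y Z => μ.internalHom Y Z,
    fun Y Z => μ.isInternalHom Y Z, MultiMap.multicategory μ, MultiMap.multicategory_isModels μ,
    fun Y Z => μ.ev Y Z, fun Y Z => μ.isEvaluation_ev Y Z, fun Γ Y Z => MultiMap.isIso_applyEv,
    fun X Y Z => inferInstanceAs (μ.toBinary X Y Z).IsIso, μ.homTwoFunctor,
    fun Y Y' Z Z' => WCommutativity.homFunctor_underlying Y Y' Z Z',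
    WCommutativity.isNatural_homFunctor, μ.homFromTwoFunctor (terminalModel T w), fun X Y => rfl,
    fun X Y => WCommutativity.homFrom_underlying X Y⟩
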